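/- **Setting.** A *local CR-generic submanifold* $M^5\subset\mathbb C^4$ is (the image of) a real-analytic embedding $\varphi:U\to\mathbb C^4$ of an open set $U\subset\mathbb R^5$ with $T_pM+iT_pM=T_p\mathbb C^4$ at every point; it has CR dimension $1$. It is of *Class III$_1$* if $$5=\operatorname{rank}_{\mathbb C}\big(T^{1,0}M+T^{0,1}M+[T^{1,0}M,T^{0,1}M]+[T^{1,0}M,[T^{1,0}M,T^{0,1}M]]+[T^{0,1}M,[T^{1,0}M,T^{0,1}M]]\big)$$ at every point. For a real-analytic generator $\mathcal L$ of $T^{1,0}M$ put $\mathcal T=i[\mathcal L,\overline{\mathcal L}]$ and $\mathcal S=[\mathcal L,\mathcal T]$, let $(\bar\sigma_0,\sigma_0,\rho_0,\bar\zeta_0,\zeta_0)$ be the coframe dual to the frame $(\overline{\mathcal S},\mathcal S,\mathcal T,\overline{\mathcal L},\mathcal L)$, and let $R$ be the coefficient of $\overline{\mathcal S}$ in $[\mathcal L,\mathcal S]=P\mathcal T+Q\mathcal S+R\overline{\mathcal S}$. **Model.** Let $\mathfrak g^7$ be the real Lie algebra of the elements $\bar\lambda e_{\bar\alpha}+\lambda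 e_\alpha+\bar\sigma e_{\bar\sigma}+\sigma e_\sigma+\rho e_\rho+\bar\zeta e_{\bar\zeta}+\zeta e_\zeta$ with $\lambda,\sigma,\zeta\in\mathbb C$, $\rho\in\mathbb R$, where, all unwritten brackets of basis vectors being zero, $$\begin{aligned}&[e_{\bar\alpha},e_{\bar\sigma}]=-2e_{\bar\sigma},\quad [e_\alpha,e_{\bar\sigma}]=-e_{\bar\sigma},\quad [e_{\bar\alpha},e_\sigma]=-e_\sigma,\quad [e_\alpha,e_\sigma]=-2e_\sigma,\quad [e_{\bar\alpha},e_\rho]=[e_\alpha,e_\rho]=-e_\rho,\\ &[e_{\bar\alpha},e_{\bar\zeta}]=-e_{\bar\zeta},\quad [e_\alpha,e_\zeta]=-e_\zeta,\quad [e_\rho,e_{\bar\zeta}]=-e_{\bar\sigma},\quad [e_\rho,e_\zeta]=-e_\sigma,\quad [e_{\bar\zeta},e_\zeta]=i\,e_\rho .\end{aligned}$$ Let $G^7\subset GL_4(\mathbb C)$ be the group of the products $n\,h$ with $h=h_a=\operatorname{diag}(1,a,a\bar a,a^2\bar a)$, $a\in\mathbb C^*$, and $$n=\begin{pmatrix}1&\zeta&\tfrac12|\zeta|^2+ir&s\\0&1&\bar\zeta&\tfrac12|\zeta|^2-ir\\0&0&1&\zeta\\0&0&0&1\end{pmatrix},\qquad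 \zeta,s\in\mathbb C,\ r\in\mathbb R;$$ let $H^2\cong\mathbb C^*$ be the subgroup of the $h_a$, and $N_5^4$ the subgroup of the $n$. Let $M_c^5\subset\mathbb C^4$ be Beloshapka's cubic $v_1=z\bar z$, $v_2=z^2\bar z+z\bar z^2$, $v_3=-i(z^2\bar z-z\bar z^2)$, where $w_j=u_j+iv_j$. **Theorem.** (1) $G^7$ is a closed connected Lie group with Lie algebra $\mathfrak g^7$ (of dimension $7$), and $H^2$ is a closed connected subgroup with Lie algebra $\mathfrak h$, the set of the elements $\bar\lambda e_{\bar\alpha}+\lambda e_\alpha$; $N_5^4$ is a closed, simply connected, nilpotent subgroup whose Lie algebra has a basis $x_1,\dots,x_5$ with $[x_1,x_2]=x_3$, $[x_1,x_3]=x_4$, $[x_2,x_3]=x_5$, the other brackets being zero. One has $G^7/H^2\cong N_5^4\cong M_c^5$: the group $G^7$ acts effectively and real-analytically on $\mathbb C^4$ by biholomorphisms preserving $M_c^5$, transitively on $M_c^5$ with isotropy group $H^2$ at the origin, and $N_5^4$ is simply transitive on $M_c^5$, its orbit map at the origin being a real-analytic diffeomorphism onto $M_c^5$. Moreover $\mathfrak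 g^7\cong\mathfrak{aut}_{CR}(M_c^5)$, the Lie algebra of (local or global) holomorphic vector fields whose real part is tangent to $M_c^5$. (2) Every Class III$_1$ local CR-generic submanifold $M$ has a real-analytic generator $\mathcal L$ of $T^{1,0}M$. To all pairs $(M,\mathcal L)$ one can associate real-analytic one-forms $\lambda,\sigma,\zeta$ ($\mathbb C$-valued) and $\rho$ ($\mathbb R$-valued) on $P^7=M\times\mathbb C^*$, with fibre coordinate $a$, such that the following holds. (a) There are real-analytic functions $\mathbf B_0,\mathbf C_0,\mathbf D_0,\mathbf E_0$ and a real-analytic one-form $\theta$ on $M$ with $\sigma=a^2\bar a\,\sigma_0$, $\rho=a\bar a(\overline{\mathbf C}_0\bar\sigma_0+\mathbf C_0\sigma_0+\rho_0)$, $\zeta=a(\overline{\mathbf D}_0\bar\sigma_0+\mathbf E_0\sigma_0+\mathbf B_0\rho_0+\zeta_0)$, $\lambda=\frac{da}a+\theta$. (b) There are functions $V_1,V_3,W_1,\dots,W_{10}$ on $M$ and $I_{\nu\mu}$ on $P$ with $$\begin{aligned}d\sigma&=(2\lambda+\bar\lambda)\wedge\sigma+\tfrac{a}{\bar a^2}\overline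 R\,\bar\sigma\wedge\bar\zeta+\rho\wedge\zeta,\\ d\rho&=(\lambda+\bar\lambda)\wedge\rho+\tfrac{V_1}{a^2\bar a^2}\bar\sigma\wedge\sigma+\tfrac{V_3}{\bar a^2}\bar\sigma\wedge\bar\zeta+\tfrac{\overline{V_3}}{a^2}\sigma\wedge\zeta+i\,\zeta\wedge\bar\zeta,\\ d\zeta&=\lambda\wedge\zeta+\tfrac{W_1}{a^2\bar a^3}\bar\sigma\wedge\sigma+\tfrac{W_2}{a\bar a^3}\bar\sigma\wedge\rho+\tfrac{W_3}{\bar a^3}\bar\sigma\wedge\bar\zeta+\tfrac{W_4}{a\bar a^2}\bar\sigma\wedge\zeta+\tfrac{W_5}{a^2\bar a^2}\sigma\wedge\rho\\&\quad+\tfrac{W_6}{a\bar a^2}\sigma\wedge\bar\zeta+\tfrac{W_7}{a^2\bar a}\sigma\wedge\zeta+\tfrac{W_8}{\bar a^2}\rho\wedge\bar\zeta+\tfrac{W_9}{a\bar a}\rho\wedge\zeta+\tfrac{W_{10}}{\bar a}\bar\zeta\wedge\zeta,\\ d\lambda&=\sum_{\nu,\mu\in\{\bar\sigma,\sigma,\rho,\bar\zeta,\zeta\}}I_{\nu\mu}\,\nu\wedge\mu.\end{aligned}$$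 (c) The $\mathfrak g^7$-valued form $\varpi=\bar\lambda e_{\bar\alpha}+\lambda e_\alpha+\bar\sigma e_{\bar\sigma}+\sigma e_\sigma+\rho e_\rho+\bar\zeta e_{\bar\zeta}+\zeta e_\zeta$ is a Cartan connection on $P^7$ modelled on $G^7/H^2$, for the right action $(p,a)\cdot h_b=(p,ab)$: it is real-analytic, $\varpi_x:T_xP\to\mathfrak g^7$ is an isomorphism for all $x\in P$, $\varpi(Y^\dagger)=y$ for all $y\in\mathfrak h$, where $Y^\dagger|_x=\frac d{dt}\big|_0(x\exp(ty))$, and $\varpi_{xh}(R_{h*}v)=\operatorname{Ad}(h^{-1})\varpi_x(v)$ for $h\in H^2$, $v\in T_xP$. (d) The Cartan connection is canonical. Let $(M,\mathcal L)$, $(M',\mathcal L')$ be two such pairs, with associated $(P,\varpi)$, $(P',\varpi')$, and let $V\subset M$ be open. Every real-analytic map $h:V\to M'$ which is locally the restriction of local biholomorphisms of $\mathbb C^4$ lifts to a real-analytic $H^2$-equivariant map $F:V\times\mathbb C^*\to P'$ over $h$ with $F^*\varpi'=\varpi$. Conversely, every real-analytic fibre-preserving map $F:V\times\mathbb C^*\to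 P'$ with $F^*\varpi'=\varpi$ covers a map $h:V\to M'$ which is real-analytic and locally the restriction of local biholomorphisms of $\mathbb C^4$. -/

import Mathlib

open Topology TensorProduct
open scoped Matrix ComplexConjugate ContDiff

noncomputable section

/-! ## CR-generic submanifolds of `ℂ⁴` of real dimension five -/

/-- Real coordinates on a local five-dimensional manifold. -/
abbrev R5 := Fin 5 → ℝ

/-- Complexified tangent vectors `∑ Xⱼ ∂/∂xⱼ`, written in real coordinates `x₁, …, x₅`. -/
abbrev C5 := Fin 5 → ℂ

/-- The ambient space, with coordinates `(z, w₁, w₂, w₃)`. -/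
abbrev C4 := Fin 4 → ℂ

/-- The complex-linear extension `X ↦ X(f)(p)` of the differential at `p` of a map `f` on `ℝ⁵` with
values in `ℂⁿ`. -/
def complexDeriv {n : ℕ} (f : R5 → (Fin n → ℂ)) (p : R5) : C5 →ₗ[ℂ] (Fin n → ℂ) :=
  Fintype.linearCombination ℂ (fun j : Fin 5 => fderiv ℝ f p (Pi.single j 1))

/-- The Lie bracket of two complex vector fields on (an open subset of) `ℝ⁵`. -/
def bracket (X Y : R5 → C5) (p : R5) : C5 :=
  complexDeriv Y p (X p) - complexDeriv X p (Y p)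

/-- The complex conjugate of a complex vector field. -/
def conjField (X : R5 → C5) (p : R5) : C5 := star (X p)

/-- A local real-analytic submanifold `M⁵ ⊂ ℂ⁴`, given by a real-analytic parametrization
`φ : U → ℂ⁴` which is an immersion and a homeomorphism onto its image. -/
structure LocalSubmanifold where
  U : Set R5
  φ : R5 → C4
  isOpen_U : IsOpen U
  analytic : AnalyticOnNhd ℝ φ U
  embedding : IsEmbedding (fun p : U => φ p)
  immersion : ∀ p ∈ U, Function.Injective (fderiv ℝ φ p)

namespace LocalSubmanifold

/-- `T^{1,0}M` at `p`: the complex tangent vectors killed by all `d z̄ₖ`. -/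
def T10 (M : LocalSubmanifold) (p : R5) : Submodule ℂ C5 :=
  LinearMap.ker (complexDeriv (fun q => star (M.φ q)) p)

/-- `T^{0,1}M` at `p`: the complex tangent vectors killed by all `d zₖ`. -/
def T01 (M : LocalSubmanifold) (p : R5) : Submodule ℂ C5 :=
  LinearMap.ker (complexDeriv M.φ p)

/-- CR-genericity: the real tangent spaces span `ℂ⁴` over `ℂ`, that is `TM + i TM = Tℂ⁴`. -/
def IsCRGeneric (M : LocalSubmanifold) : Prop :=
  ∀ p ∈ M.U, Submodule.span ℂ (Set.range (fderiv ℝ M.φ p)) = ⊤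

/-- Germs at `p` of real-analytic sections of `T^{1,0}M`. -/
def Sections10 (M : LocalSubmanifold) (p : R5) : Set (R5 → C5) :=
  {X | AnalyticAt ℝ X p ∧ ∀ᶠ q in 𝓝 p, X q ∈ M.T10 q}

/-- Germs at `p` of real-analytic sections of `T^{0,1}M`. -/
def Sections01 (M : LocalSubmanifold) (p : R5) : Set (R5 → C5) :=
  {X | AnalyticAt ℝ X p ∧ ∀ᶠ q in 𝓝 p, X q ∈ M.T01 q}

/-- The fibre at `p` of
`T^{1,0}M + T^{0,1}M + [T^{1,0}M, T^{0,1}M] + [T^{1,0}M, [T^{1,0}M, T^{0,1}M]]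
  + [T^{0,1}M, [T^{1,0}M, T^{0,1}M]]`. -/
def thirdOrderSpan (M : LocalSubmanifold) (p : R5) : Submodule ℂ C5 :=
  Submodule.span ℂ
    ({v | ∃ X ∈ M.Sections10 p, v = X p} ∪
     {v | ∃ Y ∈ M.Sections01 p, v = Y p} ∪
     {v | ∃ X ∈ M.Sections10 p, ∃ Y ∈ M.Sections01 p, v = bracket X Y p} ∪
     {v | ∃ X' ∈ M.Sections10 p, ∃ X ∈ M.Sections10 p, ∃ Y ∈ M.Sections01 p,
        v = bracket X' (bracket X Y) p} ∪
     {v | ∃ Y' ∈ M.Sections01 p, ∃ X ∈ M.Sections10 p, ∃ Y ∈ M.Sections01 p,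
        v = bracket Y' (bracket X Y) p})

/-- CR-generic submanifolds of the General Class III₁ (maximally minimal). -/
def IsClassIII1 (M : LocalSubmanifold) : Prop :=
  M.IsCRGeneric ∧ ∀ p ∈ M.U, Module.finrank ℂ (M.thirdOrderSpan p) = 5

/-- `L` is a real-analytic vector field generating the complex line bundle `T^{1,0}M`. -/
structure IsGenerator (M : LocalSubmanifold) (L : R5 → C5) : Prop where
  analytic : AnalyticOnNhd ℝ L M.U
  span_eq : ∀ p ∈ M.U, Submodule.span ℂ {L p} = M.T10 p
  ne_zero : ∀ p ∈ M.U, L p ≠ 0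

end LocalSubmanifold

/-! ## The initial frame and the initial coframe -/

/-- `𝒯 = i [ℒ, ℒ̄]`. -/
def fieldT (L : R5 → C5) (p : R5) : C5 := Complex.I • bracket L (conjField L) p

/-- `𝒮 = [ℒ, 𝒯]`. -/
def fieldS (L : R5 → C5) : R5 → C5 := bracket L (fieldT L)

/-- The matrix whose columns are `𝒮̄, 𝒮, 𝒯, ℒ̄, ℒ`, in this order. -/
def frameMatrix (L : R5 → C5) (p : R5) : Matrix (Fin 5) (Fin 5) ℂ :=
  (Matrix.of ![conjField (fieldS L) p, fieldS L p, fieldT L p, conjField L p, L p])ᵀ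

/-- The values `(σ̄₀, σ₀, ρ₀, ζ̄₀, ζ₀)(X)` of the coframe dual to `𝒮̄, 𝒮, 𝒯, ℒ̄, ℒ`. -/
def initialCoframe (L : R5 → C5) (p : R5) (X : C5) : Fin 5 → ℂ := (frameMatrix L p)⁻¹ *ᵥ X

/-- A real tangent vector seen as a complex one. -/
def toC5 (v : R5) : C5 := fun j => (v j : ℂ)

/-- The coefficient `R` of `𝒮̄` in `[ℒ, 𝒮] = P 𝒯 + Q 𝒮 + R 𝒮̄`. -/
def invariantR (L : R5 → C5) (p : R5) : ℂ := initialCoframe L p (bracket L (fieldS L) p) 0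

/-! ## The model groups and their Lie algebras -/

abbrev Mat4 := Matrix (Fin 4) (Fin 4) ℂ

attribute [local instance] LieRing.ofAssociativeRing

/-- Unipotent elements. -/
def nMat (ζ : ℂ) (r : ℝ) (s : ℂ) : Mat4 :=
  !![1, ζ, ζ * conj ζ / 2 + Complex.I * r, s;
     0, 1, conj ζ, ζ * conj ζ / 2 - Complex.I * r;
     0, 0, 1, ζ;
     0, 0, 0, 1]

/-- Diagonal elements. -/
def hMat (a : ℂ) : Mat4 :=
  !![1, 0, 0, 0;
     0, a, 0, 0;
     0, 0, a * conj a, 0;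
     0, 0, 0, a ^ 2 * conj a]

/-- The elements of the Lie algebra `𝔤⁷`, in terms of their coordinates `(λ, σ, ρ, ζ)`. -/
def gMat (l s : ℂ) (r : ℝ) (z : ℂ) : Mat4 :=
  !![0, z, Complex.I * r, -2 * Complex.I * s;
     0, l, conj z, -(Complex.I * r);
     0, 0, l + conj l, z;
     0, 0, 0, 2 * l + conj l]

theorem nMat_mul (ζ ζ' : ℂ) (r r' : ℝ) (s s' : ℂ) :
    nMat ζ r s * nMat ζ' r' s' =
      nMat (ζ + ζ') (r + r' + (ζ * conj ζ').im)
        (s' + ζ * (ζ' * conj ζ' / 2 - Complex.I * r') + (ζ * conj ζ / 2 + Complex.I * r) * ζ' + s) := by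
  ext i j
  rw [Matrix.mul_apply, Fin.sum_univ_four]
  fin_cases i <;> fin_cases j <;> apply Complex.ext <;> simp [nMat] <;> ring

theorem hMat_mul (a b : ℂ) : hMat a * hMat b = hMat (a * b) := by
  ext i j
  rw [Matrix.mul_apply, Fin.sum_univ_four]
  fin_cases i <;> fin_cases j <;> simp [hMat] <;> ring

theorem hMat_mul_nMat {a : ℂ} (ha : a ≠ 0) (ζ : ℂ) (r : ℝ) (s : ℂ) :
    hMat a * nMat ζ r s =
      nMat (ζ / a) (r / Complex.normSq a) (s / (a ^ 2 * conj a)) * hMat a := by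
  have hb : conj a ≠ 0 := by simpa using ha
  ext i j
  rw [Matrix.mul_apply, Matrix.mul_apply, Fin.sum_univ_four, Fin.sum_univ_four]
  fin_cases i <;> fin_cases j <;>
    simp [hMat, nMat, Complex.normSq_eq_conj_mul_self] <;>
    field_simp

theorem nMat_zero : nMat 0 0 0 = 1 := by
  ext i j
  fin_cases i <;> fin_cases j <;> simp [nMat]

theorem hMat_one : hMat 1 = 1 := by
  ext i j
  fin_cases i <;> fin_cases j <;> simp [hMat]

theorem nMat_mul_neg (ζ : ℂ) (r : ℝ) (s : ℂ) : nMat ζ r s * nMat (-ζ) (-r) (-s) = 1 := by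
  rw [nMat_mul, ← nMat_zero]
  congr 1
  · ring
  · simp [mul_comm]
  · simp; ring

/-- The model group `G⁷`. -/
def G7 : Subgroup (GL (Fin 4) ℂ) where
  carrier := {g | ∃ (a ζ : ℂ) (r : ℝ) (s : ℂ), a ≠ 0 ∧ (g : Mat4) = nMat ζ r s * hMat a}
  one_mem' := ⟨1, 0, 0, 0, one_ne_zero, by simp [nMat_zero, hMat_one]⟩
  mul_mem' := by
    rintro g g' ⟨a, ζ, r, s, ha, hg⟩ ⟨a', ζ', r', s', ha', hg'⟩
    exact ⟨a * a', _, _, _, mul_ne_zero ha ha', by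
      rw [Units.val_mul, hg, hg', Matrix.mul_assoc, ← Matrix.mul_assoc (hMat a),
        hMat_mul_nMat ha, Matrix.mul_assoc, hMat_mul, ← Matrix.mul_assoc, nMat_mul]⟩
  inv_mem' := by
    rintro g ⟨a, ζ, r, s, ha, hg⟩
    refine ⟨a⁻¹, -ζ / a⁻¹, -r / Complex.normSq a⁻¹, -s / (a⁻¹ ^ 2 * conj a⁻¹), inv_ne_zero ha, ?_⟩
    rw [← hMat_mul_nMat (inv_ne_zero ha)]
    refine Units.inv_eq_of_mul_eq_one_right ?_
    rw [hg, Matrix.mul_assoc, ← Matrix.mul_assoc (hMat a), hMat_mul, mul_inv_cancel₀ ha, hMat_one,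
      Matrix.one_mul, nMat_mul_neg]

/-- The isotropy group `H² ≅ (ℂ*, ×)`. -/
def H2 : Subgroup (GL (Fin 4) ℂ) where
  carrier := {g | ∃ a : ℂ, a ≠ 0 ∧ (g : Mat4) = hMat a}
  one_mem' := ⟨1, one_ne_zero, by simp [hMat_one]⟩
  mul_mem' := by
    rintro g g' ⟨a, ha, hg⟩ ⟨a', ha', hg'⟩
    exact ⟨a * a', mul_ne_zero ha ha', by rw [Units.val_mul, hg, hg', hMat_mul]⟩
  inv_mem' := by
    rintro g ⟨a, ha, hg⟩
    refine ⟨a⁻¹, inv_ne_zero ha, Units.inv_eq_of_mul_eq_one_right ?_⟩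
    rw [hg, hMat_mul, mul_inv_cancel₀ ha, hMat_one]

/-- The nilpotent group `N₅⁴`. -/
def N5 : Subgroup (GL (Fin 4) ℂ) where
  carrier := {g | ∃ (ζ : ℂ) (r : ℝ) (s : ℂ), (g : Mat4) = nMat ζ r s}
  one_mem' := ⟨0, 0, 0, by simp [nMat_zero]⟩
  mul_mem' := by
    rintro g g' ⟨ζ, r, s, hg⟩ ⟨ζ', r', s', hg'⟩
    exact ⟨_, _, _, by rw [Units.val_mul, hg, hg', nMat_mul]⟩
  inv_mem' := by
    rintro g ⟨ζ, r, s, hg⟩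
    exact ⟨_, _, _, Units.inv_eq_of_mul_eq_one_right (by rw [hg, nMat_mul_neg])⟩

theorem gMat_add (l l' s s' : ℂ) (r r' : ℝ) (z z' : ℂ) :
    gMat l s r z + gMat l' s' r' z' = gMat (l + l') (s + s') (r + r') (z + z') := by
  ext i j
  fin_cases i <;> fin_cases j <;> simp [gMat] <;> ring

theorem smul_gMat (t : ℝ) (l s : ℂ) (r : ℝ) (z : ℂ) :
    t • gMat l s r z = gMat (t • l) (t • s) (t • r) (t • z) := by
  ext i j
  fin_cases i <;> fin_cases j <;> simp [gMat] <;> ring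

theorem gMat_zero : gMat 0 0 0 0 = 0 := by
  ext i j
  fin_cases i <;> fin_cases j <;> simp [gMat]

theorem lie_gMat (l l' s s' : ℂ) (r r' : ℝ) (z z' : ℂ) :
    ⁅gMat l s r z, gMat l' s' r' z'⁆ =
      gMat 0 (s * (2 * l' + conj l') - s' * (2 * l + conj l) - r * z' + r' * z)
        (2 * (z * conj z').im + 2 * r * l'.re - 2 * r' * l.re) (z * l' - z' * l) := by
  have hk : Complex.I * ((2 * (z * conj z').im + 2 * r * l'.re - 2 * r' * l.re : ℝ) : ℂ) =
      z * conj z' - z' * conj z + Complex.I * r * (l' + conj l') -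
        Complex.I * r' * (l + conj l) := by
    apply Complex.ext
    · simp; ring
    · simp; try ring
  generalize (2 * (z * conj z').im + 2 * r * l'.re - 2 * r' * l.re : ℝ) = q at hk ⊢
  rw [Ring.lie_def]
  ext i j
  rw [Matrix.sub_apply, Matrix.mul_apply, Matrix.mul_apply, Fin.sum_univ_four, Fin.sum_univ_four]
  fin_cases i <;> fin_cases j <;> simp [gMat] <;>
    first | ring1 | linear_combination -hk | linear_combination hk

/-- The real Lie algebra `𝔤⁷`, with the commutator bracket of matrices. -/
def g7 : LieSubalgebra ℝ Mat4 where
  carrier := {X | ∃ (l s : ℂ) (r : ℝ) (z : ℂ), X = gMat l s r z}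
  zero_mem' := ⟨0, 0, 0, 0, gMat_zero.symm⟩
  add_mem' := by
    rintro X Y ⟨l, s, r, z, rfl⟩ ⟨l', s', r', z', rfl⟩
    exact ⟨_, _, _, _, gMat_add l l' s s' r r' z z'⟩
  smul_mem' := by
    rintro t X ⟨l, s, r, z, rfl⟩
    exact ⟨_, _, _, _, smul_gMat t l s r z⟩
  lie_mem' := by
    rintro X Y ⟨l, s, r, z, rfl⟩ ⟨l', s', r', z', rfl⟩
    exact ⟨_, _, _, _, lie_gMat l l' s s' r r' z z'⟩

/-- The isotropy subalgebra `𝔥`. -/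
def h2 : LieSubalgebra ℝ Mat4 where
  carrier := {X | ∃ l : ℂ, X = gMat l 0 0 0}
  zero_mem' := ⟨0, gMat_zero.symm⟩
  add_mem' := by
    rintro X Y ⟨l, rfl⟩ ⟨l', rfl⟩
    exact ⟨l + l', by rw [gMat_add]; simp⟩
  smul_mem' := by
    rintro t X ⟨l, rfl⟩
    exact ⟨t • l, by rw [smul_gMat]; simp⟩
  lie_mem' := by
    rintro X Y ⟨l, rfl⟩ ⟨l', rfl⟩
    exact ⟨0, by rw [lie_gMat]; simp⟩

/-- The nilpotent subalgebra spanned by the directions `σ, ρ, ζ`. -/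
def n5 : LieSubalgebra ℝ Mat4 where
  carrier := {X | ∃ (s : ℂ) (r : ℝ) (z : ℂ), X = gMat 0 s r z}
  zero_mem' := ⟨0, 0, 0, gMat_zero.symm⟩
  add_mem' := by
    rintro X Y ⟨s, r, z, rfl⟩ ⟨s', r', z', rfl⟩
    exact ⟨_, _, _, by rw [gMat_add, add_zero]⟩
  smul_mem' := by
    rintro t X ⟨s, r, z, rfl⟩
    exact ⟨_, _, _, by rw [smul_gMat, smul_zero]⟩
  lie_mem' := by
    rintro X Y ⟨s, r, z, rfl⟩ ⟨s', r', z', rfl⟩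
    exact ⟨_, _, _, lie_gMat 0 0 s s' r r' z z'⟩

/-- The element of `𝔤⁷` with coordinates `(λ, σ, ρ, ζ)`. -/
def gElem (l s : ℂ) (r : ℝ) (z : ℂ) : g7 := ⟨gMat l s r z, l, s, r, z, rfl⟩

/-- `𝔩` is the Lie algebra of the closed linear group `K`: it consists of all the matrices that
generate a one-parameter subgroup of `K`. -/
def IsLieAlgebraOf (𝔩 : LieSubalgebra ℝ Mat4) (K : Subgroup (GL (Fin 4) ℂ)) : Prop :=
  ∀ X : Mat4, X ∈ 𝔩 ↔ ∀ t : ℝ, ∃ g ∈ K, (g : Mat4) = NormedSpace.exp (t • X)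

/-! The basis `e_ᾱ, e_α, e_σ̄, e_σ, e_ρ, e_ζ̄, e_ζ` of the complexification `ℂ ⊗ 𝔤⁷`. -/

def eAlpha : ℂ ⊗[ℝ] g7 :=
  (1 / 2 : ℂ) ⊗ₜ gElem 1 0 0 0 - (Complex.I / 2) ⊗ₜ gElem Complex.I 0 0 0
def eAlphaBar : ℂ ⊗[ℝ] g7 :=
  (1 / 2 : ℂ) ⊗ₜ gElem 1 0 0 0 + (Complex.I / 2) ⊗ₜ gElem Complex.I 0 0 0
def eSigma : ℂ ⊗[ℝ] g7 :=
  (1 / 2 : ℂ) ⊗ₜ gElem 0 1 0 0 - (Complex.I / 2) ⊗ₜ gElem 0 Complex.I 0 0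
def eSigmaBar : ℂ ⊗[ℝ] g7 :=
  (1 / 2 : ℂ) ⊗ₜ gElem 0 1 0 0 + (Complex.I / 2) ⊗ₜ gElem 0 Complex.I 0 0
def eRho : ℂ ⊗[ℝ] g7 := (1 : ℂ) ⊗ₜ gElem 0 0 1 0
def eZeta : ℂ ⊗[ℝ] g7 :=
  (1 / 2 : ℂ) ⊗ₜ gElem 0 0 0 1 - (Complex.I / 2) ⊗ₜ gElem 0 0 0 Complex.I
def eZetaBar : ℂ ⊗[ℝ] g7 :=
  (1 / 2 : ℂ) ⊗ₜ gElem 0 0 0 1 + (Complex.I / 2) ⊗ₜ gElem 0 0 0 Complex.I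

theorem conj_smul_add_smul (l : ℂ) (X Y : g7) :
    conj l • ((1 / 2 : ℂ) ⊗ₜ[ℝ] X + (Complex.I / 2) ⊗ₜ[ℝ] Y) +
      l • ((1 / 2 : ℂ) ⊗ₜ[ℝ] X - (Complex.I / 2) ⊗ₜ[ℝ] Y) =
      (1 : ℂ) ⊗ₜ[ℝ] (l.re • X + l.im • Y) := by
  have h1 : conj l * (1 / 2) + l * (1 / 2) = (l.re : ℂ) := by
    apply Complex.ext
    · simp; ring
    · simp; try ring
  have h2 : conj l * (Complex.I / 2) - l * (Complex.I / 2) = (l.im : ℂ) := by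
    apply Complex.ext
    · simp; ring
    · simp; try ring
  have h3 : ∀ (t : ℝ) (Z : g7), (1 : ℂ) ⊗ₜ[ℝ] (t • Z) = (t : ℂ) ⊗ₜ[ℝ] Z := by
    intro t Z
    rw [← TensorProduct.smul_tmul]
    simp
  rw [TensorProduct.tmul_add, h3, h3, ← h1, ← h2, TensorProduct.add_tmul, TensorProduct.sub_tmul]
  simp only [smul_add, smul_sub, TensorProduct.smul_tmul', smul_eq_mul]
  abel

theorem one_tmul_gElem (l s : ℂ) (r : ℝ) (z : ℂ) :
    (1 : ℂ) ⊗ₜ[ℝ] gElem l s r z =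
      conj l • eAlphaBar + l • eAlpha + conj s • eSigmaBar + s • eSigma + (r : ℂ) • eRho +
      conj z • eZetaBar + z • eZeta := by
  have h : gElem l s r z =
      (l.re • gElem 1 0 0 0 + l.im • gElem Complex.I 0 0 0) +
      (s.re • gElem 0 1 0 0 + s.im • gElem 0 Complex.I 0 0) + r • gElem 0 0 1 0 +
      (z.re • gElem 0 0 0 1 + z.im • gElem 0 0 0 Complex.I) := by
    apply Subtype.ext
    simp [gElem, smul_gMat, gMat_add]
  have hr : (r : ℂ) • eRho = (1 : ℂ) ⊗ₜ[ℝ] (r • gElem 0 0 1 0) := by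
    rw [eRho, ← TensorProduct.smul_tmul, TensorProduct.smul_tmul']
    simp
  rw [h]
  simp only [TensorProduct.tmul_add (1 : ℂ) (_ + _ : g7) (_ : g7)]
  rw [← hr]
  simp only [← conj_smul_add_smul]
  simp only [eAlpha, eAlphaBar, eSigma, eSigmaBar, eZeta, eZetaBar]
  abel

/-- The bracket table of `𝔤⁷`; all the brackets of basis vectors are listed. -/
structure BracketTable : Prop where
  alphaBar_alpha : ⁅eAlphaBar, eAlpha⁆ = 0
  alphaBar_sigmaBar : ⁅eAlphaBar, eSigmaBar⁆ = -(2 : ℂ) • eSigmaBar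
  alphaBar_sigma : ⁅eAlphaBar, eSigma⁆ = -eSigma
  alphaBar_rho : ⁅eAlphaBar, eRho⁆ = -eRho
  alphaBar_zetaBar : ⁅eAlphaBar, eZetaBar⁆ = -eZetaBar
  alphaBar_zeta : ⁅eAlphaBar, eZeta⁆ = 0
  alpha_sigmaBar : ⁅eAlpha, eSigmaBar⁆ = -eSigmaBar
  alpha_sigma : ⁅eAlpha, eSigma⁆ = -(2 : ℂ) • eSigma
  alpha_rho : ⁅eAlpha, eRho⁆ = -eRho
  alpha_zetaBar : ⁅eAlpha, eZetaBar⁆ = 0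
  alpha_zeta : ⁅eAlpha, eZeta⁆ = -eZeta
  sigmaBar_sigma : ⁅eSigmaBar, eSigma⁆ = 0
  sigmaBar_rho : ⁅eSigmaBar, eRho⁆ = 0
  sigmaBar_zetaBar : ⁅eSigmaBar, eZetaBar⁆ = 0
  sigmaBar_zeta : ⁅eSigmaBar, eZeta⁆ = 0
  sigma_rho : ⁅eSigma, eRho⁆ = 0
  sigma_zetaBar : ⁅eSigma, eZetaBar⁆ = 0
  sigma_zeta : ⁅eSigma, eZeta⁆ = 0
  rho_zetaBar : ⁅eRho, eZetaBar⁆ = -eSigmaBar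
  rho_zeta : ⁅eRho, eZeta⁆ = -eSigma
  zetaBar_zeta : ⁅eZetaBar, eZeta⁆ = Complex.I • eRho

/-! ## Beloshapka's cubic model -/

/-- The defining functions `v₁ - z z̄`, `v₂ - (z² z̄ + z z̄²)`, `v₃ + i (z² z̄ - z z̄²)`. -/
def cubicEquations (x : C4) : Fin 3 → ℝ :=
  ![(x 1).im - (x 0 * conj (x 0)).re,
    (x 2).im - (x 0 ^ 2 * conj (x 0) + x 0 * conj (x 0) ^ 2).re,
    (x 3).im - (-Complex.I * (x 0 ^ 2 * conj (x 0) - x 0 * conj (x 0) ^ 2)).re]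

/-- Beloshapka's cubic `M_c⁵ ⊂ ℂ⁴`. -/
def cubic : Set C4 := {x | cubicEquations x = 0}

/-- The real part of the holomorphic vector field `∑ Vₖ ∂/∂xₖ` is tangent to the cubic at `x`
(as usual, this real part is identified with the real vector `V x` of `ℂ⁴ = ℝ⁸`). -/
def TangentToCubic (V : C4 → C4) (x : C4) : Prop := fderiv ℝ cubicEquations x (V x) = 0

/-- `Φ` identifies `𝔤⁷` with the Lie algebra `𝔞𝔲𝔱_CR(M_c⁵)` of infinitesimal CR automorphisms of the
cubic: the real parts of the holomorphic vector fields which are tangent to the cubic, including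
the fields which are only defined locally. -/
structure IsInfinitesimalCRAutIso (Φ : g7 →ₗ[ℝ] (C4 → C4)) : Prop where
  injective : Function.Injective Φ
  holomorphic : ∀ y, Differentiable ℂ (Φ y)
  tangent : ∀ y, ∀ x ∈ cubic, TangentToCubic (Φ y) x
  lie : ∀ y y' : g7, Φ ⁅y, y'⁆ = VectorField.lieBracket ℂ (Φ y) (Φ y')
  surjective : ∀ (Ω : Set C4) (V : C4 → C4), IsOpen Ω → DifferentiableOn ℂ V Ω →
    (∀ x ∈ Ω ∩ cubic, TangentToCubic V x) → ∀ x ∈ Ω ∩ cubic, ∃ y, V =ᶠ[𝓝 x] Φ y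

/-- `act` is an action of `G⁷` on `ℂ⁴` by holomorphic maps that preserve the cubic, for which the
cubic is the homogeneous space `G⁷/H²` (with `H²` the isotropy group of the origin) and is also a
copy of the simply transitive subgroup `N₅⁴`, real-analytically. -/
structure IsModelAction (act : Mat4 → C4 → C4) : Prop where
  one : act 1 = id
  mul : ∀ g ∈ G7, ∀ g' ∈ G7, act ((g * g' : GL (Fin 4) ℂ) : Mat4) = act (g : Mat4) ∘ act (g' : Mat4)
  holomorphic : ∀ g ∈ G7, Differentiable ℂ (act (g : Mat4))
  analytic : AnalyticOnNhd ℝ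
    (fun q : (ℂ × ℂ × ℝ × ℂ) × C4 => act (nMat q.1.2.1 q.1.2.2.1 q.1.2.2.2 * hMat q.1.1) q.2)
    {q | q.1.1 ≠ 0}
  preserves : ∀ g ∈ G7, Set.MapsTo (act (g : Mat4)) cubic cubic
  effective : ∀ g ∈ G7, (∀ x ∈ cubic, act (g : Mat4) x = x) → g = 1
  transitive : ∀ x ∈ cubic, ∀ y ∈ cubic, ∃ g ∈ G7, act (g : Mat4) x = y
  isotropy : ∀ g ∈ G7, act (g : Mat4) 0 = 0 ↔ g ∈ H2
  simply_transitive : ∀ x ∈ cubic, ∀ y ∈ cubic, ∃! n, n ∈ N5 ∧ act (n : Mat4) x = y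
  orbit_embedding : IsClosedEmbedding
    (fun q : ℂ × ℝ × ℂ => act (nMat q.1 q.2.1 q.2.2) 0)
  orbit_immersion : ∀ q : ℂ × ℝ × ℂ, Function.Injective
    (fderiv ℝ (fun q : ℂ × ℝ × ℂ => act (nMat q.1 q.2.1 q.2.2) 0) q)

/-- The description of the model `G⁷/H² ≅ N₅⁴ ≅ M_c⁵` and of its Lie algebra
`𝔤⁷ ≅ 𝔞𝔲𝔱_CR(M_c⁵)`. -/
structure ModelDescription : Prop where
  G7_closed : IsClosed (G7 : Set (GL (Fin 4) ℂ))
  G7_connected : IsConnected (G7 : Set (GL (Fin 4) ℂ))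
  G7_lie : IsLieAlgebraOf g7 G7
  g7_dim : Module.finrank ℝ g7 = 7
  g7_brackets : BracketTable
  H2_le : H2 ≤ G7
  H2_closed : IsClosed (H2 : Set (GL (Fin 4) ℂ))
  H2_connected : IsConnected (H2 : Set (GL (Fin 4) ℂ))
  H2_lie : IsLieAlgebraOf h2 H2
  H2_iso : ∃ e : H2 ≃* ℂˣ, ∀ h : H2, ((h : GL (Fin 4) ℂ) : Mat4) = hMat (e h : ℂ)
  N5_le : N5 ≤ G7
  N5_closed : IsClosed (N5 : Set (GL (Fin 4) ℂ))
  N5_simplyConnected : SimplyConnectedSpace N5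
  N5_nilpotent : Group.IsNilpotent N5
  N5_lie : IsLieAlgebraOf n5 N5
  n5_brackets : ∃ x : Module.Basis (Fin 5) ℝ n5,
    ⁅x 0, x 1⁆ = x 2 ∧ ⁅x 0, x 2⁆ = x 3 ∧ ⁅x 1, x 2⁆ = x 4 ∧
    (∀ j : Fin 5, ⁅x j, x 3⁆ = 0) ∧ (∀ j : Fin 5, ⁅x j, x 4⁆ = 0)
  action : ∃ act, IsModelAction act
  aut : ∃ Φ, IsInfinitesimalCRAutIso Φ

/-! ## Cartan connections on `P⁷ = M × ℂ*` -/

/-- Real coordinates on `M` together with the complex fibre coordinate `a`. -/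
abbrev E7 := R5 × ℂ

/-- The bundle `V × ℂ*` over `V ⊆ M`. -/
def bundleOver (V : Set R5) : Set E7 := {x | x.1 ∈ V ∧ x.2 ≠ 0}

/-- The right action of `H²` on `M × ℂ*`: the diagonal matrix `hMat b` acts by `(p, a) ↦ (p, a b)`;
`b` is the second diagonal entry of `hMat b`. -/
def fiberAct (x : E7) (h : Mat4) : E7 := (x.1, x.2 * h 1 1)

/-- A real-analytic Cartan connection modelled on `G⁷/H²`, on the principal bundle `P` with the
right action `fiberAct`. -/
structure IsCartanConnection (P : Set E7) (ϖ : E7 → E7 →ₗ[ℝ] g7) : Prop where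
  analytic : ∀ (v : E7) (i j : Fin 4), AnalyticOnNhd ℝ (fun x => (ϖ x v : Mat4) i j) P
  bijective : ∀ x ∈ P, Function.Bijective (ϖ x)
  fundamental : ∀ x ∈ P, ∀ y : g7, (y : Mat4) ∈ h2 →
    ϖ x (deriv (fun t : ℝ => fiberAct x (NormedSpace.exp (t • (y : Mat4)))) 0) = y
  equivariant : ∀ x ∈ P, ∀ h ∈ H2, ∀ v : E7,
    (ϖ (fiberAct x (h : Mat4)) (fderiv ℝ (fun x' => fiberAct x' (h : Mat4)) x v) : Mat4) =
      ((h⁻¹ : GL (Fin 4) ℂ) : Mat4) * (ϖ x v : Mat4) * (h : Mat4)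

/-- Complex-valued one-forms `λ, σ, ζ` and a real-valued one-form `ρ` on `M × ℂ*`; the other three
of the seven forms are the conjugates `λ̄, σ̄, ζ̄`. -/
structure Coframe where
  lam : E7 → E7 →L[ℝ] ℂ
  sig : E7 → E7 →L[ℝ] ℂ
  rho : E7 → E7 →L[ℝ] ℝ
  zet : E7 → E7 →L[ℝ] ℂ

namespace Coframe

/-- The real-analyticity of the forms on `P`. -/
def IsAnalytic (c : Coframe) (P : Set E7) : Prop :=
  AnalyticOnNhd ℝ c.lam P ∧ AnalyticOnNhd ℝ c.sig P ∧
    AnalyticOnNhd ℝ c.rho P ∧ AnalyticOnNhd ℝ c.zet P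

/-- The `𝔤⁷`-valued one-form `ϖ` with components `λ, σ, ρ, ζ`. -/
def varpi (c : Coframe) (x : E7) : E7 →ₗ[ℝ] g7 where
  toFun v := gElem (c.lam x v) (c.sig x v) (c.rho x v) (c.zet x v)
  map_add' v w := Subtype.ext (by simp [gElem, gMat_add])
  map_smul' t v := Subtype.ext (by simp only [gElem, map_smul]; exact (smul_gMat ..).symm)

/-- `ϖ = λ̄ e_ᾱ + λ e_α + σ̄ e_σ̄ + σ e_σ + ρ e_ρ + ζ̄ e_ζ̄ + ζ e_ζ`. -/
theorem one_tmul_varpi (c : Coframe) (x v : E7) :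
    (1 : ℂ) ⊗ₜ[ℝ] c.varpi x v =
      conj (c.lam x v) • eAlphaBar + c.lam x v • eAlpha +
      conj (c.sig x v) • eSigmaBar + c.sig x v • eSigma +
      (c.rho x v : ℂ) • eRho +
      conj (c.zet x v) • eZetaBar + c.zet x v • eZeta :=
  one_tmul_gElem _ _ _ _

/-- The five forms `σ̄, σ, ρ, ζ̄, ζ` at `x`, evaluated on a tangent vector. -/
def horizontal (c : Coframe) (x v : E7) : Fin 5 → ℂ :=
  ![conj (c.sig x v), c.sig x v, (c.rho x v : ℂ), conj (c.zet x v), c.zet x v]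

end Coframe

/-- The exterior derivative of a one-form, evaluated on a pair of tangent vectors. -/
def dForm {F : Type*} [NormedAddCommGroup F] [NormedSpace ℝ F]
    (η : E7 → E7 →L[ℝ] F) (x v w : E7) : F :=
  extDeriv (fun y => ContinuousAlternatingMap.ofSubsingleton ℝ E7 F (0 : Fin 1) (η y)) x ![v, w]

/-- The wedge product of two complex-valued one-forms, evaluated on a pair of tangent vectors. -/
def wedge (α β : E7 → ℂ) (v w : E7) : ℂ := α v * β w - α w * β v

/-- The forms come from the lifted coframe on `M × ℂ*` after normalizing the nondiagonal group
parameters `b = a B₀`, `c = a ā C₀`, `d = ā D₀`, `e = a E₀` by functions on `M`: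
`σ = a² ā σ₀`, `ρ = a ā (C̄₀ σ̄₀ + C₀ σ₀ + ρ₀)`, `ζ = a (D̄₀ σ̄₀ + E₀ σ₀ + B₀ ρ₀ + ζ₀)`, and
`λ = da/a + θ` with a one-form `θ` on `M`. -/
def IsReducedCoframe (M : LocalSubmanifold) (L : R5 → C5) (c : Coframe) : Prop :=
  ∃ (B₀ C₀ D₀ E₀ : R5 → ℂ) (θ : R5 → R5 →L[ℝ] ℂ),
    AnalyticOnNhd ℝ B₀ M.U ∧ AnalyticOnNhd ℝ C₀ M.U ∧ AnalyticOnNhd ℝ D₀ M.U ∧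
    AnalyticOnNhd ℝ E₀ M.U ∧ AnalyticOnNhd ℝ θ M.U ∧
    ∀ p ∈ M.U, ∀ a : ℂ, a ≠ 0 → ∀ v : E7,
      let ν₀ := initialCoframe L p (toC5 v.1)
      c.sig (p, a) v = a ^ 2 * conj a * ν₀ 1 ∧
      (c.rho (p, a) v : ℂ) = a * conj a * (conj (C₀ p) * ν₀ 0 + C₀ p * ν₀ 1 + ν₀ 2) ∧
      c.zet (p, a) v = a * (conj (D₀ p) * ν₀ 0 + E₀ p * ν₀ 1 + B₀ p * ν₀ 2 + ν₀ 4) ∧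
      c.lam (p, a) v = v.2 / a + θ p v.1

/-- The structure equations of the absolute parallelism, with torsion functions `R, V₁, V₃, W₁, …,
W₁₀` on `M`. -/
def StructureEquations (M : LocalSubmanifold) (L : R5 → C5) (c : Coframe) : Prop :=
  ∃ (V₁ V₃ W₁ W₂ W₃ W₄ W₅ W₆ W₇ W₈ W₉ W₁₀ : R5 → ℂ) (I : Fin 5 → Fin 5 → E7 → ℂ),
    ∀ p ∈ M.U, ∀ a : ℂ, a ≠ 0 → ∀ v w : E7,
      let lam : E7 → ℂ := fun v => c.lam (p, a) v
      let lamBar : E7 → ℂ := fun v => conj (c.lam (p, a) v)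
      let sig : E7 → ℂ := fun v => c.sig (p, a) v
      let sigBar : E7 → ℂ := fun v => conj (c.sig (p, a) v)
      let rho : E7 → ℂ := fun v => (c.rho (p, a) v : ℂ)
      let zet : E7 → ℂ := fun v => c.zet (p, a) v
      let zetBar : E7 → ℂ := fun v => conj (c.zet (p, a) v)
      dForm c.sig (p, a) v w =
        2 * wedge lam sig v w + wedge lamBar sig v w
        + a / conj a ^ 2 * conj (invariantR L p) * wedge sigBar zetBar v w
        + wedge rho zet v w ∧
      ((dForm c.rho (p, a) v w : ℝ) : ℂ) =
        wedge lam rho v w + wedge lamBar rho v w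
        + V₁ p / (a ^ 2 * conj a ^ 2) * wedge sigBar sig v w
        + V₃ p / conj a ^ 2 * wedge sigBar zetBar v w
        + conj (V₃ p) / a ^ 2 * wedge sig zet v w
        + Complex.I * wedge zet zetBar v w ∧
      dForm c.zet (p, a) v w =
        wedge lam zet v w
        + W₁ p / (a ^ 2 * conj a ^ 3) * wedge sigBar sig v w
        + W₂ p / (a * conj a ^ 3) * wedge sigBar rho v w
        + W₃ p / conj a ^ 3 * wedge sigBar zetBar v w
        + W₄ p / (a * conj a ^ 2) * wedge sigBar zet v w
        + W₅ p / (a ^ 2 * conj a ^ 2) * wedge sig rho v w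
        + W₆ p / (a * conj a ^ 2) * wedge sig zetBar v w
        + W₇ p / (a ^ 2 * conj a) * wedge sig zet v w
        + W₈ p / conj a ^ 2 * wedge rho zetBar v w
        + W₉ p / (a * conj a) * wedge rho zet v w
        + W₁₀ p / conj a * wedge zetBar zet v w ∧
      dForm c.lam (p, a) v w =
        ∑ j, ∑ k, I j k (p, a) *
          wedge (fun v => c.horizontal (p, a) v j) (fun v => c.horizontal (p, a) v k) v w

/-! ## Local biholomorphic equivalences and their lifts -/

/-- `h : V → M'`, with `V` open in `M`, is the restriction to `M` of local biholomorphic maps `H` of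
`ℂ⁴` with `H(M) ⊆ M'`. -/
structure IsLocalBiholomorphism (M M' : LocalSubmanifold) (V : Set R5) (h : R5 → R5) : Prop where
  isOpen : IsOpen V
  subset : V ⊆ M.U
  mapsTo : Set.MapsTo h V M'.U
  analytic : AnalyticOnNhd ℝ h V
  extends_holomorphically : ∀ p ∈ V, ∃ H : C4 → C4, AnalyticAt ℂ H (M.φ p) ∧
    Function.Bijective (fderiv ℂ H (M.φ p)) ∧ ∀ᶠ q in 𝓝 p, H (M.φ q) = M'.φ (h q)

/-- A real-analytic map `F : V × ℂ* → M' × ℂ*` which sends fibres to fibres and satisfies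
`F^* ϖ' = ϖ`. -/
structure PreservesConnection (M' : LocalSubmanifold) (V : Set R5)
    (ϖ ϖ' : E7 → E7 →ₗ[ℝ] g7) (F : E7 → E7) : Prop where
  analytic : AnalyticOnNhd ℝ F (bundleOver V)
  mapsTo : Set.MapsTo F (bundleOver V) (bundleOver M'.U)
  fiber_preserving : ∀ x ∈ bundleOver V, ∀ y ∈ bundleOver V, x.1 = y.1 → (F x).1 = (F y).1
  pullback_eq : ∀ x ∈ bundleOver V, ∀ v : E7, ϖ' (F x) (fderiv ℝ F x v) = ϖ x v

/-- `F` commutes with the right actions of the structure group `H²`. -/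
def IsEquivariant (V : Set R5) (F : E7 → E7) : Prop :=
  ∀ x ∈ bundleOver V, ∀ h ∈ H2, F (fiberAct x (h : Mat4)) = fiberAct (F x) (h : Mat4)

/-- `F` covers `h`. -/
def Covers (V : Set R5) (F : E7 → E7) (h : R5 → R5) : Prop :=
  ∀ x ∈ bundleOver V, (F x).1 = h x.1

end

-- Part (1) is explicit. A matrix of `G7` acts projectively on the column `(σ, y, z, 1)`; a fourth
-- coordinate `q`, which on the cubic equals `σ̄ - z̄ y`, is carried along holomorphically, and the
-- cubic is the orbit of the origin under `N5` (`mem_cubic_iff`, `exists_modelAction`). The Lie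
-- algebras are found in two directions: the equation `γ' = γ X` is integrated inside the group
-- (`exp_gMat`), and the polynomial equations of the group are linearized at the identity
-- (`mem_g7_of_exp`).
--
-- The infinitesimal CR automorphisms of the cubic are bounded by a rigidity argument. Along the
-- cubic, a tangent holomorphic field is `α ℒ + τ 𝒯 + β 𝒮` plus conjugates, with `τ` real, and
-- holomorphy gives first-order equations for `α, τ, β`. The commutation relations of `ℒ, ℒ̄, 𝒯, 𝒮,
-- 𝒮̄` then force `ℒ α` to be constant, so the field is determined by `α, τ, β, ℒ α` at one point
-- (`cubic_rigidity`). These are `2 + 1 + 2 + 2 = 7` real parameters, and explicit fields realize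
-- all of their values (`autMap_surjective`).
--
-- Part (2) is Cartan's equivalence method carried out on the base. The Class III₁ condition says
-- that `𝒮̄, 𝒮, 𝒯, ℒ̄, ℒ` is a frame (`isUnit_det_frameMatrix`). One looks for `ρ ≡ ρ₀` modulo `σ₀,
-- σ̄₀`, for `ζ ≡ ζ₀` modulo `σ₀, σ̄₀, ρ₀`, and for a connection form `θ` such that `dσ₀` and `dρ`
-- have the normalized shape `StructureAt`. The unknown coefficients solve linear equations one
-- after the other (`structureAt_of_coefficients`, `exists_adapted_coframe`), and the solution is
-- unique (`rho_eq_of_structureAt`, `eq_of_structureAt`). Multiplying the rows by the weights `a²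
-- ā`, `a ā`, `a` and setting `λ = da/a + θ` gives the coframe on `M × ℂ*`; its equivariance
-- expresses that the weights are those of the adjoint action of `H2`.
--
-- Canonicity is a consequence of uniqueness. A local biholomorphism sends `ℒ` to `f ℒ'`; the pulled
-- back coframe, rescaled by powers of `f` and `f̄`, solves the normalization problem of `M`, so it
-- is the coframe of `M` (`IsAdapted.pull_eq`), and `(p, a) ↦ (h p, a / f p)` is the lift.
-- Conversely, a map that preserves the connections pulls the rows back to multiples of the rows, so
-- its base map is a local diffeomorphism preserving `T^{0,1}`. A real-analytic CR map extends
-- holomorphically: after complexification it is constant along the fibres of the complexified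
-- parametrization and factors through it (`exists_holomorphic_factor`,
-- `exists_holomorphic_extension`).

attribute [local instance] LieRing.ofAssociativeRing
set_option linter.unusedSectionVars false
set_option linter.unusedSimpArgs false

/-! ### Differentiation along complexified tangent vectors of `ℝ⁵` -/

section ComplexDerivative

variable {F G : Type*} [NormedAddCommGroup F] [NormedSpace ℝ F] [NormedSpace ℂ F]
  [IsScalarTower ℝ ℂ F]

/-- The derivative of `f` at `p` along complexified tangent vectors. -/
noncomputable def cD (f : R5 → F) (p : R5) : C5 →ₗ[ℂ] F :=
  Fintype.linearCombination ℂ (fun j : Fin 5 => fderiv ℝ f p (Pi.single j 1))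

theorem complexDeriv_eq {n : ℕ} (f : R5 → (Fin n → ℂ)) (p : R5) : complexDeriv f p = cD f p := rfl

theorem cD_apply (f : R5 → F) (p : R5) (X : C5) :
    cD f p X = ∑ j, X j • fderiv ℝ f p (Pi.single j 1) := rfl

theorem clm_toC5 (A : R5 →L[ℝ] F) (v : R5) :
    ∑ j, (toC5 v j) • A (Pi.single j 1) = A v := by
  conv_rhs => rw [pi_eq_sum_univ' v, map_sum]
  refine Finset.sum_congr rfl fun j _ => ?_
  rw [map_smul, toC5]
  exact algebraMap_smul ℂ (v j) (A (Pi.single j 1))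

theorem cD_toC5 (f : R5 → F) (p v : R5) : cD f p (toC5 v) = fderiv ℝ f p v :=
  clm_toC5 _ v

theorem cD_congr {f g : R5 → F} {p : R5} (h : f =ᶠ[𝓝 p] g) : cD f p = cD g p := by
  refine LinearMap.ext fun X => ?_
  simp only [cD_apply, h.fderiv_eq]

theorem cD_const (c : F) (p : R5) : cD (fun _ => c) p = 0 := by
  refine LinearMap.ext fun X => ?_
  simp [cD_apply]

theorem cD_add {f g : R5 → F} {p : R5} (hf : DifferentiableAt ℝ f p) (hg : DifferentiableAt ℝ g p) :
    cD (fun q => f q + g q) p = cD f p + cD g p := by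
  refine LinearMap.ext fun X => ?_
  simp [cD_apply, fderiv_fun_add hf hg, Finset.sum_add_distrib]

theorem cD_neg (f : R5 → F) (p : R5) :
    cD (fun q => - f q) p = - cD f p := by
  refine LinearMap.ext fun X => ?_
  simp [cD_apply, fderiv_fun_neg]

theorem cD_sub {f g : R5 → F} {p : R5} (hf : DifferentiableAt ℝ f p) (hg : DifferentiableAt ℝ g p) :
    cD (fun q => f q - g q) p = cD f p - cD g p := by
  refine LinearMap.ext fun X => ?_
  simp [cD_apply, fderiv_fun_sub hf hg, smul_sub]

theorem cD_smul {f : R5 → ℂ} {g : R5 → F} {p : R5} (hf : DifferentiableAt ℝ f p)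
    (hg : DifferentiableAt ℝ g p) (X : C5) :
    cD (fun q => f q • g q) p X = f p • cD g p X + cD f p X • g p := by
  simp only [cD_apply, fderiv_fun_smul hf hg, add_apply, smul_apply,
    ContinuousLinearMap.smulRight_apply, smul_add,
    Finset.sum_add_distrib, Finset.smul_sum, Finset.sum_smul, smul_smul, smul_eq_mul]
  congr 1
  exact Finset.sum_congr rfl fun j _ => by rw [mul_comm]

theorem cD_mul {f g : R5 → ℂ} {p : R5} (hf : DifferentiableAt ℝ f p)
    (hg : DifferentiableAt ℝ g p) (X : C5) :
    cD (fun q => f q * g q) p X = f p * cD g p X + cD f p X * g p :=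
  cD_smul hf hg X

theorem cD_sum {ι : Type*} (s : Finset ι) {f : ι → R5 → F} {p : R5}
    (hf : ∀ i ∈ s, DifferentiableAt ℝ (f i) p) :
    cD (fun q => ∑ i ∈ s, f i q) p = ∑ i ∈ s, cD (f i) p := by
  classical
  induction s using Finset.induction_on with
  | empty => simp [cD_const]
  | insert a s ha ih =>
    simp only [Finset.sum_insert ha]
    rw [cD_add (hf a (by simp)) (DifferentiableAt.fun_sum fun i hi => hf i (by simp [hi])),
      ih fun i hi => hf i (by simp [hi])]

theorem cD_pi {n : ℕ} {f : R5 → (Fin n → ℂ)} {p : R5} (hf : DifferentiableAt ℝ f p) (X : C5)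
    (i : Fin n) : cD f p X i = cD (fun q => f q i) p X := by
  simp only [cD_apply, Finset.sum_apply, Pi.smul_apply]
  refine Finset.sum_congr rfl fun j _ => ?_
  rw [fderiv_apply (differentiableAt_pi.1 hf i |> fun _ => hf) i]
  rfl

theorem fderiv_conj (f : R5 → ℂ) (p v : R5) :
    fderiv ℝ (fun q => conj (f q)) p v = conj (fderiv ℝ f p v) := by
  have := Complex.conjCLE.comp_fderiv (f := f) (x := p)
  have h2 := congrArg (fun A : R5 →L[ℝ] ℂ => A v) this
  simpa [Function.comp_def] using h2

theorem cD_conj (f : R5 → ℂ) (p : R5) (X : C5) :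
    cD (fun q => conj (f q)) p X = conj (cD f p (star X)) := by
  simp [cD_apply, fderiv_conj]

theorem cD_star {n : ℕ} {f : R5 → (Fin n → ℂ)} {p : R5} (hf : DifferentiableAt ℝ f p) (X : C5) :
    cD (fun q => star (f q)) p X = star (cD f p (star X)) := by
  ext i
  have : DifferentiableAt ℝ (fun q => star (f q)) p := by
    rw [differentiableAt_pi] at hf ⊢
    intro i
    exact Complex.conjCLE.differentiableAt.comp p (hf i)
  rw [cD_pi this, Pi.star_apply, cD_pi hf]
  exact cD_conj _ _ _

theorem cD_comp {f : R5 → F} {h : R5 → R5} {p : R5} (hf : DifferentiableAt ℝ f (h p))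
    (hh : DifferentiableAt ℝ h p) (X : C5) :
    cD (fun q => f (h q)) p X = cD f (h p) (cD (fun q => toC5 (h q)) p X) := by
  have e1 : ∀ v, fderiv ℝ (fun q => f (h q)) p v = fderiv ℝ f (h p) (fderiv ℝ h p v) := by
    intro v
    have h2 := (hf.hasFDerivAt.comp p hh.hasFDerivAt).fderiv
    have h3 : fderiv ℝ (fun q => f (h q)) p = _ := h2
    rw [h3]; rfl
  have e2 : ∀ v, fderiv ℝ (fun q => toC5 (h q)) p v = toC5 (fderiv ℝ h p v) := by
    intro v
    have hl : HasFDerivAt toC5 (ContinuousLinearMap.pi fun j =>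
        Complex.ofRealCLM.comp (ContinuousLinearMap.proj j : R5 →L[ℝ] ℝ)) (h p) :=
      (ContinuousLinearMap.pi fun j =>
        Complex.ofRealCLM.comp (ContinuousLinearMap.proj j : R5 →L[ℝ] ℝ)).hasFDerivAt
    have h2 := (hl.comp p hh.hasFDerivAt).fderiv
    have h3 : fderiv ℝ (fun q => toC5 (h q)) p = _ := h2
    rw [h3]; rfl
  rw [cD_apply, cD_apply (fun q => toC5 (h q)), map_sum]
  refine Finset.sum_congr rfl fun j _ => ?_
  rw [map_smul, e1, e2, cD_toC5]

theorem contDiffAt_cD {f : R5 → F} {p : R5} {n : ℕ∞ω} (hf : ContDiffAt ℝ (n + 1) f p)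
    {X : R5 → C5} (hX : ContDiffAt ℝ n X p) : ContDiffAt ℝ n (fun q => cD f q (X q)) p := by
  simp only [cD_apply]
  refine ContDiffAt.sum fun j _ => ?_
  exact (contDiffAt_pi.1 hX j).smul ((hf.fderiv_right le_rfl).clm_apply contDiffAt_const)

theorem analyticAt_cD [CompleteSpace F] {f : R5 → F} {p : R5} (hf : AnalyticAt ℝ f p)
    {X : R5 → C5} (hX : AnalyticAt ℝ X p) : AnalyticAt ℝ (fun q => cD f q (X q)) p := by
  simp only [cD_apply]
  refine Finset.analyticAt_fun_sum _ fun j _ => ?_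
  refine AnalyticAt.fun_smul (analyticAt_pi_iff.1 hX j) ?_
  exact ((ContinuousLinearMap.apply ℝ F (Pi.single j (1 : ℝ) : R5)).analyticAt _).comp hf.fderiv

/-- The second derivative along complexified tangent vectors. -/
noncomputable def cD2 (f : R5 → F) (p : R5) (X Y : C5) : F :=
  ∑ j, ∑ k, X j • Y k • fderiv ℝ (fderiv ℝ f) p (Pi.single j 1) (Pi.single k 1)

theorem cD2_symm {f : R5 → F} {p : R5} (hf : ContDiffAt ℝ 2 f p) (X Y : C5) :
    cD2 f p X Y = cD2 f p Y X := by
  have hs : IsSymmSndFDerivAt ℝ f p := hf.isSymmSndFDerivAt (by simp)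
  simp only [cD2]
  rw [Finset.sum_comm]
  refine Finset.sum_congr rfl fun j _ => Finset.sum_congr rfl fun k _ => ?_
  rw [hs, smul_comm]

/-- This is the product rule. The second-order term `cD2` is symmetric in the two directions, so it
cancels in commutators and only the derivatives of the fields remain. -/
theorem cD_cD {f : R5 → F} {p : R5} (hf : ContDiffAt ℝ 2 f p) {Y : R5 → C5}
    (hY : DifferentiableAt ℝ Y p) (X : C5) :
    cD (fun q => cD f q (Y q)) p X = cD2 f p X (Y p) + cD f p (cD Y p X) := by
  have hfd : DifferentiableAt ℝ (fderiv ℝ f) p :=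
    (hf.fderiv_right (m := 1) (by norm_num)).differentiableAt (by simp)
  have hk : ∀ k : Fin 5, DifferentiableAt ℝ (fun q => fderiv ℝ f q (Pi.single k 1)) p :=
    fun k => hfd.clm_apply (differentiableAt_const _)
  have hYk : ∀ k : Fin 5, DifferentiableAt ℝ (fun q => Y q k) p := differentiableAt_pi.1 hY
  simp only [cD_apply f]
  rw [cD_sum _ fun k _ => (hYk k).fun_smul (hk k)]
  simp only [LinearMap.sum_apply]
  simp only [cD_smul (hYk _) (hk _), Finset.sum_add_distrib, ← cD_pi hY]
  congr 1
  rw [cD2, Finset.sum_comm]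
  refine Finset.sum_congr rfl fun k _ => ?_
  rw [cD_apply, Finset.smul_sum]
  refine Finset.sum_congr rfl fun j _ => ?_
  rw [smul_comm]
  congr 2
  rw [fderiv_clm_apply hfd (differentiableAt_const _)]
  simp

/-- A Lie bracket acts on functions as a commutator. -/
theorem cD_bracket {f : R5 → F} {p : R5} (hf : ContDiffAt ℝ 2 f p) {X Y : R5 → C5}
    (hX : DifferentiableAt ℝ X p) (hY : DifferentiableAt ℝ Y p) :
    cD f p (bracket X Y p) =
      cD (fun q => cD f q (Y q)) p (X p) - cD (fun q => cD f q (X q)) p (Y p) := by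
  rw [cD_cD hf hY, cD_cD hf hX, cD2_symm hf (Y p), bracket, complexDeriv_eq, complexDeriv_eq,
    map_sub]
  abel

end ComplexDerivative

/-! ### Lie brackets of complex vector fields -/

section Bracket

theorem differentiableAt_conjField {X : R5 → C5} {p : R5} (hX : DifferentiableAt ℝ X p) :
    DifferentiableAt ℝ (conjField X) p := by
  rw [differentiableAt_pi] at hX ⊢
  exact fun i => Complex.conjCLE.differentiableAt.comp p (hX i)

theorem analyticAt_conjField {X : R5 → C5} {p : R5} (hX : AnalyticAt ℝ X p) :
    AnalyticAt ℝ (conjField X) p := by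
  rw [analyticAt_pi_iff] at hX ⊢
  exact fun i => (Complex.conjCLE.toContinuousLinearMap.analyticAt _).comp (hX i)

theorem analyticAt_bracket {X Y : R5 → C5} {p : R5} (hX : AnalyticAt ℝ X p)
    (hY : AnalyticAt ℝ Y p) : AnalyticAt ℝ (bracket X Y) p :=
  (analyticAt_cD hY hX).sub (analyticAt_cD hX hY)

theorem bracket_congr {X X' Y Y' : R5 → C5} {p : R5} (hX : X =ᶠ[𝓝 p] X') (hY : Y =ᶠ[𝓝 p] Y') :
    bracket X Y p = bracket X' Y' p := by
  simp only [bracket, complexDeriv_eq, cD_congr hX, cD_congr hY, hX.eq_of_nhds, hY.eq_of_nhds]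

theorem bracket_swap (X Y : R5 → C5) (p : R5) : bracket X Y p = - bracket Y X p := by
  simp [bracket]

theorem bracket_self (X : R5 → C5) (p : R5) : bracket X X p = 0 := by
  simp [bracket]

theorem bracket_conj {X Y : R5 → C5} {p : R5} (hX : DifferentiableAt ℝ X p)
    (hY : DifferentiableAt ℝ Y p) :
    bracket (conjField X) (conjField Y) p = star (bracket X Y p) := by
  simp only [bracket, complexDeriv_eq]
  have h1 := cD_star hX (conjField Y p)
  have h2 := cD_star hY (conjField X p)
  rw [conjField, star_star] at h1 h2
  rw [star_sub, ← h1, ← h2]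
  rfl

theorem bracket_add_right {X Y Z : R5 → C5} {p : R5}
    (hY : DifferentiableAt ℝ Y p) (hZ : DifferentiableAt ℝ Z p) :
    bracket X (fun q => Y q + Z q) p = bracket X Y p + bracket X Z p := by
  simp only [bracket, complexDeriv_eq, cD_add hY hZ, map_add, LinearMap.add_apply]
  abel

theorem bracket_smul_right {f : R5 → ℂ} {X Y : R5 → C5} {p : R5} (hf : DifferentiableAt ℝ f p)
    (hY : DifferentiableAt ℝ Y p) :
    bracket X (fun q => f q • Y q) p = f p • bracket X Y p + cD f p (X p) • Y p := by
  simp only [bracket, complexDeriv_eq, cD_smul hf hY, map_smul, smul_sub]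
  abel

theorem bracket_smul_left {f : R5 → ℂ} {X Y : R5 → C5} {p : R5} (hf : DifferentiableAt ℝ f p)
    (hX : DifferentiableAt ℝ X p) :
    bracket (fun q => f q • X q) Y p = f p • bracket X Y p - cD f p (Y p) • X p := by
  rw [bracket_swap, bracket_smul_right hf hX, bracket_swap Y X, smul_neg]
  abel

end Bracket

/-! ### Holomorphic extension of real-analytic maps from `ℝⁿ` to `ℂⁿ` -/

section Complexification

variable {n : ℕ} {F : Type*} [NormedAddCommGroup F] [NormedSpace ℂ F] [CompleteSpace F]

/-- Real vectors as complex ones. -/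
def ofRealVec (v : Fin n → ℝ) : Fin n → ℂ := fun j => (v j : ℂ)

theorem norm_ofRealVec (v : Fin n → ℝ) : ‖ofRealVec v‖ = ‖v‖ := by
  simp [ofRealVec, Pi.norm_def]

theorem ofRealVec_sub (v w : Fin n → ℝ) : ofRealVec (v - w) = ofRealVec v - ofRealVec w := by
  ext j; simp [ofRealVec]

theorem continuous_ofRealVec : Continuous (ofRealVec : (Fin n → ℝ) → (Fin n → ℂ)) :=
  continuous_pi fun j => Complex.continuous_ofReal.comp (continuous_apply j)

/-- A holomorphic function near a real point which vanishes at the real points vanishes. -/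
theorem eventually_eq_zero_of_real {G : (Fin n → ℂ) → F} {p : Fin n → ℝ}
    (hG : ∀ᶠ z in 𝓝 (ofRealVec p), DifferentiableAt ℂ G z)
    (h0 : ∀ᶠ q in 𝓝 p, G (ofRealVec q) = 0) : ∀ᶠ z in 𝓝 (ofRealVec p), G z = 0 := by
  obtain ⟨r₁, hr₁, H₁⟩ := Metric.eventually_nhds_iff_ball.1 hG
  obtain ⟨r₂, hr₂, H₂⟩ := Metric.eventually_nhds_iff_ball.1 h0
  set r := min r₁ r₂ with hr
  have hrpos : 0 < r := lt_min hr₁ hr₂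
  refine Metric.eventually_nhds_iff_ball.2 ⟨r / 3, by positivity, fun z hz => ?_⟩
  set x : Fin n → ℝ := fun j => (z j).re with hx
  set y : Fin n → ℝ := fun j => (z j).im with hy
  have hz' : ‖z - ofRealVec p‖ < r / 3 := by simpa [dist_eq_norm] using hz
  have hxp : ‖x - p‖ < r / 3 := by
    refine lt_of_le_of_lt ((pi_norm_le_iff_of_nonneg (norm_nonneg _)).2 fun j => ?_) hz'
    refine le_trans ?_ (norm_le_pi_norm _ j)
    simpa [ofRealVec] using Complex.abs_re_le_norm (z j - p j)
  have hyp : ‖y‖ < r / 3 := by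
    refine lt_of_le_of_lt ((pi_norm_le_iff_of_nonneg (norm_nonneg _)).2 fun j => ?_) hz'
    refine le_trans ?_ (norm_le_pi_norm _ j)
    simpa [ofRealVec] using Complex.abs_im_le_norm (z j - p j)
  -- The point `z = x + i y` is the value at `t = i` of the complex line `x + t y`, whose points
  -- with real `t` are real. The radius `r / 3` keeps the disc `|t| < 2` inside the ball of radius
  -- `r`, and this disc contains `i`, so the identity theorem in one variable applies.
  set g : ℂ → F := fun t => G (ofRealVec x + t • ofRealVec y) with hg
  have hball : ∀ t : ℂ, ‖t‖ < 2 → ofRealVec x + t • ofRealVec y ∈ Metric.ball (ofRealVec p) r := by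
    intro t ht
    rw [mem_ball_iff_norm]
    have e : ofRealVec x + t • ofRealVec y - ofRealVec p = ofRealVec (x - p) + t • ofRealVec y := by
      rw [ofRealVec_sub]; abel
    rw [e]
    refine (norm_add_le _ _).trans_lt ?_
    rw [norm_smul, norm_ofRealVec, norm_ofRealVec]
    have := mul_le_mul ht.le hyp.le (norm_nonneg _) (by norm_num)
    linarith
  have hd : DifferentiableOn ℂ g (Metric.ball 0 2) := by
    intro t ht
    have h1 := H₁ _ (Metric.ball_subset_ball (min_le_left _ _) (hball t (by simpa using ht)))
    have h2 : DifferentiableAt ℂ (fun t : ℂ => ofRealVec x + t • ofRealVec y) t := by fun_prop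
    exact (h1.comp t h2).differentiableWithinAt
  have hz0 : ∀ t : ℝ, |t| < 2 → g (t : ℂ) = 0 := by
    intro t ht
    have e : ofRealVec x + (t : ℂ) • ofRealVec y = ofRealVec (x + t • y) := by
      ext j; simp [ofRealVec]
    have h1 := hball (t : ℂ) (by simpa using ht)
    simp only [hg]
    rw [e] at h1 ⊢
    refine H₂ _ (Metric.ball_subset_ball (min_le_right r₁ r₂) ?_)
    rw [mem_ball_iff_norm] at h1 ⊢
    rwa [← ofRealVec_sub, norm_ofRealVec] at h1
  have hfreq : ∃ᶠ t in 𝓝[≠] (0 : ℂ), g t = 0 := by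
    have ht : Filter.Tendsto (fun t : ℝ => (t : ℂ)) (𝓝[≠] 0) (𝓝[≠] 0) := by
      refine tendsto_nhdsWithin_iff.2 ⟨?_, ?_⟩
      · exact (Complex.continuous_ofReal.tendsto' 0 0 (by simp)).mono_left nhdsWithin_le_nhds
      · filter_upwards [self_mem_nhdsWithin] with t ht
        simpa using ht
    refine ht.frequently (Filter.Eventually.frequently ?_)
    filter_upwards [nhdsWithin_le_nhds (Metric.ball_mem_nhds (0 : ℝ) (by norm_num : (0 : ℝ) < 2))]
      with t ht
    exact hz0 t (by simpa using ht)
  have hzero := (hd.analyticOnNhd Metric.isOpen_ball).eqOn_zero_of_preconnected_of_frequently_eq_zero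
    (convex_ball 0 2).isPreconnected (Metric.mem_ball_self (by norm_num)) hfreq
  have hI := hzero (show Complex.I ∈ Metric.ball 0 2 by simp)
  have e : ofRealVec x + Complex.I • ofRealVec y = z := by
    ext j
    simp only [ofRealVec, hx, hy, Pi.add_apply, Pi.smul_apply, smul_eq_mul]
    rw [mul_comm, Complex.re_add_im]
  simpa [hg, e] using hI

variable [NormedSpace ℝ F] [IsScalarTower ℝ ℂ F]

/-- The complex-multilinear extension of a real multilinear map on `ℝⁿ`. -/
noncomputable def complexifyMultilinear {k : ℕ}
    (A : ContinuousMultilinearMap ℝ (fun _ : Fin k => Fin n → ℝ) F) :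
    ContinuousMultilinearMap ℂ (fun _ : Fin k => Fin n → ℂ) F :=
  ∑ s : Fin k → Fin n,
    ((ContinuousMultilinearMap.mkPiAlgebra ℂ (Fin k) ℂ).compContinuousLinearMap
      fun i => (ContinuousLinearMap.proj (s i) : (Fin n → ℂ) →L[ℂ] ℂ)).smulRight
      (A fun i => Pi.single (s i) 1)

theorem complexifyMultilinear_apply {k : ℕ}
    (A : ContinuousMultilinearMap ℝ (fun _ : Fin k => Fin n → ℝ) F) (z : Fin k → Fin n → ℂ) :
    complexifyMultilinear A z =
      ∑ s : Fin k → Fin n, (∏ i, z i (s i)) • A fun i => Pi.single (s i) 1 := by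
  simp [complexifyMultilinear]

theorem complexifyMultilinear_ofRealVec {k : ℕ}
    (A : ContinuousMultilinearMap ℝ (fun _ : Fin k => Fin n → ℝ) F) (v : Fin k → Fin n → ℝ) :
    complexifyMultilinear A (fun i => ofRealVec (v i)) = A v := by
  rw [complexifyMultilinear_apply]
  have h : v = fun i => ∑ j, v i j • (Pi.single j (1 : ℝ) : Fin n → ℝ) := by
    ext i : 1
    exact pi_eq_sum_univ' (v i)
  have e := A.toMultilinearMap.map_sum fun i (j : Fin n) => v i j • (Pi.single j (1 : ℝ) : Fin n → ℝ)
  conv_rhs => rw [h]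
  refine Eq.trans ?_ e.symm
  refine Finset.sum_congr rfl fun s _ => ?_
  rw [MultilinearMap.map_smul_univ]
  simp only [ofRealVec, ← Complex.ofReal_prod]
  exact algebraMap_smul ℂ (∏ i, v i (s i)) _

/-- There are `n ^ k` coefficients, each bounded by `‖A‖`. This crude bound shrinks the radius of
convergence at most by the factor `n`, so it stays positive. -/
theorem norm_complexifyMultilinear_le {k : ℕ}
    (A : ContinuousMultilinearMap ℝ (fun _ : Fin k => Fin n → ℝ) F) :
    ‖complexifyMultilinear A‖ ≤ n ^ k * ‖A‖ := by
  refine ContinuousMultilinearMap.opNorm_le_bound (by positivity) fun z => ?_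
  rw [complexifyMultilinear_apply]
  have hb : ∀ s : Fin k → Fin n, ‖(∏ i, z i (s i)) • A fun i => Pi.single (s i) 1‖ ≤
      ‖A‖ * ∏ i, ‖z i‖ := by
    intro s
    rw [norm_smul, norm_prod, mul_comm]
    refine mul_le_mul ?_ ?_ (by positivity) (by positivity)
    · refine (A.le_opNorm _).trans ?_
      simp [Pi.norm_single]
    · exact Finset.prod_le_prod (fun i _ => norm_nonneg _) fun i _ => norm_le_pi_norm _ _
  refine (norm_sum_le_of_le _ fun s _ => hb s).trans (le_of_eq ?_)
  simp; ring

/-- A real-analytic map on `ℝⁿ` extends to a holomorphic map on `ℂⁿ`. -/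
theorem exists_complexification {f : (Fin n → ℝ) → F} {p : Fin n → ℝ} (hf : AnalyticAt ℝ f p) :
    ∃ G : (Fin n → ℂ) → F, AnalyticAt ℂ G (ofRealVec p) ∧
      ∀ᶠ q in 𝓝 p, G (ofRealVec q) = f q := by
  obtain ⟨a, R, ha⟩ := hf
  let P : FormalMultilinearSeries ℂ (Fin n → ℂ) F := fun k => complexifyMultilinear (a k)
  obtain ⟨r, hr0, hr⟩ := ENNReal.lt_iff_exists_nnreal_btwn.1 (ha.r_pos.trans_le ha.r_le)
  obtain ⟨C, hC, hb⟩ := a.norm_mul_pow_le_of_lt_radius hr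
  have hrpos : 0 < r := by simpa using hr0
  -- The complexified coefficients lose a factor `n ^ k`, which the radius `r / (n + 1)` absorbs; `n
  -- + 1` instead of `n` also covers `n = 0`.
  have hPr : ((r / (n + 1) : NNReal) : ENNReal) ≤ P.radius := by
    refine P.le_radius_of_bound C fun k => ?_
    refine le_trans ?_ (hb k)
    have h1 := norm_complexifyMultilinear_le (a k)
    have h2 : (n : ℝ) ^ k * (r / (n + 1)) ^ k ≤ (r : ℝ) ^ k := by
      rw [← mul_pow]
      refine pow_le_pow_left₀ (by positivity) ?_ k
      rw [mul_div_assoc', div_le_iff₀ (by positivity)]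
      nlinarith [r.2]
    calc ‖P k‖ * ((r / (n + 1) : NNReal) : ℝ) ^ k
        ≤ (n ^ k * ‖a k‖) * ((r / (n + 1) : NNReal) : ℝ) ^ k := by gcongr
      _ = ‖a k‖ * ((n : ℝ) ^ k * (r / (n + 1)) ^ k) := by push_cast; ring
      _ ≤ _ := by gcongr
  have hPpos : 0 < P.radius := lt_of_lt_of_le (by
    rw [ENNReal.coe_pos]; positivity) hPr
  have hP := P.hasFPowerSeriesOnBall hPpos
  refine ⟨fun z => P.sum (z - ofRealVec p), ?_, ?_⟩
  · have h1 : AnalyticAt ℂ P.sum (ofRealVec p - ofRealVec p) := by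
      rw [sub_self]; exact hP.analyticAt
    exact h1.comp (f := fun z => z - ofRealVec p) (analyticAt_id.sub analyticAt_const)
  · have hm : Metric.eball (0 : Fin n → ℂ) P.radius ∈ 𝓝 0 := Metric.eball_mem_nhds _ hPpos
    have hm' : Metric.eball (0 : Fin n → ℝ) R ∈ 𝓝 0 := Metric.eball_mem_nhds _ ha.r_pos
    have t1 : Filter.Tendsto (fun q : Fin n → ℝ => q - p) (𝓝 p) (𝓝 0) :=
      (continuous_id.sub continuous_const).tendsto' _ _ (by simp)
    have t2 : Filter.Tendsto (fun q : Fin n → ℝ => ofRealVec q - ofRealVec p) (𝓝 p) (𝓝 0) :=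
      (continuous_ofRealVec.sub continuous_const).tendsto' _ _ (by simp)
    filter_upwards [t1 hm', t2 hm] with q hq hq'
    have s1 := ha.hasSum hq
    have s2 := hP.hasSum hq'
    simp only [add_sub_cancel, zero_add] at s1 s2
    refine s2.unique ?_
    convert s1 using 2 with k
    rw [← ofRealVec_sub]
    exact complexifyMultilinear_ofRealVec (a k) fun _ => q - p

theorem fderiv_of_complexification {f : (Fin n → ℝ) → F} {G : (Fin n → ℂ) → F} {p : Fin n → ℝ}
    (hG : DifferentiableAt ℂ G (ofRealVec p)) (h : ∀ᶠ q in 𝓝 p, G (ofRealVec q) = f q)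
    (v : Fin n → ℝ) : fderiv ℝ f p v = fderiv ℂ G (ofRealVec p) (ofRealVec v) := by
  let A : (Fin n → ℝ) →L[ℝ] (Fin n → ℂ) := ContinuousLinearMap.pi fun j =>
    Complex.ofRealCLM.comp (ContinuousLinearMap.proj j : (Fin n → ℝ) →L[ℝ] ℝ)
  have hA : HasFDerivAt (ofRealVec : (Fin n → ℝ) → (Fin n → ℂ)) A p := A.hasFDerivAt
  have h1 : HasFDerivAt G ((fderiv ℂ G (ofRealVec p)).restrictScalars ℝ) (ofRealVec p) :=
    hG.hasFDerivAt.restrictScalars ℝ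
  have h2 := (h1.comp p hA).congr_of_eventuallyEq (f₁ := f) (by
    filter_upwards [h] with q hq using hq.symm)
  rw [h2.fderiv]
  rfl

end Complexification

/-! ### Smoothness of holomorphic maps in several variables -/

section HolomorphicSmooth

variable {E F : Type*} [NormedAddCommGroup E] [NormedSpace ℂ E] [NormedAddCommGroup F]
  [NormedSpace ℂ F] [CompleteSpace F]

/-- This is the one-variable Cauchy estimate on the disc `x + t u`, `|t| ≤ r / (2 ‖u‖)`. Halving the
radius keeps the closed disc in the open ball, whence the factor `2`. -/
theorem norm_fderiv_le_of_ball {f : E → F} {x : E} {r C : ℝ} (hr : 0 < r) (hC : 0 ≤ C)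
    (hf : ∀ y ∈ Metric.ball x r, DifferentiableAt ℂ f y) (hb : ∀ y ∈ Metric.ball x r, ‖f y‖ ≤ C) :
    ‖fderiv ℂ f x‖ ≤ 2 * C / r := by
  refine ContinuousLinearMap.opNorm_le_bound _ (by positivity) fun u => ?_
  rcases eq_or_ne u 0 with rfl | hu
  · simp
  have hu' : 0 < ‖u‖ := norm_pos_iff.2 hu
  set ρ := r / (2 * ‖u‖) with hρ
  have hρpos : 0 < ρ := by positivity
  have hmem : ∀ t ∈ Metric.closedBall (0 : ℂ) ρ, x + t • u ∈ Metric.ball x r := by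
    intro t ht
    rw [mem_ball_iff_norm, add_sub_cancel_left, norm_smul]
    have h1 : ‖t‖ ≤ ρ := by simpa using ht
    calc ‖t‖ * ‖u‖ ≤ ρ * ‖u‖ := by gcongr
      _ = r / 2 := by rw [hρ]; field_simp
      _ < r := by linarith
  have hd : ∀ t ∈ Metric.closedBall (0 : ℂ) ρ, HasDerivAt (fun t : ℂ => f (x + t • u))
      (fderiv ℂ f (x + t • u) u) t := by
    intro t ht
    have h1 : HasDerivAt (fun t : ℂ => x + t • u) u t := by
      simpa using ((hasDerivAt_id t).smul_const u).const_add x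
    exact (hf _ (hmem t ht)).hasFDerivAt.comp_hasDerivAt t h1
  have hdc : DiffContOnCl ℂ (fun t : ℂ => f (x + t • u)) (Metric.ball 0 ρ) := by
    refine DifferentiableOn.diffContOnCl fun t ht => ?_
    rw [closure_ball _ hρpos.ne'] at ht
    exact (hd t ht).differentiableAt.differentiableWithinAt
  have h := Complex.norm_deriv_le_of_forall_mem_sphere_norm_le hρpos hdc
    (fun t ht => hb _ (hmem t (Metric.sphere_subset_closedBall ht)))
  rw [(hd 0 (by simp [hρpos.le])).deriv] at h
  simp only [zero_smul, add_zero] at h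
  refine h.trans (le_of_eq ?_)
  rw [hρ]; field_simp

/-- Directional derivatives of holomorphic maps are holomorphic. -/
theorem differentiableOn_fderiv_apply {f : E → F} {Ω : Set E} (hΩ : IsOpen Ω)
    [FiniteDimensional ℂ E] [FiniteDimensional ℂ F] (hf : DifferentiableOn ℂ f Ω) (u : E) :
    DifferentiableOn ℂ (fun x => fderiv ℂ f x u) Ω := by
  borelize E
  intro x₀ hx₀
  rcases eq_or_ne u 0 with rfl | hu
  · simpa using differentiableWithinAt_const (0 : F)
  have hu' : 0 < ‖u‖ := norm_pos_iff.2 hu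
  have hfd : ∀ y ∈ Ω, DifferentiableAt ℂ f y := fun y hy => hf.differentiableAt (hΩ.mem_nhds hy)
  obtain ⟨r₁, hr₁, H₁⟩ := Metric.isOpen_iff.1 hΩ x₀ hx₀
  obtain ⟨r₂, hr₂, H₂⟩ := Metric.continuousAt_iff.1 (hfd x₀ hx₀).continuousAt 1 one_pos
  set r := min r₁ r₂ with hr
  have hrpos : 0 < r := lt_min hr₁ hr₂
  have hball : Metric.ball x₀ r ⊆ Ω := (Metric.ball_subset_ball (min_le_left _ _)).trans H₁
  set C := ‖f x₀‖ + 1 with hC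
  have hbound : ∀ y ∈ Metric.ball x₀ r, ‖f y‖ ≤ C := by
    intro y hy
    have := H₂ (Metric.ball_subset_ball (min_le_right _ _) hy)
    rw [dist_eq_norm] at this
    have h2 := norm_le_insert' (f y) (f x₀)
    linarith
  have hfder : ∀ y ∈ Metric.ball x₀ (2 * r / 3), ‖fderiv ℂ f y‖ ≤ 2 * C / (r / 3) := by
    intro y hy
    have hsub : Metric.ball y (r / 3) ⊆ Metric.ball x₀ r :=
      Metric.ball_subset_ball' (by rw [Metric.mem_ball] at hy; linarith)
    exact norm_fderiv_le_of_ball (by positivity) (by positivity)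
      (fun z hz => hfd z (hball (hsub hz))) fun z hz => hbound z (hsub hz)
  set ρ := r / (3 * ‖u‖) with hρ
  have hρpos : 0 < ρ := by positivity
  have hρu : ρ * ‖u‖ = r / 3 := by rw [hρ]; field_simp
  have hmem : ∀ x ∈ Metric.ball x₀ (r / 3), ∀ t ∈ Metric.closedBall (0 : ℂ) ρ,
      x + t • u ∈ Metric.ball x₀ (2 * r / 3) := by
    intro x hx t ht
    rw [mem_ball_iff_norm] at hx ⊢
    have e : x + t • u - x₀ = (x - x₀) + t • u := by abel
    rw [e]
    refine (norm_add_le _ _).trans_lt ?_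
    rw [norm_smul]
    have h1 : ‖t‖ ≤ ρ := by simpa using ht
    have h2 : ‖t‖ * ‖u‖ ≤ ρ * ‖u‖ := by gcongr
    linarith
  have hsub : Metric.ball x₀ (2 * r / 3) ⊆ Metric.ball x₀ r :=
    Metric.ball_subset_ball (by linarith)
  have hcirc : ∀ θ : ℝ, circleMap 0 ρ θ ∈ Metric.closedBall (0 : ℂ) ρ := fun θ =>
    Metric.sphere_subset_closedBall (circleMap_mem_sphere _ hρpos.le _)
  -- Cauchy's formula writes the directional derivative at `x` as an integral over a circle of
  -- values of `f` at points depending affinely on `x`. It can be differentiated under the integral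
  -- sign, because the derivative of `f` is bounded near the circle by `norm_fderiv_le_of_ball`.
  let K : E → ℝ → F := fun x θ =>
    (deriv (circleMap 0 ρ) θ * (1 / (circleMap 0 ρ θ - 0) ^ 2)) • f (x + circleMap 0 ρ θ • u)
  let K' : E → ℝ → E →L[ℂ] F := fun x θ =>
    (deriv (circleMap 0 ρ) θ * (1 / (circleMap 0 ρ θ - 0) ^ 2)) •
      fderiv ℂ f (x + circleMap 0 ρ θ • u)
  have hker : Continuous fun θ : ℝ =>
      deriv (circleMap 0 ρ) θ * (1 / (circleMap 0 ρ θ - 0) ^ 2) := by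
    have h1 : Continuous (deriv (circleMap 0 ρ)) := by
      have : deriv (circleMap 0 ρ) = fun θ => circleMap 0 ρ θ * Complex.I := by
        ext θ; rw [deriv_circleMap]
      rw [this]; fun_prop
    refine h1.mul (continuous_const.div (by fun_prop) fun θ => ?_)
    rw [sub_zero]
    exact pow_ne_zero _ (circleMap_ne_center hρpos.ne')
  have hcauchy : ∀ x ∈ Metric.ball x₀ (r / 3),
      ∫ θ in (0 : ℝ)..2 * Real.pi, K x θ = (2 * ↑Real.pi * Complex.I) • fderiv ℂ f x u := by
    intro x hx
    have hd : ∀ t ∈ Metric.closedBall (0 : ℂ) ρ, HasDerivAt (fun t : ℂ => f (x + t • u))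
        (fderiv ℂ f (x + t • u) u) t := by
      intro t ht
      have h1 : HasDerivAt (fun t : ℂ => x + t • u) u t := by
        simpa using ((hasDerivAt_id t).smul_const u).const_add x
      exact (hfd _ (hball (hsub (hmem x hx t ht)))).hasFDerivAt.comp_hasDerivAt t h1
    have h := DifferentiableOn.deriv_eq_smul_circleIntegral hρpos
      (f := fun t : ℂ => f (x + t • u)) (c := 0)
      (fun t ht => (hd t ht).differentiableAt.differentiableWithinAt)
    rw [(hd 0 (by simp [hρpos.le])).deriv] at h
    simp only [zero_smul, add_zero] at h
    rw [← h, circleIntegral]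
    simp only [K, smul_smul]
  have hfc : ContinuousOn f Ω := hf.continuousOn
  have hKc : ∀ x ∈ Metric.ball x₀ (r / 3), Continuous (K x) := by
    intro x hx
    refine hker.smul ?_
    refine hfc.comp_continuous (by fun_prop) fun θ => ?_
    exact hball (hsub (hmem x hx _ (hcirc θ)))
  have hmain := intervalIntegral.hasFDerivAt_integral_of_dominated_of_fderiv_le
    (μ := MeasureTheory.volume) (a := 0) (b := 2 * Real.pi) (F := K) (F' := K') (x₀ := x₀)
    (s := Metric.ball x₀ (r / 3))
    (bound := fun θ => ‖deriv (circleMap 0 ρ) θ * (1 / (circleMap 0 ρ θ - 0) ^ 2)‖ *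
      (2 * C / (r / 3)))
    (Metric.ball_mem_nhds _ (by positivity))
    (by
      filter_upwards [Metric.ball_mem_nhds x₀ (show 0 < r / 3 by positivity)] with x hx
      exact (hKc x hx).aestronglyMeasurable)
    ((hKc x₀ (Metric.mem_ball_self (by positivity))).intervalIntegrable _ _)
    (by
      -- Continuity of the derivative is not yet known; the theorem on parameter integrals only asks
      -- that the differentiated integrand be measurable.
      have : ProperSpace (E →L[ℂ] F) := FiniteDimensional.proper ℂ _
      borelize (E →L[ℂ] F)
      have hm : Measurable fun θ : ℝ => fderiv ℂ f (x₀ + circleMap 0 ρ θ • u) :=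
        (measurable_fderiv ℂ f).comp (by fun_prop : Continuous _).measurable
      exact (hker.measurable.smul hm).aestronglyMeasurable)
    (by
      refine Filter.Eventually.of_forall fun θ _ x hx => ?_
      simp only [K', norm_smul]
      gcongr
      exact hfder _ (hmem x hx _ (hcirc θ)))
    ((hker.norm.mul continuous_const).intervalIntegrable _ _)
    (by
      refine Filter.Eventually.of_forall fun θ _ x hx => ?_
      have h1 := (hfd _ (hball (hsub (hmem x hx _ (hcirc θ))))).hasFDerivAt
      have h2 : HasFDerivAt (fun x : E => x + circleMap 0 ρ θ • u) (.id ℂ E) x :=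
        (hasFDerivAt_id x).add_const _
      exact (h1.comp x h2).const_smul _)
  have h2pi : (2 * ↑Real.pi * Complex.I : ℂ) ≠ 0 := by simp [Real.pi_ne_zero]
  have hev : (fun x => fderiv ℂ f x u) =ᶠ[𝓝 x₀]
      fun x => (2 * ↑Real.pi * Complex.I : ℂ)⁻¹ • ∫ θ in (0 : ℝ)..2 * Real.pi, K x θ := by
    filter_upwards [Metric.ball_mem_nhds x₀ (show 0 < r / 3 by positivity)] with x hx
    rw [hcauchy x hx, inv_smul_smul₀ h2pi]
  exact ((hmain.differentiableAt.const_smul _).congr_of_eventuallyEq hev).differentiableWithinAt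

/-- Holomorphic maps in finitely many variables are smooth. -/
theorem contDiffOn_of_holomorphic [FiniteDimensional ℂ E] [FiniteDimensional ℂ F] {f : E → F}
    {Ω : Set E} (hΩ : IsOpen Ω) (hf : DifferentiableOn ℂ f Ω) (n : ℕ) : ContDiffOn ℂ n f Ω := by
  induction n generalizing f with
  | zero => exact contDiffOn_zero.2 hf.continuousOn
  | succ n ih =>
    push_cast
    refine (contDiffOn_succ_iff_fderiv_of_isOpen hΩ).2 ⟨hf, by simp, ?_⟩
    exact contDiffOn_clm_apply.2 fun u => ih (differentiableOn_fderiv_apply hΩ hf u)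

end HolomorphicSmooth

/-! ### Topology of `G7`, `H2` and `N5` -/

section ModelGroup

theorem entries_of_mem_G7 {g : Mat4} {a ζ s : ℂ} {r : ℝ} (hg : g = nMat ζ r s * hMat a) :
    g = !![1, ζ * a, (ζ * conj ζ / 2 + Complex.I * r) * (a * conj a), s * (a ^ 2 * conj a);
      0, a, conj ζ * (a * conj a), (ζ * conj ζ / 2 - Complex.I * r) * (a ^ 2 * conj a);
      0, 0, a * conj a, ζ * (a ^ 2 * conj a);
      0, 0, 0, a ^ 2 * conj a] := by
  rw [hg]
  ext i j
  rw [Matrix.mul_apply, Fin.sum_univ_four]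
  fin_cases i <;> fin_cases j <;> simp [nMat, hMat]

/-- The real polynomial equations of `G⁷` among the invertible matrices. -/
structure IsModelMatrix (g : Mat4) : Prop where
  h00 : g 0 0 = 1
  h10 : g 1 0 = 0
  h20 : g 2 0 = 0
  h21 : g 2 1 = 0
  h30 : g 3 0 = 0
  h31 : g 3 1 = 0
  h32 : g 3 2 = 0
  h22 : g 2 2 = g 1 1 * conj (g 1 1)
  h33 : g 3 3 = g 1 1 ^ 2 * conj (g 1 1)
  h12 : g 1 2 = conj (g 0 1) * g 1 1
  h23 : g 2 3 = g 0 1 * (g 1 1 * conj (g 1 1))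
  h02 : g 0 2 + conj (g 0 2) = g 0 1 * conj (g 0 1)
  h13 : g 1 3 = conj (g 0 2) * g 1 1

/-- Describing the group by real polynomial equations gives closedness at once, and later its Lie
algebra by linearization. For the converse, the matrix is triangular, so invertibility gives `a ≠
0`, and `ζ, r, s` are read off the first row. -/
theorem mem_G7_iff (g : GL (Fin 4) ℂ) : g ∈ G7 ↔ IsModelMatrix (g : Mat4) := by
  constructor
  · rintro ⟨a, ζ, r, s, ha, hg⟩
    rw [entries_of_mem_G7 hg]
    constructor <;> simp [map_ofNat] <;> ring
  · intro h
    have hdet : (g : Mat4).det ≠ 0 := by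
      have := g.det.ne_zero
      simpa using this
    have ha : (g : Mat4) 1 1 ≠ 0 := by
      intro h0
      apply hdet
      rw [Matrix.det_of_isUpperTriangular, Fin.prod_univ_four, h0]
      · ring
      · intro i j hij
        fin_cases i <;> fin_cases j <;> first | exact absurd hij (by decide) | skip
        exacts [h.h10, h.h20, h.h21, h.h30, h.h31, h.h32]
    have hb : conj ((g : Mat4) 1 1) ≠ 0 := by simpa using ha
    set a := (g : Mat4) 1 1 with hadef
    have hr : ((((g : Mat4) 0 2).im / Complex.normSq a : ℝ) : ℂ) =
        -Complex.I * ((g : Mat4) 0 2 - conj ((g : Mat4) 0 2)) / (2 * (a * conj a)) := by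
      rw [Complex.ofReal_div, Complex.normSq_eq_conj_mul_self, Complex.sub_conj]
      field_simp
      push_cast
      linear_combination (2 * (((g : Mat4) 0 2).im : ℂ)) * Complex.I_sq
    refine ⟨a, (g : Mat4) 0 1 / a, ((g : Mat4) 0 2).im / Complex.normSq a,
      (g : Mat4) 0 3 / (a ^ 2 * conj a), ha, ?_⟩
    rw [entries_of_mem_G7 rfl, hr]
    have hc : conj ((g : Mat4) 0 2) = (g : Mat4) 0 1 * conj ((g : Mat4) 0 1) - (g : Mat4) 0 2 := by
      linear_combination h.h02
    ext i j
    fin_cases i <;> fin_cases j <;> simp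
    · exact h.h00
    · field_simp
    · rw [hc]
      field_simp
      linear_combination (-(g : Mat4) 0 1 * conj ((g : Mat4) 0 1) + 2 * (g : Mat4) 0 2) * Complex.I_sq
    · field_simp
    · exact h.h10
    · rfl
    · refine h.h12.trans ?_
      field_simp
      rfl
    · refine h.h13.trans ?_
      rw [hc]
      field_simp
      linear_combination ((g : Mat4) 0 1 * conj ((g : Mat4) 0 1) - 2 * (g : Mat4) 0 2) * a *
        Complex.I_sq
    · exact h.h20
    · exact h.h21
    · exact h.h22
    · refine h.h23.trans ?_
      field_simp
      rfl
    · exact h.h30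
    · exact h.h31
    · exact h.h32
    · exact h.h33

theorem mem_H2_iff (g : GL (Fin 4) ℂ) : g ∈ H2 ↔
    IsModelMatrix (g : Mat4) ∧ (g : Mat4) 0 1 = 0 ∧ (g : Mat4) 0 2 = 0 ∧ (g : Mat4) 0 3 = 0 := by
  constructor
  · rintro ⟨a, ha, hg⟩
    refine ⟨(mem_G7_iff g).1 ⟨a, 0, 0, 0, ha, by rw [nMat_zero, one_mul, hg]⟩, ?_⟩
    rw [hg]; simp [hMat]
  · rintro ⟨h, h1, h2, h3⟩
    obtain ⟨a, ζ, r, s, ha, hg⟩ := (mem_G7_iff g).2 h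
    have hb : conj a ≠ 0 := by simpa using ha
    rw [entries_of_mem_G7 hg] at h1 h2 h3
    simp [ha] at h1 h2 h3
    subst h1
    refine ⟨a, ha, ?_⟩
    have hr : r = 0 := by simpa using h2
    rw [hg, h3, hr, nMat_zero, one_mul]

theorem mem_N5_iff (g : GL (Fin 4) ℂ) : g ∈ N5 ↔
    IsModelMatrix (g : Mat4) ∧ (g : Mat4) 1 1 = 1 := by
  constructor
  · rintro ⟨ζ, r, s, hg⟩
    refine ⟨(mem_G7_iff g).1 ⟨1, ζ, r, s, one_ne_zero, by rw [hMat_one, mul_one, hg]⟩, ?_⟩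
    rw [hg]; simp [nMat]
  · rintro ⟨h, h1⟩
    obtain ⟨a, ζ, r, s, ha, hg⟩ := (mem_G7_iff g).2 h
    rw [entries_of_mem_G7 hg] at h1
    simp at h1
    subst h1
    exact ⟨ζ, r, s, by rw [hg, hMat_one, mul_one]⟩

theorem continuous_entry (i j : Fin 4) :
    Continuous fun g : GL (Fin 4) ℂ => (g : Mat4) i j :=
  Units.continuous_val.matrix_elem i j

theorem isClosed_modelMatrix : IsClosed {g : GL (Fin 4) ℂ | IsModelMatrix (g : Mat4)} := by
  have e : {g : GL (Fin 4) ℂ | IsModelMatrix (g : Mat4)} =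
      {g : GL (Fin 4) ℂ | (g : Mat4) 0 0 = 1} ∩ {g : GL (Fin 4) ℂ | (g : Mat4) 1 0 = 0} ∩ {g : GL (Fin 4) ℂ | (g : Mat4) 2 0 = 0} ∩
      {g : GL (Fin 4) ℂ | (g : Mat4) 2 1 = 0} ∩ {g : GL (Fin 4) ℂ | (g : Mat4) 3 0 = 0} ∩ {g : GL (Fin 4) ℂ | (g : Mat4) 3 1 = 0} ∩
      {g : GL (Fin 4) ℂ | (g : Mat4) 3 2 = 0} ∩ {g : GL (Fin 4) ℂ | (g : Mat4) 2 2 = (g : Mat4) 1 1 * conj ((g : Mat4) 1 1)} ∩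
      {g : GL (Fin 4) ℂ | (g : Mat4) 3 3 = (g : Mat4) 1 1 ^ 2 * conj ((g : Mat4) 1 1)} ∩
      {g : GL (Fin 4) ℂ | (g : Mat4) 1 2 = conj ((g : Mat4) 0 1) * (g : Mat4) 1 1} ∩
      {g : GL (Fin 4) ℂ | (g : Mat4) 2 3 = (g : Mat4) 0 1 * ((g : Mat4) 1 1 * conj ((g : Mat4) 1 1))} ∩
      {g : GL (Fin 4) ℂ | (g : Mat4) 0 2 + conj ((g : Mat4) 0 2) = (g : Mat4) 0 1 * conj ((g : Mat4) 0 1)} ∩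
      {g : GL (Fin 4) ℂ | (g : Mat4) 1 3 = conj ((g : Mat4) 0 2) * (g : Mat4) 1 1} := by
    ext g
    simp only [Set.mem_inter_iff, Set.mem_ofPred_eq]
    exact ⟨fun ⟨h1, h2, h3, h4, h5, h6, h7, h8, h9, h10, h11, h12, h13⟩ =>
      ⟨⟨⟨⟨⟨⟨⟨⟨⟨⟨⟨⟨h1, h2⟩, h3⟩, h4⟩, h5⟩, h6⟩, h7⟩, h8⟩, h9⟩, h10⟩, h11⟩, h12⟩, h13⟩,
      fun ⟨⟨⟨⟨⟨⟨⟨⟨⟨⟨⟨⟨h1, h2⟩, h3⟩, h4⟩, h5⟩, h6⟩, h7⟩, h8⟩, h9⟩, h10⟩, h11⟩, h12⟩, h13⟩ =>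
      ⟨h1, h2, h3, h4, h5, h6, h7, h8, h9, h10, h11, h12, h13⟩⟩
  rw [e]
  have c := continuous_entry
  have cc : ∀ i j, Continuous fun g : GL (Fin 4) ℂ => conj ((g : Mat4) i j) := fun i j =>
    Complex.continuous_conj.comp (c i j)
  refine IsClosed.inter (IsClosed.inter (IsClosed.inter (IsClosed.inter (IsClosed.inter
    (IsClosed.inter (IsClosed.inter (IsClosed.inter (IsClosed.inter (IsClosed.inter (IsClosed.inter
    (IsClosed.inter ?_ ?_) ?_) ?_) ?_) ?_) ?_) ?_) ?_) ?_) ?_) ?_) ?_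
  · exact isClosed_eq (c 0 0) continuous_const
  · exact isClosed_eq (c 1 0) continuous_const
  · exact isClosed_eq (c 2 0) continuous_const
  · exact isClosed_eq (c 2 1) continuous_const
  · exact isClosed_eq (c 3 0) continuous_const
  · exact isClosed_eq (c 3 1) continuous_const
  · exact isClosed_eq (c 3 2) continuous_const
  · exact isClosed_eq (c 2 2) ((c 1 1).mul (cc 1 1))
  · exact isClosed_eq (c 3 3) (((c 1 1).pow 2).mul (cc 1 1))
  · exact isClosed_eq (c 1 2) ((cc 0 1).mul (c 1 1))
  · exact isClosed_eq (c 2 3) ((c 0 1).mul ((c 1 1).mul (cc 1 1)))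
  · exact isClosed_eq ((c 0 2).add (cc 0 2)) ((c 0 1).mul (cc 0 1))
  · exact isClosed_eq (c 1 3) ((cc 0 2).mul (c 1 1))

theorem isClosed_G7 : IsClosed (G7 : Set (GL (Fin 4) ℂ)) := by
  convert isClosed_modelMatrix using 1
  ext g; exact mem_G7_iff g

theorem isClosed_H2 : IsClosed (H2 : Set (GL (Fin 4) ℂ)) := by
  have : (H2 : Set (GL (Fin 4) ℂ)) = {g : GL (Fin 4) ℂ | IsModelMatrix (g : Mat4)} ∩
      ({g | (g : Mat4) 0 1 = 0} ∩ ({g | (g : Mat4) 0 2 = 0} ∩ {g | (g : Mat4) 0 3 = 0})) := by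
    ext g; exact mem_H2_iff g
  rw [this]
  exact isClosed_modelMatrix.inter ((isClosed_eq (continuous_entry 0 1) continuous_const).inter
    ((isClosed_eq (continuous_entry 0 2) continuous_const).inter
    (isClosed_eq (continuous_entry 0 3) continuous_const)))

theorem isClosed_N5 : IsClosed (N5 : Set (GL (Fin 4) ℂ)) := by
  have : (N5 : Set (GL (Fin 4) ℂ)) = {g : GL (Fin 4) ℂ | IsModelMatrix (g : Mat4)} ∩
      {g | (g : Mat4) 1 1 = 1} := by
    ext g; exact mem_N5_iff g
  rw [this]
  exact isClosed_modelMatrix.inter (isClosed_eq (continuous_entry 1 1) continuous_const)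

theorem H2_le_G7 : H2 ≤ G7 := fun g hg => (mem_G7_iff g).2 ((mem_H2_iff g).1 hg).1

theorem N5_le_G7 : N5 ≤ G7 := fun g hg => (mem_G7_iff g).2 ((mem_N5_iff g).1 hg).1

/-- `nMat ζ r s` as an invertible matrix. -/
noncomputable def nUnit (q : ℂ × ℝ × ℂ) : GL (Fin 4) ℂ where
  val := nMat q.1 q.2.1 q.2.2
  inv := nMat (-q.1) (-q.2.1) (-q.2.2)
  val_inv := nMat_mul_neg _ _ _
  inv_val := by simpa using nMat_mul_neg (-q.1) (-q.2.1) (-q.2.2)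

/-- `hMat a` as an invertible matrix. -/
noncomputable def hUnit (a : {a : ℂ // a ≠ 0}) : GL (Fin 4) ℂ where
  val := hMat a
  inv := hMat (a : ℂ)⁻¹
  val_inv := by rw [hMat_mul, mul_inv_cancel₀ a.2, hMat_one]
  inv_val := by rw [hMat_mul, inv_mul_cancel₀ a.2, hMat_one]

theorem continuous_nMat : Continuous fun q : ℂ × ℝ × ℂ => nMat q.1 q.2.1 q.2.2 := by
  refine continuous_matrix fun i j => ?_
  fin_cases i <;> fin_cases j <;> simp [nMat] <;> fun_prop

theorem continuous_nUnit : Continuous nUnit := by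
  refine Units.continuous_iff.2 ⟨continuous_nMat, ?_⟩
  exact continuous_nMat.comp (f := fun q : ℂ × ℝ × ℂ => (-q.1, -q.2.1, -q.2.2)) (by fun_prop)

theorem continuous_hMat : Continuous hMat := by
  refine continuous_matrix fun i j => ?_
  fin_cases i <;> fin_cases j <;> simp [hMat] <;> fun_prop

theorem continuous_hUnit : Continuous hUnit := by
  refine Units.continuous_iff.2 ⟨continuous_hMat.comp continuous_subtype_val, ?_⟩
  exact continuous_hMat.comp (continuous_subtype_val.inv₀ fun a => a.2)

theorem connectedSpace_nonzero : ConnectedSpace {a : ℂ // a ≠ 0} := by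
  have h : IsConnected ({0}ᶜ : Set ℂ) :=
    isConnected_compl_singleton_of_one_lt_rank (by rw [Complex.rank_real_complex]; norm_num) 0
  exact isConnected_iff_connectedSpace.1 h

theorem isConnected_G7 : IsConnected (G7 : Set (GL (Fin 4) ℂ)) := by
  have := connectedSpace_nonzero
  have h : (G7 : Set (GL (Fin 4) ℂ)) =
      Set.range fun x : (ℂ × ℝ × ℂ) × {a : ℂ // a ≠ 0} => nUnit x.1 * hUnit x.2 := by
    ext g
    constructor
    · rintro ⟨a, ζ, r, s, ha, hg⟩
      exact ⟨((ζ, r, s), ⟨a, ha⟩), Units.ext hg.symm⟩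
    · rintro ⟨⟨⟨ζ, r, s⟩, ⟨a, ha⟩⟩, rfl⟩
      exact ⟨a, ζ, r, s, ha, rfl⟩
  rw [h]
  exact isConnected_range ((continuous_nUnit.comp continuous_fst).mul
    (continuous_hUnit.comp continuous_snd))

theorem isConnected_H2 : IsConnected (H2 : Set (GL (Fin 4) ℂ)) := by
  have := connectedSpace_nonzero
  have h : (H2 : Set (GL (Fin 4) ℂ)) = Set.range hUnit := by
    ext g
    constructor
    · rintro ⟨a, ha, hg⟩
      exact ⟨⟨a, ha⟩, Units.ext hg.symm⟩
    · rintro ⟨⟨a, ha⟩, rfl⟩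
      exact ⟨a, ha, rfl⟩
  rw [h]
  exact isConnected_range continuous_hUnit

theorem exists_H2_equiv :
    ∃ e : H2 ≃* ℂˣ, ∀ h : H2, ((h : GL (Fin 4) ℂ) : Mat4) = hMat (e h : ℂ) := by
  let f : ℂˣ →* H2 :=
    { toFun := fun a => ⟨hUnit ⟨a, a.ne_zero⟩, a, a.ne_zero, rfl⟩
      map_one' := Subtype.ext (Units.ext hMat_one)
      map_mul' := fun a b => Subtype.ext (Units.ext (hMat_mul a b).symm) }
  have hf : Function.Bijective f := by
    constructor
    · intro a b hab
      have h1 : hMat a = hMat b := congrArg (fun h : H2 => ((h : GL (Fin 4) ℂ) : Mat4)) hab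
      have h2 := congrFun (congrFun h1 1) 1
      exact Units.ext (by simpa [hMat] using h2)
    · rintro ⟨g, a, ha, hg⟩
      exact ⟨Units.mk0 a ha, Subtype.ext (Units.ext hg.symm)⟩
  refine ⟨(MulEquiv.ofBijective f hf).symm, fun h => ?_⟩
  obtain ⟨a, rfl⟩ := hf.2 h
  have : (MulEquiv.ofBijective f hf).symm (f a) = a := (MulEquiv.ofBijective f hf).symm_apply_apply a
  rw [this]
  rfl

/-- The global coordinates of `N₅⁴`. -/
noncomputable def N5Homeomorph : N5 ≃ₜ ℂ × ℝ × ℂ where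
  toFun g := ((g : GL (Fin 4) ℂ).val 0 1, ((g : GL (Fin 4) ℂ).val 0 2).im,
    (g : GL (Fin 4) ℂ).val 0 3)
  invFun q := ⟨nUnit q, q.1, q.2.1, q.2.2, rfl⟩
  left_inv := by
    rintro ⟨g, ζ, r, s, hg⟩
    apply Subtype.ext
    apply Units.ext
    simp only [nUnit]
    rw [hg]
    simp [nMat, mul_comm]
  right_inv := by
    rintro ⟨ζ, r, s⟩
    simp [nUnit, nMat, mul_comm]
  continuous_toFun := by
    have c : ∀ i j, Continuous fun g : N5 => (g : GL (Fin 4) ℂ).val i j := fun i j =>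
      (continuous_entry i j).comp continuous_subtype_val
    exact (c 0 1).prodMk ((Complex.continuous_im.comp (c 0 2)).prodMk (c 0 3))
  continuous_invFun := continuous_nUnit.subtype_mk _

theorem simplyConnected_N5 : SimplyConnectedSpace N5 := by
  have : ContractibleSpace N5 := N5Homeomorph.contractibleSpace
  infer_instance

end ModelGroup

/-! ### One-parameter subgroups and Lie algebras of the model groups -/

section ModelLieAlgebra

theorem hasDerivAt_conj {f : ℝ → ℂ} {f' : ℂ} {t : ℝ} (hf : HasDerivAt f f' t) :
    HasDerivAt (fun t => conj (f t)) (conj f') t :=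
  Complex.conjCLE.toContinuousLinearMap.hasFDerivAt.comp_hasDerivAt t hf

section
attribute [local instance] Matrix.linftyOpNormedRing Matrix.linftyOpNormedAlgebra

theorem hasDerivAt_exp_entry (X : Mat4) (t : ℝ) (i j : Fin 4) :
    HasDerivAt (fun t : ℝ => NormedSpace.exp (t • X) i j) ((NormedSpace.exp (t • X) * X) i j) t := by
  have h := hasDerivAt_exp_smul_const (𝕂 := ℝ) X t
  have hl : HasFDerivAt (fun M : Mat4 => M i j) (LinearMap.toContinuousLinearMap
      (Matrix.entryLinearMap ℝ ℂ i j : Mat4 →ₗ[ℝ] ℂ)) (NormedSpace.exp (t • X)) :=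
    (LinearMap.toContinuousLinearMap
      (Matrix.entryLinearMap ℝ ℂ i j : Mat4 →ₗ[ℝ] ℂ)).hasFDerivAt
  exact hl.comp_hasDerivAt t h

theorem exp_smul_mul_exp_neg_smul (X : Mat4) (t : ℝ) :
    NormedSpace.exp ((-t) • X) * NormedSpace.exp (t • X) = 1 := by
  rw [← Matrix.exp_add_of_commute, ← add_smul]
  · simp
  · exact ((Commute.refl X).smul_left _).smul_right _

theorem exp_zero_smul (X : Mat4) : NormedSpace.exp ((0 : ℝ) • X) = 1 := by
  rw [zero_smul, NormedSpace.exp_zero]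

theorem exp_smul_mul_comm (X : Mat4) (t : ℝ) :
    NormedSpace.exp (t • X) * X = X * NormedSpace.exp (t • X) :=
  ((Commute.refl X).smul_left t).exp_left

end

/-- An integral curve of a left-invariant vector field is a one-parameter subgroup. -/
theorem eq_exp_of_hasDerivAt {X : Mat4} {γ : ℝ → Mat4} (h0 : γ 0 = 1)
    (h : ∀ t i j, HasDerivAt (fun t => γ t i j) ((γ t * X) i j) t) (t : ℝ) :
    γ t = NormedSpace.exp (t • X) := by
  have hE : ∀ t i j, HasDerivAt (fun t : ℝ => NormedSpace.exp ((-t) • X) i j)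
      (-(X * NormedSpace.exp ((-t) • X)) i j) t := by
    intro t i j
    have := (hasDerivAt_exp_entry X (-t) i j).scomp t (hasDerivAt_neg t)
    rw [exp_smul_mul_comm] at this
    exact this.congr_deriv (by simp)
  -- The product `γ(t) exp(-tX)` has zero derivative, because `exp(-tX)` commutes with `X`; it is
  -- therefore constant.
  have hD : ∀ t, γ t * NormedSpace.exp ((-t) • X) = 1 := by
    intro t
    ext i j
    have hd : ∀ t, HasDerivAt (fun t => (γ t * NormedSpace.exp ((-t) • X)) i j) 0 t := by
      intro t
      have h1 : HasDerivAt (fun t => ∑ k, γ t i k * NormedSpace.exp ((-t) • X) k j)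
          (∑ k, ((γ t * X) i k * NormedSpace.exp ((-t) • X) k j +
            γ t i k * -(X * NormedSpace.exp ((-t) • X)) k j)) t :=
        HasDerivAt.fun_sum fun k _ => (h t i k).mul (hE t k j)
      refine HasDerivAt.congr_deriv (h1) ?_
      have h2 : ((γ t * X) * NormedSpace.exp ((-t) • X)) i j -
          (γ t * (X * NormedSpace.exp ((-t) • X))) i j = 0 := by
        rw [Matrix.mul_assoc, sub_self]
      rw [Matrix.mul_apply, Matrix.mul_apply, ← Finset.sum_sub_distrib] at h2
      rw [← h2]
      exact Finset.sum_congr rfl fun k _ => by ring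
    have hc := is_const_of_deriv_eq_zero (fun t => (hd t).differentiableAt) (fun t => (hd t).deriv)
      t 0
    rw [hc, h0, neg_zero, exp_zero_smul, one_mul]
  calc γ t = γ t * (NormedSpace.exp ((-t) • X) * NormedSpace.exp (t • X)) := by
        rw [exp_smul_mul_exp_neg_smul, mul_one]
    _ = _ := by rw [← Matrix.mul_assoc, hD, one_mul]

theorem hasDerivAt_cexp (l : ℂ) (t : ℝ) :
    HasDerivAt (fun t : ℝ => Complex.exp (t * l)) (Complex.exp (t * l) * l) t := by
  have h : HasDerivAt (fun t : ℝ => (t : ℂ) * l) l t := by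
    simpa using (Complex.ofRealCLM.hasDerivAt (x := t)).mul_const l
  exact h.cexp

/-- No closed form of the exponential is needed. The equation `γ' = γ X` for `γ = n h` is triangular
in the parameters: `a` is an exponential, and `ζ`, then `ρ`, then `S` are successive integrals of
continuous functions of those already found. By `eq_exp_of_hasDerivAt` this curve in the group is
the exponential. -/
theorem exp_gMat (l s : ℂ) (r : ℝ) (z : ℂ) (t : ℝ) : ∃ (ζ : ℂ) (ρ : ℝ) (S : ℂ),
    NormedSpace.exp (t • gMat l s r z) = nMat ζ ρ S * hMat (Complex.exp (t * l)) := by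
  let a : ℝ → ℂ := fun t => Complex.exp (t * l)
  have ha : ∀ t, a t ≠ 0 := fun t => Complex.exp_ne_zero _
  have hb : ∀ t, conj (a t) ≠ 0 := fun t => by simpa using ha t
  have hac : Continuous a := by fun_prop
  have hbc : Continuous fun t => conj (a t) := Complex.continuous_conj.comp hac
  let ζ : ℝ → ℂ := fun t => ∫ u in (0 : ℝ)..t, z / a u
  have hζ1 : Continuous fun u => z / a u := continuous_const.div hac ha
  have hζ : ∀ t, HasDerivAt ζ (z / a t) t := fun t => (hζ1.integral_hasStrictDerivAt 0 t).hasDerivAt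
  have hζc : Continuous ζ := continuous_iff_continuousAt.2 fun t => (hζ t).continuousAt
  let ρ' : ℝ → ℝ := fun t => r / Complex.normSq (a t) + (ζ t * conj (z / a t)).im
  have hρ1 : Continuous ρ' := by
    refine (continuous_const.div (Complex.continuous_normSq.comp hac) fun t => ?_).add
      (Complex.continuous_im.comp (hζc.mul (Complex.continuous_conj.comp hζ1)))
    simpa using ha t
  let ρ : ℝ → ℝ := fun t => ∫ u in (0 : ℝ)..t, ρ' u
  have hρ : ∀ t, HasDerivAt ρ (ρ' t) t := fun t => (hρ1.integral_hasStrictDerivAt 0 t).hasDerivAt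
  have hρc : Continuous ρ := continuous_iff_continuousAt.2 fun t => (hρ t).continuousAt
  let S' : ℝ → ℂ := fun t => -2 * Complex.I * s / (a t ^ 2 * conj (a t)) -
    ζ t * (Complex.I * r / (a t * conj (a t))) +
    (ζ t * conj (ζ t) / 2 + Complex.I * ρ t) * (z / a t)
  have hS1 : Continuous S' := by
    refine ((continuous_const.div ((hac.pow 2).mul hbc) fun t => ?_).sub (hζc.mul
      (continuous_const.div (hac.mul hbc) fun t => ?_))).add
      ((((hζc.mul (Complex.continuous_conj.comp hζc)).div_const 2).add
      (continuous_const.mul (Complex.continuous_ofReal.comp hρc))).mul hζ1)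
    · exact mul_ne_zero (pow_ne_zero _ (ha t)) (hb t)
    · exact mul_ne_zero (ha t) (hb t)
  let S : ℝ → ℂ := fun t => ∫ u in (0 : ℝ)..t, S' u
  have hS : ∀ t, HasDerivAt S (S' t) t := fun t => (hS1.integral_hasStrictDerivAt 0 t).hasDerivAt
  refine ⟨ζ t, ρ t, S t, ?_⟩
  refine (eq_exp_of_hasDerivAt (γ := fun t => nMat (ζ t) (ρ t) (S t) * hMat (a t)) ?_ ?_ t).symm
  · simp [ζ, ρ, S, a, nMat_zero, hMat_one]
  intro t i j
  have da : HasDerivAt a (a t * l) t := hasDerivAt_cexp l t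
  have db := hasDerivAt_conj da
  have dz := hζ t
  have dzb := hasDerivAt_conj dz
  have dr : HasDerivAt (fun t => (ρ t : ℂ)) (ρ' t : ℂ) t :=
    Complex.ofRealCLM.hasFDerivAt.comp_hasDerivAt t (hρ t)
  have er : (ρ' t : ℂ) = r / (a t * conj (a t)) -
      Complex.I * (ζ t * conj (z / a t) - conj (ζ t) * (z / a t)) / 2 := by
    have h1 : ((ζ t * conj (z / a t)).im : ℂ) =
        - Complex.I * (ζ t * conj (z / a t) - conj (ζ t * conj (z / a t))) / 2 := by
      rw [Complex.sub_conj]; push_cast; linear_combination ((ζ t * conj (z / a t)).im : ℂ) *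
        Complex.I_sq
    simp only [ρ', Complex.ofReal_add, Complex.ofReal_div]
    rw [h1, Complex.normSq_eq_conj_mul_self, map_mul, Complex.conj_conj, mul_comm (conj (a t))]
    ring
  rw [er] at dr
  have dS := hS t
  have hat := ha t
  have hbt := hb t
  rw [entries_of_mem_G7 (rfl : nMat (ζ t) (ρ t) (S t) * hMat (a t) = _)]
  simp only [fun t => entries_of_mem_G7 (rfl : nMat (ζ t) (ρ t) (S t) * hMat (a t) = _)]
  rw [Matrix.mul_apply, Fin.sum_univ_four]
  fin_cases i <;> fin_cases j <;> simp [gMat]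
  · exact hasDerivAt_const _ _
  · refine HasDerivAt.congr_deriv (dz.mul da) ?_
    field_simp
  · refine HasDerivAt.congr_deriv ((((dz.mul dzb).div_const 2).add (dr.const_mul Complex.I)).mul (da.mul db)) ?_
    simp only [Pi.mul_apply, Pi.pow_apply, Pi.add_apply, Pi.sub_apply, map_mul, map_div₀]
    field_simp
    ring_nf
    simp only [Complex.I_sq]
    ring
  · refine HasDerivAt.congr_deriv (dS.mul ((da.pow 2).mul db)) ?_
    simp only [Pi.mul_apply, Pi.pow_apply, Pi.add_apply, Pi.sub_apply, map_mul, map_div₀, S']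
    field_simp
    ring
  · exact hasDerivAt_const _ _
  · exact da
  · refine HasDerivAt.congr_deriv (dzb.mul (da.mul db)) ?_
    simp only [Pi.mul_apply, Pi.pow_apply, Pi.add_apply, Pi.sub_apply, map_mul, map_div₀]
    field_simp
  · refine HasDerivAt.congr_deriv ((((dz.mul dzb).div_const 2).sub (dr.const_mul Complex.I)).mul ((da.pow 2).mul db)) ?_
    simp only [Pi.mul_apply, Pi.pow_apply, Pi.add_apply, Pi.sub_apply, map_mul, map_div₀]
    field_simp
    ring_nf
    simp only [Complex.I_sq]
    ring
  · exact hasDerivAt_const _ _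
  · exact hasDerivAt_const _ _
  · refine HasDerivAt.congr_deriv (da.mul db) ?_
    simp only [Pi.mul_apply, Pi.pow_apply, Pi.add_apply, Pi.sub_apply, map_mul]
    ring
  · refine HasDerivAt.congr_deriv (dz.mul ((da.pow 2).mul db)) ?_
    simp only [Pi.mul_apply, Pi.pow_apply, Pi.add_apply, Pi.sub_apply, map_mul]
    field_simp
    ring
  · exact hasDerivAt_const _ _
  · exact hasDerivAt_const _ _
  · exact hasDerivAt_const _ _
  · refine HasDerivAt.congr_deriv ((da.pow 2).mul db) ?_
    simp only [Pi.mul_apply, Pi.pow_apply, Pi.add_apply, Pi.sub_apply, map_mul]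
    ring

theorem exp_gMat_diag (l : ℂ) (t : ℝ) :
    NormedSpace.exp (t • gMat l 0 0 0) = hMat (Complex.exp (t * l)) := by
  refine (eq_exp_of_hasDerivAt (γ := fun t => hMat (Complex.exp (t * l))) ?_ ?_ t).symm
  · simp [hMat_one]
  intro t i j
  have da := hasDerivAt_cexp l t
  have db := hasDerivAt_conj da
  rw [Matrix.mul_apply, Fin.sum_univ_four]
  fin_cases i <;> fin_cases j <;>
    simp only [gMat, hMat, Fin.mk_zero, Fin.mk_one, Fin.reduceFinMk, Matrix.of_apply,
      Matrix.cons_val, mul_zero, zero_mul, add_zero, zero_add, Complex.ofReal_zero, neg_zero,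
      map_zero] <;> try exact hasDerivAt_const _ _
  · exact da
  · refine HasDerivAt.congr_deriv (da.mul db) ?_
    simp only [Pi.mul_apply, Pi.pow_apply, Pi.add_apply, Pi.sub_apply, map_mul]
    ring
  · refine HasDerivAt.congr_deriv ((da.pow 2).mul db) ?_
    simp only [Pi.mul_apply, Pi.pow_apply, Pi.add_apply, Pi.sub_apply, map_mul]
    ring

/-- These linear equations are the differentials at the identity of the equations `IsModelMatrix`,
which is how they enter `mem_g7_of_exp`. -/
theorem mem_g7_iff (X : Mat4) : X ∈ g7 ↔ X 0 0 = 0 ∧ X 1 0 = 0 ∧ X 2 0 = 0 ∧ X 2 1 = 0 ∧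
    X 3 0 = 0 ∧ X 3 1 = 0 ∧ X 3 2 = 0 ∧ X 2 2 = X 1 1 + conj (X 1 1) ∧
    X 3 3 = 2 * X 1 1 + conj (X 1 1) ∧ X 1 2 = conj (X 0 1) ∧ X 2 3 = X 0 1 ∧
    X 0 2 + conj (X 0 2) = 0 ∧ X 1 3 = conj (X 0 2) := by
  constructor
  · rintro ⟨l, s, r, z, rfl⟩
    simp [gMat]
  · rintro ⟨h00, h10, h20, h21, h30, h31, h32, h22, h33, h12, h23, h02, h13⟩
    have hre : (X 0 2).re = 0 := by
      have := congrArg Complex.re h02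
      simp at this; linarith
    have h02' : X 0 2 = Complex.I * ((X 0 2).im : ℂ) := by
      apply Complex.ext <;> simp [hre]
    refine ⟨X 1 1, X 0 3 / (-2 * Complex.I), (X 0 2).im, X 0 1, ?_⟩
    have h03 : X 0 3 = -2 * Complex.I * (X 0 3 / (-2 * Complex.I)) := by
      field_simp
    have h13' : X 1 3 = -(Complex.I * ((X 0 2).im : ℂ)) := by
      rw [h13]; apply Complex.ext <;> simp [hre]
    ext i j
    fin_cases i <;> fin_cases j
    exacts [h00, rfl, h02', h03, h10, rfl, h12, h13', h20, h21, h22, h23, h30, h31, h32, h33]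

/-- The linearization at the identity of the equations of `G⁷`. -/
theorem mem_g7_of_exp {X : Mat4}
    (h : ∀ t : ℝ, IsModelMatrix (NormedSpace.exp (t • X))) : X ∈ g7 := by
  have d : ∀ i j, HasDerivAt (fun t : ℝ => NormedSpace.exp (t • X) i j) (X i j) 0 := by
    intro i j
    simpa [exp_zero_smul] using hasDerivAt_exp_entry X 0 i j
  have dc : ∀ i j, HasDerivAt (fun t : ℝ => conj (NormedSpace.exp (t • X) i j)) (conj (X i j)) 0 :=
    fun i j => hasDerivAt_conj (d i j)
  have key : ∀ {f g : ℝ → ℂ} {f' g' : ℂ}, HasDerivAt f f' 0 → HasDerivAt g g' 0 →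
      (∀ t, f t = g t) → f' = g' := by
    intro f g f' g' hf hg hfg
    obtain rfl : f = g := funext hfg
    exact hf.unique hg
  have c := fun (w : ℂ) => hasDerivAt_const (0 : ℝ) w
  rw [mem_g7_iff]
  refine ⟨key (d 0 0) (c _) fun t => (h t).h00, key (d 1 0) (c _) fun t => (h t).h10,
    key (d 2 0) (c _) fun t => (h t).h20, key (d 2 1) (c _) fun t => (h t).h21,
    key (d 3 0) (c _) fun t => (h t).h30, key (d 3 1) (c _) fun t => (h t).h31,
    key (d 3 2) (c _) fun t => (h t).h32,
    (key (d 2 2) ((d 1 1).mul (dc 1 1)) fun t => (h t).h22).trans ?_,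
    (key (d 3 3) (((d 1 1).pow 2).mul (dc 1 1)) fun t => (h t).h33).trans ?_,
    (key (d 1 2) ((dc 0 1).mul (d 1 1)) fun t => (h t).h12).trans ?_,
    (key (d 2 3) ((d 0 1).mul ((d 1 1).mul (dc 1 1))) fun t => (h t).h23).trans ?_,
    (key ((d 0 2).add (dc 0 2)) ((d 0 1).mul (dc 0 1)) fun t => (h t).h02).trans ?_,
    (key (d 1 3) ((dc 0 2).mul (d 1 1)) fun t => (h t).h13).trans ?_⟩ <;>
  simp

theorem g7_isLieAlgebraOf : IsLieAlgebraOf g7 G7 := by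
  intro X
  constructor
  · rintro ⟨l, s, r, z, rfl⟩ t
    obtain ⟨ζ, ρ, S, h⟩ := exp_gMat l s r z t
    exact ⟨nUnit (ζ, ρ, S) * hUnit ⟨_, Complex.exp_ne_zero (t * l)⟩,
      ⟨_, ζ, ρ, S, Complex.exp_ne_zero (t * l), rfl⟩, h.symm⟩
  · intro h
    refine mem_g7_of_exp fun t => ?_
    obtain ⟨g, hg, e⟩ := h t
    rw [← e]; exact (mem_G7_iff g).1 hg

theorem n5_isLieAlgebraOf : IsLieAlgebraOf n5 N5 := by
  intro X
  constructor
  · rintro ⟨s, r, z, rfl⟩ t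
    obtain ⟨ζ, ρ, S, h⟩ := exp_gMat 0 s r z t
    exact ⟨nUnit (ζ, ρ, S), ⟨ζ, ρ, S, rfl⟩, by
      rw [h, mul_zero, Complex.exp_zero, hMat_one, mul_one]; rfl⟩
  · intro h
    have h7 : X ∈ g7 := by
      refine mem_g7_of_exp fun t => ?_
      obtain ⟨g, hg, e⟩ := h t
      rw [← e]; exact ((mem_N5_iff g).1 hg).1
    have h1 : X 1 1 = 0 := by
      have d := hasDerivAt_exp_entry X 0 1 1
      rw [exp_zero_smul, one_mul] at d
      have : (fun t : ℝ => NormedSpace.exp (t • X) 1 1) = fun _ => 1 := by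
        funext t
        obtain ⟨g, hg, e⟩ := h t
        rw [← e]; exact ((mem_N5_iff g).1 hg).2
      rw [this] at d
      exact d.unique (hasDerivAt_const _ _)
    obtain ⟨l, s, r, z, rfl⟩ := h7
    obtain rfl : l = 0 := by simpa [gMat] using h1
    exact ⟨s, r, z, rfl⟩

theorem h2_isLieAlgebraOf : IsLieAlgebraOf h2 H2 := by
  intro X
  constructor
  · rintro ⟨l, rfl⟩ t
    exact ⟨hUnit ⟨_, Complex.exp_ne_zero (t * l)⟩, ⟨_, Complex.exp_ne_zero (t * l), rfl⟩,
      (exp_gMat_diag l t).symm⟩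
  · intro h
    have h7 : X ∈ g7 := by
      refine mem_g7_of_exp fun t => ?_
      obtain ⟨g, hg, e⟩ := h t
      rw [← e]; exact ((mem_H2_iff g).1 hg).1
    have h1 : ∀ j : Fin 4, j ≠ 0 → X 0 j = 0 := by
      intro j hj
      have d := hasDerivAt_exp_entry X 0 0 j
      rw [exp_zero_smul, one_mul] at d
      have : (fun t : ℝ => NormedSpace.exp (t • X) 0 j) = fun _ => 0 := by
        funext t
        obtain ⟨g, hg, e⟩ := h t
        obtain ⟨-, h1, h2, h3⟩ := (mem_H2_iff g).1 hg
        rw [← e]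
        fin_cases j
        exacts [absurd rfl hj, h1, h2, h3]
      rw [this] at d
      exact d.unique (hasDerivAt_const _ _)
    obtain ⟨l, s, r, z, rfl⟩ := h7
    have e1 := h1 1 (by decide)
    have e2 := h1 2 (by decide)
    have e3 := h1 3 (by decide)
    simp [gMat] at e1 e2 e3
    subst e1 e2 e3
    exact ⟨l, rfl⟩

theorem gMat_injective {l s l' s' : ℂ} {r r' : ℝ} {z z' : ℂ}
    (h : gMat l s r z = gMat l' s' r' z') : l = l' ∧ s = s' ∧ r = r' ∧ z = z' := by
  have h1 := congrFun (congrFun h 1) 1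
  have h2 := congrFun (congrFun h 0) 3
  have h3 := congrFun (congrFun h 0) 2
  have h4 := congrFun (congrFun h 0) 1
  simp [gMat] at h1 h2 h3 h4
  exact ⟨h1, h2, h3, h4⟩

theorem gElem_surjective (y : g7) : ∃ l s r z, y = gElem l s r z := by
  obtain ⟨_, l, s, r, z, rfl⟩ := y
  exact ⟨l, s, r, z, rfl⟩

/-- The coordinates `(λ, σ, ρ, ζ)` on `𝔤⁷`. -/
noncomputable def g7Equiv : (ℂ × ℂ × ℝ × ℂ) ≃ₗ[ℝ] g7 :=
  LinearEquiv.ofBijective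
    { toFun := fun q => gElem q.1 q.2.1 q.2.2.1 q.2.2.2
      map_add' := fun q q' => Subtype.ext (by simp [gElem, gMat_add])
      map_smul' := fun t q => Subtype.ext (by simp [gElem, smul_gMat]) }
    ⟨by
      rintro ⟨l, s, r, z⟩ ⟨l', s', r', z'⟩ h
      obtain ⟨rfl, rfl, rfl, rfl⟩ := gMat_injective (congrArg Subtype.val h)
      rfl, by
      intro y
      obtain ⟨l, s, r, z, rfl⟩ := gElem_surjective y
      exact ⟨(l, s, r, z), rfl⟩⟩

theorem finrank_g7 : Module.finrank ℝ g7 = 7 := by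
  rw [← g7Equiv.finrank_eq]
  simp

end ModelLieAlgebra

/-! ### The bracket table in the complexification of `𝔤⁷` -/

section ModelBrackets

theorem gElem_add (l l' s s' : ℂ) (r r' : ℝ) (z z' : ℂ) :
    gElem l s r z + gElem l' s' r' z' = gElem (l + l') (s + s') (r + r') (z + z') :=
  Subtype.ext (gMat_add _ _ _ _ _ _ _ _)

theorem smul_gElem (t : ℝ) (l s : ℂ) (r : ℝ) (z : ℂ) :
    t • gElem l s r z = gElem (t • l) (t • s) (t • r) (t • z) :=
  Subtype.ext (smul_gMat _ _ _ _ _)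

theorem lie_gElem (l l' s s' : ℂ) (r r' : ℝ) (z z' : ℂ) :
    ⁅gElem l s r z, gElem l' s' r' z'⁆ =
      gElem 0 (s * (2 * l' + conj l') - s' * (2 * l + conj l) - r * z' + r' * z)
        (2 * (z * conj z').im + 2 * r * l'.re - 2 * r' * l.re) (z * l' - z' * l) :=
  Subtype.ext (lie_gMat _ _ _ _ _ _ _ _)

theorem gElem_zero : gElem 0 0 0 0 = 0 := Subtype.ext gMat_zero

theorem lie_combination (a b a' b' : ℂ) (X Y X' Y' : g7) :
    ⁅a ⊗ₜ[ℝ] X + b ⊗ₜ[ℝ] Y, a' ⊗ₜ[ℝ] X' + b' ⊗ₜ[ℝ] Y'⁆ =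
      (a * a') ⊗ₜ[ℝ] ⁅X, X'⁆ + (a * b') ⊗ₜ[ℝ] ⁅X, Y'⁆ + (b * a') ⊗ₜ[ℝ] ⁅Y, X'⁆ +
        (b * b') ⊗ₜ[ℝ] ⁅Y, Y'⁆ := by
  simp only [add_lie, lie_add, LieAlgebra.ExtendScalars.bracket_tmul]
  abel

/-- The basis of `𝔤⁷` formed by the real and imaginary parts of the coordinates. -/
noncomputable def g7Basis : Module.Basis (Fin 7) ℝ g7 :=
  Module.Basis.ofEquivFun (LinearEquiv.ofBijective
    ({ toFun := fun v => gElem (v 0 + v 1 * Complex.I) (v 2 + v 3 * Complex.I) (v 4)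
          (v 5 + v 6 * Complex.I)
       map_add' := fun v w => by
        rw [gElem_add]
        congr 1 <;> simp <;> ring
       map_smul' := fun t v => by
        rw [RingHom.id_apply, smul_gElem]
        congr 1 <;> simp <;> ring } : (Fin 7 → ℝ) →ₗ[ℝ] g7)
    ⟨by
      intro v w h
      obtain ⟨h1, h2, h3, h4⟩ := gMat_injective (congrArg Subtype.val h)
      have e1 := congrArg Complex.re h1
      have e2 := congrArg Complex.im h1
      have e3 := congrArg Complex.re h2
      have e4 := congrArg Complex.im h2
      have e5 := congrArg Complex.re h4
      have e6 := congrArg Complex.im h4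
      simp at e1 e2 e3 e4 e5 e6
      ext i
      fin_cases i
      exacts [e1, e2, e3, e4, h3, e5, e6], by
      intro y
      obtain ⟨l, s, r, z, rfl⟩ := gElem_surjective y
      refine ⟨![l.re, l.im, s.re, s.im, r, z.re, z.im], ?_⟩
      simp [Complex.re_add_im]⟩).symm

theorem g7Basis_repr (l s : ℂ) (r : ℝ) (z : ℂ) :
    ⇑(g7Basis.repr (gElem l s r z)) = ![l.re, l.im, s.re, s.im, r, z.re, z.im] := by
  rw [← Module.Basis.equivFun_apply, g7Basis, Module.Basis.equivFun_ofEquivFun,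
    LinearEquiv.symm_apply_eq]
  change gElem l s r z = gElem (l.re + l.im * Complex.I) (s.re + s.im * Complex.I) r
    (z.re + z.im * Complex.I)
  simp only [Complex.re_add_im]

theorem tmul_gElem_repr (w l s : ℂ) (r : ℝ) (z : ℂ) (i : Fin 7) :
    (Algebra.TensorProduct.basis ℂ g7Basis).repr (w ⊗ₜ[ℝ] gElem l s r z) i =
      w * (![l.re, l.im, s.re, s.im, r, z.re, z.im] i : ℝ) := by
  rw [Algebra.TensorProduct.basis_repr_tmul]
  simp [g7Basis_repr, mul_comm]

set_option maxHeartbeats 4000000 in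
theorem bracketTable : BracketTable := by
  have hA : eAlpha = (1 / 2 : ℂ) ⊗ₜ[ℝ] gElem 1 0 0 0 +
      (-Complex.I / 2) ⊗ₜ[ℝ] gElem Complex.I 0 0 0 := by
    rw [eAlpha, sub_eq_add_neg, ← TensorProduct.neg_tmul, neg_div]
  have hS : eSigma = (1 / 2 : ℂ) ⊗ₜ[ℝ] gElem 0 1 0 0 +
      (-Complex.I / 2) ⊗ₜ[ℝ] gElem 0 Complex.I 0 0 := by
    rw [eSigma, sub_eq_add_neg, ← TensorProduct.neg_tmul, neg_div]
  have hZ : eZeta = (1 / 2 : ℂ) ⊗ₜ[ℝ] gElem 0 0 0 1 +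
      (-Complex.I / 2) ⊗ₜ[ℝ] gElem 0 0 0 Complex.I := by
    rw [eZeta, sub_eq_add_neg, ← TensorProduct.neg_tmul, neg_div]
  -- The vector `e_ρ` is padded with a zero term so that all seven basis vectors have the two-term
  -- form that `lie_combination` expects.
  have hR : eRho = (1 : ℂ) ⊗ₜ[ℝ] gElem 0 0 1 0 + (0 : ℂ) ⊗ₜ[ℝ] gElem 0 0 1 0 := by
    rw [eRho, TensorProduct.zero_tmul, add_zero]
  constructor <;>
    (simp only [hA, hS, hZ, hR, eAlphaBar, eSigmaBar, eZetaBar, lie_combination, lie_gElem]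
     refine (Algebra.TensorProduct.basis ℂ g7Basis).ext_elem fun i => ?_
     simp only [map_add, map_neg, map_smul, map_zero, Finsupp.add_apply, Finsupp.neg_apply,
       Finsupp.smul_apply, Finsupp.zero_apply, tmul_gElem_repr]
     fin_cases i <;> apply Complex.ext <;> simp <;> try norm_num)

end ModelBrackets

/-! ### Structure of the nilpotent algebra `n5` and of the group `N5` -/

section Nilpotent

theorem exists_n5_basis : ∃ x : Module.Basis (Fin 5) ℝ n5,
    ⁅x 0, x 1⁆ = x 2 ∧ ⁅x 0, x 2⁆ = x 3 ∧ ⁅x 1, x 2⁆ = x 4 ∧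
    (∀ j : Fin 5, ⁅x j, x 3⁆ = 0) ∧ (∀ j : Fin 5, ⁅x j, x 4⁆ = 0) := by
  -- The generators are the directions `ζ = 1` and `ζ = i`. By `lie_gMat` their bracket has `ρ = 2
  -- Im(1 · ī) = -2`, and bracketing them with it gives `σ = -2` and `σ = -2 i`; the factors `-2`
  -- make these brackets the remaining basis vectors.
  let e : (Fin 5 → ℝ) →ₗ[ℝ] n5 :=
    { toFun := fun v => ⟨gMat 0 (-2 * (v 3 + v 4 * Complex.I)) (-2 * v 2) (v 0 + v 1 * Complex.I),
        _, _, _, rfl⟩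
      map_add' := fun v w => Subtype.ext (by
        change gMat _ _ _ _ = gMat _ _ _ _ + gMat _ _ _ _
        rw [gMat_add]
        congr 1 <;> simp <;> ring)
      map_smul' := fun t v => Subtype.ext (by
        change gMat _ _ _ _ = t • gMat _ _ _ _
        rw [smul_gMat]
        congr 1 <;> simp <;> ring) }
  have he : Function.Bijective e := by
    constructor
    · intro v w h
      obtain ⟨-, h2, h3, h4⟩ := gMat_injective (congrArg Subtype.val h)
      have h2' := mul_left_cancel₀ (by norm_num) h2
      have e3 := congrArg Complex.re h2'
      have e4 := congrArg Complex.im h2'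
      have e5 := congrArg Complex.re h4
      have e6 := congrArg Complex.im h4
      simp at e3 e4 e5 e6 h3
      ext i
      fin_cases i
      exacts [e5, e6, h3, e3, e4]
    · rintro ⟨_, s, r, z, rfl⟩
      refine ⟨![z.re, z.im, -r / 2, -s.re / 2, -s.im / 2], Subtype.ext ?_⟩
      simp only [e, LinearMap.coe_mk, AddHom.coe_mk]
      congr 1
      · apply Complex.ext <;> simp <;> ring
      · simp; ring
      · simp [Complex.re_add_im]
  let x : Module.Basis (Fin 5) ℝ n5 :=
    Module.Basis.ofEquivFun (LinearEquiv.ofBijective e he).symm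
  have hx : ∀ i, (x i : Mat4) = e (Pi.single i 1) := by
    intro i
    simp only [x, Module.Basis.coe_ofEquivFun, LinearEquiv.symm_symm]
    rfl
  refine ⟨x, ?_, ?_, ?_, fun j => ?_, fun j => ?_⟩ <;> apply Subtype.ext
  · simp only [LieSubalgebra.coe_bracket, hx, e, LinearMap.coe_mk, AddHom.coe_mk, lie_gMat]
    congr 1 <;> simp
  · simp only [LieSubalgebra.coe_bracket, hx, e, LinearMap.coe_mk, AddHom.coe_mk, lie_gMat]
    congr 1 <;> simp
  · simp only [LieSubalgebra.coe_bracket, hx, e, LinearMap.coe_mk, AddHom.coe_mk, lie_gMat]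
    congr 1 <;> simp
  · simp only [LieSubalgebra.coe_bracket, hx, e, LinearMap.coe_mk, AddHom.coe_mk, lie_gMat]
    refine Eq.trans ?_ gMat_zero
    congr 1 <;> simp
  · simp only [LieSubalgebra.coe_bracket, hx, e, LinearMap.coe_mk, AddHom.coe_mk, lie_gMat]
    refine Eq.trans ?_ gMat_zero
    congr 1 <;> simp

theorem N5_entries {g : N5} {ζ s : ℂ} {r : ℝ} (hg : ((g : GL (Fin 4) ℂ) : Mat4) = nMat ζ r s) :
    (((g : GL (Fin 4) ℂ) : Mat4) 0 1 = 0 ↔ ζ = 0) ∧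
    (((g : GL (Fin 4) ℂ) : Mat4) 0 1 = 0 ∧ ((g : GL (Fin 4) ℂ) : Mat4) 0 2 = 0 ↔
      ζ = 0 ∧ r = 0) := by
  rw [hg]
  constructor
  · simp [nMat]
  · simp only [nMat, Matrix.of_apply, Matrix.cons_val]
    constructor
    · rintro ⟨rfl, h⟩
      simpa using h
    · rintro ⟨rfl, rfl⟩
      simp

theorem N5_inv {g : N5} {ζ s : ℂ} {r : ℝ} (hg : ((g : GL (Fin 4) ℂ) : Mat4) = nMat ζ r s) :
    (((g⁻¹ : N5) : GL (Fin 4) ℂ) : Mat4) = nMat (-ζ) (-r) (-s) :=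
  Units.inv_eq_of_mul_eq_one_right (by rw [hg, nMat_mul_neg])

theorem N5_mul {g g' : N5} {ζ s ζ' s' : ℂ} {r r' : ℝ}
    (hg : ((g : GL (Fin 4) ℂ) : Mat4) = nMat ζ r s)
    (hg' : ((g' : GL (Fin 4) ℂ) : Mat4) = nMat ζ' r' s') :
    (((g * g' : N5) : GL (Fin 4) ℂ) : Mat4) = nMat (ζ + ζ') (r + r' + (ζ * conj ζ').im)
        (s' + ζ * (ζ' * conj ζ' / 2 - Complex.I * r') + (ζ * conj ζ / 2 + Complex.I * r) * ζ' + s) := by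
  rw [← nMat_mul, ← hg, ← hg']; rfl

/-- The terms of the upper central series of `N₅⁴`. -/
def N5Series : ℕ → Subgroup N5
  | 0 => ⊥
  | 1 =>
    { carrier := {g | ((g : GL (Fin 4) ℂ) : Mat4) 0 1 = 0 ∧ ((g : GL (Fin 4) ℂ) : Mat4) 0 2 = 0}
      one_mem' := by simp
      mul_mem' := by
        rintro ⟨g, ζ, r, s, hg⟩ ⟨g', ζ', r', s', hg'⟩ h h'
        obtain ⟨rfl, rfl⟩ := (N5_entries hg).2.1 h
        obtain ⟨rfl, rfl⟩ := (N5_entries hg').2.1 h'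
        exact (N5_entries (N5_mul hg hg')).2.2 (by simp)
      inv_mem' := by
        rintro ⟨g, ζ, r, s, hg⟩ h
        obtain ⟨rfl, rfl⟩ := (N5_entries hg).2.1 h
        exact (N5_entries (N5_inv hg)).2.2 (by simp) }
  | 2 =>
    { carrier := {g | ((g : GL (Fin 4) ℂ) : Mat4) 0 1 = 0}
      one_mem' := by simp
      mul_mem' := by
        rintro ⟨g, ζ, r, s, hg⟩ ⟨g', ζ', r', s', hg'⟩ h h'
        obtain rfl := (N5_entries hg).1.1 h
        obtain rfl := (N5_entries hg').1.1 h'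
        exact (N5_entries (N5_mul hg hg')).1.2 (by simp)
      inv_mem' := by
        rintro ⟨g, ζ, r, s, hg⟩ h
        obtain rfl := (N5_entries hg).1.1 h
        exact (N5_entries (N5_inv hg)).1.2 (by simp) }
  | _ => ⊤

/-- Commutators descend the series one step at a time. In a commutator the `ζ` entries always
cancel; if one factor has `ζ = 0`, the `r` entry cancels as well; if it has `ζ = r = 0`, it is
central. -/
theorem nilpotent_N5 : Group.IsNilpotent N5 := by
  refine (Subgroup.nilpotent_iff_finite_ascending_central_series N5).2 ⟨3, N5Series, ⟨rfl, ?_⟩, rfl⟩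
  intro x n h g
  obtain ⟨ζ, r, s, hx⟩ := x.2
  obtain ⟨ζ', r', s', hg⟩ := g.2
  have hc := N5_mul (N5_mul (N5_mul hx hg) (N5_inv hx)) (N5_inv hg)
  match n with
  | 0 =>
    obtain ⟨rfl, rfl⟩ := (N5_entries hx).2.1 h
    refine Subtype.ext (Units.ext (hc.trans ?_))
    rw [Subgroup.coe_one, Units.val_one, ← nMat_zero]
    congr 1
    · simp
    · simp [mul_comm]
    · simp; ring
  | 1 =>
    obtain rfl := (N5_entries hx).1.1 h
    refine (N5_entries hc).2.2 ⟨by simp, ?_⟩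
    simp [mul_comm]
  | 2 => exact (N5_entries hc).1.2 (by ring)
  | n + 3 => trivial

end Nilpotent

/-! ### The holomorphic action of `G7` on `ℂ⁴` and the cubic as an orbit -/

section ModelAction

/-- Coordinates `(z, y, σ, q)` on `ℂ⁴` in which `N₅⁴` acts by affine maps. -/
noncomputable def modelCoord (x : C4) : C4 :=
  ![x 0, -(Complex.I / 2) * x 1, -(Complex.I / 4) * (x 2 + Complex.I * x 3) +
    Complex.I / 2 * (x 0 * x 1), Complex.I / 4 * (x 2 - Complex.I * x 3)]

/-- The inverse of `modelCoord`. -/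
noncomputable def modelPoint (v : C4) : C4 :=
  ![v 0, 2 * Complex.I * v 1, 2 * Complex.I * (v 2 + v 0 * v 1 - v 3), 2 * (v 2 + v 0 * v 1 + v 3)]

/-- The action of a unipotent element. -/
noncomputable def nCoord (ζ : ℂ) (r : ℝ) (s : ℂ) (v : C4) : C4 :=
  ![v 0 + ζ, v 1 + conj ζ * v 0 + (ζ * conj ζ / 2 - Complex.I * r),
    v 2 + ζ * v 1 + (ζ * conj ζ / 2 + Complex.I * r) * v 0 + s,
    v 3 + (conj s - conj ζ * (ζ * conj ζ / 2 - Complex.I * r)) - 2 * conj ζ * v 1 -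
      conj ζ ^ 2 * v 0]

/-- The action of a diagonal element. -/
noncomputable def hCoord (a : ℂ) (v : C4) : C4 :=
  ![v 0 / a, v 1 / (a * conj a), v 2 / (a ^ 2 * conj a), v 3 / (conj a ^ 2 * a)]

theorem vec4_ext {v w : C4} (h0 : v 0 = w 0) (h1 : v 1 = w 1) (h2 : v 2 = w 2) (h3 : v 3 = w 3) :
    v = w := by
  ext i
  fin_cases i
  exacts [h0, h1, h2, h3]

theorem modelPoint_modelCoord (x : C4) : modelPoint (modelCoord x) = x := by
  refine vec4_ext ?_ ?_ ?_ ?_ <;> simp [modelPoint, modelCoord] <;> ring_nf <;>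
    simp only [Complex.I_sq] <;> ring

theorem modelCoord_modelPoint (v : C4) : modelCoord (modelPoint v) = v := by
  refine vec4_ext ?_ ?_ ?_ ?_ <;> simp [modelPoint, modelCoord] <;> ring_nf <;>
    simp only [Complex.I_sq] <;> ring

/-- The coordinates are chosen so that `nCoord` multiplies the column `(σ, y, z, 1)` by the matrix
`n`, and `hCoord` does the same with `h`, followed by division by the last entry. On the cubic `q`
is the function `σ̄ - z̄ y`, and its transformation law is the one forced by this relation: the
terms in `z̄` cancel, so the law is holomorphic. The orbit of the origin is then exactly the set
described by these equations. -/
theorem mem_cubic_iff (x : C4) : x ∈ cubic ↔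
    modelCoord x 1 + conj (modelCoord x 1) = modelCoord x 0 * conj (modelCoord x 0) ∧
    modelCoord x 3 = conj (modelCoord x 2) - conj (modelCoord x 0) * modelCoord x 1 := by
  have e : x ∈ cubic ↔ (x 1).im - (x 0 * conj (x 0)).re = 0 ∧
      (x 2).im - (x 0 ^ 2 * conj (x 0) + x 0 * conj (x 0) ^ 2).re = 0 ∧
      (x 3).im - (-Complex.I * (x 0 ^ 2 * conj (x 0) - x 0 * conj (x 0) ^ 2)).re = 0 := by
    change cubicEquations x = 0 ↔ _
    simp only [funext_iff, Fin.forall_fin_succ, cubicEquations]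
    simp
  rw [e]
  simp only [Complex.ext_iff, modelCoord, Matrix.cons_val]
  simp [pow_two, map_ofNat]
  constructor
  · rintro ⟨h1, h2, h3⟩
    refine ⟨⟨by linarith, by ring⟩, ?_, ?_⟩
    · linear_combination (-1 / 2 : ℝ) * h2 + (x 0).re * h1
    · linear_combination (1 / 2 : ℝ) * h3 - (x 0).im * h1
  · rintro ⟨⟨h1, -⟩, h2, h3⟩
    have h1' : (x 1).im - ((x 0).re * (x 0).re + (x 0).im * (x 0).im) = 0 := by linarith
    refine ⟨h1', ?_, ?_⟩
    · linear_combination (-2 : ℝ) * h2 + 2 * (x 0).re * h1'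
    · linear_combination (2 : ℝ) * h3 + 2 * (x 0).im * h1'

theorem nCoord_nCoord (ζ ζ' : ℂ) (r r' : ℝ) (s s' : ℂ) (v : C4) :
    nCoord ζ r s (nCoord ζ' r' s' v) = nCoord (ζ + ζ') (r + r' + (ζ * conj ζ').im)
        (s' + ζ * (ζ' * conj ζ' / 2 - Complex.I * r') + (ζ * conj ζ / 2 + Complex.I * r) * ζ' + s)
        v := by
  have h : (((ζ * conj ζ').im : ℝ) : ℂ) =
      -Complex.I * (ζ * conj ζ' - conj ζ * ζ') / 2 := by
    have := Complex.sub_conj (ζ * conj ζ')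
    rw [map_mul, Complex.conj_conj] at this
    rw [this]; push_cast
    linear_combination ((ζ * conj ζ').im : ℂ) * Complex.I_sq
  refine vec4_ext ?_ ?_ ?_ ?_ <;> simp only [nCoord, Matrix.cons_val, map_add, map_mul, map_sub,
    map_div₀, Complex.conj_I, Complex.conj_conj, Complex.conj_ofReal, Complex.ofReal_add, h,
    map_ofNat] <;> ring_nf <;> simp only [Complex.I_sq] <;> ring

theorem hCoord_hCoord (a b : ℂ) (v : C4) : hCoord a (hCoord b v) = hCoord (a * b) v := by
  refine vec4_ext ?_ ?_ ?_ ?_ <;> simp only [hCoord, Matrix.cons_val, map_mul, div_div] <;>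
    congr 1 <;> ring

theorem hCoord_nCoord {a : ℂ} (ha : a ≠ 0) (ζ : ℂ) (r : ℝ) (s : ℂ) (v : C4) :
    hCoord a (nCoord ζ r s v) =
      nCoord (ζ / a) (r / Complex.normSq a) (s / (a ^ 2 * conj a)) (hCoord a v) := by
  have hb : conj a ≠ 0 := by simpa using ha
  refine vec4_ext ?_ ?_ ?_ ?_ <;> simp only [nCoord, hCoord, Matrix.cons_val, map_add, map_mul,
    map_sub, map_div₀, map_pow, Complex.conj_conj, Complex.ofReal_div,
    Complex.normSq_eq_conj_mul_self] <;> field_simp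

/-- The action of `n h` on `ℂ⁴`. -/
noncomputable def actPair (ζ : ℂ) (r : ℝ) (s a : ℂ) (x : C4) : C4 :=
  modelPoint (nCoord ζ r s (hCoord a (modelCoord x)))

/-- The action of `G⁷` on `ℂ⁴`. -/
noncomputable def modelAct (g : Mat4) : C4 → C4 :=
  actPair (g 0 1 / g 1 1) (g 0 2 / g 2 2).im (g 0 3 / g 3 3) (g 1 1)

theorem modelAct_eq {a : ℂ} (ha : a ≠ 0) (ζ : ℂ) (r : ℝ) (s : ℂ) :
    modelAct (nMat ζ r s * hMat a) = actPair ζ r s a := by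
  have hb : conj a ≠ 0 := by simpa using ha
  rw [modelAct, entries_of_mem_G7 rfl]
  simp only [Matrix.of_apply, Matrix.cons_val]
  rw [mul_div_cancel_right₀ _ ha, mul_div_cancel_right₀ _ (mul_ne_zero ha hb),
    mul_div_cancel_right₀ _ (mul_ne_zero (pow_ne_zero 2 ha) hb)]
  congr 1
  simp [mul_comm]

theorem modelAct_nMat (ζ : ℂ) (r : ℝ) (s : ℂ) :
    modelAct (nMat ζ r s) = actPair ζ r s 1 := by
  rw [← modelAct_eq one_ne_zero, hMat_one, mul_one]

theorem hCoord_one (v : C4) : hCoord 1 v = v := by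
  refine vec4_ext ?_ ?_ ?_ ?_ <;> simp [hCoord]

theorem nCoord_zero (v : C4) : nCoord 0 0 0 v = v := by
  refine vec4_ext ?_ ?_ ?_ ?_ <;> simp [nCoord]

theorem modelAct_mul {g g' : GL (Fin 4) ℂ} (hg : g ∈ G7) (hg' : g' ∈ G7) :
    modelAct ((g * g' : GL (Fin 4) ℂ) : Mat4) = modelAct (g : Mat4) ∘ modelAct (g' : Mat4) := by
  obtain ⟨a, ζ, r, s, ha, hg⟩ := hg
  obtain ⟨a', ζ', r', s', ha', hg'⟩ := hg'
  rw [Units.val_mul, hg, hg', modelAct_eq ha, modelAct_eq ha', Matrix.mul_assoc,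
    ← Matrix.mul_assoc (hMat a), hMat_mul_nMat ha, Matrix.mul_assoc, hMat_mul, ← Matrix.mul_assoc,
    nMat_mul, modelAct_eq (mul_ne_zero ha ha')]
  ext1 x
  simp only [actPair, Function.comp_apply, modelCoord_modelPoint]
  rw [hCoord_nCoord ha, nCoord_nCoord, hCoord_hCoord]

theorem modelCoord_zero : modelCoord 0 = 0 := by
  refine vec4_ext ?_ ?_ ?_ ?_ <;> simp [modelCoord]

theorem hCoord_zero (a : ℂ) : hCoord a 0 = 0 := by
  refine vec4_ext ?_ ?_ ?_ ?_ <;> simp [hCoord]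

theorem actPair_zero (ζ : ℂ) (r : ℝ) (s a : ℂ) :
    modelCoord (actPair ζ r s a 0) = ![ζ, ζ * conj ζ / 2 - Complex.I * r, s,
      conj s - conj ζ * (ζ * conj ζ / 2 - Complex.I * r)] := by
  rw [actPair, modelCoord_zero, hCoord_zero, modelCoord_modelPoint]
  refine vec4_ext ?_ ?_ ?_ ?_ <;> simp [nCoord]

/-- A left inverse of the orbit map of `N₅⁴` at the origin. -/
noncomputable def orbitInv (x : C4) : ℂ × ℝ × ℂ :=
  (modelCoord x 0, -(modelCoord x 1).im, modelCoord x 2)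

theorem orbitInv_actPair (q : ℂ × ℝ × ℂ) (a : ℂ) : orbitInv (actPair q.1 q.2.1 q.2.2 a 0) = q := by
  rw [orbitInv, actPair_zero]
  refine Prod.ext rfl (Prod.ext ?_ rfl)
  simp [mul_comm]

/-- On the cubic, `Re y` and `q` are functions of `z`, `Im y` and `σ`, so the three quantities kept
by `orbitInv` determine the point. -/
theorem actPair_orbitInv {x : C4} (hx : x ∈ cubic) :
    actPair (orbitInv x).1 (orbitInv x).2.1 (orbitInv x).2.2 1 0 = x := by
  obtain ⟨h1, h2⟩ := (mem_cubic_iff x).1 hx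
  rw [← modelPoint_modelCoord (actPair _ _ _ _ _), actPair_zero, ← modelPoint_modelCoord x]
  congr 1
  have h3 : modelCoord x 0 * conj (modelCoord x 0) / 2 - Complex.I * (-(modelCoord x 1).im : ℝ) =
      modelCoord x 1 := by
    rw [← h1, Complex.add_conj]
    push_cast
    conv_rhs => rw [← Complex.re_add_im (modelCoord x 1)]
    ring
  rw [modelPoint_modelCoord x]
  refine vec4_ext rfl h3 rfl ?_
  rw [h2]
  simp only [orbitInv, Matrix.cons_val]
  rw [h3]

theorem actPair_mem_cubic {ζ s a : ℂ} (ha : a ≠ 0) {r : ℝ} {x : C4} (hx : x ∈ cubic) :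
    actPair ζ r s a x ∈ cubic := by
  have hb : conj a ≠ 0 := by simpa using ha
  obtain ⟨h1, h2⟩ := (mem_cubic_iff x).1 hx
  rw [mem_cubic_iff, actPair, modelCoord_modelPoint]
  set v := modelCoord x
  have h1' : conj (v 1) = v 0 * conj (v 0) - v 1 := by linear_combination h1
  simp only [nCoord, hCoord, Matrix.cons_val, map_add, map_mul,
    map_sub, map_div₀, map_pow, Complex.conj_conj, Complex.conj_I, Complex.conj_ofReal, map_ofNat,
    h1', h2]
  constructor <;> field_simp <;> ring

theorem continuous_modelCoord : Continuous modelCoord := by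
  refine continuous_pi fun i => ?_
  fin_cases i <;> simp [modelCoord] <;> fun_prop

theorem continuous_orbitInv : Continuous orbitInv := by
  have h := continuous_pi_iff.1 continuous_modelCoord
  exact (h 0).prodMk ((Complex.continuous_im.comp (h 1)).neg.prodMk (h 2))

theorem differentiable_actPair (ζ : ℂ) (r : ℝ) (s a : ℂ) : Differentiable ℂ (actPair ζ r s a) := by
  refine differentiable_pi.2 fun i => ?_
  fin_cases i <;> simp [actPair, modelPoint, nCoord, hCoord, modelCoord] <;> fun_prop

theorem analyticAt_conj' {E : Type*} [NormedAddCommGroup E] [NormedSpace ℝ E] {f : E → ℂ} {x : E}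
    (hf : AnalyticAt ℝ f x) : AnalyticAt ℝ (fun y => conj (f y)) x :=
  (Complex.conjCLE.toContinuousLinearMap.analyticAt _).comp hf

theorem analyticAt_ofReal' {E : Type*} [NormedAddCommGroup E] [NormedSpace ℝ E] {f : E → ℝ} {x : E}
    (hf : AnalyticAt ℝ f x) : AnalyticAt ℝ (fun y => (f y : ℂ)) x :=
  (Complex.ofRealCLM.analyticAt _).comp hf

theorem analyticAt_actPair {q : (ℂ × ℂ × ℝ × ℂ) × C4} (hq : q.1.1 ≠ 0) :
    AnalyticAt ℝ (fun q : (ℂ × ℂ × ℝ × ℂ) × C4 =>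
      actPair q.1.2.1 q.1.2.2.1 q.1.2.2.2 q.1.1 q.2) q := by
  let A := ContinuousLinearMap.fst ℝ (ℂ × ℂ × ℝ × ℂ) C4
  let B := (ContinuousLinearMap.snd ℝ ℂ (ℂ × ℝ × ℂ)).comp A
  let C := (ContinuousLinearMap.snd ℝ ℂ (ℝ × ℂ)).comp B
  have ha : AnalyticAt ℝ (fun q : (ℂ × ℂ × ℝ × ℂ) × C4 => q.1.1) q :=
    ((ContinuousLinearMap.fst ℝ ℂ (ℂ × ℝ × ℂ)).comp A).analyticAt q
  have hz : AnalyticAt ℝ (fun q : (ℂ × ℂ × ℝ × ℂ) × C4 => q.1.2.1) q :=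
    ((ContinuousLinearMap.fst ℝ ℂ (ℝ × ℂ)).comp B).analyticAt q
  have hr : AnalyticAt ℝ (fun q : (ℂ × ℂ × ℝ × ℂ) × C4 => (q.1.2.2.1 : ℂ)) q :=
    (Complex.ofRealCLM.comp ((ContinuousLinearMap.fst ℝ ℝ ℂ).comp C)).analyticAt q
  have hs : AnalyticAt ℝ (fun q : (ℂ × ℂ × ℝ × ℂ) × C4 => q.1.2.2.2) q :=
    ((ContinuousLinearMap.snd ℝ ℝ ℂ).comp C).analyticAt q
  have hx : ∀ j, AnalyticAt ℝ (fun q : (ℂ × ℂ × ℝ × ℂ) × C4 => q.2 j) q := fun j =>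
    (ContinuousLinearMap.proj (R := ℝ) (φ := fun _ : Fin 4 => ℂ) j).analyticAt _ |>.comp
      analyticAt_snd
  have ha' := analyticAt_conj' ha
  have hz' := analyticAt_conj' hz
  have hs' := analyticAt_conj' hs
  have hb : conj q.1.1 ≠ 0 := by simpa using hq
  have h0 := hx 0
  have h1 := hx 1
  have h2 := hx 2
  have h3 := hx 3
  refine analyticAt_pi_iff.2 fun i => ?_
  have c : ∀ w : ℂ, AnalyticAt ℝ (fun _ : (ℂ × ℂ × ℝ × ℂ) × C4 => w) q := fun w => analyticAt_const
  fin_cases i <;> simp [actPair, modelPoint, nCoord, hCoord, modelCoord] <;>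
    fun_prop (disch := simpa using hq)

theorem continuous_actPair_zero :
    Continuous fun q : ℂ × ℝ × ℂ => actPair q.1 q.2.1 q.2.2 1 0 := by
  refine continuous_iff_continuousAt.2 fun q => ?_
  have h2 := (analyticAt_actPair (q := ((1, q), 0)) one_ne_zero).continuousAt
  exact h2.comp (f := fun q : ℂ × ℝ × ℂ => (((1 : ℂ), q), (0 : C4))) (by fun_prop)

theorem differentiable_orbitInv : Differentiable ℝ orbitInv := by
  have h : ∀ i, Differentiable ℝ fun x => modelCoord x i := by
    intro i
    fin_cases i <;> simp [modelCoord] <;> fun_prop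
  exact (h 0).prodMk ((Complex.imCLM.differentiable.comp (h 1)).neg.prodMk (h 2))

theorem exists_modelAction : ∃ act, IsModelAction act := by
  have hmul : ∀ g ∈ G7, ∀ g' ∈ G7, ∀ x, modelAct ((g * g' : GL (Fin 4) ℂ) : Mat4) x =
      modelAct (g : Mat4) (modelAct (g' : Mat4) x) := fun g hg g' hg' x =>
    congrFun (modelAct_mul hg hg') x
  have hone : modelAct 1 = id := by
    rw [← nMat_zero, modelAct_nMat]
    ext1 x
    rw [actPair, hCoord_one, nCoord_zero, modelPoint_modelCoord, id]
  have hinv : ∀ g ∈ G7, ∀ x, modelAct ((g⁻¹ : GL (Fin 4) ℂ) : Mat4) (modelAct (g : Mat4) x) = x := by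
    intro g hg x
    rw [← hmul _ (inv_mem hg) _ hg, inv_mul_cancel, Units.val_one, hone, id]
  have horb : ∀ x ∈ cubic, ∃ n ∈ N5, modelAct (n : Mat4) 0 = x := by
    intro x hx
    refine ⟨nUnit (orbitInv x), ⟨_, _, _, rfl⟩, ?_⟩
    exact (congrFun (modelAct_nMat _ _ _) 0).trans (actPair_orbitInv hx)
  have hfree : ∀ n ∈ N5, ∀ n' ∈ N5, modelAct (n : Mat4) 0 = modelAct (n' : Mat4) 0 → n = n' := by
    rintro n ⟨ζ, r, s, hn⟩ n' ⟨ζ', r', s', hn'⟩ h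
    rw [hn, hn', modelAct_nMat, modelAct_nMat] at h
    have h2 := congrArg orbitInv h
    rw [orbitInv_actPair (ζ, r, s), orbitInv_actPair (ζ', r', s')] at h2
    simp only [Prod.mk.injEq] at h2
    obtain ⟨rfl, rfl, rfl⟩ := h2
    exact Units.ext (hn.trans hn'.symm)
  refine ⟨modelAct, hone, fun g hg g' hg' => modelAct_mul hg hg', ?_, ?_, ?_, ?_, ?_, ?_, ?_, ?_, ?_⟩
  · rintro g ⟨a, ζ, r, s, ha, hg⟩
    rw [hg, modelAct_eq ha]
    exact differentiable_actPair _ _ _ _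
  · intro q hq
    refine (analyticAt_actPair hq).congr ?_
    have : ∀ᶠ q' : (ℂ × ℂ × ℝ × ℂ) × C4 in 𝓝 q, q'.1.1 ≠ 0 :=
      (continuous_fst.comp continuous_fst).continuousAt.eventually_ne hq
    filter_upwards [this] with q' hq'
    rw [modelAct_eq hq']
  · rintro g ⟨a, ζ, r, s, ha, hg⟩ x hx
    rw [hg, modelAct_eq ha]
    exact actPair_mem_cubic ha hx
  · rintro g ⟨a, ζ, r, s, ha, hg⟩ h
    rw [hg, modelAct_eq ha] at h
    have h0 : (0 : C4) ∈ cubic := by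
      rw [mem_cubic_iff, modelCoord_zero]; simp
    have e := congrArg orbitInv (h 0 h0)
    rw [orbitInv_actPair (ζ, r, s)] at e
    simp only [orbitInv, modelCoord_zero, Pi.zero_apply, Complex.zero_im, neg_zero,
      Prod.mk.injEq] at e
    obtain ⟨rfl, rfl, rfl⟩ := e
    -- Fixing the origin has left only the diagonal part. It acts on the coordinate `z` by `1 / a`,
    -- so a point of the cubic with `z = 1` detects `a`.
    have h1 : actPair 1 0 0 1 0 ∈ cubic := actPair_mem_cubic one_ne_zero h0
    have e1 := congrArg (fun x => modelCoord x 0) (h _ h1)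
    have e2 := actPair_zero 1 0 0 1
    rw [actPair, modelCoord_modelPoint, nCoord_zero, e2] at e1
    simp [hCoord] at e1
    obtain rfl : a = 1 := by simpa using e1
    refine Units.ext ?_
    rw [hg, nMat_zero, hMat_one, one_mul, Units.val_one]
  · intro x hx y hy
    obtain ⟨n, hn, rfl⟩ := horb x hx
    obtain ⟨n', hn', rfl⟩ := horb y hy
    refine ⟨n' * n⁻¹, mul_mem (N5_le_G7 hn') (inv_mem (N5_le_G7 hn)), ?_⟩
    rw [hmul _ (N5_le_G7 hn') _ (inv_mem (N5_le_G7 hn)), hinv _ (N5_le_G7 hn)]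
  · rintro g ⟨a, ζ, r, s, ha, hg⟩
    constructor
    · intro h
      rw [hg, modelAct_eq ha] at h
      have e := congrArg orbitInv h
      rw [orbitInv_actPair (ζ, r, s)] at e
      simp only [orbitInv, modelCoord_zero, Pi.zero_apply, Complex.zero_im, neg_zero,
        Prod.mk.injEq] at e
      obtain ⟨rfl, rfl, rfl⟩ := e
      exact ⟨a, ha, by rw [hg, nMat_zero, one_mul]⟩
    · rintro ⟨b, hb, hg'⟩
      rw [hg', ← one_mul (hMat b), ← nMat_zero, modelAct_eq hb, actPair, modelCoord_zero,
        hCoord_zero, nCoord_zero]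
      refine vec4_ext ?_ ?_ ?_ ?_ <;> simp [modelPoint]
  · intro x hx y hy
    obtain ⟨n, hn, rfl⟩ := horb x hx
    obtain ⟨n', hn', rfl⟩ := horb y hy
    refine ⟨n' * n⁻¹, ⟨mul_mem hn' (inv_mem hn), ?_⟩, ?_⟩
    · rw [hmul _ (N5_le_G7 hn') _ (inv_mem (N5_le_G7 hn)), hinv _ (N5_le_G7 hn)]
    · rintro m ⟨hm, e⟩
      rw [← hmul _ (N5_le_G7 hm) _ (N5_le_G7 hn)] at e
      exact eq_mul_inv_of_mul_eq (hfree _ (mul_mem hm hn) _ hn' e)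
  -- A continuous left inverse makes the orbit map a closed embedding. Below, the differentiability
  -- of the same left inverse makes it an immersion.
  · have hl : Function.LeftInverse orbitInv
        fun q : ℂ × ℝ × ℂ => modelAct (nMat q.1 q.2.1 q.2.2) 0 := by
      intro q
      simp only [modelAct_nMat]
      exact orbitInv_actPair q 1
    have hc : Continuous fun q : ℂ × ℝ × ℂ => modelAct (nMat q.1 q.2.1 q.2.2) 0 := by
      simp only [modelAct_nMat]
      exact continuous_actPair_zero
    exact hl.isClosedEmbedding continuous_orbitInv hc
  · intro q
    have e : (fun q : ℂ × ℝ × ℂ => modelAct (nMat q.1 q.2.1 q.2.2) 0) =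
        fun q => actPair q.1 q.2.1 q.2.2 1 0 := by
      ext1 q; rw [modelAct_nMat]
    rw [e]
    have h1 : DifferentiableAt ℝ (fun q : ℂ × ℝ × ℂ => actPair q.1 q.2.1 q.2.2 1 0) q := by
      have h2 := (analyticAt_actPair (q := ((1, q), 0)) one_ne_zero).differentiableAt
      exact h2.comp q (f := fun q : ℂ × ℝ × ℂ => (((1 : ℂ), q), (0 : C4))) (by fun_prop)
    have h3 := (differentiable_orbitInv (actPair q.1 q.2.1 q.2.2 1 0)).hasFDerivAt.comp q
      h1.hasFDerivAt
    have h4 : orbitInv ∘ (fun q : ℂ × ℝ × ℂ => actPair q.1 q.2.1 q.2.2 1 0) = id :=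
      funext fun q => orbitInv_actPair q 1
    rw [h4] at h3
    have h5 := h3.unique (hasFDerivAt_id q)
    refine Function.LeftInverse.injective (g := fderiv ℝ orbitInv (actPair q.1 q.2.1 q.2.2 1 0))
      fun v => ?_
    exact congrArg (fun A : (ℂ × ℝ × ℂ) →L[ℝ] (ℂ × ℝ × ℂ) => A v) h5

end ModelAction

/-! ### The seven-dimensional algebra of fields tangent to the cubic -/

section InfinitesimalAutomorphisms

/-- The holomorphic vector field on `ℂ⁴` with parameters `(λ, σ, ρ, ζ)`. -/
noncomputable def infField (l s : ℂ) (r : ℝ) (c : ℂ) (x : C4) : C4 :=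
  ![l * x 0 - c,
    (l + conj l) * x 1 - 2 * Complex.I * conj c * x 0 - 2 * r,
    2 * Complex.I * (((2 * l + conj l) * (-(Complex.I / 4) * (x 2 + Complex.I * x 3)) +
        Complex.I * c * x 1 - conj c * x 0 ^ 2 + 2 * Complex.I * s) -
      ((2 * conj l + l) * (Complex.I / 4 * (x 2 - Complex.I * x 3)) -
        Complex.I * conj c * x 1 - 2 * Complex.I * conj s)),
    2 * (((2 * l + conj l) * (-(Complex.I / 4) * (x 2 + Complex.I * x 3)) +
        Complex.I * c * x 1 - conj c * x 0 ^ 2 + 2 * Complex.I * s) +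
      ((2 * conj l + l) * (Complex.I / 4 * (x 2 - Complex.I * x 3)) -
        Complex.I * conj c * x 1 - 2 * Complex.I * conj s))]

/-- The derivative of `infField` in the direction `u`. -/
noncomputable def infFieldDeriv (l c : ℂ) (x u : C4) : C4 :=
  ![l * u 0,
    (l + conj l) * u 1 - 2 * Complex.I * conj c * u 0,
    2 * Complex.I * (((2 * l + conj l) * (-(Complex.I / 4) * (u 2 + Complex.I * u 3)) +
        Complex.I * c * u 1 - conj c * (2 * x 0 * u 0)) -
      ((2 * conj l + l) * (Complex.I / 4 * (u 2 - Complex.I * u 3)) -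
        Complex.I * conj c * u 1)),
    2 * (((2 * l + conj l) * (-(Complex.I / 4) * (u 2 + Complex.I * u 3)) +
        Complex.I * c * u 1 - conj c * (2 * x 0 * u 0)) +
      ((2 * conj l + l) * (Complex.I / 4 * (u 2 - Complex.I * u 3)) -
        Complex.I * conj c * u 1))]

theorem differentiable_infField (l s : ℂ) (r : ℝ) (c : ℂ) :
    Differentiable ℂ (infField l s r c) := by
  refine differentiable_pi.2 fun i => ?_
  fin_cases i <;> simp [infField] <;> fun_prop

theorem fderiv_infField (l s : ℂ) (r : ℝ) (c : ℂ) (x u : C4) :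
    fderiv ℂ (infField l s r c) x u = infFieldDeriv l c x u := by
  have h1 : HasDerivAt (fun t : ℂ => x + t • u) u 0 := by
    simpa using ((hasDerivAt_id (0 : ℂ)).smul_const u).const_add x
  have h2 : HasDerivAt (fun t : ℂ => infField l s r c (x + t • u))
      (fderiv ℂ (infField l s r c) x u) 0 := by
    exact HasFDerivAt.comp_hasDerivAt_of_eq 0 (differentiable_infField l s r c x).hasFDerivAt h1
      (by simp)
  have hx : ∀ j, HasDerivAt (fun t : ℂ => (x + t • u) j) (u j) 0 := hasDerivAt_pi.1 h1
  refine h2.unique (hasDerivAt_pi.2 fun i => ?_)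
  have hP := (((hx 2).fun_add ((hx 3).const_mul Complex.I)).const_mul (-(Complex.I / 4))).const_mul
    (2 * l + conj l)
  have hQ := (((hx 2).fun_sub ((hx 3).const_mul Complex.I)).const_mul (Complex.I / 4)).const_mul
    (2 * conj l + l)
  have hP' := ((hP.fun_add ((hx 1).const_mul (Complex.I * c))).fun_sub
    (((hx 0).fun_pow 2).const_mul (conj c))).add_const (2 * Complex.I * s)
  have hQ' := (hQ.fun_sub ((hx 1).const_mul (Complex.I * conj c))).sub_const
    (2 * Complex.I * conj s)
  fin_cases i
  · exact ((hx 0).const_mul l).sub_const c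
  · exact (((hx 1).const_mul (l + conj l)).fun_sub
      ((hx 0).const_mul (2 * Complex.I * conj c))).sub_const _
  · refine ((hP'.fun_sub hQ').const_mul (2 * Complex.I)).congr_deriv ?_
    simp [infFieldDeriv]
  · refine ((hP'.fun_add hQ').const_mul 2).congr_deriv ?_
    simp [infFieldDeriv]

/-- The fields `infField` are the negatives of the infinitesimal generators of the action: its first
component is `l z - c`, while the action moves `z` with velocity `-l z + c`. The generators of a
left action form an antihomomorphism, and the change of sign turns it into a homomorphism. -/
theorem infField_lie (l l' s s' : ℂ) (r r' : ℝ) (c c' : ℂ) :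
    infField 0 (s * (2 * l' + conj l') - s' * (2 * l + conj l) - r * c' + r' * c)
        (2 * (c * conj c').im + 2 * r * l'.re - 2 * r' * l.re) (c * l' - c' * l) =
      VectorField.lieBracket ℂ (infField l s r c) (infField l' s' r' c') := by
  ext1 x
  rw [VectorField.lieBracket, fderiv_infField, fderiv_infField]
  have hk : ((2 * (c * conj c').im + 2 * r * l'.re - 2 * r' * l.re : ℝ) : ℂ) =
      -Complex.I * (c * conj c' - c' * conj c) + r * (l' + conj l') - r' * (l + conj l) := by
    apply Complex.ext
    · simp; ring
    · simp; try ring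
  refine vec4_ext ?_ ?_ ?_ ?_ <;> simp only [infField, infFieldDeriv, Matrix.cons_val,
    Pi.sub_apply, hk, map_zero, map_sub, map_add, map_mul, Complex.conj_conj, Complex.conj_ofReal,
    map_ofNat, zero_mul, add_zero, mul_zero] <;> ring_nf <;>
    simp only [Complex.I_sq, Complex.I_pow_three, Complex.I_pow_four] <;> ring

theorem fderiv_cubicEquations (x u : C4) : fderiv ℝ cubicEquations x u =
    ![(u 1).im - (u 0 * conj (x 0) + x 0 * conj (u 0)).re,
      (u 2).im - (2 * x 0 * u 0 * conj (x 0) + x 0 ^ 2 * conj (u 0) + u 0 * conj (x 0) ^ 2 +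
        x 0 * (2 * conj (x 0) * conj (u 0))).re,
      (u 3).im - (-Complex.I * (2 * x 0 * u 0 * conj (x 0) + x 0 ^ 2 * conj (u 0) -
        (u 0 * conj (x 0) ^ 2 + x 0 * (2 * conj (x 0) * conj (u 0))))).re] := by
  have hd : Differentiable ℝ cubicEquations := by
    have hz : Differentiable ℝ fun x : C4 => x 0 := by fun_prop
    have hz' : Differentiable ℝ fun x : C4 => conj (x 0) :=
      Complex.conjCLE.toContinuousLinearMap.differentiable.comp hz
    have hi : ∀ j, Differentiable ℝ fun x : C4 => (x j).im := fun j =>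
      Complex.imCLM.differentiable.comp (by fun_prop : Differentiable ℝ fun x : C4 => x j)
    refine differentiable_pi.2 fun i => ?_
    fin_cases i
    · exact (hi 1).sub (Complex.reCLM.differentiable.comp (hz.mul hz'))
    · exact (hi 2).sub (Complex.reCLM.differentiable.comp
        (((hz.pow 2).mul hz').add (hz.mul (hz'.pow 2))))
    · exact (hi 3).sub (Complex.reCLM.differentiable.comp
        ((((hz.pow 2).mul hz').sub (hz.mul (hz'.pow 2))).const_mul (-Complex.I)))
  have h1 : HasDerivAt (fun t : ℝ => x + t • u) u 0 := by
    simpa using ((hasDerivAt_id (0 : ℝ)).smul_const u).const_add x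
  have h2 : HasDerivAt (fun t : ℝ => cubicEquations (x + t • u))
      (fderiv ℝ cubicEquations x u) 0 := by
    exact HasFDerivAt.comp_hasDerivAt_of_eq 0 (hd x).hasFDerivAt h1 (by simp)
  have hx : ∀ j, HasDerivAt (fun t : ℝ => (x + t • u) j) (u j) 0 := hasDerivAt_pi.1 h1
  have hc : HasDerivAt (fun t : ℝ => conj ((x + t • u) 0)) (conj (u 0)) 0 := hasDerivAt_conj (hx 0)
  have him : ∀ {f : ℝ → ℂ} {f' : ℂ}, HasDerivAt f f' 0 → HasDerivAt (fun t => (f t).im) f'.im 0 :=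
    fun hf => Complex.imCLM.hasFDerivAt.comp_hasDerivAt 0 hf
  have hre : ∀ {f : ℝ → ℂ} {f' : ℂ}, HasDerivAt f f' 0 → HasDerivAt (fun t => (f t).re) f'.re 0 :=
    fun hf => Complex.reCLM.hasFDerivAt.comp_hasDerivAt 0 hf
  have h3 := ((hx 0).fun_pow 2).fun_mul hc
  have h4 := (hx 0).fun_mul (hc.fun_pow 2)
  refine h2.unique (hasDerivAt_pi.2 fun i => ?_)
  fin_cases i
  · refine ((him (hx 1)).fun_sub (hre ((hx 0).fun_mul hc))).congr_deriv ?_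
    simp
  · refine ((him (hx 2)).fun_sub (hre (h3.fun_add h4))).congr_deriv ?_
    simp
    ring
  · refine ((him (hx 3)).fun_sub (hre ((h3.fun_sub h4).const_mul (-Complex.I)))).congr_deriv ?_
    simp
    try ring

theorem tangentToCubic_iff (V : C4 → C4) (x : C4) : TangentToCubic V x ↔
    (V x 1).im = (V x 0 * conj (x 0) + x 0 * conj (V x 0)).re ∧
    (V x 2).im = (2 * x 0 * V x 0 * conj (x 0) + x 0 ^ 2 * conj (V x 0) + V x 0 * conj (x 0) ^ 2 +
        x 0 * (2 * conj (x 0) * conj (V x 0))).re ∧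
    (V x 3).im = (-Complex.I * (2 * x 0 * V x 0 * conj (x 0) + x 0 ^ 2 * conj (V x 0) -
        (V x 0 * conj (x 0) ^ 2 + x 0 * (2 * conj (x 0) * conj (V x 0))))).re := by
  rw [TangentToCubic, fderiv_cubicEquations]
  simp only [funext_iff, Fin.forall_fin_succ, Matrix.cons_val_zero, Matrix.cons_val_succ,
    Pi.zero_apply, sub_eq_zero, IsEmpty.forall_iff, and_true]

theorem mem_cubic_iff_im (x : C4) : x ∈ cubic ↔ (x 1).im = (x 0 * conj (x 0)).re ∧
    (x 2).im = (x 0 ^ 2 * conj (x 0) + x 0 * conj (x 0) ^ 2).re ∧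
    (x 3).im = (-Complex.I * (x 0 ^ 2 * conj (x 0) - x 0 * conj (x 0) ^ 2)).re := by
  change cubicEquations x = 0 ↔ _
  simp only [cubicEquations, funext_iff, Fin.forall_fin_succ, Matrix.cons_val_zero,
    Matrix.cons_val_succ, Pi.zero_apply, sub_eq_zero, IsEmpty.forall_iff, and_true]

theorem infField_tangent (l s : ℂ) (r : ℝ) (c : ℂ) {x : C4} (hx : x ∈ cubic) :
    TangentToCubic (infField l s r c) x := by
  obtain ⟨h1, h2, h3⟩ := (mem_cubic_iff_im x).1 hx
  rw [tangentToCubic_iff]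
  simp only [infField, Matrix.cons_val]
  simp [pow_two] at h1 h2 h3 ⊢
  refine ⟨?_, ?_, ?_⟩
  · linear_combination 2 * l.re * h1
  · rw [h1, h2, h3]; ring
  · rw [h1, h2, h3]; ring

/-- The vector field of an element of `𝔤⁷`. -/
noncomputable def autMap : g7 →ₗ[ℝ] (C4 → C4) :=
  ({ toFun := fun q => infField q.1 q.2.1 q.2.2.1 q.2.2.2
     map_add' := fun q q' => by
      ext1 x
      refine vec4_ext ?_ ?_ ?_ ?_ <;> simp [infField] <;> ring
     map_smul' := fun t q => by
      ext1 x
      refine vec4_ext ?_ ?_ ?_ ?_ <;> simp [infField] <;> ring } :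
    (ℂ × ℂ × ℝ × ℂ) →ₗ[ℝ] (C4 → C4)) ∘ₗ g7Equiv.symm.toLinearMap

theorem autMap_gElem (l s : ℂ) (r : ℝ) (c : ℂ) : autMap (gElem l s r c) = infField l s r c := by
  have h : g7Equiv.symm (gElem l s r c) = (l, s, r, c) := by
    rw [LinearEquiv.symm_apply_eq]; rfl
  simp only [autMap, LinearMap.comp_apply, LinearEquiv.coe_coe, h]
  rfl

theorem autMap_injective : Function.Injective autMap := by
  refine (injective_iff_map_eq_zero _).2 fun y hy => ?_
  obtain ⟨l, s, r, c, rfl⟩ := gElem_surjective y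
  rw [autMap_gElem] at hy
  have e1 := congrFun (congrFun hy 0) 0
  have e2 := congrFun (congrFun hy ![1, 0, 0, 0]) 0
  have e3 := congrFun (congrFun hy 0) 1
  have e4 := congrFun (congrFun hy 0) 2
  have e5 := congrFun (congrFun hy 0) 3
  simp [infField] at e1 e2 e3
  subst e1
  simp at e2
  subst e2 e3
  simp [infField] at e4 e5
  have hs : s = 0 := by linear_combination (-Complex.I / 4) * (e4 + e5) + s * Complex.I_sq
  rw [hs, gElem_zero]

theorem autMap_lie (y y' : g7) :
    autMap ⁅y, y'⁆ = VectorField.lieBracket ℂ (autMap y) (autMap y') := by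
  obtain ⟨l, s, r, c, rfl⟩ := gElem_surjective y
  obtain ⟨l', s', r', c', rfl⟩ := gElem_surjective y'
  rw [lie_gElem, autMap_gElem, autMap_gElem, autMap_gElem, infField_lie]

end InfinitesimalAutomorphisms

/-! ### The CR frame of the cubic and its commutation relations as operators -/

section CubicFields

/-- The derivative of a function along a complex vector field. -/
noncomputable def der (X : R5 → C5) (f : R5 → ℂ) (q : R5) : ℂ := cD f q (X q)

theorem der_congr {B : Set R5} (hB : IsOpen B) {f g : R5 → ℂ} (h : Set.EqOn f g B) (X : R5 → C5) :
    Set.EqOn (der X f) (der X g) B := fun q hq => by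
  rw [der, der, cD_congr (h.eventuallyEq_of_mem (hB.mem_nhds hq))]

theorem contDiffOn_der {B : Set R5} (hB : IsOpen B) {f : R5 → ℂ} {X : R5 → C5}
    (hf : ContDiffOn ℝ ∞ f B) (hX : ContDiff ℝ ∞ X) : ContDiffOn ℝ ∞ (der X f) B := fun q hq =>
  (contDiffAt_cD (n := ∞) (by simpa using hf.contDiffAt (hB.mem_nhds hq))
    hX.contDiffAt).contDiffWithinAt

theorem der_conj (X : R5 → C5) (f : R5 → ℂ) (q : R5) :
    der X (fun q => conj (f q)) q = conj (der (conjField X) f q) := cD_conj _ _ _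

theorem conjField_conjField (X : R5 → C5) : conjField (conjField X) = X := by
  ext q; simp [conjField]

/-- The coordinate `z` as a function of the real parameters of the cubic. -/
noncomputable def zCoord : R5 →L[ℝ] ℂ :=
  Complex.ofRealCLM.comp (ContinuousLinearMap.proj 0) +
    Complex.I • Complex.ofRealCLM.comp (ContinuousLinearMap.proj 1)

noncomputable def zBarCoord : R5 →L[ℝ] ℂ :=
  Complex.ofRealCLM.comp (ContinuousLinearMap.proj 0) -
    Complex.I • Complex.ofRealCLM.comp (ContinuousLinearMap.proj 1)

theorem conj_zCoord (p : R5) : conj (zCoord p) = zBarCoord p := by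
  simp [zCoord, zBarCoord, sub_eq_add_neg]

theorem conj_zBarCoord (p : R5) : conj (zBarCoord p) = zCoord p := by
  simp [zCoord, zBarCoord]

theorem cD_clm {F : Type*} [NormedAddCommGroup F] [NormedSpace ℝ F] [NormedSpace ℂ F]
    [IsScalarTower ℝ ℂ F] (A : R5 →L[ℝ] F) (p : R5) (X : C5) :
    cD (fun q => A q) p X = ∑ j, X j • A (Pi.single j 1) := by
  rw [cD_apply, A.fderiv]

theorem cD_zCoord (p : R5) (X : C5) : cD (fun q => zCoord q) p X = X 0 + Complex.I * X 1 := by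
  rw [cD_clm, Fin.sum_univ_five]
  simp [zCoord, mul_comm]

theorem cD_zBarCoord (p : R5) (X : C5) :
    cD (fun q => zBarCoord q) p X = X 0 - Complex.I * X 1 := by
  rw [cD_clm, Fin.sum_univ_five]
  simp [zBarCoord, mul_comm, sub_eq_add_neg]

/-- The vector field `ℒ` of the cubic, in the parametrization `cubicParam`. -/
noncomputable def cubicL (p : R5) : C5 :=
  ![1 / 2, -Complex.I / 2, Complex.I * zBarCoord p,
    Complex.I * (2 * zCoord p * zBarCoord p + zBarCoord p * zBarCoord p),
    2 * zCoord p * zBarCoord p - zBarCoord p * zBarCoord p]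

noncomputable def cubicT (p : R5) : C5 :=
  ![0, 0, 2, 4 * (zCoord p + zBarCoord p), -4 * Complex.I * (zCoord p - zBarCoord p)]

noncomputable def cubicS (_ : R5) : C5 := ![0, 0, 0, 4, -4 * Complex.I]

theorem conjField_cubicL (p : R5) : conjField cubicL p =
    ![1 / 2, Complex.I / 2, -Complex.I * zCoord p,
      -Complex.I * (2 * zCoord p * zBarCoord p + zCoord p * zCoord p),
      2 * zCoord p * zBarCoord p - zCoord p * zCoord p] := by
  ext i
  fin_cases i <;> simp [conjField, cubicL, conj_zCoord, conj_zBarCoord] <;> ring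

theorem conjField_cubicT : conjField cubicT = cubicT := by
  ext p i
  fin_cases i <;> simp [conjField, cubicT, conj_zCoord, conj_zBarCoord] <;> ring

theorem conjField_cubicS (p : R5) : conjField cubicS p = ![0, 0, 0, 4, 4 * Complex.I] := by
  ext i
  fin_cases i <;> simp [conjField, cubicS]

theorem contDiff_cubicL : ContDiff ℝ ∞ cubicL := by
  refine contDiff_pi.2 fun i => ?_
  fin_cases i <;> simp [cubicL] <;> fun_prop

theorem contDiff_cubicT : ContDiff ℝ ∞ cubicT := by
  refine contDiff_pi.2 fun i => ?_
  fin_cases i <;> simp [cubicT] <;> fun_prop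

theorem contDiff_cubicS : ContDiff ℝ ∞ cubicS := contDiff_const

theorem contDiff_conjField {X : R5 → C5} {n : ℕ∞ω} (hX : ContDiff ℝ n X) :
    ContDiff ℝ n (conjField X) := by
  rw [contDiff_pi] at hX ⊢
  exact fun i => Complex.conjCLE.contDiff.comp (hX i)

theorem cD_cubicL (p : R5) (X : C5) : cD cubicL p X =
    ![0, 0, Complex.I * (X 0 - Complex.I * X 1),
      Complex.I * (2 * (X 0 + Complex.I * X 1) * zBarCoord p +
        2 * zCoord p * (X 0 - Complex.I * X 1) + 2 * zBarCoord p * (X 0 - Complex.I * X 1)),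
      2 * (X 0 + Complex.I * X 1) * zBarCoord p +
        2 * zCoord p * (X 0 - Complex.I * X 1) - 2 * zBarCoord p * (X 0 - Complex.I * X 1)] := by
  have hz : DifferentiableAt ℝ (fun q => zCoord q) p := zCoord.differentiableAt
  have hb : DifferentiableAt ℝ (fun q => zBarCoord q) p := zBarCoord.differentiableAt
  have hc : ∀ c : ℂ, DifferentiableAt ℝ (fun _ : R5 => c) p := fun c => differentiableAt_const c
  ext i
  rw [cD_pi (contDiff_cubicL.differentiable (by simp) p)]
  fin_cases i
  · simp [cubicL, cD_const]
  · simp [cubicL, cD_const]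
  · simp [cubicL, cD_mul (hc _) hb, cD_const, cD_zBarCoord]
  · simp only [cubicL, Matrix.cons_val, Fin.reduceFinMk]
    rw [cD_mul (hc _) (((hc _).fun_mul hz).fun_mul hb |>.fun_add (hb.fun_mul hb)),
      cD_add (((hc _).fun_mul hz).fun_mul hb) (hb.fun_mul hb), LinearMap.add_apply,
      cD_mul ((hc _).fun_mul hz) hb, cD_mul (hc _) hz, cD_mul hb hb, cD_zCoord, cD_zBarCoord,
      cD_const, cD_const]
    simp; ring
  · simp only [cubicL, Matrix.cons_val, Fin.reduceFinMk]
    rw [cD_sub (((hc _).fun_mul hz).fun_mul hb) (hb.fun_mul hb), LinearMap.sub_apply,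
      cD_mul ((hc _).fun_mul hz) hb, cD_mul (hc _) hz, cD_mul hb hb, cD_zCoord, cD_zBarCoord,
      cD_const]
    simp; ring

theorem cD_cubicT (p : R5) (X : C5) : cD cubicT p X =
    ![0, 0, 0, 8 * X 0, 8 * X 1] := by
  have hz : DifferentiableAt ℝ (fun q => zCoord q) p := zCoord.differentiableAt
  have hb : DifferentiableAt ℝ (fun q => zBarCoord q) p := zBarCoord.differentiableAt
  have hc : ∀ c : ℂ, DifferentiableAt ℝ (fun _ : R5 => c) p := fun c => differentiableAt_const c
  ext i
  rw [cD_pi (contDiff_cubicT.differentiable (by simp) p)]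
  fin_cases i
  · simp [cubicT, cD_const]
  · simp [cubicT, cD_const]
  · simp [cubicT, cD_const]
  · simp only [cubicT, Matrix.cons_val, Fin.reduceFinMk]
    rw [cD_mul (hc _) (hz.fun_add hb), cD_add hz hb, LinearMap.add_apply, cD_zCoord, cD_zBarCoord,
      cD_const]
    simp; ring
  · simp only [cubicT, Matrix.cons_val, Fin.reduceFinMk]
    rw [cD_mul (hc _) (hz.fun_sub hb), cD_sub hz hb, LinearMap.sub_apply, cD_zCoord, cD_zBarCoord,
      cD_const]
    simp; ring_nf; simp

theorem cD_conjField_cubicL (p : R5) (X : C5) :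
    cD (conjField cubicL) p X = star (cD cubicL p (star X)) :=
  cD_star (contDiff_cubicL.differentiable (by simp) p) X

theorem bracket_cubicL_conj (p : R5) :
    bracket cubicL (conjField cubicL) p = -Complex.I • cubicT p := by
  simp only [bracket, complexDeriv_eq, cD_conjField_cubicL, cD_cubicL, conjField_cubicL]
  ext i
  fin_cases i <;> simp [cubicL, cubicT, conj_zCoord, conj_zBarCoord] <;> ring_nf <;> simp <;> ring

theorem bracket_cubicL_cubicT (p : R5) : bracket cubicL cubicT p = cubicS p := by
  simp only [bracket, complexDeriv_eq, cD_cubicL, cD_cubicT]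
  ext i
  fin_cases i <;> simp [cubicL, cubicT, cubicS] <;> ring_nf

theorem bracket_cubicL_cubicS (p : R5) : bracket cubicL cubicS p = 0 := by
  have h : cD cubicS p = 0 := cD_const _ _
  simp only [bracket, complexDeriv_eq, cD_cubicL, h]
  ext i
  fin_cases i <;> simp [cubicS]

theorem bracket_cubicL_conjS (p : R5) : bracket cubicL (conjField cubicS) p = 0 := by
  have h : cD (conjField cubicS) p = 0 := cD_const (star (cubicS p)) p
  simp only [bracket, complexDeriv_eq, cD_cubicL, h]
  ext i
  fin_cases i <;> simp [cubicS, conjField]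

section Operators

variable {B : Set R5} {f : R5 → ℂ} {q : R5}

theorem der_bracket (hB : IsOpen B) (hf : ContDiffOn ℝ ∞ f B) (hq : q ∈ B) {X Y : R5 → C5}
    (hX : ContDiff ℝ ∞ X) (hY : ContDiff ℝ ∞ Y) :
    cD f q (bracket X Y q) = der X (der Y f) q - der Y (der X f) q :=
  cD_bracket ((hf.contDiffAt (hB.mem_nhds hq)).of_le ENat.LEInfty.out)
    (hX.differentiable (by simp) q) (hY.differentiable (by simp) q)

theorem der_cubicT (hB : IsOpen B) (hf : ContDiffOn ℝ ∞ f B) (hq : q ∈ B) :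
    der cubicT f q = Complex.I * (der cubicL (der (conjField cubicL) f) q -
      der (conjField cubicL) (der cubicL f) q) := by
  rw [← der_bracket hB hf hq contDiff_cubicL (contDiff_conjField contDiff_cubicL),
    bracket_cubicL_conj, map_smul, smul_eq_mul, ← mul_assoc]
  simp [der]

theorem der_cubicS (hB : IsOpen B) (hf : ContDiffOn ℝ ∞ f B) (hq : q ∈ B) :
    der cubicS f q = der cubicL (der cubicT f) q - der cubicT (der cubicL f) q := by
  rw [← der_bracket hB hf hq contDiff_cubicL contDiff_cubicT, bracket_cubicL_cubicT]; rfl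

theorem der_conjS (hB : IsOpen B) (hf : ContDiffOn ℝ ∞ f B) (hq : q ∈ B) :
    der (conjField cubicS) f q = der (conjField cubicL) (der cubicT f) q -
      der cubicT (der (conjField cubicL) f) q := by
  rw [← der_bracket hB hf hq (contDiff_conjField contDiff_cubicL) contDiff_cubicT]
  have h := bracket_conj (contDiff_cubicL.differentiable (by simp) q)
    (contDiff_cubicT.differentiable (by simp) q)
  rw [conjField_cubicT, bracket_cubicL_cubicT] at h
  rw [h]; rfl

theorem der_cubicL_cubicS (hB : IsOpen B) (hf : ContDiffOn ℝ ∞ f B) (hq : q ∈ B) :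
    der cubicL (der cubicS f) q = der cubicS (der cubicL f) q := by
  have h := der_bracket hB hf hq contDiff_cubicL contDiff_cubicS
  rw [bracket_cubicL_cubicS, map_zero] at h
  exact (sub_eq_zero.1 h.symm)

theorem der_cubicL_conjS (hB : IsOpen B) (hf : ContDiffOn ℝ ∞ f B) (hq : q ∈ B) :
    der cubicL (der (conjField cubicS) f) q = der (conjField cubicS) (der cubicL f) q := by
  have h := der_bracket hB hf hq contDiff_cubicL (contDiff_conjField contDiff_cubicS)
  rw [bracket_cubicL_conjS, map_zero] at h
  exact (sub_eq_zero.1 h.symm)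

theorem der_conjL_cubicS (hB : IsOpen B) (hf : ContDiffOn ℝ ∞ f B) (hq : q ∈ B) :
    der (conjField cubicL) (der cubicS f) q = der cubicS (der (conjField cubicL) f) q := by
  have h := der_bracket hB hf hq (contDiff_conjField contDiff_cubicL) contDiff_cubicS
  have h2 := bracket_conj (contDiff_cubicL.differentiable (by simp) q)
    ((contDiff_conjField contDiff_cubicS).differentiable (by simp) q)
  rw [conjField_conjField, bracket_cubicL_conjS, star_zero] at h2
  rw [h2, map_zero] at h
  exact (sub_eq_zero.1 h.symm)

theorem der_zero (X : R5 → C5) (q : R5) : der X (fun _ => 0) q = 0 := by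
  simp [der, cD_const]

theorem der_eq_zero_of_eqOn (hB : IsOpen B) (h : ∀ q ∈ B, f q = 0) (X : R5 → C5) (hq : q ∈ B) :
    der X f q = 0 :=
  (der_congr hB (g := fun _ => 0) h X hq).trans (der_zero X q)

/-- The fields `ℒ` and `ℒ̄` generate all directions by brackets. A function killed by both is killed
by `𝒯`, hence by `𝒮` and `𝒮̄`; these five fields span, so all the partial derivatives vanish. -/
theorem eqOn_const_of_der_eq_zero (hB : IsOpen B) (hBc : Convex ℝ B) (hf : ContDiffOn ℝ ∞ f B)
    (h1 : ∀ q ∈ B, der cubicL f q = 0) (h2 : ∀ q ∈ B, der (conjField cubicL) f q = 0)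
    {p : R5} (hp : p ∈ B) (hq : q ∈ B) : f q = f p := by
  have hT : ∀ q ∈ B, der cubicT f q = 0 := fun q hq => by
    rw [der_cubicT hB hf hq, der_eq_zero_of_eqOn hB h2 _ hq, der_eq_zero_of_eqOn hB h1 _ hq]; simp
  have hS : ∀ q ∈ B, der cubicS f q = 0 := fun q hq => by
    rw [der_cubicS hB hf hq, der_eq_zero_of_eqOn hB hT _ hq, der_eq_zero_of_eqOn hB h1 _ hq]; simp
  have hS' : ∀ q ∈ B, der (conjField cubicS) f q = 0 := fun q hq => by
    rw [der_conjS hB hf hq, der_eq_zero_of_eqOn hB hT _ hq, der_eq_zero_of_eqOn hB h2 _ hq]; simp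
  have hd : DifferentiableOn ℝ f B := hf.differentiableOn (by simp)
  refine hBc.is_const_of_fderivWithin_eq_zero hd (fun q hq => ?_) hq hp
  rw [fderivWithin_of_isOpen hB hq]
  have e1 := h1 q hq
  have e2 := h2 q hq
  have e3 := hT q hq
  have e4 := hS q hq
  have e5 := hS' q hq
  rw [der, conjField_cubicL] at e2
  rw [der, conjField_cubicS] at e5
  simp only [der, cD_apply, Fin.sum_univ_five, cubicL, cubicT, cubicS, Matrix.cons_val,
    smul_eq_mul] at e1 e2 e3 e4 e5
  set d : Fin 5 → ℂ := fun j => fderiv ℝ f q (Pi.single j 1) with hdd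
  have d3 : d 3 = 0 := by simp only [hdd]; linear_combination (1 / 8 : ℂ) * (e4 + e5)
  have d4 : d 4 = 0 := by
    simp only [hdd]
    linear_combination (Complex.I / 8) * (e4 - e5) + fderiv ℝ f q (Pi.single 4 1) * Complex.I_sq
  have d2 : d 2 = 0 := by
    simp only [hdd] at d3 d4 ⊢
    rw [d3, d4] at e3
    linear_combination (1 / 2 : ℂ) * e3
  simp only [hdd] at d2 d3 d4
  rw [d2, d3, d4] at e1 e2
  have d0 : d 0 = 0 := by simp only [hdd]; linear_combination e1 + e2
  have d1 : d 1 = 0 := by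
    simp only [hdd]
    linear_combination Complex.I * (e1 - e2) + fderiv ℝ f q (Pi.single 1 1) * Complex.I_sq
  refine ContinuousLinearMap.ext fun v => ?_
  rw [← clm_toC5, Fin.sum_univ_five]
  simp only [hdd] at d0 d1
  simp [d0, d1, d2, d3, d4]

end Operators

end CubicFields

/-! ### Rigidity of the holomorphic fields tangent to the cubic -/

section CubicRigidity

theorem cD_holomorphic_comp {E F : Type*} [NormedAddCommGroup E] [NormedSpace ℝ E]
    [NormedSpace ℂ E] [IsScalarTower ℝ ℂ E] [NormedAddCommGroup F] [NormedSpace ℝ F]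
    [NormedSpace ℂ F] [IsScalarTower ℝ ℂ F] {f : R5 → E} {H : E → F} {p : R5}
    (hf : DifferentiableAt ℝ f p) (hH : DifferentiableAt ℂ H (f p)) (X : C5) :
    cD (fun q => H (f q)) p X = fderiv ℂ H (f p) (cD f p X) := by
  simp only [cD_apply, map_sum, map_smul]
  refine Finset.sum_congr rfl fun j _ => ?_
  have h2 : fderiv ℝ (fun q => H (f q)) p = _ :=
    ((hH.hasFDerivAt.restrictScalars ℝ).comp p hf.hasFDerivAt).fderiv
  rw [h2]; rfl

/-- Put `κ = ℒα` and `μ = 2κ + κ̄`. The commutators give successively `𝒯β = α`, `𝒯τ = κ + κ̄`, `𝒮β =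
μ` and `𝒮̄β = 0`. Since `𝒮` commutes with `ℒ̄`, `ℒ̄μ = 𝒮ℒ̄β = 0`. Since `𝒮̄` commutes with `ℒ`, `𝒮̄τ
= 0`, so `𝒮τ = 0` because `τ` is real, and then `ℒμ = 𝒮ℒβ = 0`. The two equations for `μ` form an
invertible linear system for `ℒκ` and the conjugate of `ℒ̄κ`, so `κ` is constant. With zero initial
values, `κ`, `α`, `τ`, `β` vanish one after the other. -/
theorem cubic_rigidity {B : Set R5} (hB : IsOpen B) (hBc : Convex ℝ B) {α τ β : R5 → ℂ}
    (hα : ContDiffOn ℝ ∞ α B) (hτ : ContDiffOn ℝ ∞ τ B) (hβ : ContDiffOn ℝ ∞ β B)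
    (hαL : ∀ q ∈ B, der (conjField cubicL) α q = 0) (hτr : ∀ q ∈ B, conj (τ q) = τ q)
    (hτL : ∀ q ∈ B, der (conjField cubicL) τ q = -Complex.I * α q)
    (hβL : ∀ q ∈ B, der cubicL β q = -τ q) (hβL' : ∀ q ∈ B, der (conjField cubicL) β q = 0)
    {p : R5} (hp : p ∈ B) (hα0 : α p = 0) (hτ0 : τ p = 0) (hβ0 : β p = 0)
    (hκ0 : der cubicL α p = 0) {q : R5} (hq : q ∈ B) : α q = 0 ∧ τ q = 0 ∧ β q = 0 := by
  set κ : R5 → ℂ := der cubicL α with hκ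
  have hκs : ContDiffOn ℝ ∞ κ B := contDiffOn_der hB hα contDiff_cubicL
  have sm : ∀ {f : R5 → ℂ}, ContDiffOn ℝ ∞ f B → ∀ {q}, q ∈ B → DifferentiableAt ℝ f q :=
    fun hf q hq => (hf.contDiffAt (hB.mem_nhds hq)).differentiableAt (by simp)
  have hconj : ∀ {f : R5 → ℂ}, ContDiffOn ℝ ∞ f B → ContDiffOn ℝ ∞ (fun q => conj (f q)) B :=
    fun hf => Complex.conjCLE.contDiff.comp_contDiffOn hf
  have hcs : ∀ c : ℂ, DifferentiableAt ℝ (fun _ : R5 => c) q := fun c => differentiableAt_const c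
  have der_cm : ∀ (X : R5 → C5) (c : ℂ) {f : R5 → ℂ}, ContDiffOn ℝ ∞ f B → ∀ q ∈ B,
      der X (fun q => c * f q) q = c * der X f q := fun X c f hf q hq => by
    rw [der, cD_mul (differentiableAt_const c) (sm hf hq), cD_const]; simp [der]
  have der_ad : ∀ (X : R5 → C5) {f g : R5 → ℂ}, ContDiffOn ℝ ∞ f B → ContDiffOn ℝ ∞ g B →
      ∀ q ∈ B, der X (fun q => f q + g q) q = der X f q + der X g q := fun X f g hf hg q hq => by
    rw [der, cD_add (sm hf hq) (sm hg hq)]; rfl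
  have der_ng : ∀ (X : R5 → C5) (f : R5 → ℂ) (q), der X (fun q => - f q) q = - der X f q :=
    fun X f q => by rw [der, cD_neg]; rfl
  have hτc : Set.EqOn (fun q => conj (τ q)) τ B := hτr
  have hτL2 : ∀ q ∈ B, der cubicL τ q = Complex.I * conj (α q) := fun q hq => by
    rw [← der_congr hB hτc cubicL hq, der_conj, hτL q hq]; simp
  have hTβ : ∀ q ∈ B, der cubicT β q = α q := fun q hq => by
    rw [der_cubicT hB hβ hq, der_eq_zero_of_eqOn hB hβL' _ hq,
      der_congr hB (g := fun q => - τ q) hβL _ hq, der_ng, hτL q hq]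
    linear_combination -α q * Complex.I_sq
  have hαLc : ∀ q ∈ B, der (conjField cubicL) (fun q => conj (α q)) q = conj (κ q) :=
    fun q hq => by rw [der_conj, conjField_conjField]
  have hTτ : ∀ q ∈ B, der cubicT τ q = κ q + conj (κ q) := fun q hq => by
    rw [der_cubicT hB hτ hq, der_congr hB (g := fun q => -Complex.I * α q) hτL _ hq,
      der_congr hB (g := fun q => Complex.I * conj (α q)) hτL2 _ hq, der_cm _ _ hα q hq,
      der_cm _ _ (hconj hα) q hq, hαLc q hq]
    linear_combination (-κ q - conj (κ q)) * Complex.I_sq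
  set μ : R5 → ℂ := fun q => 2 * κ q + conj (κ q) with hμ
  have hSβ : ∀ q ∈ B, der cubicS β q = μ q := fun q hq => by
    rw [der_cubicS hB hβ hq, der_congr hB (g := α) hTβ _ hq,
      der_congr hB (g := fun q => - τ q) hβL _ hq, der_ng, hTτ q hq, hμ]
    ring
  have hS'β : ∀ q ∈ B, der (conjField cubicS) β q = 0 := fun q hq => by
    rw [der_conjS hB hβ hq, der_congr hB (g := α) hTβ _ hq, hαL q hq,
      der_eq_zero_of_eqOn hB hβL' _ hq, sub_zero]
  have hLμ' : ∀ q ∈ B, der (conjField cubicL) μ q = 0 := fun q hq => by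
    rw [← der_congr hB (f := der cubicS β) (g := μ) hSβ _ hq, der_conjL_cubicS hB hβ hq,
      der_eq_zero_of_eqOn hB hβL' _ hq]
  have hS'τ : ∀ q ∈ B, der (conjField cubicS) τ q = 0 := fun q hq => by
    have h := der_cubicL_conjS hB hβ hq
    rw [der_eq_zero_of_eqOn hB hS'β _ hq, der_congr hB (g := fun q => - τ q) hβL _ hq, der_ng] at h
    simpa using h.symm
  have hSτ : ∀ q ∈ B, der cubicS τ q = 0 := fun q hq => by
    rw [← der_congr hB hτc _ hq, der_conj, hS'τ q hq, map_zero]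
  have hLμ : ∀ q ∈ B, der cubicL μ q = 0 := fun q hq => by
    rw [← der_congr hB (f := der cubicS β) (g := μ) hSβ _ hq, der_cubicL_cubicS hB hβ hq,
      der_congr hB (g := fun q => - τ q) hβL _ hq, der_ng, hSτ q hq, neg_zero]
  have hκc := hconj hκs
  have h2κ : ContDiffOn ℝ ∞ (fun q => 2 * κ q) B := contDiffOn_const.mul hκs
  have h1 : ∀ q ∈ B, 2 * der cubicL κ q + conj (der (conjField cubicL) κ q) = 0 := fun q hq => by
    have h := hLμ q hq
    rw [hμ, der_ad _ h2κ hκc q hq, der_cm _ _ hκs q hq, der_conj] at h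
    exact h
  have h2 : ∀ q ∈ B, 2 * der (conjField cubicL) κ q + conj (der cubicL κ q) = 0 := fun q hq => by
    have h := hLμ' q hq
    rw [hμ, der_ad _ h2κ hκc q hq, der_cm _ _ hκs q hq, der_conj, conjField_conjField] at h
    exact h
  have h2' : ∀ q ∈ B, 2 * conj (der (conjField cubicL) κ q) + der cubicL κ q = 0 := fun q hq => by
    have h := congrArg conj (h2 q hq)
    rwa [map_add, map_mul, Complex.conj_conj, map_zero, map_ofNat] at h
  have k1 : ∀ q ∈ B, der cubicL κ q = 0 := fun q hq => by
    linear_combination (2 / 3 : ℂ) * h1 q hq - (1 / 3 : ℂ) * h2' q hq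
  have k2 : ∀ q ∈ B, der (conjField cubicL) κ q = 0 := fun q hq => by
    have h := h2 q hq
    rw [k1 q hq, map_zero] at h
    simpa using h
  have kz : ∀ q ∈ B, κ q = 0 := fun q hq =>
    (eqOn_const_of_der_eq_zero hB hBc hκs k1 k2 hp hq).trans hκ0
  have az : ∀ q ∈ B, α q = 0 := fun q hq =>
    (eqOn_const_of_der_eq_zero hB hBc hα kz hαL hp hq).trans hα0
  have tz : ∀ q ∈ B, τ q = 0 := fun q hq =>
    (eqOn_const_of_der_eq_zero hB hBc hτ (fun q hq => by rw [hτL2 q hq, az q hq]; simp)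
      (fun q hq => by rw [hτL q hq, az q hq]; simp) hp hq).trans hτ0
  exact ⟨az q hq, tz q hq, (eqOn_const_of_der_eq_zero hB hBc hβ
    (fun q hq => by rw [hβL q hq, tz q hq]; simp) hβL' hp hq).trans hβ0⟩

/-- The parametrization of the cubic by `(x, y, u₁, u₂, u₃)`. -/
noncomputable def cubicParam (p : R5) : C4 :=
  ![zCoord p, (p 2 : ℂ) + Complex.I * (zCoord p * zBarCoord p),
    (p 3 : ℂ) + Complex.I * (zCoord p * zCoord p * zBarCoord p +
      zCoord p * (zBarCoord p * zBarCoord p)),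
    (p 4 : ℂ) + (zCoord p * zCoord p * zBarCoord p - zCoord p * (zBarCoord p * zBarCoord p))]

theorem contDiff_cubicParam : ContDiff ℝ ∞ cubicParam := by
  have h : ∀ j : Fin 5, ContDiff ℝ ∞ fun p : R5 => (p j : ℂ) := fun j =>
    Complex.ofRealCLM.contDiff.comp (contDiff_apply ℝ ℝ j)
  refine contDiff_pi.2 fun i => ?_
  fin_cases i
  · exact zCoord.contDiff
  · simp only [cubicParam, Matrix.cons_val, Fin.reduceFinMk]
    exact (h 2).add (contDiff_const.mul (zCoord.contDiff.mul zBarCoord.contDiff))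
  · simp only [cubicParam, Matrix.cons_val, Fin.reduceFinMk]
    exact (h 3).add (contDiff_const.mul (((zCoord.contDiff.mul zCoord.contDiff).mul
      zBarCoord.contDiff).add (zCoord.contDiff.mul (zBarCoord.contDiff.mul zBarCoord.contDiff))))
  · simp only [cubicParam, Matrix.cons_val, Fin.reduceFinMk]
    exact (h 4).add (((zCoord.contDiff.mul zCoord.contDiff).mul
      zBarCoord.contDiff).sub (zCoord.contDiff.mul (zBarCoord.contDiff.mul zBarCoord.contDiff)))

theorem cubicParam_mem (p : R5) : cubicParam p ∈ cubic := by
  rw [mem_cubic_iff_im]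
  simp [cubicParam, zCoord, zBarCoord, pow_two]

theorem exists_cubicParam {x : C4} (hx : x ∈ cubic) : ∃ p, cubicParam p = x := by
  obtain ⟨h1, h2, h3⟩ := (mem_cubic_iff_im x).1 hx
  refine ⟨![(x 0).re, (x 0).im, (x 1).re, (x 2).re, (x 3).re], ?_⟩
  have hz : zCoord ![(x 0).re, (x 0).im, (x 1).re, (x 2).re, (x 3).re] = x 0 := by
    apply Complex.ext <;> simp [zCoord]
  have hb : zBarCoord ![(x 0).re, (x 0).im, (x 1).re, (x 2).re, (x 3).re] = conj (x 0) := by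
    rw [← conj_zCoord, hz]
  refine vec4_ext ?_ ?_ ?_ ?_ <;> simp only [cubicParam, hz, hb, Matrix.cons_val]
  · apply Complex.ext
    · simp; ring
    · rw [h1]; simp
  · apply Complex.ext
    · simp [pow_two]; ring
    · rw [h2]; simp [pow_two]
  · apply Complex.ext
    · simp [pow_two]; ring
    · rw [h3]; simp [pow_two]

theorem cD_cubicParam (p : R5) (X : C5) : cD cubicParam p X =
    ![X 0 + Complex.I * X 1,
      X 2 + Complex.I * ((X 0 + Complex.I * X 1) * zBarCoord p +
        zCoord p * (X 0 - Complex.I * X 1)),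
      X 3 + Complex.I * (2 * zCoord p * zBarCoord p * (X 0 + Complex.I * X 1) +
        zCoord p ^ 2 * (X 0 - Complex.I * X 1) + (X 0 + Complex.I * X 1) * zBarCoord p ^ 2 +
        2 * zCoord p * zBarCoord p * (X 0 - Complex.I * X 1)),
      X 4 + (2 * zCoord p * zBarCoord p * (X 0 + Complex.I * X 1) +
        zCoord p ^ 2 * (X 0 - Complex.I * X 1) - ((X 0 + Complex.I * X 1) * zBarCoord p ^ 2 +
        2 * zCoord p * zBarCoord p * (X 0 - Complex.I * X 1)))] := by
  have hz : DifferentiableAt ℝ (fun q => zCoord q) p := zCoord.differentiableAt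
  have hb : DifferentiableAt ℝ (fun q => zBarCoord q) p := zBarCoord.differentiableAt
  have hI : DifferentiableAt ℝ (fun _ : R5 => Complex.I) p := differentiableAt_const _
  have hu : ∀ j : Fin 5, DifferentiableAt ℝ (fun q : R5 => (q j : ℂ)) p := fun j =>
    (Complex.ofRealCLM.comp (ContinuousLinearMap.proj j : R5 →L[ℝ] ℝ)).differentiableAt
  have hu' : ∀ j : Fin 5, cD (fun q : R5 => (q j : ℂ)) p X = X j := fun j => by
    have := cD_clm (Complex.ofRealCLM.comp (ContinuousLinearMap.proj j : R5 →L[ℝ] ℝ)) p X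
    refine this.trans ?_
    rw [Finset.sum_eq_single j]
    · simp
    · intro k _ hk
      simp [Pi.single_apply, hk.symm]
    · simp
  have h2 := (hz.fun_mul hz).fun_mul hb
  have h3 := hz.fun_mul (hb.fun_mul hb)
  ext i
  rw [cD_pi (contDiff_cubicParam.differentiable (by simp) p)]
  fin_cases i
  · exact cD_zCoord p X
  · simp only [cubicParam, Matrix.cons_val, Fin.reduceFinMk]
    rw [cD_add (hu 2) (hI.fun_mul (hz.fun_mul hb)), LinearMap.add_apply, cD_mul hI (hz.fun_mul hb),
      cD_mul hz hb, cD_const, hu', cD_zCoord, cD_zBarCoord]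
    simp; ring
  · simp only [cubicParam, Matrix.cons_val, Fin.reduceFinMk]
    rw [cD_add (hu 3) (hI.fun_mul (h2.fun_add h3)), LinearMap.add_apply, cD_mul hI (h2.fun_add h3),
      cD_add h2 h3, LinearMap.add_apply, cD_mul (hz.fun_mul hz) hb, cD_mul hz hz,
      cD_mul hz (hb.fun_mul hb), cD_mul hb hb, cD_const, hu', cD_zCoord, cD_zBarCoord]
    simp; ring
  · simp only [cubicParam, Matrix.cons_val, Fin.reduceFinMk]
    rw [cD_add (hu 4) (h2.fun_sub h3), LinearMap.add_apply,
      cD_sub h2 h3, LinearMap.sub_apply, cD_mul (hz.fun_mul hz) hb, cD_mul hz hz,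
      cD_mul hz (hb.fun_mul hb), cD_mul hb hb, hu', cD_zCoord, cD_zBarCoord]
    ring

theorem cD_cubicParam_conjL (p : R5) : cD cubicParam p (conjField cubicL p) = 0 := by
  rw [cD_cubicParam, conjField_cubicL]
  refine vec4_ext ?_ ?_ ?_ ?_ <;> simp <;> ring_nf <;> simp

theorem cD_cubicParam_L_zero (p : R5) : cD cubicParam p (cubicL p) 0 = 1 := by
  rw [cD_cubicParam]
  simp [cubicL]
  ring_nf
  simp
  norm_num

section Vanishing

variable {Ω : Set C4} {V : C4 → C4} {p q : R5}

/-- The `τ` coefficient of a holomorphic field along the cubic. -/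
noncomputable def tauCoef (V : C4 → C4) (q : R5) : ℂ :=
  (1 / 2) * (V (cubicParam q) 1 + -(2 * Complex.I) * (zBarCoord q * V (cubicParam q) 0))

/-- The `β` coefficient of a holomorphic field along the cubic. -/
noncomputable def betaCoef (V : C4 → C4) (q : R5) : ℂ :=
  (1 / 8) * (V (cubicParam q) 2 + Complex.I * V (cubicParam q) 3 +
    -4 * (zCoord q * V (cubicParam q) 1))

theorem im_eq_re_iff (a b : ℂ) : a.im = b.re → conj b = b → conj a = a - 2 * Complex.I * b := by
  intro h hb
  have hb' : b.im = 0 := Complex.conj_eq_iff_im.1 hb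
  apply Complex.ext
  · simp [hb']
  · simp [h]; ring

theorem conj_component (h : TangentToCubic V (cubicParam q)) :
    conj (V (cubicParam q) 1) = V (cubicParam q) 1 - 2 * Complex.I *
      (V (cubicParam q) 0 * zBarCoord q + zCoord q * conj (V (cubicParam q) 0)) ∧
    conj (V (cubicParam q) 2) = V (cubicParam q) 2 - 2 * Complex.I *
      (2 * zCoord q * V (cubicParam q) 0 * zBarCoord q + zCoord q ^ 2 * conj (V (cubicParam q) 0) +
        V (cubicParam q) 0 * zBarCoord q ^ 2 +
        zCoord q * (2 * zBarCoord q * conj (V (cubicParam q) 0))) ∧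
    conj (V (cubicParam q) 3) = V (cubicParam q) 3 - 2 * Complex.I *
      (-Complex.I * (2 * zCoord q * V (cubicParam q) 0 * zBarCoord q +
        zCoord q ^ 2 * conj (V (cubicParam q) 0) - (V (cubicParam q) 0 * zBarCoord q ^ 2 +
        zCoord q * (2 * zBarCoord q * conj (V (cubicParam q) 0))))) := by
  obtain ⟨h1, h2, h3⟩ := (tangentToCubic_iff V _).1 h
  have hz : cubicParam q 0 = zCoord q := rfl
  rw [hz, conj_zCoord] at h1 h2 h3
  refine ⟨im_eq_re_iff _ _ h1 ?_, im_eq_re_iff _ _ h2 ?_, im_eq_re_iff _ _ h3 ?_⟩ <;>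
    simp only [map_add, map_sub, map_mul, map_neg, map_pow, conj_zCoord, conj_zBarCoord,
      Complex.conj_conj, Complex.conj_I, map_ofNat] <;> ring

/-- The reality of `τ` is the first of the three tangency equations: `Im V₁ = 2 Re(z̄ V₀)` says that
`V₁ - 2 i z̄ V₀` is real. -/
theorem conj_tauCoef (h : TangentToCubic V (cubicParam q)) :
    conj (tauCoef V q) = tauCoef V q := by
  have h1 := (conj_component h).1
  simp only [tauCoef, map_add, map_mul, map_neg, map_div₀, map_one, map_ofNat, conj_zBarCoord,
    Complex.conj_I, h1]
  ring

theorem conj_betaCoef (h : TangentToCubic V (cubicParam q)) :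
    conj (betaCoef V q) = (1 / 8) * (V (cubicParam q) 2 + -Complex.I * V (cubicParam q) 3 +
      (-4 * (zBarCoord q * V (cubicParam q) 1) +
      (4 * Complex.I) * (zBarCoord q * (zBarCoord q * V (cubicParam q) 0)))) := by
  obtain ⟨h1, h2, h3⟩ := conj_component h
  simp only [betaCoef, map_add, map_mul, map_neg, map_div₀, map_one, map_ofNat, conj_zCoord,
    Complex.conj_I, h1, h2, h3]
  ring_nf
  simp only [Complex.I_sq, Complex.I_pow_three]
  ring

theorem differentiableAt_component (hV : DifferentiableAt ℂ V (cubicParam q)) (i : Fin 4) :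
    DifferentiableAt ℝ (fun q => V (cubicParam q) i) q :=
  DifferentiableAt.comp q (((differentiableAt_pi.1 hV i).restrictScalars ℝ))
    (contDiff_cubicParam.differentiable (by simp) q)

theorem der_component (hV : DifferentiableAt ℂ V (cubicParam q)) (X : R5 → C5) (i : Fin 4) :
    der X (fun q => V (cubicParam q) i) q =
      fderiv ℂ V (cubicParam q) (cD cubicParam q (X q)) i := by
  have h := cD_holomorphic_comp (contDiff_cubicParam.differentiable (by simp) q)
    (differentiableAt_pi.1 hV i) (X q)
  rw [der, h, fderiv_apply hV]
  rfl

/-- Restrictions of holomorphic functions to the cubic are CR functions: `ℒ̄` annihilates the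
parametrization. -/
theorem der_component_conjL (hV : DifferentiableAt ℂ V (cubicParam q)) (i : Fin 4) :
    cD (fun q => V (cubicParam q) i) q (conjField cubicL q) = 0 := by
  have h := der_component hV (conjField cubicL) i
  rw [cD_cubicParam_conjL, map_zero] at h
  exact h

theorem der_tauCoef (hV : DifferentiableAt ℂ V (cubicParam q)) :
    der (conjField cubicL) (tauCoef V) q = -Complex.I * V (cubicParam q) 0 := by
  have hb : DifferentiableAt ℝ (fun q => zBarCoord q) q := zBarCoord.differentiableAt
  have hc : ∀ c : ℂ, DifferentiableAt ℝ (fun _ : R5 => c) q := fun c => differentiableAt_const c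
  have h0 := differentiableAt_component hV 0
  have h1 := differentiableAt_component hV 1
  have h2 := hb.fun_mul h0
  unfold der tauCoef
  rw [cD_mul (hc _) (h1.fun_add ((hc _).fun_mul h2)), cD_add h1 ((hc _).fun_mul h2),
    LinearMap.add_apply, cD_mul (hc _) h2, cD_mul hb h0, der_component_conjL hV,
    der_component_conjL hV, cD_zBarCoord, cD_const, cD_const]
  simp [conjField_cubicL]
  ring_nf; simp; ring

theorem der_betaCoef (hV : DifferentiableAt ℂ V (cubicParam q)) :
    der (conjField cubicL) (betaCoef V) q = 0 := by
  have hz : DifferentiableAt ℝ (fun q => zCoord q) q := zCoord.differentiableAt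
  have hc : ∀ c : ℂ, DifferentiableAt ℝ (fun _ : R5 => c) q := fun c => differentiableAt_const c
  have h1 := differentiableAt_component hV 1
  have h2 := differentiableAt_component hV 2
  have h3 := (hc Complex.I).fun_mul (differentiableAt_component hV 3)
  have h4 := (hc (-4)).fun_mul (hz.fun_mul h1)
  unfold der betaCoef
  rw [cD_mul (hc _) ((h2.fun_add h3).fun_add h4), cD_add (h2.fun_add h3) h4, cD_add h2 h3,
    LinearMap.add_apply, LinearMap.add_apply, cD_mul (hc _) (hz.fun_mul h1), cD_mul hz h1,
    cD_mul (hc _) (differentiableAt_component hV 3), der_component_conjL hV,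
    der_component_conjL hV, der_component_conjL hV, cD_zCoord, cD_const, cD_const, cD_const]
  simp [conjField_cubicL]
  ring_nf; simp

/-- By tangency, `β̄` is a combination of the components of `V` with coefficients that are
polynomials in `z̄` (`conj_betaCoef`). In this expression `ℒ̄` differentiates only `z̄`; conjugating
the result gives `ℒβ`, using that `τ` is real. -/
theorem der_conj_betaCoef {B : Set R5} (hB : IsOpen B)
    (hV : ∀ q ∈ B, DifferentiableAt ℂ V (cubicParam q))
    (ht : ∀ q ∈ B, TangentToCubic V (cubicParam q)) (hq : q ∈ B) :
    der cubicL (betaCoef V) q = - tauCoef V q := by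
  have hb : DifferentiableAt ℝ (fun q => zBarCoord q) q := zBarCoord.differentiableAt
  have hc : ∀ c : ℂ, DifferentiableAt ℝ (fun _ : R5 => c) q := fun c => differentiableAt_const c
  have hVq := hV q hq
  have h0 := differentiableAt_component hVq 0
  have h1 := differentiableAt_component hVq 1
  have h2 := differentiableAt_component hVq 2
  have h3 := (hc (-Complex.I)).fun_mul (differentiableAt_component hVq 3)
  have h4 := (hc (-4)).fun_mul (hb.fun_mul h1)
  have h5 := (hc (4 * Complex.I)).fun_mul (hb.fun_mul (hb.fun_mul h0))
  have key : der (conjField cubicL) (fun q => conj (betaCoef V q)) q = - tauCoef V q := by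
    rw [der_congr hB (f := fun q => conj (betaCoef V q)) (fun q hq => conj_betaCoef (ht q hq)) _ hq]
    unfold der tauCoef
    rw [cD_mul (hc _) ((h2.fun_add h3).fun_add (h4.fun_add h5)),
      cD_add (h2.fun_add h3) (h4.fun_add h5), cD_add h2 h3, cD_add h4 h5,
      LinearMap.add_apply, LinearMap.add_apply, LinearMap.add_apply,
      cD_mul (hc _) (hb.fun_mul h1), cD_mul hb h1,
      cD_mul (hc _) (hb.fun_mul (hb.fun_mul h0)), cD_mul hb (hb.fun_mul h0), cD_mul hb h0,
      cD_mul (hc _) (differentiableAt_component hVq 3), der_component_conjL hVq,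
      der_component_conjL hVq, der_component_conjL hVq, der_component_conjL hVq,
      cD_zBarCoord, cD_const, cD_const, cD_const, cD_const]
    simp [conjField_cubicL]
    ring_nf; simp; ring
  rw [der_conj, conjField_conjField] at key
  rw [← Complex.conj_conj (der cubicL (betaCoef V) q), key, map_neg, conj_tauCoef (ht q hq)]

/-- A holomorphic map that vanishes on the cubic near a point vanishes near this point. -/
theorem eventually_eq_zero_of_cubicParam (hV : ∀ᶠ x in 𝓝 (cubicParam p), DifferentiableAt ℂ V x)
    (h0 : ∀ᶠ q in 𝓝 p, V (cubicParam q) = 0) : ∀ᶠ x in 𝓝 (cubicParam p), V x = 0 := by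
  set y : ℂ := (p 1 : ℂ) with hy
  -- Fixing `Im z` cuts out of the cubic a four-dimensional slice with real parameters `Re z, u₁,
  -- u₂, u₃`. `Θ` is its parametrization extended to complex parameters and `Ξ` is a polynomial
  -- inverse, so vanishing on the slice spreads to a neighbourhood by `eventually_eq_zero_of_real`.
  let Θ : C4 → C4 := fun v =>
    ![v 0 + Complex.I * y, v 1 + Complex.I * ((v 0 + Complex.I * y) * (v 0 - Complex.I * y)),
      v 2 + Complex.I * ((v 0 + Complex.I * y) * (v 0 + Complex.I * y) * (v 0 - Complex.I * y) +
        (v 0 + Complex.I * y) * ((v 0 - Complex.I * y) * (v 0 - Complex.I * y))),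
      v 3 + ((v 0 + Complex.I * y) * (v 0 + Complex.I * y) * (v 0 - Complex.I * y) -
        (v 0 + Complex.I * y) * ((v 0 - Complex.I * y) * (v 0 - Complex.I * y)))]
  let Ξ : C4 → C4 := fun x =>
    ![x 0 - Complex.I * y, x 1 - Complex.I * (x 0 * (x 0 - Complex.I * y - Complex.I * y)),
      x 2 - Complex.I * (x 0 * x 0 * (x 0 - Complex.I * y - Complex.I * y) +
        x 0 * ((x 0 - Complex.I * y - Complex.I * y) * (x 0 - Complex.I * y - Complex.I * y))),
      x 3 - (x 0 * x 0 * (x 0 - Complex.I * y - Complex.I * y) -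
        x 0 * ((x 0 - Complex.I * y - Complex.I * y) * (x 0 - Complex.I * y - Complex.I * y)))]
  have hΘd : Differentiable ℂ Θ := by
    refine differentiable_pi.2 fun i => ?_
    fin_cases i <;> simp [Θ] <;> fun_prop
  have hΞc : Continuous Ξ := by
    refine continuous_pi fun i => ?_
    fin_cases i <;> simp [Ξ] <;> fun_prop
  have hΘΞ : ∀ x, Θ (Ξ x) = x := fun x => by
    refine vec4_ext ?_ ?_ ?_ ?_ <;> simp [Θ, Ξ]
  set p' : Fin 4 → ℝ := ![p 0, p 2, p 3, p 4] with hp'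
  let ι : (Fin 4 → ℝ) → R5 := fun v => ![v 0, p 1, v 1, v 2, v 3]
  have hι : Continuous ι := by
    refine continuous_pi fun i => ?_
    fin_cases i <;> simp [ι] <;> fun_prop
  have hιp : ι p' = p := by
    ext i; fin_cases i <;> rfl
  have hΘι : ∀ v, Θ (ofRealVec v) = cubicParam (ι v) := fun v => by
    refine vec4_ext ?_ ?_ ?_ ?_ <;> simp [Θ, ι, cubicParam, zCoord, zBarCoord, ofRealVec, hy]
  have hΘp : Θ (ofRealVec p') = cubicParam p := by rw [hΘι, hιp]
  have hΞp : Ξ (cubicParam p) = ofRealVec p' := by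
    refine vec4_ext ?_ ?_ ?_ ?_ <;>
      simp [Ξ, cubicParam, zCoord, zBarCoord, ofRealVec, hy, hp']
  have h1 : ∀ᶠ v in 𝓝 (ofRealVec p'), DifferentiableAt ℂ (fun v => V (Θ v)) v := by
    have h2 : Filter.Tendsto Θ (𝓝 (ofRealVec p')) (𝓝 (cubicParam p)) := by
      rw [← hΘp]; exact hΘd.continuous.tendsto _
    filter_upwards [h2.eventually hV] with v hv
    exact DifferentiableAt.comp v hv (hΘd v)
  have h2 : ∀ᶠ v in 𝓝 p', V (Θ (ofRealVec v)) = 0 := by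
    have h3 : Filter.Tendsto ι (𝓝 p') (𝓝 p) := by
      have := hι.tendsto p'; rwa [hιp] at this
    filter_upwards [h3.eventually h0] with v hv
    rwa [hΘι]
  have h3 := eventually_eq_zero_of_real (G := fun v => V (Θ v)) h1 h2
  have h4 : Filter.Tendsto Ξ (𝓝 (cubicParam p)) (𝓝 (ofRealVec p')) := by
    rw [← hΞp]; exact hΞc.tendsto _
  filter_upwards [h4.eventually h3] with x hx
  rwa [hΘΞ] at hx

/-- The coefficients `α = V₀`, `τ`, `β` satisfy the hypotheses of `cubic_rigidity`, the last initial
condition being the value of `ℒα`. Their vanishing makes the field zero on the cubic near the point,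
and a holomorphic map that is zero there is zero nearby. -/
theorem eventually_eq_zero_of_tangent (hΩ : IsOpen Ω) (hV : DifferentiableOn ℂ V Ω)
    (ht : ∀ x ∈ Ω ∩ cubic, TangentToCubic V x) (hp : cubicParam p ∈ Ω)
    (h0 : V (cubicParam p) 0 = 0) (h1 : tauCoef V p = 0) (h2 : betaCoef V p = 0)
    (h3 : fderiv ℂ V (cubicParam p) (cD cubicParam p (cubicL p)) 0 = 0) :
    ∀ᶠ x in 𝓝 (cubicParam p), V x = 0 := by
  have hop : IsOpen (cubicParam ⁻¹' Ω) := hΩ.preimage contDiff_cubicParam.continuous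
  obtain ⟨ε, hε, hB⟩ := Metric.isOpen_iff.1 hop p hp
  set B := Metric.ball p ε with hBdef
  have hd : ∀ q ∈ B, DifferentiableAt ℂ V (cubicParam q) := fun q hq =>
    hV.differentiableAt (hΩ.mem_nhds (hB hq))
  have hsm : ContDiffOn ℝ ∞ V Ω := contDiffOn_infty.2 fun n =>
    (contDiffOn_of_holomorphic hΩ hV n).restrict_scalars ℝ
  have hW : ContDiffOn ℝ ∞ (fun q => V (cubicParam q)) B :=
    hsm.comp contDiff_cubicParam.contDiffOn hB
  have hWi : ∀ i, ContDiffOn ℝ ∞ (fun q => V (cubicParam q) i) B := contDiffOn_pi.1 hW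
  have hτ : ContDiffOn ℝ ∞ (tauCoef V) B :=
    contDiffOn_const.mul ((hWi 1).add (contDiffOn_const.mul (zBarCoord.contDiff.contDiffOn.mul
      (hWi 0))))
  have hβ : ContDiffOn ℝ ∞ (betaCoef V) B :=
    contDiffOn_const.mul (((hWi 2).add (contDiffOn_const.mul (hWi 3))).add
      (contDiffOn_const.mul (zCoord.contDiff.contDiffOn.mul (hWi 1))))
  have htB : ∀ q ∈ B, TangentToCubic V (cubicParam q) := fun q hq =>
    ht _ ⟨hB hq, cubicParam_mem q⟩
  have hpB : p ∈ B := Metric.mem_ball_self hε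
  have key : ∀ q ∈ B, V (cubicParam q) 0 = 0 ∧ tauCoef V q = 0 ∧ betaCoef V q = 0 := fun q hq =>
    cubic_rigidity Metric.isOpen_ball (convex_ball p ε) (hWi 0) hτ hβ
      (fun q hq => der_component_conjL (hd q hq) 0) (fun q hq => conj_tauCoef (htB q hq))
      (fun q hq => der_tauCoef (hd q hq))
      (fun q hq => der_conj_betaCoef Metric.isOpen_ball hd htB hq)
      (fun q hq => der_betaCoef (hd q hq)) hpB h0 h1 h2
      (by rw [der_component (hd p hpB)]; exact h3) hq
  refine eventually_eq_zero_of_cubicParam ?_ ?_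
  · filter_upwards [hΩ.mem_nhds hp] with x hx using hV.differentiableAt (hΩ.mem_nhds hx)
  · filter_upwards [Metric.isOpen_ball.mem_nhds hpB] with q hq
    obtain ⟨k0, k1, k2⟩ := key q hq
    -- `β = 0` controls `V₂ + i V₃` and `β̄ = 0` controls `V₂ - i V₃`, once `V₀` and `V₁` are known
    -- to vanish.
    have k3 := conj_betaCoef (htB q hq)
    rw [k2, map_zero] at k3
    rw [tauCoef, k0] at k1
    have k4 : V (cubicParam q) 1 = 0 := by linear_combination 2 * k1
    rw [betaCoef, k4] at k2
    rw [k4, k0] at k3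
    refine vec4_ext k0 k4 ?_ ?_
    · simp only [Pi.zero_apply]
      linear_combination 4 * k2 - 4 * k3
    · simp only [Pi.zero_apply]
      linear_combination (-4 * Complex.I) * (k2 + k3) + V (cubicParam q) 3 * Complex.I_sq

end Vanishing

theorem tauCoef_sub (V W : C4 → C4) (q : R5) :
    tauCoef (fun x => V x - W x) q = tauCoef V q - tauCoef W q := by
  simp only [tauCoef, Pi.sub_apply]; ring

theorem betaCoef_sub (V W : C4 → C4) (q : R5) :
    betaCoef (fun x => V x - W x) q = betaCoef V q - betaCoef W q := by
  simp only [betaCoef, Pi.sub_apply]; ring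

theorem autMap_surjective (Ω : Set C4) (V : C4 → C4) (hΩ : IsOpen Ω) (hV : DifferentiableOn ℂ V Ω)
    (ht : ∀ x ∈ Ω ∩ cubic, TangentToCubic V x) (x : C4) (hx : x ∈ Ω ∩ cubic) :
    ∃ y, V =ᶠ[𝓝 x] autMap y := by
  obtain ⟨p, rfl⟩ := exists_cubicParam hx.2
  -- The parameters are chosen in triangular order: `l` matches `ℒα`, then `c` matches `α`, `r`
  -- matches `τ` and `s` matches `β`. The parameter `r` has to be real, which is possible because
  -- `τ` is real for both fields.
  set l : ℂ := fderiv ℂ V (cubicParam p) (cD cubicParam p (cubicL p)) 0 with hl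
  set c : ℂ := l * zCoord p - V (cubicParam p) 0 with hc
  set r : ℝ := (tauCoef (infField l 0 0 c) p - tauCoef V p).re with hr
  set s : ℂ := betaCoef (infField l 0 r c) p - betaCoef V p with hs
  have hrc : (r : ℂ) = tauCoef (infField l 0 0 c) p - tauCoef V p := by
    rw [hr]
    refine Complex.conj_eq_iff_re.1 ?_
    rw [map_sub, conj_tauCoef (ht _ hx), conj_tauCoef (infField_tangent l 0 0 c hx.2)]
  refine ⟨gElem l s r c, ?_⟩
  rw [autMap_gElem]
  have hd : DifferentiableAt ℂ V (cubicParam p) := hV.differentiableAt (hΩ.mem_nhds hx.1)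
  have key : ∀ᶠ x in 𝓝 (cubicParam p), V x - infField l s r c x = 0 := by
    refine eventually_eq_zero_of_tangent (V := fun x => V x - infField l s r c x) hΩ
      (hV.sub (differentiable_infField l s r c).differentiableOn) (fun x hx => ?_) hx.1 ?_ ?_ ?_ ?_
    · have h1 := ht x hx
      have h2 := infField_tangent l s r c hx.2
      rw [TangentToCubic] at h1 h2 ⊢
      rw [map_sub, h1, h2, sub_zero]
    · simp only [Pi.sub_apply, infField, Matrix.cons_val, hc]
      rw [show cubicParam p 0 = zCoord p from rfl]; ring
    · rw [tauCoef_sub]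
      have h1 : tauCoef (infField l s r c) p = tauCoef (infField l 0 0 c) p - r := by
        simp only [tauCoef, infField, Matrix.cons_val]; push_cast; ring
      rw [h1, hrc]; ring
    · rw [betaCoef_sub]
      have h1 : betaCoef (infField l s r c) p = betaCoef (infField l 0 r c) p - s := by
        simp only [betaCoef, infField, Matrix.cons_val, map_zero]
        ring_nf; simp; ring
      rw [h1, hs]; ring
    · rw [fderiv_fun_sub hd (differentiable_infField l s r c _), sub_apply,
        fderiv_infField, Pi.sub_apply, ← hl]
      simp [infFieldDeriv, cD_cubicParam_L_zero]
  filter_upwards [key] with x hx using sub_eq_zero.1 hx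

theorem autMap_isInfinitesimalCRAutIso : IsInfinitesimalCRAutIso autMap where
  injective := autMap_injective
  holomorphic y := by
    obtain ⟨l, s, r, c, rfl⟩ := gElem_surjective y
    rw [autMap_gElem]; exact differentiable_infField l s r c
  tangent y x hx := by
    obtain ⟨l, s, r, c, rfl⟩ := gElem_surjective y
    rw [autMap_gElem]; exact infField_tangent l s r c hx
  lie := autMap_lie
  surjective := autMap_surjective

theorem modelDescription : ModelDescription where
  G7_closed := isClosed_G7
  G7_connected := isConnected_G7
  G7_lie := g7_isLieAlgebraOf
  g7_dim := finrank_g7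
  g7_brackets := bracketTable
  H2_le := H2_le_G7
  H2_closed := isClosed_H2
  H2_connected := isConnected_H2
  H2_lie := h2_isLieAlgebraOf
  H2_iso := exists_H2_equiv
  N5_le := N5_le_G7
  N5_closed := isClosed_N5
  N5_simplyConnected := simplyConnected_N5
  N5_nilpotent := nilpotent_N5
  N5_lie := n5_isLieAlgebraOf
  n5_brackets := exists_n5_basis
  action := exists_modelAction
  aut := ⟨autMap, autMap_isInfinitesimalCRAutIso⟩

end CubicRigidity

/-! ### Exterior calculus with complex coefficients on `ℝ⁵` -/

section FormCalculus

/-- The exterior derivative of a complex one-form on `ℝ⁵` given by its coefficients. -/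
noncomputable def dM (η : R5 → C5) (p : R5) (X Y : C5) : ℂ :=
  cD η p X ⬝ᵥ Y - cD η p Y ⬝ᵥ X

/-- The wedge product of two covectors. -/
noncomputable def wd (α β X Y : C5) : ℂ := (α ⬝ᵥ X) * (β ⬝ᵥ Y) - (α ⬝ᵥ Y) * (β ⬝ᵥ X)

variable {η ξ : R5 → C5} {p : R5}

theorem dM_congr (h : η =ᶠ[𝓝 p] ξ) : dM η p = dM ξ p := by
  ext X Y
  simp only [dM, cD_congr h]

theorem dM_smul {f : R5 → ℂ} (hf : DifferentiableAt ℝ f p) (hη : DifferentiableAt ℝ η p)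
    (X Y : C5) : dM (fun q => f q • η q) p X Y =
      f p * dM η p X Y + cD f p X * (η p ⬝ᵥ Y) - cD f p Y * (η p ⬝ᵥ X) := by
  simp only [dM, cD_smul hf hη, add_dotProduct, smul_dotProduct, smul_eq_mul]; ring

theorem star_dotProduct_eq (v w : C5) : star v ⬝ᵥ w = conj (v ⬝ᵥ star w) := by
  have h := Matrix.star_dotProduct v w
  rw [h, dotProduct_comm (star w) v]
  rfl

theorem dM_conj (hη : DifferentiableAt ℝ η p) (X Y : C5) :
    dM (conjField η) p X Y = conj (dM η p (star X) (star Y)) := by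
  have h : ∀ X, cD (conjField η) p X = star (cD η p (star X)) := cD_star hη
  simp only [dM, h, star_dotProduct_eq, map_sub]

theorem cD_dotProduct {Y : R5 → C5} (hη : DifferentiableAt ℝ η p) (hY : DifferentiableAt ℝ Y p)
    (X : C5) : cD (fun q => η q ⬝ᵥ Y q) p X = cD η p X ⬝ᵥ Y p + η p ⬝ᵥ cD Y p X := by
  have h1 := differentiableAt_pi.1 hη
  have h2 := differentiableAt_pi.1 hY
  simp only [dotProduct]
  rw [cD_sum _ fun i _ => (h1 i).fun_mul (h2 i), LinearMap.sum_apply, ← Finset.sum_add_distrib]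
  refine Finset.sum_congr rfl fun i _ => ?_
  rw [cD_mul (h1 i) (h2 i), ← cD_pi hη, ← cD_pi hY]; ring

/-- Cartan's formula. -/
theorem dM_cartan {X Y : R5 → C5} (hη : DifferentiableAt ℝ η p) (hX : DifferentiableAt ℝ X p)
    (hY : DifferentiableAt ℝ Y p) : dM η p (X p) (Y p) =
      cD (fun q => η q ⬝ᵥ Y q) p (X p) - cD (fun q => η q ⬝ᵥ X q) p (Y p) -
        η p ⬝ᵥ bracket X Y p := by
  rw [cD_dotProduct hη hX, cD_dotProduct hη hY, dM, bracket, complexDeriv_eq, complexDeriv_eq,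
    dotProduct_sub]
  ring

theorem dM_cartan_of_eq_zero {X Y : R5 → C5} (hη : DifferentiableAt ℝ η p)
    (hX : DifferentiableAt ℝ X p) (hY : DifferentiableAt ℝ Y p) {a b : ℂ}
    (h1 : ∀ᶠ q in 𝓝 p, η q ⬝ᵥ Y q = a) (h2 : ∀ᶠ q in 𝓝 p, η q ⬝ᵥ X q = b) :
    dM η p (X p) (Y p) = - (η p ⬝ᵥ bracket X Y p) := by
  rw [dM_cartan hη hX hY, cD_congr (g := fun _ => a) h1, cD_congr (g := fun _ => b) h2, cD_const,
    cD_const]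
  simp

theorem dM_swap (η : R5 → C5) (p : R5) (X Y : C5) : dM η p X Y = - dM η p Y X := by
  simp [dM]

theorem dM_self (η : R5 → C5) (p : R5) (X : C5) : dM η p X X = 0 := by simp [dM]

/-- The exterior derivative as a bilinear form. -/
noncomputable def dMBilin (η : R5 → C5) (p : R5) : C5 →ₗ[ℂ] C5 →ₗ[ℂ] ℂ :=
  LinearMap.mk₂ ℂ (dM η p)
    (fun X X' Y => by simp only [dM, map_add, add_dotProduct, dotProduct_add]; ring)
    (fun c X Y => by simp only [dM, map_smul, smul_dotProduct, dotProduct_smul, smul_eq_mul]; ring)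
    (fun X Y Y' => by simp only [dM, map_add, add_dotProduct, dotProduct_add]; ring)
    (fun c X Y => by simp only [dM, map_smul, smul_dotProduct, dotProduct_smul, smul_eq_mul]; ring)

theorem dM_sub_smul_left (c : ℂ) (X X' Y : C5) :
    dM η p (X - c • X') Y = dM η p X Y - c * dM η p X' Y := by
  simp only [dM, map_sub, map_smul, sub_dotProduct, smul_dotProduct, dotProduct_sub,
    dotProduct_smul, smul_eq_mul]
  ring

/-- The expansion of a bilinear form in a coframe. -/
theorem bilin_expand {e F : Fin 5 → C5} (hF : ∀ X, X = ∑ a, (e a ⬝ᵥ X) • F a)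
    (β : C5 →ₗ[ℂ] C5 →ₗ[ℂ] ℂ) (X Y : C5) :
    β X Y = ∑ a, ∑ b, (e a ⬝ᵥ X) * ((e b ⬝ᵥ Y) * β (F a) (F b)) := by
  conv_lhs => rw [hF X, hF Y]
  simp only [map_sum, LinearMap.sum_apply, map_smul, LinearMap.smul_apply, smul_eq_mul]
  rw [Finset.sum_comm]
  refine Finset.sum_congr rfl fun a _ => ?_
  rw [Finset.mul_sum]
  exact Finset.sum_congr rfl fun b _ => mul_left_comm _ _ _

/-- The expansion of an alternating form in a coframe. -/
theorem alternating_expand {e F : Fin 5 → C5} (hF : ∀ X, X = ∑ a, (e a ⬝ᵥ X) • F a)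
    (β : C5 →ₗ[ℂ] C5 →ₗ[ℂ] ℂ) (h0 : ∀ X, β X X = 0) (X Y : C5) : β X Y =
      β (F 0) (F 1) * wd (e 0) (e 1) X Y + β (F 0) (F 2) * wd (e 0) (e 2) X Y +
      β (F 0) (F 3) * wd (e 0) (e 3) X Y + β (F 0) (F 4) * wd (e 0) (e 4) X Y +
      β (F 1) (F 2) * wd (e 1) (e 2) X Y + β (F 1) (F 3) * wd (e 1) (e 3) X Y +
      β (F 1) (F 4) * wd (e 1) (e 4) X Y + β (F 2) (F 3) * wd (e 2) (e 3) X Y +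
      β (F 2) (F 4) * wd (e 2) (e 4) X Y + β (F 3) (F 4) * wd (e 3) (e 4) X Y := by
  have hs : ∀ a b, β (F a) (F b) = - β (F b) (F a) := fun a b => by
    have h := h0 (F a + F b)
    simp only [map_add, LinearMap.add_apply, h0, zero_add, add_zero] at h
    exact eq_neg_of_add_eq_zero_right h
  rw [bilin_expand hF]
  simp only [Fin.sum_univ_five, h0, wd]
  rw [hs 1 0, hs 2 0, hs 3 0, hs 4 0, hs 2 1, hs 3 1, hs 4 1, hs 3 2, hs 4 2, hs 4 3]
  ring

/-- The expansion of a two-form in a coframe. -/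
theorem dM_expand {e F : Fin 5 → C5} (hF : ∀ X, X = ∑ a, (e a ⬝ᵥ X) • F a) (η : R5 → C5) (p : R5)
    (X Y : C5) : dM η p X Y =
      dM η p (F 0) (F 1) * wd (e 0) (e 1) X Y + dM η p (F 0) (F 2) * wd (e 0) (e 2) X Y +
      dM η p (F 0) (F 3) * wd (e 0) (e 3) X Y + dM η p (F 0) (F 4) * wd (e 0) (e 4) X Y +
      dM η p (F 1) (F 2) * wd (e 1) (e 2) X Y + dM η p (F 1) (F 3) * wd (e 1) (e 3) X Y +
      dM η p (F 1) (F 4) * wd (e 1) (e 4) X Y + dM η p (F 2) (F 3) * wd (e 2) (e 3) X Y +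
      dM η p (F 2) (F 4) * wd (e 2) (e 4) X Y + dM η p (F 3) (F 4) * wd (e 3) (e 4) X Y :=
  alternating_expand hF (dMBilin η p) (dM_self η p) X Y

/-- The wedge product as a bilinear form. -/
noncomputable def wdBilin (α β : C5) : C5 →ₗ[ℂ] C5 →ₗ[ℂ] ℂ :=
  LinearMap.mk₂ ℂ (wd α β)
    (fun X X' Y => by simp only [wd, dotProduct_add]; ring)
    (fun c X Y => by simp only [wd, dotProduct_smul, smul_eq_mul]; ring)
    (fun X Y Y' => by simp only [wd, dotProduct_add]; ring)
    (fun c X Y => by simp only [wd, dotProduct_smul, smul_eq_mul]; ring)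

theorem analyticAt_dM (hη : AnalyticAt ℝ η p) {X Y : R5 → C5} (hX : AnalyticAt ℝ X p)
    (hY : AnalyticAt ℝ Y p) : AnalyticAt ℝ (fun q => dM η q (X q) (Y q)) p := by
  have h : ∀ {Z W : R5 → C5}, AnalyticAt ℝ Z p → AnalyticAt ℝ W p →
      AnalyticAt ℝ (fun q => Z q ⬝ᵥ W q) p := fun hZ hW => by
    simp only [dotProduct]
    exact Finset.analyticAt_fun_sum _ fun i _ =>
      (analyticAt_pi_iff.1 hZ i).fun_mul (analyticAt_pi_iff.1 hW i)
  exact (h (analyticAt_cD hη hX) hY).fun_sub (h (analyticAt_cD hη hY) hX)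

theorem analyticAt_dotProduct {Z W : R5 → C5} (hZ : AnalyticAt ℝ Z p) (hW : AnalyticAt ℝ W p) :
    AnalyticAt ℝ (fun q => Z q ⬝ᵥ W q) p := by
  simp only [dotProduct]
  exact Finset.analyticAt_fun_sum _ fun i _ =>
    (analyticAt_pi_iff.1 hZ i).fun_mul (analyticAt_pi_iff.1 hW i)

/-- The differential of a map of `ℝ⁵`, extended to complexified tangent vectors. -/
noncomputable def push (h : R5 → R5) (p : R5) : C5 →ₗ[ℂ] C5 := cD (fun q => toC5 (h q)) p

/-- The pullback of a one-form by a map of `ℝ⁵`. -/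
noncomputable def pull (h : R5 → R5) (η : R5 → C5) (p : R5) : C5 :=
  fun j => η (h p) ⬝ᵥ push h p (Pi.single j 1)

theorem pull_dotProduct (h : R5 → R5) (η : R5 → C5) (p : R5) (X : C5) :
    pull h η p ⬝ᵥ X = η (h p) ⬝ᵥ push h p X := by
  conv_rhs => rw [pi_eq_sum_univ' X, map_sum]
  simp only [map_smul, dotProduct_sum, dotProduct_smul, pull, smul_eq_mul]
  simp only [dotProduct]
  exact Finset.sum_congr rfl fun j _ => mul_comm _ _

theorem analyticAt_toC5 {h : R5 → R5} (hh : AnalyticAt ℝ h p) :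
    AnalyticAt ℝ (fun q => toC5 (h q)) p :=
  (ContinuousLinearMap.pi fun j =>
    Complex.ofRealCLM.comp (ContinuousLinearMap.proj j : R5 →L[ℝ] ℝ)).analyticAt _ |>.comp hh

theorem push_toC5 (h : R5 → R5) (p v : R5) (hh : DifferentiableAt ℝ h p) :
    push h p (toC5 v) = toC5 (fderiv ℝ h p v) := by
  rw [push, cD_toC5]
  have h3 : fderiv ℝ (fun q => toC5 (h q)) p = _ := ((ContinuousLinearMap.pi fun j =>
    Complex.ofRealCLM.comp (ContinuousLinearMap.proj j : R5 →L[ℝ] ℝ)).hasFDerivAt.comp p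
      hh.hasFDerivAt).fderiv
  rw [h3]; rfl

theorem push_star (h : R5 → R5) (p : R5) (hh : DifferentiableAt ℝ h p) (X : C5) :
    push h p (star X) = star (push h p X) := by
  have hd : DifferentiableAt ℝ (fun q => toC5 (h q)) p :=
    (ContinuousLinearMap.pi fun j => Complex.ofRealCLM.comp
      (ContinuousLinearMap.proj j : R5 →L[ℝ] ℝ)).differentiableAt.comp p hh
  have h1 := cD_star hd (star X)
  rw [star_star] at h1
  simp only [push]
  rw [← h1]
  congr 2
  ext q i
  simp [toC5]

theorem conjField_pull {h : R5 → R5} (hh : DifferentiableAt ℝ h p) :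
    conjField (pull h η) p = pull h (conjField η) p := by
  ext j
  have h1 : star (Pi.single j 1 : C5) = Pi.single j 1 := by
    ext i
    by_cases hij : i = j
    · subst hij; simp
    · simp [Pi.single_apply, hij]
  have h2 := star_dotProduct_eq (η (h p)) (push h p (Pi.single j 1))
  rw [← push_star h p hh, h1] at h2
  exact h2.symm

/-- The exterior derivative commutes with pullbacks. -/
theorem dM_pull {h : R5 → R5} (hη : DifferentiableAt ℝ η (h p)) (hh : AnalyticAt ℝ h p)
    (X Y : C5) : dM (pull h η) p X Y = dM η (h p) (push h p X) (push h p Y) := by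
  have ha := analyticAt_toC5 hh
  have hc : ContDiffAt ℝ 2 (fun q => toC5 (h q)) p := ha.contDiffAt
  have hd : DifferentiableAt ℝ (fun q => η (h q)) p :=
    DifferentiableAt.comp p hη hh.differentiableAt
  have hpull : DifferentiableAt ℝ (pull h η) p := by
    refine differentiableAt_pi.2 fun j => ?_
    have hp : DifferentiableAt ℝ (fun q => push h q (Pi.single j 1)) p :=
      (analyticAt_cD ha analyticAt_const).differentiableAt
    simp only [pull, dotProduct]
    exact DifferentiableAt.fun_sum fun i _ =>
      (differentiableAt_pi.1 hd i).fun_mul (differentiableAt_pi.1 hp i)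
  -- Besides the expected term there is one containing the second derivative of `h`; it is symmetric
  -- in `X, Y` and disappears on antisymmetrization.
  have key : ∀ X Y : C5, cD (pull h η) p X ⬝ᵥ Y =
      cD η (h p) (push h p X) ⬝ᵥ push h p Y + η (h p) ⬝ᵥ cD2 (fun q => toC5 (h q)) p X Y := by
    intro X Y
    have h1 := cD_dotProduct (Y := fun _ => Y) hpull (differentiableAt_const _) X
    rw [cD_const] at h1
    simp only [pull_dotProduct, LinearMap.zero_apply, dotProduct_zero, add_zero] at h1
    rw [← h1]
    have hp : DifferentiableAt ℝ (fun q => push h q Y) p :=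
      (analyticAt_cD ha analyticAt_const).differentiableAt
    rw [cD_dotProduct hd hp, cD_comp hη hh.differentiableAt]
    have h2 := cD_cD (Y := fun _ => Y) hc (differentiableAt_const _) X
    rw [cD_const] at h2
    simp only [LinearMap.zero_apply, map_zero, add_zero] at h2
    rw [← h2]
    rfl
  simp only [dM, key, cD2_symm hc X Y]
  ring

end FormCalculus

/-! ### Analytic generators of `T^{1,0}M` -/

section Generators

open scoped ComplexOrder in
theorem eq_zero_of_star_dotProduct {v : C5} (h : star v ⬝ᵥ v = 0) : v = 0 :=
  dotProduct_star_self_eq_zero.1 h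

/-- The generalized cross product: a vector orthogonal to the four rows. -/
noncomputable def cross (A : Matrix (Fin 4) (Fin 5) ℂ) : C5 := fun j =>
  (Matrix.of (Fin.cons (Pi.single j 1) A : Fin 5 → C5)).det

/-- This is the cofactor expansion along the top row. It makes `cross A` orthogonal to each row of
`A`, since repeating a row gives determinant zero. -/
theorem det_cons_eq_dotProduct (A : Matrix (Fin 4) (Fin 5) ℂ) (r : C5) :
    (Matrix.of (Fin.cons r A : Fin 5 → C5)).det = r ⬝ᵥ cross A := by
  have h : ∀ r : C5, (Matrix.of (Fin.cons r A : Fin 5 → C5)).det =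
      ∑ j : Fin 5, (-1) ^ (j : ℕ) * r j *
        (Matrix.of fun (i : Fin 4) k => A i (j.succAbove k)).det := fun r => by
    rw [Matrix.det_succ_row_zero]
    rfl
  rw [h, dotProduct]
  refine Finset.sum_congr rfl fun j _ => ?_
  rw [cross, h, Finset.sum_eq_single j]
  · simp; ring
  · intro k _ hk
    simp [Pi.single_apply, hk]
  · simp

theorem mulVec_cross (A : Matrix (Fin 4) (Fin 5) ℂ) : A *ᵥ cross A = 0 := by
  ext i
  change A i ⬝ᵥ cross A = 0
  rw [← det_cons_eq_dotProduct]
  exact Matrix.det_zero_of_row_eq (i := 0) (j := i.succ) (Fin.succ_ne_zero i).symm rfl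

theorem finrank_ker_of_surjective {A : C5 →ₗ[ℂ] C4} (hA : LinearMap.range A = ⊤) :
    Module.finrank ℂ (LinearMap.ker A) = 1 := by
  have h := A.finrank_range_add_finrank_ker
  rw [hA, finrank_top] at h
  simp at h
  omega

/-- The kernel of `A` is a line `ℂ k`. If the cross product vanished, the matrix with the extra row
`star k` would be singular; its kernel would contain a nonzero multiple of `k` orthogonal to `k` for
the Hermitian product. -/
theorem cross_ne_zero {A : Matrix (Fin 4) (Fin 5) ℂ} (hA : LinearMap.range A.mulVecLin = ⊤) :
    cross A ≠ 0 := by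
  intro h0
  obtain ⟨k, hk0, hk⟩ := finrank_eq_one_iff'.1 (finrank_ker_of_surjective hA)
  have hdet : (Matrix.of (Fin.cons (star (k : C5)) A : Fin 5 → C5)).det = 0 := by
    rw [det_cons_eq_dotProduct, h0, dotProduct_zero]
  obtain ⟨v, hv0, hv⟩ := Matrix.exists_mulVec_eq_zero_iff.2 hdet
  have hvA : v ∈ LinearMap.ker A.mulVecLin := by
    rw [LinearMap.mem_ker]
    ext i
    exact congrFun hv i.succ
  obtain ⟨c, hc⟩ := hk ⟨v, hvA⟩
  have hc' : c • (k : C5) = v := congrArg Subtype.val hc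
  have h1 : star (k : C5) ⬝ᵥ v = 0 := congrFun hv 0
  rw [← hc', dotProduct_smul, smul_eq_mul, mul_eq_zero] at h1
  rcases h1 with h1 | h1
  · rw [h1, zero_smul] at hc'
    exact hv0 hc'.symm
  · exact hk0 (Subtype.ext (eq_zero_of_star_dotProduct h1))

theorem analyticAt_det {n : ℕ} {E : Type*} [NormedAddCommGroup E] [NormedSpace ℝ E]
    {A : E → Matrix (Fin n) (Fin n) ℂ} {x : E} (hA : ∀ i j, AnalyticAt ℝ (fun y => A y i j) x) :
    AnalyticAt ℝ (fun y => (A y).det) x := by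
  simp only [Matrix.det_apply]
  refine Finset.analyticAt_fun_sum _ fun σ _ => ?_
  have h := Finset.analyticAt_fun_prod (𝕜 := ℝ) Finset.univ fun i _ => hA (σ i) i
  rcases Int.units_eq_one_or (Equiv.Perm.sign σ) with hs | hs <;> rw [hs]
  · simpa using h
  · simpa using h.fun_neg

theorem analyticAt_inv_entry {n : ℕ} {E : Type*} [NormedAddCommGroup E] [NormedSpace ℝ E]
    {A : E → Matrix (Fin n) (Fin n) ℂ} {x : E} (hA : ∀ i j, AnalyticAt ℝ (fun y => A y i j) x)
    (h0 : (A x).det ≠ 0) (i j : Fin n) : AnalyticAt ℝ (fun y => (A y)⁻¹ i j) x := by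
  have h : ∀ y, (A y)⁻¹ i j = ((A y).det)⁻¹ * ((A y).updateRow j (Pi.single i 1)).det := fun y => by
    rw [Matrix.inv_def, Matrix.smul_apply, Matrix.adjugate_apply, Ring.inverse_eq_inv', smul_eq_mul]
  simp only [h]
  refine AnalyticAt.fun_mul ((analyticAt_det hA).fun_inv h0) (analyticAt_det fun k l => ?_)
  by_cases hk : k = j
  · subst hk
    simp only [Matrix.updateRow_self]
    exact analyticAt_const
  · simp only [Matrix.updateRow_ne hk]
    exact hA k l

namespace LocalSubmanifold

variable {M : LocalSubmanifold} {L : R5 → C5} {p : R5}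

/-- The Jacobian matrix of the parametrization. -/
noncomputable def jac (M : LocalSubmanifold) (p : R5) : Matrix (Fin 4) (Fin 5) ℂ :=
  Matrix.of fun i j => fderiv ℝ M.φ p (Pi.single j 1) i

theorem complexDeriv_eq_jac (M : LocalSubmanifold) (p : R5) :
    complexDeriv M.φ p = (M.jac p).mulVecLin := by
  refine LinearMap.ext fun X => ?_
  rw [complexDeriv_eq, cD_apply]
  ext i
  simp [jac, Matrix.mulVec, dotProduct, mul_comm]

theorem range_complexDeriv (hM : M.IsCRGeneric) (hp : p ∈ M.U) :
    LinearMap.range (complexDeriv M.φ p) = ⊤ := by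
  rw [eq_top_iff, ← hM p hp, Submodule.span_le]
  rintro _ ⟨v, rfl⟩
  exact ⟨toC5 v, cD_toC5 _ _ _⟩

theorem mem_T10_iff (hp : p ∈ M.U) (X : C5) : X ∈ M.T10 p ↔ star X ∈ M.T01 p := by
  rw [T10, T01, LinearMap.mem_ker, LinearMap.mem_ker, complexDeriv_eq, complexDeriv_eq,
    cD_star (M.analytic p hp).differentiableAt, star_eq_zero]

theorem analyticAt_jac (hp : p ∈ M.U) (i : Fin 4) (j : Fin 5) :
    AnalyticAt ℝ (fun q => M.jac q i j) p := by
  have h1 : AnalyticAt ℝ (fun q => fderiv ℝ M.φ q (Pi.single j 1)) p :=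
    ((ContinuousLinearMap.apply ℝ C4 (Pi.single j (1 : ℝ) : R5)).analyticAt _).comp
      (M.analytic p hp).fderiv
  exact analyticAt_pi_iff.1 h1 i

/-- By genericity the complexified differential of the parametrization is onto `ℂ⁴`, so its kernel
`T^{0,1}M` is a line. The cross product of the rows of the Jacobian spans this line, never vanishes,
and depends analytically on the point; its conjugate is a generator on all of `M`. -/
theorem exists_generator (hM : M.IsCRGeneric) : ∃ L, M.IsGenerator L := by
  have hker : ∀ p, cross (M.jac p) ∈ M.T01 p := fun p => by
    rw [T01, LinearMap.mem_ker, complexDeriv_eq_jac, Matrix.mulVecLin_apply, mulVec_cross]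
  have hne : ∀ p ∈ M.U, cross (M.jac p) ≠ 0 := fun p hp =>
    cross_ne_zero (by rw [← complexDeriv_eq_jac]; exact range_complexDeriv hM hp)
  refine ⟨conjField fun p => cross (M.jac p), fun p hp => analyticAt_conjField ?_, fun p hp => ?_,
    fun p hp h => hne p hp (star_eq_zero.1 h)⟩
  · refine analyticAt_pi_iff.2 fun j => analyticAt_det fun i k => ?_
    refine Fin.cases ?_ (fun i => ?_) i
    · exact analyticAt_const
    · exact analyticAt_jac hp i k
  · refine le_antisymm ?_ fun X hX => ?_
    · rw [Submodule.span_singleton_le_iff_mem, mem_T10_iff hp, conjField, star_star]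
      exact hker p
    · rw [mem_T10_iff hp] at hX
      have h1 : Module.finrank ℂ (M.T01 p) = 1 :=
        finrank_ker_of_surjective (range_complexDeriv hM hp)
      have h2 : (⟨cross (M.jac p), hker p⟩ : M.T01 p) ≠ 0 := fun h =>
        hne p hp (congrArg Subtype.val h)
      obtain ⟨c, hc⟩ := (finrank_eq_one_iff_of_nonzero' _ h2).1 h1 ⟨star X, hX⟩
      have hc' : c • cross (M.jac p) = star X := congrArg Subtype.val hc
      refine Submodule.mem_span_singleton.2 ⟨conj c, ?_⟩
      rw [conjField, ← star_star X, ← hc', star_smul]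
      rfl

/-- The coefficient is a quotient of Hermitian products with `L`, which makes its analyticity
visible. -/
theorem IsGenerator.exists_smul (hL : M.IsGenerator L) (hp : p ∈ M.U) {X : R5 → C5}
    (hX : X ∈ M.Sections10 p) :
    ∃ f : R5 → ℂ, AnalyticAt ℝ f p ∧ X =ᶠ[𝓝 p] fun q => f q • L q := by
  have hLa := hL.analytic p hp
  have hne : star (L p) ⬝ᵥ L p ≠ 0 := fun h => hL.ne_zero p hp (eq_zero_of_star_dotProduct h)
  refine ⟨fun q => (star (L q) ⬝ᵥ X q) / (star (L q) ⬝ᵥ L q),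
    (analyticAt_dotProduct (analyticAt_conjField hLa) hX.1).fun_div
      (analyticAt_dotProduct (analyticAt_conjField hLa) hLa) hne, ?_⟩
  filter_upwards [hX.2, M.isOpen_U.mem_nhds hp] with q hq hqU
  have hneq : star (L q) ⬝ᵥ L q ≠ 0 := fun h => hL.ne_zero q hqU (eq_zero_of_star_dotProduct h)
  rw [← hL.span_eq q hqU] at hq
  obtain ⟨c, hc⟩ := Submodule.mem_span_singleton.1 hq
  rw [← hc, dotProduct_smul, smul_eq_mul, mul_div_assoc, div_self hneq, mul_one]

theorem IsGenerator.exists_smul_conj (hL : M.IsGenerator L) (hp : p ∈ M.U) {Y : R5 → C5}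
    (hY : Y ∈ M.Sections01 p) :
    ∃ f : R5 → ℂ, AnalyticAt ℝ f p ∧ Y =ᶠ[𝓝 p] fun q => f q • conjField L q := by
  have hY' : conjField Y ∈ M.Sections10 p := by
    refine ⟨analyticAt_conjField hY.1, ?_⟩
    filter_upwards [hY.2, M.isOpen_U.mem_nhds hp] with q hq hqU
    rw [mem_T10_iff hqU, conjField, star_star]
    exact hq
  obtain ⟨f, hf, h⟩ := hL.exists_smul hp hY'
  refine ⟨fun q => conj (f q), analyticAt_conj' hf, ?_⟩
  filter_upwards [h] with q hq
  rw [← star_star (Y q)]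
  change star (conjField Y q) = _
  rw [hq, star_smul]
  rfl

end LocalSubmanifold

/-! ### The Class III₁ condition in terms of the initial frame -/

section Frame

variable {L : R5 → C5} {p : R5}

theorem analyticAt_fieldT (hL : AnalyticAt ℝ L p) : AnalyticAt ℝ (fieldT L) p :=
  AnalyticAt.fun_smul analyticAt_const (analyticAt_bracket hL (analyticAt_conjField hL))

theorem analyticAt_fieldS (hL : AnalyticAt ℝ L p) : AnalyticAt ℝ (fieldS L) p :=
  analyticAt_bracket hL (analyticAt_fieldT hL)

theorem bracket_L_conjL (L : R5 → C5) (p : R5) :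
    bracket L (conjField L) p = -Complex.I • fieldT L p := by
  rw [fieldT, smul_smul]
  simp

theorem conjField_fieldT (hL : DifferentiableAt ℝ L p) : conjField (fieldT L) p = fieldT L p := by
  have h := bracket_conj hL (differentiableAt_conjField hL)
  rw [conjField_conjField] at h
  rw [conjField, fieldT, star_smul, ← h, bracket_swap (conjField L) L]
  simp

theorem bracket_conjL_T (hL : AnalyticAt ℝ L p) :
    bracket (conjField L) (fieldT L) p = conjField (fieldS L) p := by
  have h : conjField (fieldT L) =ᶠ[𝓝 p] fieldT L := by
    filter_upwards [hL.eventually_analyticAt] with q hq using conjField_fieldT hq.differentiableAt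
  rw [← bracket_congr (Filter.EventuallyEq.refl _ _) h,
    bracket_conj hL.differentiableAt (analyticAt_fieldT hL).differentiableAt]
  rfl

/-- The span of the initial frame. -/
noncomputable def frameSpan (L : R5 → C5) (p : R5) : Submodule ℂ C5 :=
  Submodule.span ℂ (Set.range (frameMatrix L p).col)

theorem fieldT_mem : fieldT L p ∈ frameSpan L p := Submodule.subset_span ⟨2, rfl⟩
theorem fieldS_mem : fieldS L p ∈ frameSpan L p := Submodule.subset_span ⟨1, rfl⟩
theorem conjS_mem : conjField (fieldS L) p ∈ frameSpan L p := Submodule.subset_span ⟨0, rfl⟩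
theorem conjL_mem : conjField L p ∈ frameSpan L p := Submodule.subset_span ⟨3, rfl⟩
theorem L_mem : L p ∈ frameSpan L p := Submodule.subset_span ⟨4, rfl⟩

theorem bracket_combination_mem (hL : AnalyticAt ℝ L p) {Z V : R5 → C5} (hZ : AnalyticAt ℝ Z p)
    {W : Submodule ℂ C5} (hZm : Z p ∈ W) (hT : fieldT L p ∈ W) (hLm : L p ∈ W)
    (hLm' : conjField L p ∈ W) (h1 : bracket Z (fieldT L) p ∈ W)
    (h2 : bracket Z (conjField L) p ∈ W) (h3 : bracket Z L p ∈ W) {f a b c : R5 → ℂ}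
    (hf : AnalyticAt ℝ f p) (ha : AnalyticAt ℝ a p) (hb : AnalyticAt ℝ b p)
    (hc : AnalyticAt ℝ c p)
    (hV : V =ᶠ[𝓝 p] fun q => a q • fieldT L q + (b q • conjField L q + c q • L q)) :
    bracket (fun q => f q • Z q) V p ∈ W := by
  have dT := (analyticAt_fieldT hL).differentiableAt
  have dL := hL.differentiableAt
  have dL' := (analyticAt_conjField hL).differentiableAt
  have da := ha.differentiableAt
  have db := hb.differentiableAt
  have dc := hc.differentiableAt
  rw [bracket_congr (Filter.EventuallyEq.refl _ _) hV,
    bracket_smul_left hf.differentiableAt hZ.differentiableAt,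
    bracket_add_right (da.fun_smul dT) ((db.fun_smul dL').fun_add (dc.fun_smul dL)),
    bracket_add_right (db.fun_smul dL') (dc.fun_smul dL),
    bracket_smul_right da dT, bracket_smul_right db dL', bracket_smul_right dc dL]
  exact W.sub_mem (W.smul_mem _ (W.add_mem (W.add_mem (W.smul_mem _ h1) (W.smul_mem _ hT))
    (W.add_mem (W.add_mem (W.smul_mem _ h2) (W.smul_mem _ hLm'))
      (W.add_mem (W.smul_mem _ h3) (W.smul_mem _ hLm))))) (W.smul_mem _ hZm)

theorem exists_bracket_combination (hL : AnalyticAt ℝ L p) {f g : R5 → ℂ} (hf : AnalyticAt ℝ f p)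
    (hg : AnalyticAt ℝ g p) : ∃ a b c : R5 → ℂ, AnalyticAt ℝ a p ∧ AnalyticAt ℝ b p ∧
      AnalyticAt ℝ c p ∧
      bracket (fun q => f q • L q) (fun q => g q • conjField L q) =ᶠ[𝓝 p]
        fun q => a q • fieldT L q + (b q • conjField L q + c q • L q) := by
  have hL' := analyticAt_conjField hL
  refine ⟨fun q => -Complex.I * (f q * g q), fun q => f q * cD g q (L q),
    fun q => -cD f q (g q • conjField L q), analyticAt_const.fun_mul (hf.fun_mul hg),
    hf.fun_mul (analyticAt_cD hg hL), (analyticAt_cD hf (hg.fun_smul hL')).fun_neg, ?_⟩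
  filter_upwards [hf.eventually_analyticAt, hg.eventually_analyticAt, hL.eventually_analyticAt]
    with q hfq hgq hLq
  rw [bracket_smul_left hfq.differentiableAt hLq.differentiableAt,
    bracket_smul_right hgq.differentiableAt (analyticAt_conjField hLq).differentiableAt,
    bracket_L_conjL]
  module

/-- All sections are multiples of `ℒ` or of `ℒ̄`. By the Leibniz rule, the derivatives of the
coefficients only contribute terms in `ℒ, ℒ̄, 𝒯`, and the remaining brackets are multiples of `𝒯`,
`𝒮`, `𝒮̄`. -/
theorem thirdOrderSpan_le {M : LocalSubmanifold} (hL : M.IsGenerator L) (hp : p ∈ M.U) :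
    M.thirdOrderSpan p ≤ frameSpan L p := by
  have hLa := hL.analytic p hp
  have hLa' := analyticAt_conjField hLa
  set W := frameSpan L p with hW
  have hbr : ∀ {X Y : R5 → C5}, X ∈ M.Sections10 p → Y ∈ M.Sections01 p →
      ∃ a b c : R5 → ℂ, AnalyticAt ℝ a p ∧ AnalyticAt ℝ b p ∧ AnalyticAt ℝ c p ∧
      bracket X Y =ᶠ[𝓝 p] fun q => a q • fieldT L q + (b q • conjField L q + c q • L q) := by
    intro X Y hX hY
    obtain ⟨f, hf, hXf⟩ := hL.exists_smul hp hX
    obtain ⟨g, hg, hYg⟩ := hL.exists_smul_conj hp hY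
    obtain ⟨a, b, c, ha, hb, hc, h⟩ := exists_bracket_combination hLa hf hg
    refine ⟨a, b, c, ha, hb, hc, Filter.EventuallyEq.trans ?_ h⟩
    filter_upwards [hXf.eventuallyEq_nhds, hYg.eventuallyEq_nhds] with q h1 h2
    exact bracket_congr h1 h2
  rw [LocalSubmanifold.thirdOrderSpan, Submodule.span_le]
  rintro v ((((⟨X, hX, rfl⟩ | ⟨Y, hY, rfl⟩) | ⟨X, hX, Y, hY, rfl⟩) | ⟨X', hX', X, hX, Y, hY, rfl⟩) |
    ⟨Y', hY', X, hX, Y, hY, rfl⟩)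
  · obtain ⟨f, hf, h⟩ := hL.exists_smul hp hX
    rw [h.eq_of_nhds]
    exact W.smul_mem _ L_mem
  · obtain ⟨f, hf, h⟩ := hL.exists_smul_conj hp hY
    rw [h.eq_of_nhds]
    exact W.smul_mem _ conjL_mem
  · obtain ⟨a, b, c, ha, hb, hc, h⟩ := hbr hX hY
    rw [h.eq_of_nhds]
    exact W.add_mem (W.smul_mem _ fieldT_mem)
      (W.add_mem (W.smul_mem _ conjL_mem) (W.smul_mem _ L_mem))
  · obtain ⟨a, b, c, ha, hb, hc, h⟩ := hbr hX hY
    obtain ⟨f, hf, hXf⟩ := hL.exists_smul hp hX'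
    rw [bracket_congr hXf (Filter.EventuallyEq.refl _ _)]
    refine bracket_combination_mem hLa hLa L_mem fieldT_mem L_mem conjL_mem fieldS_mem ?_ ?_
      hf ha hb hc h
    · rw [bracket_L_conjL]; exact W.smul_mem _ fieldT_mem
    · rw [bracket_self]; exact W.zero_mem
  · obtain ⟨a, b, c, ha, hb, hc, h⟩ := hbr hX hY
    obtain ⟨f, hf, hYf⟩ := hL.exists_smul_conj hp hY'
    rw [bracket_congr hYf (Filter.EventuallyEq.refl _ _)]
    refine bracket_combination_mem hLa hLa' conjL_mem fieldT_mem L_mem conjL_mem ?_ ?_ ?_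
      hf ha hb hc h
    · rw [bracket_conjL_T hLa]; exact conjS_mem
    · rw [bracket_self]; exact W.zero_mem
    · rw [bracket_swap, bracket_L_conjL]; exact W.neg_mem (W.smul_mem _ fieldT_mem)

/-- The span of dimension five in Class III₁ is everything and lies in the span of the five fields,
so these fields form a basis. -/
theorem isUnit_det_frameMatrix {M : LocalSubmanifold} (hM : M.IsClassIII1) (hL : M.IsGenerator L)
    (hp : p ∈ M.U) : IsUnit (frameMatrix L p).det := by
  have h1 : M.thirdOrderSpan p = ⊤ :=
    Submodule.eq_top_of_finrank_eq (by rw [hM.2 p hp]; simp)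
  have h2 : frameSpan L p = ⊤ := top_le_iff.1 (h1 ▸ thirdOrderSpan_le hL hp)
  rw [frameSpan, ← Matrix.range_mulVecLin, LinearMap.range_eq_top] at h2
  exact (Matrix.isUnit_iff_isUnit_det _).1 (Matrix.mulVec_surjective_iff_isUnit.1 h2)

end Frame

end Generators

/-! ### Solving the normalization equations at a point -/

section AdaptedCoframes

/-- The structure equations of an adapted coframe `(σ, ρ, ζ)` with connection form `θ` at `p`. -/
def StructureAt (σ ρ ζ θ : R5 → C5) (p : R5) (K V₁ V₃ : ℂ) : Prop :=
  (∀ X Y, dM σ p X Y = 2 * wd (θ p) (σ p) X Y + wd (star (θ p)) (σ p) X Y +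
    K * wd (star (σ p)) (star (ζ p)) X Y + wd (ρ p) (ζ p) X Y) ∧
  ∀ X Y, dM ρ p X Y = wd (θ p) (ρ p) X Y + wd (star (θ p)) (ρ p) X Y +
    V₁ * wd (star (σ p)) (σ p) X Y + V₃ * wd (star (σ p)) (star (ζ p)) X Y +
    conj V₃ * wd (σ p) (ζ p) X Y + Complex.I * wd (ζ p) (star (ζ p)) X Y

/-- The combination `2 θ + θ̄` that solves the structure equations. -/
noncomputable def weightForm (σ ρ ζ : C5) (m₀ x m₂ m₃ m₄ : ℂ) : C5 :=
  m₀ • star σ + x • σ + m₂ • ρ + m₃ • star ζ + m₄ • ζ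

theorem star_eq_conj (c : ℂ) : star c = conj c := rfl

/-- The form `θ` enters `dσ` only through `W = 2θ + θ̄` and `dρ` only through `θ + θ̄ = (W + W̄)/3`;
conversely `θ = (2W - W̄)/3`. The terms of `dσ` that contain `σ` fix `W` up to a multiple of `σ`,
and the `σ ∧ ρ` term of `dρ` fixes that multiple. Three terms cannot be absorbed in `θ` and
determine the change of `ζ₀`: `σ̄ ∧ ρ` in `dσ` gives `D` (`hs₂`), `σ̄ ∧ ζ₀` in `dρ` gives `E`
(`hv₄`), and `ρ ∧ ζ₀` in `dρ` gives `B` (`ht`). -/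
theorem structureAt_of_coefficients {σ ρ ζ θ : R5 → C5} {p : R5} {ζ₀ : C5}
    {B E D s₁ s₂ K s₅ s₆ s₇ v₁ v₂ v₃ v₄ t m₀ y : ℂ} (hρ : star (ρ p) = ρ p)
    (hσ : ∀ X Y, dM σ p X Y = s₁ * wd (star (σ p)) (σ p) X Y + s₂ * wd (star (σ p)) (ρ p) X Y +
      K * wd (star (σ p)) (star ζ₀) X Y + s₅ * wd (σ p) (ρ p) X Y + s₆ * wd (σ p) (star ζ₀) X Y +
      s₇ * wd (σ p) ζ₀ X Y + wd (ρ p) ζ₀ X Y)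
    (hdρ : ∀ X Y, dM ρ p X Y = v₁ * wd (star (σ p)) (σ p) X Y + v₂ * wd (star (σ p)) (ρ p) X Y +
      conj v₂ * wd (σ p) (ρ p) X Y + v₃ * wd (star (σ p)) (star ζ₀) X Y +
      conj v₃ * wd (σ p) ζ₀ X Y + v₄ * wd (star (σ p)) ζ₀ X Y +
      conj v₄ * wd (σ p) (star ζ₀) X Y + t * wd (ρ p) ζ₀ X Y + conj t * wd (ρ p) (star ζ₀) X Y +
      Complex.I * wd ζ₀ (star ζ₀) X Y)
    (hs₂ : s₂ = K * conj B - D) (hv₄ : v₄ = -Complex.I * conj E)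
    (ht : t = (s₇ + conj s₆) / 3 - Complex.I * conj B)
    (hm₀ : m₀ = s₁ - K * conj D + s₆ * conj E + s₇ * D)
    (hy : y = conj v₂ - B * conj v₃ - conj B * conj v₄ + t * E + conj t * conj D +
      Complex.I * E * conj B - Complex.I * B * conj D)
    (hζ : ζ p = ζ₀ + B • ρ p + E • σ p + D • star (σ p))
    (hθ : θ p = (2 / 3 : ℂ) • weightForm (σ p) (ρ p) (ζ p) m₀ (3 * y - conj m₀)
        (-(s₅ - s₆ * conj B - s₇ * B + E)) (-s₆) (-s₇) -
      (1 / 3 : ℂ) • star (weightForm (σ p) (ρ p) (ζ p) m₀ (3 * y - conj m₀)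
        (-(s₅ - s₆ * conj B - s₇ * B + E)) (-s₆) (-s₇))) :
    StructureAt σ ρ ζ θ p K
      (v₁ - v₃ * conj D + conj v₃ * D - v₄ * E + conj v₄ * conj E - Complex.I * E * conj E +
        Complex.I * D * conj D) (v₃ - Complex.I * D) := by
  have hζb : star (ζ p) = star ζ₀ + conj B • ρ p + conj E • star (σ p) + conj D • σ p := by
    rw [hζ]
    simp only [star_add, star_smul, star_star, hρ]
    rfl
  set W := weightForm (σ p) (ρ p) (ζ p) m₀ (3 * y - conj m₀)
        (-(s₅ - s₆ * conj B - s₇ * B + E)) (-s₆) (-s₇) with hW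
  have hWb : star W = conj m₀ • σ p + (3 * conj y - m₀) • star (σ p) +
      conj (-(s₅ - s₆ * conj B - s₇ * B + E)) • ρ p + (-conj s₆) • ζ p +
      (-conj s₇) • star (ζ p) := by
    rw [hW, weightForm]
    simp only [star_add, star_smul, star_star, hρ, star_eq_conj, map_sub, map_mul, map_neg,
      map_ofNat, Complex.conj_conj]
  have hθb : star (θ p) = (2 / 3 : ℂ) • star W - (1 / 3 : ℂ) • W := by
    rw [hθ]
    simp only [star_sub, star_smul, star_star, star_eq_conj, map_div₀, map_one, map_ofNat]
  rw [weightForm] at hW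
  rw [StructureAt]
  -- From here on the conjugate forms are independent symbols, and both structure equations become
  -- polynomial identities.
  generalize star (θ p) = θb at hθb ⊢
  generalize star W = Wb at hθ hθb hWb
  generalize star (ζ p) = ζb at hW hWb hζb ⊢
  subst hs₂ hv₄ ht
  constructor
  · intro X Y
    rw [hσ]
    simp only [wd, hθb, hθ, hWb, hW, hζb, hζ, add_dotProduct, sub_dotProduct, smul_dotProduct,
      smul_eq_mul]
    subst hm₀
    ring
  · intro X Y
    rw [hdρ]
    subst hy
    simp only [wd, hθb, hθ, hWb, hW, hζb, hζ, add_dotProduct, sub_dotProduct, smul_dotProduct,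
      smul_eq_mul, map_sub, map_add, map_mul, map_neg, map_div₀, map_one, map_ofNat,
      Complex.conj_conj, Complex.conj_I]
    ring

end AdaptedCoframes

/-! ### Dual frames, conjugation and triangular changes of coframe -/

section DualFrames

/-- `e` and `F` are dual bases. -/
structure IsDualFrame (e F : Fin 5 → C5) : Prop where
  dual : ∀ a b, e a ⬝ᵥ F b = if a = b then 1 else 0
  expand : ∀ X, X = ∑ a, (e a ⬝ᵥ X) • F a

theorem IsDualFrame.row_ext {e F : Fin 5 → C5} (h : IsDualFrame e F) {r r' : C5}
    (hr : ∀ b, r ⬝ᵥ F b = r' ⬝ᵥ F b) : r = r' := by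
  have h1 : ∀ X, r ⬝ᵥ X = r' ⬝ᵥ X := fun X => by
    rw [h.expand X, dotProduct_sum, dotProduct_sum]
    exact Finset.sum_congr rfl fun a _ => by rw [dotProduct_smul, dotProduct_smul, hr]
  ext j
  have := h1 (Pi.single j 1)
  simpa using this

/-- The covectors of the initial coframe. -/
noncomputable def coRow (L : R5 → C5) (a : Fin 5) (p : R5) : C5 := (frameMatrix L p)⁻¹ a

/-- The vector fields of the initial frame. -/
noncomputable def frame (L : R5 → C5) (a : Fin 5) (p : R5) : C5 := (frameMatrix L p).col a

theorem initialCoframe_eq (L : R5 → C5) (p : R5) (X : C5) (a : Fin 5) :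
    initialCoframe L p X a = coRow L a p ⬝ᵥ X := rfl

variable {L : R5 → C5} {p : R5}

theorem isDualFrame_frame (h : IsUnit (frameMatrix L p).det) :
    IsDualFrame (fun a => coRow L a p) (fun a => frame L a p) where
  dual a b := by
    have h1 := congrFun (congrFun (Matrix.nonsing_inv_mul _ h) a) b
    rw [Matrix.one_apply] at h1
    exact h1
  expand X := by
    have h1 : frameMatrix L p *ᵥ ((frameMatrix L p)⁻¹ *ᵥ X) = X := by
      rw [Matrix.mulVec_mulVec, Matrix.mul_nonsing_inv _ h, Matrix.one_mulVec]
    conv_lhs => rw [← h1]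
    ext i
    simp only [Matrix.mulVec, dotProduct, Finset.sum_apply, Pi.smul_apply, smul_eq_mul, coRow,
      frame, Matrix.col]
    exact Finset.sum_congr rfl fun a _ => mul_comm _ _

theorem frame_zero : frame L 0 p = conjField (fieldS L) p := rfl
theorem frame_one : frame L 1 p = fieldS L p := rfl
theorem frame_two : frame L 2 p = fieldT L p := rfl
theorem frame_three : frame L 3 p = conjField L p := rfl
theorem frame_four : frame L 4 p = L p := rfl

theorem analyticAt_frame (hL : AnalyticAt ℝ L p) (a : Fin 5) : AnalyticAt ℝ (frame L a) p := by
  fin_cases a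
  · exact analyticAt_conjField (analyticAt_fieldS hL)
  · exact analyticAt_fieldS hL
  · exact analyticAt_fieldT hL
  · exact analyticAt_conjField hL
  · exact hL

theorem analyticAt_coRow (hL : AnalyticAt ℝ L p) (h : IsUnit (frameMatrix L p).det) (a : Fin 5) :
    AnalyticAt ℝ (coRow L a) p := by
  refine analyticAt_pi_iff.2 fun j => analyticAt_inv_entry (fun i k => ?_) h.ne_zero a j
  exact analyticAt_pi_iff.1 (analyticAt_frame hL k) i

/-- Conjugation exchanges `𝒮` with `𝒮̄` and `ℒ` with `ℒ̄` and fixes `𝒯`; it therefore permutes the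
dual coframe in the same way. The two lemmas below have the same reason. -/
theorem star_coRow_one (hL : AnalyticAt ℝ L p) (h : IsUnit (frameMatrix L p).det) :
    star (coRow L 1 p) = coRow L 0 p := by
  have hd := isDualFrame_frame h
  refine hd.row_ext fun b => ?_
  rw [star_dotProduct_eq, hd.dual]
  fin_cases b
  · exact (congrArg conj ((congrArg (coRow L 1 p ⬝ᵥ ·) (star_star (fieldS L p))).trans
      (hd.dual 1 1))).trans (by simp)
  · exact (congrArg conj (hd.dual 1 0)).trans (by simp)
  · exact (congrArg conj ((congrArg (coRow L 1 p ⬝ᵥ ·) (conjField_fieldT hL.differentiableAt)).trans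
      (hd.dual 1 2))).trans (by simp)
  · exact (congrArg conj ((congrArg (coRow L 1 p ⬝ᵥ ·) (star_star (L p))).trans
      (hd.dual 1 4))).trans (by simp)
  · exact (congrArg conj (hd.dual 1 3)).trans (by simp)

theorem star_coRow_two (hL : AnalyticAt ℝ L p) (h : IsUnit (frameMatrix L p).det) :
    star (coRow L 2 p) = coRow L 2 p := by
  have hd := isDualFrame_frame h
  refine hd.row_ext fun b => ?_
  rw [star_dotProduct_eq, hd.dual]
  fin_cases b
  · exact (congrArg conj ((congrArg (coRow L 2 p ⬝ᵥ ·) (star_star (fieldS L p))).trans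
      (hd.dual 2 1))).trans (by simp)
  · exact (congrArg conj (hd.dual 2 0)).trans (by simp)
  · exact (congrArg conj ((congrArg (coRow L 2 p ⬝ᵥ ·) (conjField_fieldT hL.differentiableAt)).trans
      (hd.dual 2 2))).trans (by simp)
  · exact (congrArg conj ((congrArg (coRow L 2 p ⬝ᵥ ·) (star_star (L p))).trans
      (hd.dual 2 4))).trans (by simp)
  · exact (congrArg conj (hd.dual 2 3)).trans (by simp)

theorem star_coRow_four (hL : AnalyticAt ℝ L p) (h : IsUnit (frameMatrix L p).det) :
    star (coRow L 4 p) = coRow L 3 p := by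
  have hd := isDualFrame_frame h
  refine hd.row_ext fun b => ?_
  rw [star_dotProduct_eq, hd.dual]
  fin_cases b
  · exact (congrArg conj ((congrArg (coRow L 4 p ⬝ᵥ ·) (star_star (fieldS L p))).trans
      (hd.dual 4 1))).trans (by simp)
  · exact (congrArg conj (hd.dual 4 0)).trans (by simp)
  · exact (congrArg conj ((congrArg (coRow L 4 p ⬝ᵥ ·) (conjField_fieldT hL.differentiableAt)).trans
      (hd.dual 4 2))).trans (by simp)
  · exact (congrArg conj ((congrArg (coRow L 4 p ⬝ᵥ ·) (star_star (L p))).trans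
      (hd.dual 4 4))).trans (by simp)
  · exact (congrArg conj (hd.dual 4 3)).trans (by simp)

/-- The change of a coframe `(σ̄, σ, ρ, ζ̄, ζ)` that replaces `ρ` by `ρ + C σ + C̄ σ̄`. -/
theorem IsDualFrame.shear {e F : Fin 5 → C5} (h : IsDualFrame e F) (c : ℂ) :
    IsDualFrame ![e 0, e 1, conj c • e 0 + c • e 1 + e 2, e 3, e 4]
      ![F 0 - conj c • F 2, F 1 - c • F 2, F 2, F 3, F 4] where
  dual a b := by
    fin_cases a <;> fin_cases b <;>
      simp [add_dotProduct, smul_dotProduct, dotProduct_sub, dotProduct_smul, h.dual]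
  expand X := by
    conv_lhs => rw [h.expand X]
    simp only [Fin.sum_univ_five, Matrix.cons_val, add_dotProduct, smul_dotProduct, smul_eq_mul]
    module

/-- The change of a coframe `(σ̄, σ, ρ, ζ̄, ζ)` that adds multiples of `σ̄, σ, ρ` to `ζ`. -/
theorem IsDualFrame.shear_zeta {e F : Fin 5 → C5} (h : IsDualFrame e F) (b d k b' d' k' : ℂ) :
    IsDualFrame ![e 0, e 1, e 2, e 3 + b' • e 2 + k' • e 0 + d' • e 1,
        e 4 + b • e 2 + k • e 1 + d • e 0]
      ![F 0 - d • F 4 - k' • F 3, F 1 - k • F 4 - d' • F 3, F 2 - b • F 4 - b' • F 3, F 3, F 4] where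
  dual a b := by
    fin_cases a <;> fin_cases b <;>
      simp [add_dotProduct, smul_dotProduct, dotProduct_sub, dotProduct_smul, h.dual]
  expand X := by
    conv_lhs => rw [h.expand X]
    simp only [Fin.sum_univ_five, Matrix.cons_val, add_dotProduct, smul_dotProduct, smul_eq_mul]
    module

end DualFrames

/-! ### Uniqueness of the normalized coframe -/

section Uniqueness

variable {σ ρ ζ θ ρ' ζ' θ' : R5 → C5} {p : R5} {F : Fin 5 → C5}

/-- The normalized `dσ` has no `σ̄ ∧ ζ` term. A change of `ρ` by `c' σ̄` would create the term `c'
σ̄ ∧ ζ` from `ρ' ∧ ζ'`, so `c' = 0`; the multiple of `σ` disappears because `ρ` and `ρ'` are real.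
-/
theorem rho_eq_of_structureAt (hF : IsDualFrame ![star (σ p), σ p, ρ p, star (ζ p), ζ p] F)
    (hρ : star (ρ p) = ρ p) (hρ' : star (ρ' p) = ρ' p) {b c d k c' : ℂ}
    (h1 : ρ' p = ρ p + c • σ p + c' • star (σ p))
    (h2 : ζ' p = ζ p + b • ρ p + k • σ p + d • star (σ p))
    {K V₁ V₃ K' V₁' V₃' : ℂ} (hs : StructureAt σ ρ ζ θ p K V₁ V₃)
    (hs' : StructureAt σ ρ' ζ' θ' p K' V₁' V₃') : ρ' p = ρ p := by
  have e0 : ∀ b, star (σ p) ⬝ᵥ F b = if 0 = b then 1 else 0 := hF.dual 0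
  have e1 : ∀ b, σ p ⬝ᵥ F b = if 1 = b then 1 else 0 := hF.dual 1
  have e2 : ∀ b, ρ p ⬝ᵥ F b = if 2 = b then 1 else 0 := hF.dual 2
  have e3 : ∀ b, star (ζ p) ⬝ᵥ F b = if 3 = b then 1 else 0 := hF.dual 3
  have e4 : ∀ b, ζ p ⬝ᵥ F b = if 4 = b then 1 else 0 := hF.dual 4
  have h2' : star (ζ' p) = star (ζ p) + conj b • ρ p + conj k • star (σ p) + conj d • σ p := by
    rw [h2]
    simp only [star_add, star_smul, star_star, hρ, star_eq_conj]
  have key := (hs.1 (F 0) (F 4)).symm.trans (hs'.1 (F 0) (F 4))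
  simp only [wd, h2'] at key
  simp only [h1, h2, add_dotProduct, smul_dotProduct, e0, e1, e2, e3, e4] at key
  simp at key
  subst key
  rw [zero_smul, add_zero] at h1
  have h3 := hρ'
  rw [h1, star_add, star_smul, hρ, add_right_inj] at h3
  have h4 := congrArg (· ⬝ᵥ F 1) h3
  simp only [smul_dotProduct, e0, e1] at h4
  simp at h4
  rw [h1, ← h4, zero_smul, add_zero]

/-- The two sets of equations are subtracted, with `M = 2(θ' - θ) + conj(θ' - θ)`. The terms `σ ∧ ζ`
and `σ ∧ ζ̄` of `dσ` show that `M` has no `ζ, ζ̄` components. Then `ρ ∧ ζ` in `dρ` gives `b = 0`,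
`σ̄ ∧ ρ` in `dσ` gives `d = 0`, and `σ ∧ ζ̄` in `dρ` gives `k = 0`. The other components of `M` now
vanish, and `3(θ' - θ) = 2M - M̄`. Since `dρ` is compared, `ρ'` and `ρ` have to agree near the point
and not only at it. -/
theorem eq_of_structureAt (hF : IsDualFrame ![star (σ p), σ p, ρ p, star (ζ p), ζ p] F)
    (hρ : star (ρ p) = ρ p) (hρ' : ρ' =ᶠ[𝓝 p] ρ) {b d k : ℂ}
    (h2 : ζ' p = ζ p + b • ρ p + k • σ p + d • star (σ p))
    {K V₁ V₃ K' V₁' V₃' : ℂ} (hs : StructureAt σ ρ ζ θ p K V₁ V₃)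
    (hs' : StructureAt σ ρ' ζ' θ' p K' V₁' V₃') : ζ' p = ζ p ∧ θ' p = θ p := by
  have e0 : ∀ b, star (σ p) ⬝ᵥ F b = if 0 = b then 1 else 0 := hF.dual 0
  have e1 : ∀ b, σ p ⬝ᵥ F b = if 1 = b then 1 else 0 := hF.dual 1
  have e2 : ∀ b, ρ p ⬝ᵥ F b = if 2 = b then 1 else 0 := hF.dual 2
  have e3 : ∀ b, star (ζ p) ⬝ᵥ F b = if 3 = b then 1 else 0 := hF.dual 3
  have e4 : ∀ b, ζ p ⬝ᵥ F b = if 4 = b then 1 else 0 := hF.dual 4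
  have h2' : star (ζ' p) = star (ζ p) + conj b • ρ p + conj k • star (σ p) + conj d • σ p := by
    rw [h2]
    simp only [star_add, star_smul, star_star, hρ, star_eq_conj]
  obtain ⟨hσ1, hρ1⟩ := hs
  obtain ⟨hσ2, hρ2⟩ := hs'
  rw [dM_congr hρ', hρ'.eq_of_nhds] at hρ2
  rw [hρ'.eq_of_nhds] at hσ2
  set M : C5 := (2 : ℂ) • (θ' p - θ p) + star (θ' p - θ p) with hM
  have hMst : star M = (2 : ℂ) • star (θ' p - θ p) + (θ' p - θ p) := by
    rw [hM, star_add, star_smul, star_star, star_eq_conj, map_ofNat]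
  have keyσ : ∀ X Y, wd M (σ p) X Y + (K' * wd (star (σ p)) (star (ζ' p)) X Y +
      wd (ρ p) (ζ' p) X Y) - (K * wd (star (σ p)) (star (ζ p)) X Y + wd (ρ p) (ζ p) X Y) = 0 := by
    intro X Y
    have h := (hσ1 X Y).symm.trans (hσ2 X Y)
    simp only [wd, hM, star_sub, add_dotProduct, smul_dotProduct, sub_dotProduct,
      smul_eq_mul] at h ⊢
    linear_combination -h
  have keyρ : ∀ X Y, wd M (ρ p) X Y + wd (star M) (ρ p) X Y +
      3 * (V₁' * wd (star (σ p)) (σ p) X Y + V₃' * wd (star (σ p)) (star (ζ' p)) X Y +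
        conj V₃' * wd (σ p) (ζ' p) X Y + Complex.I * wd (ζ' p) (star (ζ' p)) X Y) -
      3 * (V₁ * wd (star (σ p)) (σ p) X Y + V₃ * wd (star (σ p)) (star (ζ p)) X Y +
        conj V₃ * wd (σ p) (ζ p) X Y + Complex.I * wd (ζ p) (star (ζ p)) X Y) = 0 := by
    intro X Y
    have h := (hρ1 X Y).symm.trans (hρ2 X Y)
    rw [hMst]
    simp only [wd, hM, star_sub, add_dotProduct, smul_dotProduct, sub_dotProduct,
      smul_eq_mul] at h ⊢
    linear_combination -3 * h
  have k02 := keyσ (F 0) (F 2)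
  have k03 := keyσ (F 0) (F 3)
  have k12 := keyσ (F 1) (F 2)
  have k13 := keyσ (F 1) (F 3)
  have k14 := keyσ (F 1) (F 4)
  simp only [wd, h2'] at k02 k03 k12 k13 k14
  simp only [h2, add_dotProduct, smul_dotProduct, e0, e1, e2, e3, e4] at k02 k03 k12 k13 k14
  simp at k02 k03 k12 k13 k14
  have hMe : M = (M ⬝ᵥ F 0) • star (σ p) + (M ⬝ᵥ F 1) • σ p + (M ⬝ᵥ F 2) • ρ p := by
    refine hF.row_ext fun b => ?_
    simp only [add_dotProduct, smul_dotProduct, e0, e1, e2]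
    fin_cases b <;> simp [k13, k14]
  have hMe' : star M = conj (M ⬝ᵥ F 0) • σ p + conj (M ⬝ᵥ F 1) • star (σ p) +
      conj (M ⬝ᵥ F 2) • ρ p := by
    conv_lhs => rw [hMe]
    simp only [star_add, star_smul, star_star, hρ, star_eq_conj]
  have r24 := keyρ (F 2) (F 4)
  rw [hMe'] at r24
  simp only [wd, h2'] at r24
  simp only [h2, add_dotProduct, smul_dotProduct, e0, e1, e2, e3, e4] at r24
  simp [k14] at r24
  subst r24
  simp at k02
  subst k02
  have r13 := keyρ (F 1) (F 3)
  rw [hMe'] at r13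
  simp only [wd, h2'] at r13
  simp only [h2, add_dotProduct, smul_dotProduct, e0, e1, e2, e3, e4] at r13
  simp [k13] at r13
  subst r13
  have hζ : ζ' p = ζ p := by rw [h2]; simp
  refine ⟨hζ, ?_⟩
  have k01 := keyσ (F 0) (F 1)
  rw [hζ] at k01
  simp only [wd, e0, e1, e2, e3, e4] at k01
  simp at k01 k12
  have r12 := keyρ (F 1) (F 2)
  rw [hMe', hζ] at r12
  simp only [wd, add_dotProduct, smul_dotProduct, e0, e1, e2, e3, e4] at r12
  simp [k01] at r12
  have hM0 : M = 0 := by rw [hMe, k01, k12, r12]; simp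
  have hM0' : (2 : ℂ) • star (θ' p - θ p) + (θ' p - θ p) = 0 := by rw [← hMst, hM0, star_zero]
  have h3 : (3 : ℂ) • (θ' p - θ p) = 0 := by
    have : (3 : ℂ) • (θ' p - θ p) = (2 : ℂ) • M -
        ((2 : ℂ) • star (θ' p - θ p) + (θ' p - θ p)) := by
      rw [hM]; module
    rw [this, hM0, hM0']; simp
  rw [smul_eq_zero] at h3
  exact sub_eq_zero.1 (h3.resolve_left (by norm_num))

end Uniqueness

/-! ### Existence of an analytic normalized coframe -/

section Reduction

attribute [local fun_prop] analyticAt_conj'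

@[fun_prop]
theorem analyticAt_star' {E : Type*} [NormedAddCommGroup E] [NormedSpace ℝ E] {f : E → C5} {x : E}
    (hf : AnalyticAt ℝ f x) : AnalyticAt ℝ (fun y => star (f y)) x := by
  rw [analyticAt_pi_iff] at hf ⊢
  exact fun i => analyticAt_conj' (hf i)

variable {L : R5 → C5} {p : R5}

/-- In Cartan's formula the pairings of coframe and frame are constant, so only the bracket term
survives: the coefficients of the differentials are the structure functions of the frame. -/
theorem dM_coRow_frame (hL : AnalyticAt ℝ L p) (h : ∀ᶠ q in 𝓝 p, IsUnit (frameMatrix L q).det)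
    (a b c : Fin 5) : dM (coRow L a) p (frame L b p) (frame L c p) =
      - (coRow L a p ⬝ᵥ bracket (frame L b) (frame L c) p) := by
  refine dM_cartan_of_eq_zero (a := if a = c then 1 else 0) (b := if a = b then 1 else 0)
    (analyticAt_coRow hL h.self_of_nhds a).differentiableAt (analyticAt_frame hL b).differentiableAt
    (analyticAt_frame hL c).differentiableAt ?_ ?_
  · filter_upwards [h] with q hq using (isDualFrame_frame hq).dual a c
  · filter_upwards [h] with q hq using (isDualFrame_frame hq).dual a b

theorem bracket_conjL_L (L : R5 → C5) (p : R5) :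
    bracket (conjField L) L p = Complex.I • fieldT L p := by
  rw [bracket_swap, bracket_L_conjL]; simp

theorem bracket_conjS_conjL (hL : AnalyticAt ℝ L p) :
    bracket (conjField (fieldS L)) (conjField L) p = - star (bracket L (fieldS L) p) := by
  rw [bracket_conj (analyticAt_fieldS hL).differentiableAt hL.differentiableAt, bracket_swap,
    star_neg]

/-- The normalized coframe of a generator. -/
theorem exists_adapted_coframe {U : Set R5} (hU : IsOpen U) (hL : AnalyticOnNhd ℝ L U)
    (hdet : ∀ p ∈ U, IsUnit (frameMatrix L p).det) :
    ∃ (B C D E : R5 → ℂ) (ρ ζ θ : R5 → C5), ∀ p ∈ U,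
      AnalyticAt ℝ B p ∧ AnalyticAt ℝ C p ∧ AnalyticAt ℝ D p ∧ AnalyticAt ℝ E p ∧
      AnalyticAt ℝ ρ p ∧ AnalyticAt ℝ ζ p ∧ AnalyticAt ℝ θ p ∧
      ρ p = conj (C p) • coRow L 0 p + C p • coRow L 1 p + coRow L 2 p ∧
      ζ p = conj (D p) • coRow L 0 p + E p • coRow L 1 p + B p • coRow L 2 p + coRow L 4 p ∧
      ∃ V₁ V₃, StructureAt (coRow L 1) ρ ζ θ p (conj (invariantR L p)) V₁ V₃ := by
  have hev : ∀ {p}, p ∈ U → ∀ᶠ q in 𝓝 p, IsUnit (frameMatrix L q).det := fun hp =>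
    Filter.mem_of_superset (hU.mem_nhds hp) hdet
  have hfr : ∀ {p}, p ∈ U → ∀ a, AnalyticAt ℝ (frame L a) p := fun hp a =>
    analyticAt_frame (hL _ hp) a
  have hco : ∀ {p}, p ∈ U → ∀ a, AnalyticAt ℝ (coRow L a) p := fun hp a =>
    analyticAt_coRow (hL _ hp) (hdet _ hp) a
  -- `C` is chosen to kill the `σ̄ ∧ ζ` term of `dσ₀`: in the new dual frame `𝒮̄` becomes `𝒮̄ - C̄
  -- 𝒯`, and `dσ₀(𝒯, ℒ) = 1`.
  obtain ⟨C, hC⟩ : ∃ C : R5 → ℂ, ∀ q, C q = conj (dM (coRow L 1) q (frame L 0 q) (frame L 4 q)) :=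
    ⟨_, fun _ => rfl⟩
  have hCa : ∀ {p}, p ∈ U → AnalyticAt ℝ C p := fun hp => by
    rw [funext hC]; exact analyticAt_conj' (analyticAt_dM (hco hp 1) (hfr hp 0) (hfr hp 4))
  obtain ⟨ρ, hρ⟩ : ∃ ρ : R5 → C5, ∀ q, ρ q = conj (C q) • coRow L 0 q + C q • coRow L 1 q +
      coRow L 2 q := ⟨_, fun _ => rfl⟩
  have hρa : ∀ {p}, p ∈ U → AnalyticAt ℝ ρ p := fun {p} hp => by
    rw [funext hρ]
    have h0 := hco hp 0
    have h1 := hco hp 1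
    have h2 := hco hp 2
    have h3 := hCa hp
    fun_prop
  obtain ⟨F0, hF0⟩ : ∃ F0 : R5 → C5, ∀ q, F0 q = frame L 0 q - conj (C q) • frame L 2 q :=
    ⟨_, fun _ => rfl⟩
  obtain ⟨F1, hF1⟩ : ∃ F1 : R5 → C5, ∀ q, F1 q = frame L 1 q - C q • frame L 2 q :=
    ⟨_, fun _ => rfl⟩
  have hF0a : ∀ {p}, p ∈ U → AnalyticAt ℝ F0 p := fun {p} hp => by
    rw [funext hF0]
    have h0 := hfr hp 0
    have h2 := hfr hp 2
    have h3 := hCa hp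
    fun_prop
  have hF1a : ∀ {p}, p ∈ U → AnalyticAt ℝ F1 p := fun {p} hp => by
    rw [funext hF1]
    have h0 := hfr hp 1
    have h2 := hfr hp 2
    have h3 := hCa hp
    fun_prop
  -- the coefficients of `dσ` and `dρ`
  have mk : ∀ (η X Y : R5 → C5), (∀ {p}, p ∈ U → AnalyticAt ℝ η p) →
      (∀ {p}, p ∈ U → AnalyticAt ℝ X p) → (∀ {p}, p ∈ U → AnalyticAt ℝ Y p) →
      ∃ s : R5 → ℂ, (∀ {p}, p ∈ U → AnalyticAt ℝ s p) ∧ ∀ q, dM η q (X q) (Y q) = s q :=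
    fun η X Y h1 h2 h3 => ⟨_, fun hp => analyticAt_dM (h1 hp) (h2 hp) (h3 hp), fun _ => rfl⟩
  obtain ⟨s₁, as₁, hs₁⟩ := mk (coRow L 1) F0 F1 (hco · 1) hF0a hF1a
  obtain ⟨s₂, as₂, hs₂⟩ := mk (coRow L 1) F0 (frame L 2) (hco · 1) hF0a (hfr · 2)
  obtain ⟨K, aK, hK⟩ := mk (coRow L 1) F0 (frame L 3) (hco · 1) hF0a (hfr · 3)
  obtain ⟨s₅, as₅, hs₅⟩ := mk (coRow L 1) F1 (frame L 2) (hco · 1) hF1a (hfr · 2)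
  obtain ⟨s₆, as₆, hs₆⟩ := mk (coRow L 1) F1 (frame L 3) (hco · 1) hF1a (hfr · 3)
  obtain ⟨s₇, as₇, hs₇⟩ := mk (coRow L 1) F1 (frame L 4) (hco · 1) hF1a (hfr · 4)
  obtain ⟨v₁, -, hv₁⟩ := mk ρ F0 F1 hρa hF0a hF1a
  obtain ⟨v₂, av₂, hv₂⟩ := mk ρ F0 (frame L 2) hρa hF0a (hfr · 2)
  obtain ⟨v₃, av₃, hv₃⟩ := mk ρ F0 (frame L 3) hρa hF0a (hfr · 3)
  obtain ⟨v₄, av₄, hv₄⟩ := mk ρ F0 (frame L 4) hρa hF0a (hfr · 4)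
  obtain ⟨t, at', ht⟩ := mk ρ (frame L 2) (frame L 4) hρa (hfr · 2) (hfr · 4)
  -- `E`, `B` and `D` are the solutions of the equations `hv₄`, `ht` and `hs₂` of
  -- `structureAt_of_coefficients`; `D` comes last because its equation contains `B`.
  obtain ⟨E, hE⟩ : ∃ E : R5 → ℂ, ∀ q, E q = -Complex.I * conj (v₄ q) := ⟨_, fun _ => rfl⟩
  obtain ⟨B, hB⟩ : ∃ B : R5 → ℂ, ∀ q, B q = Complex.I *
      ((conj (s₇ q) + s₆ q) / 3 - conj (t q)) := ⟨_, fun _ => rfl⟩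
  obtain ⟨D, hD⟩ : ∃ D : R5 → ℂ, ∀ q, D q = K q * conj (B q) - s₂ q := ⟨_, fun _ => rfl⟩
  obtain ⟨y, hy⟩ : ∃ y : R5 → ℂ, ∀ q, y q = conj (v₂ q) - B q * conj (v₃ q) -
      conj (B q) * conj (v₄ q) + t q * E q + conj (t q) * conj (D q) +
      Complex.I * E q * conj (B q) - Complex.I * B q * conj (D q) := ⟨_, fun _ => rfl⟩
  obtain ⟨m₀, hm₀⟩ : ∃ m₀ : R5 → ℂ, ∀ q, m₀ q = s₁ q - K q * conj (D q) + s₆ q * conj (E q) +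
      s₇ q * D q := ⟨_, fun _ => rfl⟩
  obtain ⟨ζ, hζ⟩ : ∃ ζ : R5 → C5, ∀ q, ζ q = coRow L 4 q + B q • ρ q + E q • coRow L 1 q +
      D q • star (coRow L 1 q) := ⟨_, fun _ => rfl⟩
  obtain ⟨W, hW⟩ : ∃ W : R5 → C5, ∀ q, W q = weightForm (coRow L 1 q) (ρ q) (ζ q) (m₀ q)
        (3 * y q - conj (m₀ q)) (-(s₅ q - s₆ q * conj (B q) - s₇ q * B q + E q)) (-s₆ q) (-s₇ q) :=
    ⟨_, fun _ => rfl⟩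
  obtain ⟨θ, hθ⟩ : ∃ θ : R5 → C5, ∀ q, θ q = (2 / 3 : ℂ) • W q - (1 / 3 : ℂ) • star (W q) :=
    ⟨_, fun _ => rfl⟩
  -- In `ζ` the multiple `B ρ` contains `B C σ₀ + B C̄ σ̄₀`, so in terms of the initial coframe the
  -- coefficients of `σ₀` and `σ̄₀` are `E + B C` and `D + B C̄`; the announced shape names the
  -- latter by its conjugate.
  refine ⟨B, C, fun q => conj (D q + B q * conj (C q)), fun q => E q + B q * C q, ρ, ζ, θ,
    fun p hp => ?_⟩
  have a₁ := as₁ hp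
  have a₂ := as₂ hp
  have a₅ := as₅ hp
  have a₆ := as₆ hp
  have a₇ := as₇ hp
  have aK' := aK hp
  have b₂ := av₂ hp
  have b₃ := av₃ hp
  have b₄ := av₄ hp
  have a_t := at' hp
  have aC := hCa hp
  have aρ := hρa hp
  have a1 := hco hp 1
  have a4 := hco hp 4
  have aE : AnalyticAt ℝ E p := by rw [funext hE]; fun_prop
  have aB : AnalyticAt ℝ B p := by rw [funext hB]; fun_prop
  have aD : AnalyticAt ℝ D p := by rw [funext hD]; fun_prop
  have ay : AnalyticAt ℝ y p := by rw [funext hy]; fun_prop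
  have am : AnalyticAt ℝ m₀ p := by rw [funext hm₀]; fun_prop
  have aζ : AnalyticAt ℝ ζ p := by rw [funext hζ]; fun_prop
  have aW : AnalyticAt ℝ W p := by
    rw [funext hW]; unfold weightForm; fun_prop
  have aθ : AnalyticAt ℝ θ p := by rw [funext hθ]; fun_prop
  have hLp := hL p hp
  have st1 := star_coRow_one hLp (hdet p hp)
  have st4 := star_coRow_four hLp (hdet p hp)
  have hdual := isDualFrame_frame (hdet p hp)
  have hdual' : IsDualFrame ![star (coRow L 1 p), coRow L 1 p, ρ p, star (coRow L 4 p), coRow L 4 p]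
      ![F0 p, F1 p, frame L 2 p, frame L 3 p, frame L 4 p] := by
    rw [hρ, hF0, hF1, st1, st4]
    exact hdual.shear (C p)
  have hρstar : ∀ {q}, q ∈ U → star (ρ q) = ρ q := fun {q} hq => by
    have h0 := star_coRow_one (hL q hq) (hdet q hq)
    have h2 := star_coRow_two (hL q hq) (hdet q hq)
    rw [hρ, ← h0]
    simp only [star_add, star_smul, star_star, h2, star_eq_conj, Complex.conj_conj]
    abel
  have hbr := dM_coRow_frame hLp (hev hp)
  have c24 : dM (coRow L 1) p (frame L 2 p) (frame L 4 p) = 1 := by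
    rw [hbr, bracket_swap]
    simp only [dotProduct_neg, neg_neg]
    exact hdual.dual 1 1
  have c23 : dM (coRow L 1) p (frame L 2 p) (frame L 3 p) = 0 := by
    rw [hbr, bracket_swap]
    simp only [dotProduct_neg, neg_neg]
    have h := hdual.dual 1 0
    have h' : bracket (frame L 3) (frame L 2) p = frame L 0 p := bracket_conjL_T hLp
    rw [h', h]
    simp
  have c34 : dM (coRow L 1) p (frame L 3 p) (frame L 4 p) = 0 := by
    rw [hbr]
    have h : bracket (frame L 3) (frame L 4) p = Complex.I • frame L 2 p := bracket_conjL_L L p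
    rw [h, dotProduct_smul, hdual.dual]
    simp
  have c04 : dM (coRow L 1) p (F0 p) (frame L 4 p) = 0 := by
    rw [hF0, dM_sub_smul_left, c24, hC, Complex.conj_conj]
    ring
  -- `K` is the value of `dσ₀` on `𝒮̄, ℒ̄`, and the bracket `[𝒮̄, ℒ̄]` is minus the conjugate of
  -- `[ℒ, 𝒮]`; replacing `𝒮̄` by `𝒮̄ - C̄ 𝒯` is harmless because `dσ₀(𝒯, ℒ̄) = 0`.
  have hKR : K p = conj (invariantR L p) := by
    rw [← hK, hF0, dM_sub_smul_left, c23, hbr]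
    have h : bracket (frame L 0) (frame L 3) p = - star (bracket L (fieldS L) p) :=
      bracket_conjS_conjL hLp
    rw [h, dotProduct_neg, neg_neg, mul_zero, sub_zero, invariantR, initialCoframe_eq, ← st1,
      star_dotProduct_eq, Complex.conj_conj]
  -- Since `ρ` is real on a neighbourhood, so is `dρ`; its coefficients come in conjugate pairs and
  -- only half of them need names.
  have hρconj : ∀ X Y, dM ρ p (star X) (star Y) = conj (dM ρ p X Y) := fun X Y => by
    have h1 : conjField ρ =ᶠ[𝓝 p] ρ := by
      filter_upwards [hU.mem_nhds hp] with q hq using hρstar hq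
    have h2 := dM_conj aρ.differentiableAt (star X) (star Y)
    rwa [dM_congr h1, star_star, star_star] at h2
  have sT : star (frame L 2 p) = frame L 2 p := conjField_fieldT hLp.differentiableAt
  have sL : star (frame L 3 p) = frame L 4 p := star_star _
  have sL' : star (frame L 4 p) = frame L 3 p := rfl
  have sS : star (frame L 0 p) = frame L 1 p := star_star _
  have sF : star (F0 p) = F1 p := by
    rw [hF0, hF1, star_sub, star_smul, sT, sS, star_eq_conj, Complex.conj_conj]
  have d12 : dM ρ p (F1 p) (frame L 2 p) = conj (v₂ p) := by rw [← hv₂, ← hρconj, sF, sT]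
  have d14 : dM ρ p (F1 p) (frame L 4 p) = conj (v₃ p) := by rw [← hv₃, ← hρconj, sF, sL]
  have d13 : dM ρ p (F1 p) (frame L 3 p) = conj (v₄ p) := by rw [← hv₄, ← hρconj, sF, sL']
  have d23 : dM ρ p (frame L 2 p) (frame L 3 p) = conj (t p) := by rw [← ht, ← hρconj, sT, sL']
  have hρL : ∀ {q}, q ∈ U → ρ q ⬝ᵥ frame L 3 q = 0 ∧ ρ q ⬝ᵥ frame L 4 q = 0 ∧
      ρ q ⬝ᵥ frame L 2 q = 1 := fun {q} hq => by
    have hd := (isDualFrame_frame (hdet q hq)).dual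
    rw [hρ]
    simp [add_dotProduct, smul_dotProduct, hd]
  have d34 : dM ρ p (frame L 3 p) (frame L 4 p) = -Complex.I := by
    rw [dM_cartan_of_eq_zero (a := 0) (b := 0) aρ.differentiableAt (hfr hp 3).differentiableAt
      (hfr hp 4).differentiableAt]
    · have h : bracket (frame L 3) (frame L 4) p = Complex.I • frame L 2 p := bracket_conjL_L L p
      rw [h, dotProduct_smul, (hρL hp).2.2, smul_eq_mul, mul_one]
    · filter_upwards [hU.mem_nhds hp] with q hq using (hρL hq).2.1
    · filter_upwards [hU.mem_nhds hp] with q hq using (hρL hq).1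
  rw [← hKR]
  refine ⟨aB, aC, by fun_prop, by fun_prop, aρ, aζ, aθ, hρ p, ?_, _, _,
    structureAt_of_coefficients (s₁ := s₁ p) (s₂ := s₂ p) (s₅ := s₅ p) (s₆ := s₆ p) (s₇ := s₇ p)
      (v₁ := v₁ p) (v₂ := v₂ p) (v₃ := v₃ p) (v₄ := v₄ p) (t := t p) (hρstar hp) ?_ ?_ ?_ ?_ ?_
      (hm₀ p) (hy p) (hζ p) ?_⟩
  · simp only [hζ, hρ, st1, Complex.conj_conj]
    module
  · intro X Y
    rw [dM_expand hdual'.expand]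
    simp only [Matrix.cons_val, hs₁, hs₂, hK, hs₅, hs₆, hs₇, c24, c23, c34, c04]
    ring
  · intro X Y
    rw [dM_expand hdual'.expand]
    simp only [Matrix.cons_val, hv₁, hv₂, hv₃, hv₄, ht, d12, d13, d14, d23, d34]
    simp only [wd]
    ring
  · rw [hD]
    ring
  · rw [hE]
    simp only [map_mul, map_neg, Complex.conj_I, Complex.conj_conj]
    linear_combination v₄ p * Complex.I_sq
  · rw [hB]
    simp only [map_mul, map_sub, map_add, map_div₀, map_ofNat, Complex.conj_I, Complex.conj_conj]
    linear_combination (-(s₇ p + conj (s₆ p)) / 3 + t p) * Complex.I_sq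
  · rw [hθ, hW]

end Reduction

/-! ### Lifting a base coframe to `M × ℂ*` with weights -/

section Bundle

attribute [local fun_prop] analyticAt_conj'

theorem dForm_apply {F : Type*} [NormedAddCommGroup F] [NormedSpace ℝ F] {η : E7 → E7 →L[ℝ] F}
    {x : E7} (hη : DifferentiableAt ℝ η x) (v w : E7) :
    dForm η x v w = fderiv ℝ (fun y => η y w) x v - fderiv ℝ (fun y => η y v) x w := by
  have h : DifferentiableAt ℝ
      (fun y => ContinuousAlternatingMap.ofSubsingleton ℝ E7 F (0 : Fin 1) (η y)) x :=
    ((ContinuousAlternatingMap.ofSubsingletonLIE (𝕜 := ℝ) (E := E7) (F := F)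
      (0 : Fin 1)).toContinuousLinearEquiv.differentiableAt).comp x hη
  rw [dForm, extDeriv_apply h, Fin.sum_univ_two]
  simp [Fin.removeNth, sub_eq_add_neg]

/-- A covector on `M` as a complex-valued one-form on `M × ℂ*`. -/
noncomputable def rowForm (r : C5) : E7 →L[ℝ] ℂ :=
  ∑ j, r j • Complex.ofRealCLM.comp
    ((ContinuousLinearMap.proj j : R5 →L[ℝ] ℝ).comp (ContinuousLinearMap.fst ℝ R5 ℂ))

theorem rowForm_apply (r : C5) (v : E7) : rowForm r v = r ⬝ᵥ toC5 v.1 := by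
  simp [rowForm, dotProduct, toC5]

theorem analyticAt_rowForm {r : R5 → C5} {x : E7} (hr : AnalyticAt ℝ r x.1) :
    AnalyticAt ℝ (fun y : E7 => rowForm (r y.1)) x := by
  unfold rowForm
  refine Finset.analyticAt_fun_sum _ fun j _ => AnalyticAt.fun_smul ?_ analyticAt_const
  exact (analyticAt_pi_iff.1 hr j).comp analyticAt_fst

/-- The coframe on `M × ℂ*` of the rows `σ, ρ, ζ` and of the connection form `θ`. -/
noncomputable def coframeOf (σ ρ ζ θ : R5 → C5) : Coframe where
  lam x := (x.2)⁻¹ • ContinuousLinearMap.snd ℝ R5 ℂ + rowForm (θ x.1)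
  sig x := (x.2 ^ 2 * conj x.2) • rowForm (σ x.1)
  rho x := Complex.reCLM.comp ((x.2 * conj x.2) • rowForm (ρ x.1))
  zet x := x.2 • rowForm (ζ x.1)

variable {σ ρ ζ θ : R5 → C5} {p : R5} {a : ℂ} {v w : E7}

theorem coframeOf_lam : (coframeOf σ ρ ζ θ).lam (p, a) v = v.2 / a + θ p ⬝ᵥ toC5 v.1 := by
  simp [coframeOf, rowForm_apply, div_eq_inv_mul]

theorem coframeOf_sig : (coframeOf σ ρ ζ θ).sig (p, a) v =
    a ^ 2 * conj a * (σ p ⬝ᵥ toC5 v.1) := by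
  simp [coframeOf, rowForm_apply]

theorem coframeOf_zet : (coframeOf σ ρ ζ θ).zet (p, a) v = a * (ζ p ⬝ᵥ toC5 v.1) := by
  simp [coframeOf, rowForm_apply]

theorem star_toC5 (u : R5) : star (toC5 u) = toC5 u := by
  ext j; simp [toC5]

theorem coframeOf_rho (hρ : star (ρ p) = ρ p) : ((coframeOf σ ρ ζ θ).rho (p, a) v : ℂ) =
    a * conj a * (ρ p ⬝ᵥ toC5 v.1) := by
  have h : conj (a * conj a * (ρ p ⬝ᵥ toC5 v.1)) = a * conj a * (ρ p ⬝ᵥ toC5 v.1) := by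
    have h1 := star_dotProduct_eq (ρ p) (toC5 v.1)
    rw [star_toC5, hρ] at h1
    rw [map_mul, ← h1, map_mul, Complex.conj_conj, mul_comm (conj a)]
  rw [Complex.conj_eq_iff_re] at h
  rw [← h]
  simp [coframeOf, rowForm_apply]

theorem conj_dot_toC5 (r : C5) (u : R5) : conj (r ⬝ᵥ toC5 u) = star r ⬝ᵥ toC5 u := by
  rw [star_dotProduct_eq, star_toC5]

theorem coframeOf_isAnalytic {U : Set R5} (hσ : AnalyticOnNhd ℝ σ U) (hρ : AnalyticOnNhd ℝ ρ U)
    (hζ : AnalyticOnNhd ℝ ζ U) (hθ : AnalyticOnNhd ℝ θ U) :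
    (coframeOf σ ρ ζ θ).IsAnalytic (bundleOver U) := by
  refine ⟨fun x hx => ?_, fun x hx => ?_, fun x hx => ?_, fun x hx => ?_⟩
  · exact ((analyticAt_snd.inv hx.2).fun_smul analyticAt_const).fun_add
      (analyticAt_rowForm (hθ _ hx.1))
  · exact AnalyticAt.fun_smul ((analyticAt_snd.fun_pow 2).fun_mul (analyticAt_conj' analyticAt_snd))
      (analyticAt_rowForm (hσ _ hx.1))
  · exact ((ContinuousLinearMap.compL ℝ E7 ℂ ℝ Complex.reCLM).analyticAt _).comp
      (AnalyticAt.fun_smul (analyticAt_snd.fun_mul (analyticAt_conj' analyticAt_snd))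
        (analyticAt_rowForm (hρ _ hx.1)))
  · exact AnalyticAt.fun_smul analyticAt_snd (analyticAt_rowForm (hζ _ hx.1))

theorem fderiv_scaled_row {k : ℂ → ℂ} {s : R5 → C5} (hk : DifferentiableAt ℝ k a)
    (hs : DifferentiableAt ℝ s p) (u : R5) (v : E7) :
    fderiv ℝ (fun y : E7 => k y.2 * (s y.1 ⬝ᵥ toC5 u)) (p, a) v =
      fderiv ℝ k a v.2 * (s p ⬝ᵥ toC5 u) + k a * (cD s p (toC5 v.1) ⬝ᵥ toC5 u) := by
  have h1 : HasFDerivAt (fun y : E7 => k y.2) ((fderiv ℝ k a).comp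
      (ContinuousLinearMap.snd ℝ R5 ℂ)) (p, a) :=
    HasFDerivAt.comp (p, a) (f := Prod.snd) hk.hasFDerivAt hasFDerivAt_snd
  have hd : DifferentiableAt ℝ (fun q => s q ⬝ᵥ toC5 u) p := by
    simp only [dotProduct]
    exact DifferentiableAt.fun_sum fun i _ =>
      (differentiableAt_pi.1 hs i).fun_mul (differentiableAt_const _)
  have h2 : HasFDerivAt (fun y : E7 => s y.1 ⬝ᵥ toC5 u)
      ((fderiv ℝ (fun q => s q ⬝ᵥ toC5 u) p).comp (ContinuousLinearMap.fst ℝ R5 ℂ)) (p, a) :=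
    HasFDerivAt.comp (p, a) (f := Prod.fst) hd.hasFDerivAt hasFDerivAt_fst
  have h3 : fderiv ℝ (fun q => s q ⬝ᵥ toC5 u) p v.1 = cD s p (toC5 v.1) ⬝ᵥ toC5 u := by
    rw [← cD_toC5, cD_dotProduct (Y := fun _ => toC5 u) hs (differentiableAt_const _), cD_const]
    simp
  rw [(h1.fun_mul h2).fderiv]
  simp [h3, mul_comm]
  ring

theorem dForm_scaled_row {η : E7 → E7 →L[ℝ] ℂ} {k : ℂ → ℂ} {s : R5 → C5}
    (hη : DifferentiableAt ℝ η (p, a)) (hk : DifferentiableAt ℝ k a)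
    (hs : DifferentiableAt ℝ s p) (h : ∀ y v, η y v = k y.2 * (s y.1 ⬝ᵥ toC5 v.1)) (v w : E7) :
    dForm η (p, a) v w = fderiv ℝ k a v.2 * (s p ⬝ᵥ toC5 w.1) -
      fderiv ℝ k a w.2 * (s p ⬝ᵥ toC5 v.1) + k a * dM s p (toC5 v.1) (toC5 w.1) := by
  rw [dForm_apply hη]
  simp only [h, fderiv_scaled_row hk hs, dM]
  ring

theorem hasFDerivAt_conj_complex (a : ℂ) :
    HasFDerivAt (fun a : ℂ => conj a) Complex.conjCLE.toContinuousLinearMap a :=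
  Complex.conjCLE.toContinuousLinearMap.hasFDerivAt

theorem fderiv_weight_sigma (a u : ℂ) : fderiv ℝ (fun a : ℂ => a ^ 2 * conj a) a u =
    2 * a * conj a * u + a ^ 2 * conj u := by
  have h1 : HasFDerivAt (fun a : ℂ => a * a) _ a := (hasFDerivAt_id (𝕜 := ℝ) a).fun_mul
    (hasFDerivAt_id a)
  have h2 := h1.fun_mul (hasFDerivAt_conj_complex a)
  have h3 : (fun a : ℂ => a ^ 2 * conj a) = fun a => a * a * conj a := by
    ext a; ring
  rw [h3, h2.fderiv]
  simp
  ring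

theorem fderiv_weight_rho (a u : ℂ) : fderiv ℝ (fun a : ℂ => a * conj a) a u =
    conj a * u + a * conj u := by
  have h1 : HasFDerivAt (fun a : ℂ => a * conj a) _ a := (hasFDerivAt_id (𝕜 := ℝ) a).fun_mul
    (hasFDerivAt_conj_complex a)
  rw [h1.fderiv]
  simp
  ring

theorem differentiableAt_weight_sigma (a : ℂ) :
    DifferentiableAt ℝ (fun a : ℂ => a ^ 2 * conj a) a :=
  (differentiableAt_id.pow 2).mul (hasFDerivAt_conj_complex a).differentiableAt

theorem differentiableAt_weight_rho (a : ℂ) :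
    DifferentiableAt ℝ (fun a : ℂ => a * conj a) a :=
  differentiableAt_id.mul (hasFDerivAt_conj_complex a).differentiableAt

end Bundle

/-! ### Exterior derivatives of `ρ` and `λ`, and the reduced form of the lifted coframe -/

section AdaptedBundle

/-- The rows `ρ, ζ, θ` form, together with `σ₀`, a normalized coframe at `p`. -/
structure IsAdapted (L : R5 → C5) (B C D E : R5 → ℂ) (ρ ζ θ : R5 → C5) (p : R5) : Prop where
  analytic_B : AnalyticAt ℝ B p
  analytic_C : AnalyticAt ℝ C p
  analytic_D : AnalyticAt ℝ D p
  analytic_E : AnalyticAt ℝ E p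
  analytic_rho : AnalyticAt ℝ ρ p
  analytic_zeta : AnalyticAt ℝ ζ p
  analytic_theta : AnalyticAt ℝ θ p
  rho_eq : ρ p = conj (C p) • coRow L 0 p + C p • coRow L 1 p + coRow L 2 p
  zeta_eq : ζ p = conj (D p) • coRow L 0 p + E p • coRow L 1 p + B p • coRow L 2 p + coRow L 4 p
  structureAt : ∃ V₁ V₃, StructureAt (coRow L 1) ρ ζ θ p (conj (invariantR L p)) V₁ V₃

variable {L : R5 → C5} {B C D E : R5 → ℂ} {ρ ζ θ : R5 → C5} {p : R5} {a : ℂ} {v w : E7}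

theorem IsAdapted.star_rho (h : IsAdapted L B C D E ρ ζ θ p) (hL : AnalyticAt ℝ L p)
    (hdet : IsUnit (frameMatrix L p).det) : star (ρ p) = ρ p := by
  rw [h.rho_eq, ← star_coRow_one hL hdet]
  simp only [star_add, star_smul, star_star, star_coRow_two hL hdet, star_eq_conj,
    Complex.conj_conj]
  abel

theorem IsDualFrame.adapted {e F : Fin 5 → C5} (h : IsDualFrame e F) (h1 : star (e 1) = e 0)
    (h2 : star (e 2) = e 2) (h4 : star (e 4) = e 3) {b c d k : ℂ} {r z : C5}
    (hr : r = conj c • e 0 + c • e 1 + e 2)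
    (hz : z = conj d • e 0 + k • e 1 + b • e 2 + e 4) :
    ∃ F', IsDualFrame ![star (e 1), e 1, r, star z, z] F' := by
  -- The second shear is taken relative to the new `ρ`, so the contributions `b (c e₁ + c̄ e₀)`
  -- already contained in `b ρ` are subtracted from the coefficients of `σ` and `σ̄`.
  have h5 := (h.shear c).shear_zeta b (conj d - b * conj c) (k - b * c) (conj b)
    (d - conj b * c) (conj k - conj b * conj c)
  refine Exists.intro _ (Eq.mp (congrArg₂ IsDualFrame ?_ rfl) h5)
  have hz' : star z = d • e 1 + conj k • e 0 + conj b • e 2 + e 3 := by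
    rw [hz, ← h1, ← h4]
    simp only [star_add, star_smul, star_star, h2, star_eq_conj, Complex.conj_conj]
  rw [hz', hr, hz, h1]
  simp only [Matrix.cons_val]
  congr 1
  congr 1
  congr 1
  congr 1
  · module
  · congr 1
    module

theorem IsAdapted.exists_dual (h : IsAdapted L B C D E ρ ζ θ p) (hL : AnalyticAt ℝ L p)
    (hdet : IsUnit (frameMatrix L p).det) :
    ∃ F, IsDualFrame ![star (coRow L 1 p), coRow L 1 p, ρ p, star (ζ p), ζ p] F :=
  (isDualFrame_frame hdet).adapted (star_coRow_one hL hdet) (star_coRow_two hL hdet)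
    (star_coRow_four hL hdet) h.rho_eq h.zeta_eq

theorem dForm_rho {U : Set R5} (hU : IsOpen U) (hp : p ∈ U) {σ : R5 → C5}
    (hρ : AnalyticAt ℝ ρ p) (hr : ∀ q ∈ U, star (ρ q) = ρ q) (v w : E7) :
    ((dForm (coframeOf σ ρ ζ θ).rho (p, a) v w : ℝ) : ℂ) =
      (conj a * v.2 + a * conj v.2) * (ρ p ⬝ᵥ toC5 w.1) -
      (conj a * w.2 + a * conj w.2) * (ρ p ⬝ᵥ toC5 v.1) +
      a * conj a * dM ρ p (toC5 v.1) (toC5 w.1) := by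
  have han : AnalyticAt ℝ (coframeOf σ ρ ζ θ).rho (p, a) :=
    ((ContinuousLinearMap.compL ℝ E7 ℂ ℝ Complex.reCLM).analyticAt _).comp
      (AnalyticAt.fun_smul (analyticAt_snd.fun_mul (analyticAt_conj' analyticAt_snd))
        (analyticAt_rowForm hρ))
  have hf : ∀ v w : E7, ((fderiv ℝ (fun y => (coframeOf σ ρ ζ θ).rho y w) (p, a) v : ℝ) : ℂ) =
      fderiv ℝ (fun y : E7 => (y.2 * conj y.2) * (ρ y.1 ⬝ᵥ toC5 w.1)) (p, a) v := fun v w => by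
    have hd : DifferentiableAt ℝ (fun y => (coframeOf σ ρ ζ θ).rho y w) (p, a) :=
      han.differentiableAt.clm_apply (differentiableAt_const w)
    -- The real form is defined as a real part. It agrees with the weighted complex row only over
    -- `U`, where `ρ` is real; agreement near the point is enough to compare derivatives.
    have h1 : (fun y => (((coframeOf σ ρ ζ θ).rho y w : ℝ) : ℂ)) =ᶠ[𝓝 (p, a)]
        fun y : E7 => (y.2 * conj y.2) * (ρ y.1 ⬝ᵥ toC5 w.1) := by
      have : ∀ᶠ y : E7 in 𝓝 (p, a), y.1 ∈ U :=
        (continuous_fst.tendsto (p, a)).eventually (hU.mem_nhds hp)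
      filter_upwards [this] with y hy using coframeOf_rho (hr y.1 hy)
    rw [← h1.fderiv_eq]
    have h2 := (Complex.ofRealCLM.hasFDerivAt.comp (p, a) hd.hasFDerivAt).fderiv
    have h3 : fderiv ℝ (fun y => (((coframeOf σ ρ ζ θ).rho y w : ℝ) : ℂ)) (p, a) = _ := h2
    rw [h3]
    rfl
  rw [dForm_apply han.differentiableAt, Complex.ofReal_sub, hf, hf,
    fderiv_scaled_row (k := fun a => a * conj a) (differentiableAt_weight_rho a)
      hρ.differentiableAt,
    fderiv_scaled_row (k := fun a => a * conj a) (differentiableAt_weight_rho a)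
      hρ.differentiableAt, fderiv_weight_rho, fderiv_weight_rho, dM]
  ring

/-- The form `da/a` is closed, so only the base part contributes. This is why `dλ` contains no `λ`
terms. -/
theorem dForm_lam {σ : R5 → C5} (hθ : AnalyticAt ℝ θ p) (ha : a ≠ 0) (v w : E7) :
    dForm (coframeOf σ ρ ζ θ).lam (p, a) v w = dM θ p (toC5 v.1) (toC5 w.1) := by
  have han : AnalyticAt ℝ (coframeOf σ ρ ζ θ).lam (p, a) :=
    ((analyticAt_snd.inv ha).fun_smul analyticAt_const).fun_add (analyticAt_rowForm hθ)
  have hk : DifferentiableAt ℝ (fun b : ℂ => b⁻¹) a :=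
    (hasDerivAt_inv ha).differentiableAt.restrictScalars ℝ
  have h1 : ∀ v w : E7, fderiv ℝ (fun y => (coframeOf σ ρ ζ θ).lam y w) (p, a) v =
      fderiv ℝ (fun b : ℂ => b⁻¹) a v.2 * w.2 + cD θ p (toC5 v.1) ⬝ᵥ toC5 w.1 := fun v w => by
    have e1 : HasFDerivAt (fun y : E7 => y.2⁻¹ * w.2) (w.2 • (fderiv ℝ (fun b : ℂ => b⁻¹) a).comp
        (ContinuousLinearMap.snd ℝ R5 ℂ)) (p, a) :=
      (HasFDerivAt.comp (p, a) (f := Prod.snd) hk.hasFDerivAt hasFDerivAt_snd).mul_const w.2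
    have e2 : DifferentiableAt ℝ (fun y : E7 => (1 : ℂ) * (θ y.1 ⬝ᵥ toC5 w.1)) (p, a) := by
      have h := (analyticAt_rowForm (x := (p, a)) hθ).differentiableAt.clm_apply
        (differentiableAt_const w)
      simpa [rowForm_apply] using h
    have e3 : (fun y => (coframeOf σ ρ ζ θ).lam y w) =
        fun y : E7 => y.2⁻¹ * w.2 + 1 * (θ y.1 ⬝ᵥ toC5 w.1) := by
      ext y
      rw [one_mul, ← rowForm_apply]
      rfl
    rw [e3, (e1.fun_add e2.hasFDerivAt).fderiv, add_apply,
      fderiv_scaled_row (k := fun _ => 1) (differentiableAt_const _) hθ.differentiableAt]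
    simp
    ring
  rw [dForm_apply han.differentiableAt, h1, h1, dM]
  have h2 : ∀ u : ℂ, fderiv ℝ (fun b : ℂ => b⁻¹) a u = -(a ^ 2)⁻¹ * u := fun u => by
    have h := ((hasDerivAt_inv ha).hasFDerivAt.restrictScalars ℝ).fderiv
    rw [h]
    simp [mul_comm]
  simp only [h2]
  ring

theorem coframeOf_isReduced {M : LocalSubmanifold}
    (h : ∀ p ∈ M.U, IsAdapted L B C D E ρ ζ θ p) (hL : AnalyticOnNhd ℝ L M.U)
    (hdet : ∀ p ∈ M.U, IsUnit (frameMatrix L p).det) :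
    IsReducedCoframe M L (coframeOf (coRow L 1) ρ ζ θ) := by
  refine ⟨B, C, D, E, fun p => ∑ j, θ p j • Complex.ofRealCLM.comp
    (ContinuousLinearMap.proj j : R5 →L[ℝ] ℝ), fun p hp => (h p hp).analytic_B,
    fun p hp => (h p hp).analytic_C, fun p hp => (h p hp).analytic_D,
    fun p hp => (h p hp).analytic_E, fun p hp => ?_, fun p hp a ha v => ?_⟩
  · exact Finset.analyticAt_fun_sum _ fun j _ => AnalyticAt.fun_smul
      (analyticAt_pi_iff.1 (h p hp).analytic_theta j) analyticAt_const
  · have hp' := h p hp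
    refine ⟨?_, ?_, ?_, ?_⟩
    · rw [coframeOf_sig, initialCoframe_eq]
    · rw [coframeOf_rho (hp'.star_rho (hL p hp) (hdet p hp)), hp'.rho_eq]
      simp only [initialCoframe_eq, add_dotProduct, smul_dotProduct, smul_eq_mul]
    · rw [coframeOf_zet, hp'.zeta_eq]
      simp only [initialCoframe_eq, add_dotProduct, smul_dotProduct, smul_eq_mul]
    · rw [coframeOf_lam]
      simp [dotProduct, toC5]

end AdaptedBundle

/-! ### The structure equations on the bundle -/

section BundleStructure

variable {L : R5 → C5} {B C D E : R5 → ℂ} {ρ ζ θ σ : R5 → C5} {p : R5} {a : ℂ} {v w : E7}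

theorem dForm_sig (hσ : AnalyticAt ℝ σ p) (v w : E7) :
    dForm (coframeOf σ ρ ζ θ).sig (p, a) v w =
      (2 * a * conj a * v.2 + a ^ 2 * conj v.2) * (σ p ⬝ᵥ toC5 w.1) -
      (2 * a * conj a * w.2 + a ^ 2 * conj w.2) * (σ p ⬝ᵥ toC5 v.1) +
      a ^ 2 * conj a * dM σ p (toC5 v.1) (toC5 w.1) := by
  have han : AnalyticAt ℝ (coframeOf σ ρ ζ θ).sig (p, a) :=
    AnalyticAt.fun_smul ((analyticAt_snd.fun_pow 2).fun_mul (analyticAt_conj' analyticAt_snd))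
      (analyticAt_rowForm hσ)
  rw [dForm_scaled_row han.differentiableAt (differentiableAt_weight_sigma a) hσ.differentiableAt
    (fun y v => coframeOf_sig), fderiv_weight_sigma, fderiv_weight_sigma]

theorem dForm_zet (hζ : AnalyticAt ℝ ζ p) (v w : E7) :
    dForm (coframeOf σ ρ ζ θ).zet (p, a) v w =
      v.2 * (ζ p ⬝ᵥ toC5 w.1) - w.2 * (ζ p ⬝ᵥ toC5 v.1) +
      a * dM ζ p (toC5 v.1) (toC5 w.1) := by
  have han : AnalyticAt ℝ (coframeOf σ ρ ζ θ).zet (p, a) :=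
    AnalyticAt.fun_smul analyticAt_snd (analyticAt_rowForm hζ)
  rw [dForm_scaled_row (k := fun a => a) han.differentiableAt differentiableAt_id
    hζ.differentiableAt (fun y v => coframeOf_zet)]
  simp

/-- The weights of the five horizontal forms. -/
noncomputable def weight (a : ℂ) : Fin 5 → ℂ :=
  ![conj a ^ 2 * a, a ^ 2 * conj a, a * conj a, conj a, a]

theorem weight_ne_zero (ha : a ≠ 0) (j : Fin 5) : weight a j ≠ 0 := by
  have hb : conj a ≠ 0 := by simpa using ha
  fin_cases j <;> simp [weight, ha]

theorem coframeOf_horizontal (hρ : star (ρ p) = ρ p) (j : Fin 5) :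
    (coframeOf σ ρ ζ θ).horizontal (p, a) v j =
      weight a j * (![star (σ p), σ p, ρ p, star (ζ p), ζ p] j ⬝ᵥ toC5 v.1) := by
  fin_cases j
  · simp [Coframe.horizontal, coframeOf_sig, weight, conj_dot_toC5]
  · simp [Coframe.horizontal, coframeOf_sig, weight]
  · simp [Coframe.horizontal, coframeOf_rho hρ, weight]
  · simp [Coframe.horizontal, coframeOf_zet, weight, conj_dot_toC5]
  · simp [Coframe.horizontal, coframeOf_zet, weight]

/-- The sum runs over all ordered pairs, so each wedge product is counted twice; the factor `2` in
the denominator compensates for it. -/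
theorem curvature_expand {e F : Fin 5 → C5} (hF : IsDualFrame e F) (f : Fin 5 → ℂ)
    (hf : ∀ j, f j ≠ 0) (η : R5 → C5) (p : R5) (X Y : C5) :
    dM η p X Y = ∑ j, ∑ k, dM η p (F j) (F k) / (2 * f j * f k) *
      (f j * (e j ⬝ᵥ X) * (f k * (e k ⬝ᵥ Y)) - f j * (e j ⬝ᵥ Y) * (f k * (e k ⬝ᵥ X))) := by
  have h1 : ∀ X Y, dM η p X Y =
      ∑ a, ∑ b, (e a ⬝ᵥ X) * ((e b ⬝ᵥ Y) * dM η p (F a) (F b)) :=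
    bilin_expand hF.expand (dMBilin η p)
  have h2 : dM η p X Y = (dM η p X Y - dM η p Y X) / 2 := by rw [dM_swap η p Y X]; ring
  rw [h2, h1 X Y, h1 Y X, ← Finset.sum_sub_distrib, Finset.sum_div]
  refine Finset.sum_congr rfl fun j _ => ?_
  rw [← Finset.sum_sub_distrib, Finset.sum_div]
  refine Finset.sum_congr rfl fun k _ => ?_
  have := hf j
  have := hf k
  field_simp

/-- The differentials of the weights are exactly the `da/a` terms of `2λ + λ̄`, `λ + λ̄` and `λ`.
What remains is the base equation multiplied by the weight of the form, and each torsion coefficient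
is divided by the weights of the two factors of its wedge product; this produces the powers of `a`
and `ā`. -/
theorem coframeOf_structureEquations {M : LocalSubmanifold}
    (h : ∀ p ∈ M.U, IsAdapted L B C D E ρ ζ θ p) (hL : AnalyticOnNhd ℝ L M.U)
    (hdet : ∀ p ∈ M.U, IsUnit (frameMatrix L p).det) :
    StructureEquations M L (coframeOf (coRow L 1) ρ ζ θ) := by
  have hV := fun p hp => (h p hp).structureAt
  choose! V₁ V₃ hV using hV
  have hF := fun p hp => (h p hp).exists_dual (hL p hp) (hdet p hp)
  choose! F hF using hF
  -- No normalization is imposed on `dζ`: the functions `W₁, …, W₁₀` are all the components of the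
  -- two-form `dζ - θ ∧ ζ`.
  let β : R5 → Fin 5 → Fin 5 → ℂ := fun p j k =>
    (dMBilin ζ p - wdBilin (θ p) (ζ p)) (F p j) (F p k)
  refine ⟨V₁, V₃, fun p => β p 0 1, fun p => β p 0 2, fun p => β p 0 3, fun p => β p 0 4,
    fun p => β p 1 2, fun p => β p 1 3, fun p => β p 1 4, fun p => β p 2 3, fun p => β p 2 4,
    fun p => β p 3 4, fun j k x => dM θ x.1 (F x.1 j) (F x.1 k) / (2 * weight x.2 j * weight x.2 k),
    fun p hp a ha v w => ?_⟩
  have hb : conj a ≠ 0 := by simpa using ha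
  have hA := h p hp
  have hr := fun q hq => (h q hq).star_rho (hL q hq) (hdet q hq)
  have hrp := hr p hp
  have hr' : ∀ v : E7, ((coframeOf (coRow L 1) ρ ζ θ).rho (p, a) v : ℂ) =
      a * conj a * (ρ p ⬝ᵥ toC5 v.1) := fun v => coframeOf_rho hrp
  have hdζ := alternating_expand (hF p hp).expand (dMBilin ζ p - wdBilin (θ p) (ζ p))
    (fun X => by
      change dM ζ p X X - wd (θ p) (ζ p) X X = 0
      rw [dM_self, wd]; ring) (toC5 v.1) (toC5 w.1)
  have hdζ' : dM ζ p (toC5 v.1) (toC5 w.1) = wd (θ p) (ζ p) (toC5 v.1) (toC5 w.1) +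
      (dMBilin ζ p - wdBilin (θ p) (ζ p)) (toC5 v.1) (toC5 w.1) := by
    change _ = wd (θ p) (ζ p) (toC5 v.1) (toC5 w.1) + (dM ζ p (toC5 v.1) (toC5 w.1) -
      wd (θ p) (ζ p) (toC5 v.1) (toC5 w.1))
    ring
  rw [hdζ] at hdζ'
  refine ⟨?_, ?_, ?_, ?_⟩
  · rw [dForm_sig (analyticAt_coRow (hL p hp) (hdet p hp) 1), (hV p hp).1]
    simp only [wedge, wd, map_add, map_mul, map_div₀, map_pow, Complex.conj_conj,
      conj_dot_toC5, hr', coframeOf_lam, coframeOf_sig, coframeOf_zet]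
    field_simp
    ring
  · rw [dForm_rho M.isOpen_U hp hA.analytic_rho hr, (hV p hp).2]
    simp only [wedge, wd, map_add, map_mul, map_div₀, map_pow, Complex.conj_conj,
      conj_dot_toC5, hr', coframeOf_lam, coframeOf_sig, coframeOf_zet]
    field_simp
    ring
  · rw [dForm_zet hA.analytic_zeta, hdζ']
    simp only [wedge, wd, map_add, map_mul, map_div₀, map_pow, Complex.conj_conj,
      conj_dot_toC5, hr', coframeOf_lam, coframeOf_sig, coframeOf_zet, β,
      Matrix.cons_val]
    field_simp
    ring
  · rw [dForm_lam hA.analytic_theta ha, curvature_expand (hF p hp) _ (weight_ne_zero ha)]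
    simp only [wedge, coframeOf_horizontal hrp]

end BundleStructure

/-! ### The Cartan connection axioms -/

section BundleConnection

variable {σ ρ ζ θ : R5 → C5} {U : Set R5}

theorem analyticAt_clm_apply_const {F : Type*} [NormedAddCommGroup F] [NormedSpace ℝ F]
    {η : E7 → E7 →L[ℝ] F} {x : E7} (h : AnalyticAt ℝ η x) (v : E7) :
    AnalyticAt ℝ (fun y => η y v) x :=
  ((ContinuousLinearMap.apply ℝ F v).analyticAt _).comp h

/-- Under `Ad(h⁻¹)` the coordinates `λ, σ, ρ, ζ` are multiplied by `1, b² b̄, b b̄, b`, the weights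
of the lifted coframe. The identity is written without inverses; equivariance follows from it. -/
theorem hMat_mul_gMat (b l s z : ℂ) (r : ℝ) :
    hMat b * gMat l (b ^ 2 * conj b * s) (Complex.normSq b * r) (b * z) =
      gMat l s r z * hMat b := by
  ext i j
  rw [Matrix.mul_apply, Matrix.mul_apply, Fin.sum_univ_four, Fin.sum_univ_four]
  fin_cases i <;> fin_cases j <;> simp [hMat, gMat, Complex.normSq_eq_conj_mul_self] <;> ring

/-- A vector killed by `σ, ρ, ζ` is killed by their conjugates too, hence has no base component; on
such vertical vectors `λ` is `da/a`. -/
theorem coframeOf_varpi_injective {F : Fin 5 → C5} {p : R5} {a : ℂ} (ha : a ≠ 0)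
    (hρ : star (ρ p) = ρ p)
    (hF : IsDualFrame ![star (σ p), σ p, ρ p, star (ζ p), ζ p] F) :
    Function.Injective ((coframeOf σ ρ ζ θ).varpi (p, a)) := by
  have hb : conj a ≠ 0 := by simpa using ha
  rw [injective_iff_map_eq_zero]
  intro v hv
  obtain ⟨h1, h2, h3, h4⟩ := gMat_injective (congrArg Subtype.val (hv.trans gElem_zero.symm))
  have h0 : ∀ j, ![star (σ p), σ p, ρ p, star (ζ p), ζ p] j ⬝ᵥ toC5 v.1 = 0 := by
    intro j
    have h5 : (coframeOf σ ρ ζ θ).horizontal (p, a) v j = 0 := by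
      rw [Coframe.horizontal, h2, h3, h4]
      fin_cases j <;> simp
    rw [coframeOf_horizontal hρ] at h5
    exact (mul_eq_zero.1 h5).resolve_left (weight_ne_zero ha j)
  have h6 : toC5 v.1 = 0 := by
    rw [hF.expand (toC5 v.1)]
    simp [h0]
  rw [coframeOf_lam, h6, dotProduct_zero, add_zero, div_eq_zero_iff] at h1
  refine Prod.ext ?_ (h1.resolve_right ha)
  ext j
  have := congrFun h6 j
  simpa [toC5] using this

theorem coframeOf_isCartanConnection (hσ : AnalyticOnNhd ℝ σ U) (hρ : AnalyticOnNhd ℝ ρ U)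
    (hζ : AnalyticOnNhd ℝ ζ U) (hθ : AnalyticOnNhd ℝ θ U) (hr : ∀ p ∈ U, star (ρ p) = ρ p)
    (hF : ∀ p ∈ U, ∃ F, IsDualFrame ![star (σ p), σ p, ρ p, star (ζ p), ζ p] F) :
    IsCartanConnection (bundleOver U) (coframeOf σ ρ ζ θ).varpi := by
  refine ⟨fun v i j x hx => ?_, fun x hx => ?_, fun x hx y hy => ?_, fun x hx h hh v => ?_⟩
  · obtain ⟨h1, h2, h3, h4⟩ := coframeOf_isAnalytic hσ hρ hζ hθ
    have h1 := analyticAt_clm_apply_const (h1 x hx) v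
    have h2 := analyticAt_clm_apply_const (h2 x hx) v
    have h3 := analyticAt_ofReal' (analyticAt_clm_apply_const (h3 x hx) v)
    have h4 := analyticAt_clm_apply_const (h4 x hx) v
    have h1' := analyticAt_conj' h1
    have h4' := analyticAt_conj' h4
    have hI : AnalyticAt ℝ (fun _ : E7 => Complex.I) x := analyticAt_const
    have h5 := hI.fun_mul h3
    have h6 := ((analyticAt_const (v := (-2 : ℂ))).fun_mul hI).fun_mul h2
    have h7 := h1.fun_add h1'
    have h8 := ((analyticAt_const (v := (2 : ℂ))).fun_mul h1).fun_add h1'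
    have h0 : AnalyticAt ℝ (fun _ : E7 => (0 : ℂ)) x := analyticAt_const
    fin_cases i <;> fin_cases j
    exacts [h0, h4, h5, h6, h0, h1, h4', h5.fun_neg, h0, h0, h7, h4, h0, h0, h0, h8]
  · obtain ⟨F, hF⟩ := hF x.1 hx.1
    have h1 := coframeOf_varpi_injective (θ := θ) (a := x.2) hx.2 (hr x.1 hx.1) hF
    refine ⟨h1, ?_⟩
    -- Both spaces have real dimension seven.
    refine (LinearMap.injective_iff_surjective_of_finrank_eq_finrank ?_).1 h1
    rw [finrank_g7]
    simp
  · obtain ⟨l, hl⟩ := hy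
    have h1 : HasDerivAt (fun t : ℝ => fiberAct x (NormedSpace.exp (t • (y : Mat4))))
        ((0 : R5), x.2 * l) 0 := by
      have h2 : (fun t : ℝ => fiberAct x (NormedSpace.exp (t • (y : Mat4)))) =
          fun t : ℝ => (x.1, x.2 * Complex.exp (t * l)) := by
        ext1 t
        rw [hl, exp_gMat_diag]
        simp [fiberAct, hMat]
      rw [h2]
      have h3 := (hasDerivAt_cexp l 0).const_mul x.2
      simpa using (hasDerivAt_const (0 : ℝ) x.1).prodMk h3
    rw [h1.deriv]
    refine Subtype.ext ?_
    rw [hl]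
    change gMat _ _ _ _ = _
    obtain ⟨p, a⟩ := x
    have ha : a ≠ 0 := hx.2
    have h0 : toC5 (0 : R5) = 0 := by ext; simp [toC5]
    have h4 : (coframeOf σ ρ ζ θ).rho (p, a) ((0 : R5), a * l) = 0 := by
      rw [← Complex.ofReal_eq_zero, coframeOf_rho (hr p hx.1), h0, dotProduct_zero, mul_zero]
    rw [coframeOf_lam, coframeOf_sig, coframeOf_zet, h4]
    simp only [h0, dotProduct_zero, mul_zero, add_zero]
    rw [mul_div_cancel_left₀ _ ha]
  · obtain ⟨b, hb, hhb⟩ := hh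
    obtain ⟨p, a⟩ := x
    have h1 : (fun x' => fiberAct x' (h : Mat4)) = fun x' : E7 => (x'.1, x'.2 * b) := by
      ext1 x'
      simp [fiberAct, hhb, hMat]
    have h2 : HasFDerivAt (fun x' : E7 => (x'.1, x'.2 * b))
        ((ContinuousLinearMap.fst ℝ R5 ℂ).prod (b • ContinuousLinearMap.snd ℝ R5 ℂ)) (p, a) :=
      hasFDerivAt_fst.prodMk (hasFDerivAt_snd.mul_const b)
    have h3 : fiberAct (p, a) (h : Mat4) = (p, a * b) := congrFun h1 (p, a)
    have h4 : fderiv ℝ (fun x' => fiberAct x' (h : Mat4)) (p, a) v = (v.1, b * v.2) := by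
      rw [h1, h2.fderiv]
      rfl
    rw [h3, h4]
    have h5 : (coframeOf σ ρ ζ θ).rho (p, a * b) (v.1, b * v.2) =
        Complex.normSq b * (coframeOf σ ρ ζ θ).rho (p, a) v := by
      apply Complex.ofReal_injective
      rw [Complex.ofReal_mul, coframeOf_rho (hr p hx.1), coframeOf_rho (hr p hx.1),
        Complex.normSq_eq_conj_mul_self, map_mul]
      ring
    have h6 : (((coframeOf σ ρ ζ θ).varpi (p, a * b) (v.1, b * v.2) : g7) : Mat4) =
        gMat ((coframeOf σ ρ ζ θ).lam (p, a) v)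
          (b ^ 2 * conj b * (coframeOf σ ρ ζ θ).sig (p, a) v)
          (Complex.normSq b * (coframeOf σ ρ ζ θ).rho (p, a) v)
          (b * (coframeOf σ ρ ζ θ).zet (p, a) v) := by
      change gMat _ _ _ _ = _
      rw [h5]
      have ha : a ≠ 0 := hx.2
      congr 1
      · rw [coframeOf_lam, coframeOf_lam]
        field_simp
      · rw [coframeOf_sig, coframeOf_sig, map_mul]
        ring
      · rw [coframeOf_zet, coframeOf_zet]
        ring
    have h7 := hMat_mul_gMat b ((coframeOf σ ρ ζ θ).lam (p, a) v)
      ((coframeOf σ ρ ζ θ).sig (p, a) v) ((coframeOf σ ρ ζ θ).zet (p, a) v)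
      ((coframeOf σ ρ ζ θ).rho (p, a) v)
    rw [← h6, ← hhb] at h7
    rw [Matrix.mul_assoc]
    change _ = _ * (gMat _ _ _ _ * _)
    rw [← h7, ← Matrix.mul_assoc, ← Units.val_mul, inv_mul_cancel, Units.val_one, Matrix.one_mul]

end BundleConnection

/-! ### Pullback of the initial coframe by a map that sends `ℒ` to `f ℒ'` -/

section Pullback

variable {L L' : R5 → C5} {p : R5} {h : R5 → R5} {f : R5 → ℂ}

theorem analyticAt_pull {η : R5 → C5} (hη : AnalyticAt ℝ η (h p)) (hh : AnalyticAt ℝ h p) :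
    AnalyticAt ℝ (pull h η) p :=
  analyticAt_pi_iff.2 fun j => analyticAt_dotProduct (hη.comp hh)
    (analyticAt_cD (analyticAt_toC5 hh) (X := fun _ => Pi.single j 1) analyticAt_const)

theorem push_conjField (hh : DifferentiableAt ℝ h p) (hp : push h p (L p) = f p • L' (h p)) :
    push h p (conjField L p) = conj (f p) • conjField L' (h p) := by
  rw [conjField, push_star h p hh, hp, star_smul]
  rfl

/-- `h` is real-analytic at `p` and, near `p`, it sends `L` to `f L'`. -/
structure PushesGenerator (L L' : R5 → C5) (h : R5 → R5) (f : R5 → ℂ) (p : R5) : Prop where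
  analytic : AnalyticAt ℝ h p
  analytic_factor : AnalyticAt ℝ f p
  ne_zero : f p ≠ 0
  push_eq : ∀ᶠ q in 𝓝 p, push h q (L q) = f q • L' (h q)
  generator : AnalyticAt ℝ L p
  generator' : AnalyticAt ℝ L' (h p)
  isUnit_det : ∀ᶠ q in 𝓝 p, IsUnit (frameMatrix L q).det
  isUnit_det' : ∀ᶠ q in 𝓝 (h p), IsUnit (frameMatrix L' q).det

namespace PushesGenerator

variable (H : PushesGenerator L L' h f p)
include H

theorem pull_dot_L : ∀ᶠ q in 𝓝 p, ∀ a, pull h (coRow L' a) q ⬝ᵥ L q = if a = 4 then f q else 0 := by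
  filter_upwards [H.push_eq, H.analytic.continuousAt.eventually H.isUnit_det'] with q h1 h2 a
  rw [pull_dotProduct, h1, dotProduct_smul, ← frame_four (L := L'), (isDualFrame_frame h2).dual]
  simp

theorem pull_dot_conjL : ∀ᶠ q in 𝓝 p, ∀ a,
    pull h (coRow L' a) q ⬝ᵥ conjField L q = if a = 3 then conj (f q) else 0 := by
  filter_upwards [H.push_eq, H.analytic.continuousAt.eventually H.isUnit_det',
    H.analytic.eventually_analyticAt] with q h1 h2 h3 a
  rw [pull_dotProduct, push_conjField h3.differentiableAt h1, dotProduct_smul, ← frame_three (L := L'),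
    (isDualFrame_frame h2).dual]
  simp

/-- Brackets are not pushed forward directly. The pulled back row vanishes on `ℒ` and `ℒ̄`, so
Cartan's formula expresses its value on `[ℒ, ℒ̄]` through the differential of the original row on `f
ℒ'` and `f̄ ℒ̄'`. -/
theorem pull_dot_T {a : Fin 5} (h3 : a ≠ 3) (h4 : a ≠ 4) :
    pull h (coRow L' a) p ⬝ᵥ fieldT L p = if a = 2 then f p * conj (f p) else 0 := by
  have hr := analyticAt_coRow H.generator' H.isUnit_det'.self_of_nhds a
  have h5 := dM_cartan_of_eq_zero (a := 0) (b := 0)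
    (analyticAt_pull hr H.analytic).differentiableAt H.generator.differentiableAt
    (differentiableAt_conjField H.generator.differentiableAt)
    (by filter_upwards [H.pull_dot_conjL] with q hq; rw [hq, if_neg h3])
    (by filter_upwards [H.pull_dot_L] with q hq; rw [hq, if_neg h4])
  have h6 := dM_coRow_frame H.generator' H.isUnit_det' a 4 3
  have h7 : frame L' 4 = L' := rfl
  have h8 : frame L' 3 = conjField L' := rfl
  rw [h7, h8, bracket_L_conjL, ← frame_two, dotProduct_smul,
    (isDualFrame_frame H.isUnit_det'.self_of_nhds).dual] at h6
  have h9 : ∀ c d : ℂ, ∀ X Y, dM (coRow L' a) (h p) (c • X) (d • Y) =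
      c * d * dM (coRow L' a) (h p) X Y := fun c d X Y => by
    simp only [dM, map_smul, smul_dotProduct, dotProduct_smul, smul_eq_mul]
    ring
  rw [dM_pull hr.differentiableAt H.analytic, H.push_eq.self_of_nhds,
    push_conjField H.analytic.differentiableAt H.push_eq.self_of_nhds, h9, h6, bracket_L_conjL,
    dotProduct_smul] at h5
  simp only [smul_eq_mul] at h5
  have hI := Complex.I_mul_I
  split_ifs at h5 ⊢ with h2
  · linear_combination Complex.I * h5 + (pull h (coRow L' a) p ⬝ᵥ fieldT L p - f p * conj (f p)) * hI
  · linear_combination Complex.I * h5 + (pull h (coRow L' a) p ⬝ᵥ fieldT L p) * hI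

/-- Cartan's formula differentiates the pairings, so the identities at a point are needed on a
neighbourhood. -/
theorem eventually : ∀ᶠ q in 𝓝 p, PushesGenerator L L' h f q := by
  filter_upwards [H.analytic.eventually_analyticAt, H.analytic_factor.eventually_analyticAt,
    H.analytic_factor.continuousAt.eventually_ne H.ne_zero, H.push_eq.eventually_nhds,
    H.generator.eventually_analyticAt, H.analytic.continuousAt.eventually
      H.generator'.eventually_analyticAt, H.isUnit_det.eventually_nhds,
    H.analytic.continuousAt.eventually H.isUnit_det'.eventually_nhds]
    with q h1 h2 h3 h4 h5 h6 h7 h8 using ⟨h1, h2, h3, h4, h5, h6, h7, h8⟩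

theorem push_T : ∃ c d : ℂ, push h p (fieldT L p) =
    (f p * conj (f p)) • fieldT L' (h p) + c • conjField L' (h p) + d • L' (h p) := by
  have h1 := (isDualFrame_frame H.isUnit_det'.self_of_nhds).expand (push h p (fieldT L p))
  simp only [Fin.sum_univ_five, ← pull_dotProduct] at h1
  rw [H.pull_dot_T (a := 0) (by decide) (by decide), H.pull_dot_T (a := 1) (by decide) (by decide),
    H.pull_dot_T (a := 2) (by decide) (by decide)] at h1
  refine ⟨pull h (coRow L' 3) p ⬝ᵥ fieldT L p, pull h (coRow L' 4) p ⬝ᵥ fieldT L p, h1.trans ?_⟩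
  simp only [show (0 : Fin 5) ≠ 2 by decide, show (1 : Fin 5) ≠ 2 by decide, if_false, if_true,
    zero_smul, zero_add]
  rfl

/-- The same argument applies to `[ℒ, 𝒯]`. Of the image `f f̄ 𝒯' + c ℒ̄' + d ℒ'` of `𝒯`, the `ℒ'`
part gives nothing against `f ℒ'`, and the `ℒ̄'` part only involves `[ℒ', ℒ̄']`, which the row kills
since `a ≠ 2`. -/
theorem pull_dot_S {a : Fin 5} (h2 : a ≠ 2) (h3 : a ≠ 3) (h4 : a ≠ 4) :
    pull h (coRow L' a) p ⬝ᵥ fieldS L p = if a = 1 then f p ^ 2 * conj (f p) else 0 := by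
  have hr := analyticAt_coRow H.generator' H.isUnit_det'.self_of_nhds a
  have h5 := dM_cartan_of_eq_zero (a := 0) (b := 0)
    (analyticAt_pull hr H.analytic).differentiableAt H.generator.differentiableAt
    (analyticAt_fieldT H.generator).differentiableAt
    (by filter_upwards [H.eventually] with q hq; rw [hq.pull_dot_T h3 h4, if_neg h2])
    (by filter_upwards [H.pull_dot_L] with q hq; rw [hq, if_neg h4])
  have hd := (isDualFrame_frame H.isUnit_det'.self_of_nhds).dual
  have h6 := dM_coRow_frame H.generator' H.isUnit_det' a 4 3
  have h6' := dM_coRow_frame H.generator' H.isUnit_det' a 4 2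
  have h7 : frame L' 4 = L' := rfl
  have h8 : frame L' 3 = conjField L' := rfl
  have h8' : frame L' 2 = fieldT L' := rfl
  have h8'' : bracket L' (fieldT L') = frame L' 1 := rfl
  rw [h7, h8, bracket_L_conjL, ← frame_two, dotProduct_smul, hd, if_neg h2, smul_zero, neg_zero] at h6
  rw [h7, h8', h8'', hd] at h6'
  obtain ⟨c, d, hT⟩ := H.push_T
  have h9 : ∀ k m : ℂ, ∀ X Y Z, dM (coRow L' a) (h p) (k • X) (m • Y + c • Z + d • X) =
      k * m * dM (coRow L' a) (h p) X Y + k * c * dM (coRow L' a) (h p) X Z := fun k m X Y Z => by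
    simp only [dM, map_smul, smul_dotProduct, dotProduct_smul, smul_eq_mul, map_add, add_dotProduct,
      dotProduct_add]
    ring
  rw [dM_pull hr.differentiableAt H.analytic, H.push_eq.self_of_nhds, hT, h9, h6, h6'] at h5
  change _ = -(_ ⬝ᵥ fieldS L p) at h5
  split_ifs at h5 ⊢ with h1
  · linear_combination h5
  · simpa using h5.symm

/-- The row `σ₀` is rescaled exactly, with no added terms; this is what lets the normalization start
from `σ₀`. Its value on `𝒮̄` is the conjugate of the value of the row `σ̄₀` on `𝒮`. -/
theorem pull_coRow_one : pull h (coRow L' 1) p = (f p ^ 2 * conj (f p)) • coRow L 1 p := by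
  have hdet := H.isUnit_det.self_of_nhds
  have hS : pull h (coRow L' 1) p ⬝ᵥ conjField (fieldS L) p = 0 := by
    have h0 := H.pull_dot_S (a := 0) (by decide) (by decide) (by decide)
    rw [if_neg (by decide), pull_dotProduct] at h0
    rw [pull_dotProduct, conjField, push_star h p H.analytic.differentiableAt,
      ← star_star (coRow L' 1 (h p)), star_coRow_one H.generator' H.isUnit_det'.self_of_nhds,
      star_dotProduct_eq, star_star, h0, map_zero]
  refine (isDualFrame_frame hdet).row_ext fun b => ?_
  rw [smul_dotProduct, (isDualFrame_frame hdet).dual]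
  have h1 := H.pull_dot_S (a := 1) (by decide) (by decide) (by decide)
  have h2 := H.pull_dot_T (a := 1) (by decide) (by decide)
  have h3 := H.pull_dot_conjL.self_of_nhds 1
  have h4 := H.pull_dot_L.self_of_nhds 1
  fin_cases b
  · simpa [frame_zero] using hS
  · simpa [frame_one] using h1
  · simpa [frame_two] using h2
  · simpa [frame_three] using h3
  · simpa [frame_four] using h4

theorem pull_coRow_two : ∃ c c' : ℂ, pull h (coRow L' 2) p =
    c • coRow L 0 p + c' • coRow L 1 p + (f p * conj (f p)) • coRow L 2 p := by
  have hdet := H.isUnit_det.self_of_nhds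
  refine ⟨pull h (coRow L' 2) p ⬝ᵥ frame L 0 p, pull h (coRow L' 2) p ⬝ᵥ frame L 1 p,
    (isDualFrame_frame hdet).row_ext fun b => ?_⟩
  have h2 := H.pull_dot_T (a := 2) (by decide) (by decide)
  have h3 := H.pull_dot_conjL.self_of_nhds 2
  have h4 := H.pull_dot_L.self_of_nhds 2
  simp only [add_dotProduct, smul_dotProduct, (isDualFrame_frame hdet).dual]
  fin_cases b
  · simp
  · simp
  · simpa [frame_two] using h2
  · simpa [frame_three] using h3
  · simpa [frame_four] using h4

theorem pull_coRow_four : ∃ c c' b : ℂ, pull h (coRow L' 4) p =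
    c • coRow L 0 p + c' • coRow L 1 p + b • coRow L 2 p + f p • coRow L 4 p := by
  have hdet := H.isUnit_det.self_of_nhds
  refine ⟨pull h (coRow L' 4) p ⬝ᵥ frame L 0 p, pull h (coRow L' 4) p ⬝ᵥ frame L 1 p,
    pull h (coRow L' 4) p ⬝ᵥ frame L 2 p, (isDualFrame_frame hdet).row_ext fun b => ?_⟩
  have h3 := H.pull_dot_conjL.self_of_nhds 4
  have h4 := H.pull_dot_L.self_of_nhds 4
  simp only [add_dotProduct, smul_dotProduct, (isDualFrame_frame hdet).dual]
  fin_cases b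
  · simp
  · simp
  · simp
  · simpa [frame_three] using h3
  · simpa [frame_four] using h4

end PushesGenerator

end Pullback

/-! ### Naturality of the normalized coframe -/

section PullbackStructure

variable {L L' : R5 → C5} {p : R5} {h : R5 → R5} {f : R5 → ℂ}
  {σ ρ ζ θ σ' ρ' ζ' θ' : R5 → C5}

theorem star_dotProduct_push (hh : DifferentiableAt ℝ h p) (η : R5 → C5) (X : C5) :
    star (η (h p)) ⬝ᵥ push h p X = star (pull h η p) ⬝ᵥ X := by
  have h1 := pull_dotProduct h (conjField η) p X
  rw [← conjField_pull hh] at h1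
  exact h1.symm

/-- The exterior derivative commutes with pullback, and the shape of the equations survives the
rescaling of `σ, ρ, ζ` by `f² f̄, f f̄, f`: the differentials of these factors are cancelled by the
terms `df/f` in the pulled back `θ'`. Only the torsion coefficients change, by powers of `f` and
`f̄`. -/
theorem structureAt_of_pull (hh : AnalyticAt ℝ h p) (hf : AnalyticAt ℝ f p) (hf0 : f p ≠ 0)
    (hσd : DifferentiableAt ℝ σ p) (hρd : DifferentiableAt ℝ ρ p)
    (hσd' : DifferentiableAt ℝ σ' (h p)) (hρd' : DifferentiableAt ℝ ρ' (h p))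
    (hσ : pull h σ' =ᶠ[𝓝 p] fun q => (f q ^ 2 * conj (f q)) • σ q)
    (hρ : pull h ρ' =ᶠ[𝓝 p] fun q => (f q * conj (f q)) • ρ q)
    (hζ : pull h ζ' p = f p • ζ p)
    (hθ : ∀ X, pull h θ' p ⬝ᵥ X = θ p ⬝ᵥ X + cD f p X / f p) {K V₁ V₃ : ℂ}
    (hs : StructureAt σ' ρ' ζ' θ' (h p) K V₁ V₃) :
    StructureAt σ ρ ζ θ p (K * conj (f p) ^ 2 / f p) (V₁ * f p ^ 2 * conj (f p) ^ 2)
      (V₃ * conj (f p) ^ 2) := by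
  have hb : conj (f p) ≠ 0 := by simpa using hf0
  have hfd := hf.differentiableAt
  have hfb : DifferentiableAt ℝ (fun q => conj (f q)) p := (analyticAt_conj' hf).differentiableAt
  have hff : DifferentiableAt ℝ (fun q => f q * f q) p := hfd.mul hfd
  have hθb : ∀ X, star (pull h θ' p) ⬝ᵥ X =
      star (θ p) ⬝ᵥ X + cD (fun q => conj (f q)) p X / conj (f p) := fun X => by
    rw [star_dotProduct_eq, hθ, star_dotProduct_eq, cD_conj, map_add, map_div₀]
  have hζb : star (pull h ζ' p) = conj (f p) • star (ζ p) := by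
    rw [hζ, star_smul]; rfl
  have hσp := hσ.self_of_nhds
  have hρp := hρ.self_of_nhds
  have hσb : star (pull h σ' p) = (conj (f p) ^ 2 * f p) • star (σ p) := by
    rw [hσp, star_smul, star_eq_conj, map_mul, map_pow, Complex.conj_conj]
  have k1 : ∀ X, cD (fun q => f q ^ 2 * conj (f q)) p X =
      2 * f p * conj (f p) * cD f p X + f p ^ 2 * cD (fun q => conj (f q)) p X := fun X => by
    have h1 : (fun q => f q ^ 2 * conj (f q)) = fun q => f q * f q * conj (f q) := by
      ext q; ring
    rw [h1, cD_mul hff hfb, cD_mul hfd hfd]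
    ring
  have k2 : ∀ X, cD (fun q => f q * conj (f q)) p X =
      conj (f p) * cD f p X + f p * cD (fun q => conj (f q)) p X := fun X => by
    rw [cD_mul hfd hfb]
    ring
  constructor
  · intro X Y
    have e := hs.1 (push h p X) (push h p Y)
    rw [← dM_pull hσd' hh, dM_congr hσ, dM_smul ((hff.mul hfb).congr_of_eventuallyEq
      (Filter.Eventually.of_forall fun q => by simp only [Pi.mul_apply]; ring)) hσd, k1, k1] at e
    simp only [wd, star_dotProduct_push hh.differentiableAt, ← pull_dotProduct, hθ, hθb, hζb, hσb]
      at e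
    rw [hσp, hρp, hζ] at e
    simp only [smul_dotProduct, smul_eq_mul] at e
    simp only [wd]
    generalize conj (f p) = b at *
    field_simp at e ⊢
    refine mul_left_cancel₀ hb ?_
    linear_combination e
  · intro X Y
    have e := hs.2 (push h p X) (push h p Y)
    rw [← dM_pull hρd' hh, dM_congr hρ, dM_smul (hfd.fun_mul hfb) hρd, k2, k2] at e
    simp only [wd, star_dotProduct_push hh.differentiableAt, ← pull_dotProduct, hθ, hθb, hζb, hσb]
      at e
    rw [hσp, hρp, hζ] at e
    simp only [smul_dotProduct, smul_eq_mul] at e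
    simp only [wd, map_mul, map_pow, Complex.conj_conj]
    generalize conj (f p) = b at *
    field_simp at e ⊢
    refine mul_left_cancel₀ (mul_ne_zero hf0 hb) ?_
    linear_combination e

theorem PushesGenerator.pull_coRow_zero (H : PushesGenerator L L' h f p) :
    pull h (coRow L' 0) p = (conj (f p) ^ 2 * f p) • coRow L 0 p := by
  have e := conjField_pull (η := coRow L' 1) H.analytic.differentiableAt
  have e2 : pull h (conjField (coRow L' 1)) p = pull h (coRow L' 0) p := by
    ext j
    have := star_coRow_one H.generator' H.isUnit_det'.self_of_nhds
    rw [pull, pull, conjField, this]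
  rw [← e2, ← e, conjField, H.pull_coRow_one, star_smul, star_coRow_one H.generator H.isUnit_det.self_of_nhds,
    star_eq_conj, map_mul, map_pow, Complex.conj_conj]

variable {B C D E B' C' D' E' : R5 → ℂ}

theorem PushesGenerator.exists_pull_rho (H : PushesGenerator L L' h f p) {c d : ℂ}
    (hρ : ρ p = conj c • coRow L 0 p + c • coRow L 1 p + coRow L 2 p)
    (hρ' : ρ' (h p) = conj d • coRow L' 0 (h p) + d • coRow L' 1 (h p) + coRow L' 2 (h p)) :
    ∃ x y : ℂ, pull h ρ' p = (f p * conj (f p)) • ρ p + x • coRow L 1 p + y • coRow L 0 p := by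
  obtain ⟨x, y, h2⟩ := H.pull_coRow_two
  have h1 := H.pull_coRow_one
  have h0 := H.pull_coRow_zero
  have h3 : pull h ρ' p = conj d • pull h (coRow L' 0) p + d • pull h (coRow L' 1) p +
      pull h (coRow L' 2) p := by
    ext j
    simp only [pull, hρ', Pi.add_apply, Pi.smul_apply, add_dotProduct, smul_dotProduct]
  refine ⟨d * (f p ^ 2 * conj (f p)) + y - f p * conj (f p) * c,
    conj d * (conj (f p) ^ 2 * f p) + x - f p * conj (f p) * conj c, ?_⟩
  rw [h3, h0, h1, h2, hρ]
  module

theorem PushesGenerator.exists_pull_zeta (H : PushesGenerator L L' h f p) {b c d k b' d' k' : ℂ}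
    (hρ : ρ p = conj c • coRow L 0 p + c • coRow L 1 p + coRow L 2 p)
    (hζ : ζ p = d • coRow L 0 p + k • coRow L 1 p + b • coRow L 2 p + coRow L 4 p)
    (hζ' : ζ' (h p) = d' • coRow L' 0 (h p) + k' • coRow L' 1 (h p) + b' • coRow L' 2 (h p) +
      coRow L' 4 (h p)) :
    ∃ x y z : ℂ, pull h ζ' p = f p • ζ p + x • ρ p + y • coRow L 1 p + z • coRow L 0 p := by
  obtain ⟨x, y, h2⟩ := H.pull_coRow_two
  obtain ⟨x', y', z', h4⟩ := H.pull_coRow_four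
  have h1 := H.pull_coRow_one
  have h0 := H.pull_coRow_zero
  have h3 : pull h ζ' p = d' • pull h (coRow L' 0) p + k' • pull h (coRow L' 1) p +
      b' • pull h (coRow L' 2) p + pull h (coRow L' 4) p := by
    ext j
    simp only [pull, hζ', Pi.add_apply, Pi.smul_apply, add_dotProduct, smul_dotProduct]
  set X := b' * (f p * conj (f p)) + z' - f p * b with hX
  refine ⟨X, k' * (f p ^ 2 * conj (f p)) + b' * y + y' - f p * k - X * c,
    d' * (conj (f p) ^ 2 * f p) + b' * x + x' - f p * d - X * conj c, ?_⟩
  rw [h3, h0, h1, h2, h4, hρ, hζ, hX]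
  module

/-- The pulled back coframe, divided by its weights and with `df/f` removed from `θ'`, is a
normalized coframe on `M` built on the same `σ₀`, so the uniqueness lemmas identify it. The equality
for `ρ` is obtained on all of `V` before `ζ` and `θ` are compared at `p`, because `dρ` enters the
second comparison. -/
theorem IsAdapted.pull_eq {V : Set R5} (hV : IsOpen V)
    (H : ∀ q ∈ V, PushesGenerator L L' h f q) (hA : ∀ q ∈ V, IsAdapted L B C D E ρ ζ θ q)
    (hA' : ∀ q ∈ V, IsAdapted L' B' C' D' E' ρ' ζ' θ' (h q)) {p : R5} (hp : p ∈ V) :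
    pull h ρ' p = (f p * conj (f p)) • ρ p ∧ pull h ζ' p = f p • ζ p ∧
      ∀ X, pull h θ' p ⬝ᵥ X = θ p ⬝ᵥ X + cD f p X / f p := by
  set ρt : R5 → C5 := fun q => (f q * conj (f q))⁻¹ • pull h ρ' q with hρt
  set ζt : R5 → C5 := fun q => (f q)⁻¹ • pull h ζ' q with hζt
  set θt : R5 → C5 := fun q => pull h θ' q - (f q)⁻¹ • fun j => cD f q (Pi.single j 1) with hθt
  have hθt' : ∀ q X, pull h θ' q ⬝ᵥ X = θt q ⬝ᵥ X + cD f q X / f q := fun q X => by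
    have h1 : (fun j => cD f q (Pi.single j 1)) ⬝ᵥ X = cD f q X := by
      conv_rhs => rw [pi_eq_sum_univ' X, map_sum]
      simp only [map_smul, dotProduct, smul_eq_mul, mul_comm]
    rw [hθt, sub_dotProduct, smul_dotProduct, h1, smul_eq_mul]
    ring
  have hf2 : ∀ q ∈ V, f q * conj (f q) ≠ 0 := fun q hq =>
    mul_ne_zero (H q hq).ne_zero (by simpa using (H q hq).ne_zero)
  have hρ2 : ∀ q ∈ V, pull h ρ' q = (f q * conj (f q)) • ρt q := fun q hq => by
    rw [hρt, smul_inv_smul₀ (hf2 q hq)]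
  have hζ2 : ∀ q ∈ V, pull h ζ' q = f q • ζt q := fun q hq => by
    rw [hζt, smul_inv_smul₀ (H q hq).ne_zero]
  have hρ3 : ∀ q ∈ V, star (ρt q) = ρt q := fun q hq => by
    have h1 := conjField_pull (η := ρ') (H q hq).analytic.differentiableAt
    have h2 : pull h (conjField ρ') q = pull h ρ' q := by
      ext j
      rw [pull, pull, conjField,
        (hA' q hq).star_rho (H q hq).generator' (H q hq).isUnit_det'.self_of_nhds]
    rw [h2, conjField] at h1
    rw [hρt, star_smul, h1, star_eq_conj, map_inv₀, map_mul, Complex.conj_conj, mul_comm]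
  have hs : ∀ q ∈ V, ∃ K V₁ V₃, StructureAt (coRow L 1) ρt ζt θt q K V₁ V₃ := fun q hq => by
    obtain ⟨V₁, V₃, h1⟩ := (hA' q hq).structureAt
    have Hq := H q hq
    have hd : DifferentiableAt ℝ ρt q :=
      (((Hq.analytic_factor.fun_mul (analyticAt_conj' Hq.analytic_factor)).fun_inv
        (hf2 q hq)).fun_smul (analyticAt_pull (hA' q hq).analytic_rho Hq.analytic)).differentiableAt
    refine ⟨_, _, _, structureAt_of_pull Hq.analytic Hq.analytic_factor Hq.ne_zero
      (analyticAt_coRow Hq.generator Hq.isUnit_det.self_of_nhds 1).differentiableAt hd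
      (analyticAt_coRow Hq.generator' Hq.isUnit_det'.self_of_nhds 1).differentiableAt
      (hA' q hq).analytic_rho.differentiableAt ?_ ?_ (hζ2 q hq) (hθt' q) h1⟩
    · filter_upwards [hV.mem_nhds hq] with y hy using (H y hy).pull_coRow_one
    · filter_upwards [hV.mem_nhds hq] with y hy using hρ2 y hy
  have hstar : ∀ q ∈ V, star (coRow L 1 q) = coRow L 0 q := fun q hq =>
    star_coRow_one (H q hq).generator (H q hq).isUnit_det.self_of_nhds
  have hζ3 : ∀ q ∈ V, ∃ b k d : ℂ,
      ζt q = ζ q + b • ρ q + k • coRow L 1 q + d • star (coRow L 1 q) := fun q hq => by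
    obtain ⟨x, y, z, h1⟩ := (H q hq).exists_pull_zeta (hA q hq).rho_eq (hA q hq).zeta_eq
      (hA' q hq).zeta_eq
    refine ⟨(f q)⁻¹ * x, (f q)⁻¹ * y, (f q)⁻¹ * z, ?_⟩
    rw [hζt, hstar q hq]
    simp only [h1, smul_add, smul_smul, inv_mul_cancel₀ (H q hq).ne_zero, one_smul]
  have hρ4 : ∀ q ∈ V, ρt q = ρ q := fun q hq => by
    obtain ⟨x, y, h1⟩ := (H q hq).exists_pull_rho (hA q hq).rho_eq (hA' q hq).rho_eq
    obtain ⟨b, k, d, h2⟩ := hζ3 q hq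
    obtain ⟨K, V₁, V₃, h3⟩ := hs q hq
    obtain ⟨V₁', V₃', h4⟩ := (hA q hq).structureAt
    obtain ⟨F, hF⟩ := (hA q hq).exists_dual (H q hq).generator (H q hq).isUnit_det.self_of_nhds
    refine rho_eq_of_structureAt hF ((hA q hq).star_rho (H q hq).generator
      (H q hq).isUnit_det.self_of_nhds) (hρ3 q hq) (c := (f q * conj (f q))⁻¹ * x)
      (c' := (f q * conj (f q))⁻¹ * y) ?_ h2 h4 h3
    rw [hρt, hstar q hq]
    simp only [h1, smul_add, smul_smul, inv_mul_cancel₀ (hf2 q hq), one_smul]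
  obtain ⟨b, k, d, h2⟩ := hζ3 p hp
  obtain ⟨K, V₁, V₃, h3⟩ := hs p hp
  obtain ⟨V₁', V₃', h4⟩ := (hA p hp).structureAt
  obtain ⟨F, hF⟩ := (hA p hp).exists_dual (H p hp).generator (H p hp).isUnit_det.self_of_nhds
  obtain ⟨h5, h6⟩ := eq_of_structureAt hF ((hA p hp).star_rho (H p hp).generator
    (H p hp).isUnit_det.self_of_nhds)
    (by filter_upwards [hV.mem_nhds hp] with y hy using hρ4 y hy) h2 h4 h3
  refine ⟨?_, ?_, fun X => ?_⟩
  · rw [hρ2 p hp, hρ4 p hp]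
  · rw [hζ2 p hp, h5]
  · rw [hθt' p, h6]

end PullbackStructure

/-! ### The lift of a local biholomorphism -/

section ForwardLift

variable {L L' : R5 → C5} {p : R5} {h : R5 → R5} {f : R5 → ℂ} {V : Set R5}
  {ρ ζ θ ρ' ζ' θ' : R5 → C5}

/-- The lift of `h` to the bundles when `h` sends `L` to `f L'`. -/
noncomputable def bundleLift (h : R5 → R5) (f : R5 → ℂ) (x : E7) : E7 := (h x.1, x.2 / f x.1)

theorem fderiv_bundleLift (hh : DifferentiableAt ℝ h p) (hf : DifferentiableAt ℝ f p)
    (hf0 : f p ≠ 0) (a : ℂ) (v : E7) : fderiv ℝ (bundleLift h f) (p, a) v =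
      (fderiv ℝ h p v.1, v.2 / f p - a * cD f p (toC5 v.1) / f p ^ 2) := by
  have h1 : HasFDerivAt (fun x : E7 => h x.1) ((fderiv ℝ h p).comp
      (ContinuousLinearMap.fst ℝ R5 ℂ)) (p, a) :=
    HasFDerivAt.comp (p, a) (f := Prod.fst) hh.hasFDerivAt hasFDerivAt_fst
  have h2 : HasFDerivAt (fun x : E7 => f x.1) ((fderiv ℝ f p).comp
      (ContinuousLinearMap.fst ℝ R5 ℂ)) (p, a) :=
    HasFDerivAt.comp (p, a) (f := Prod.fst) hf.hasFDerivAt hasFDerivAt_fst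
  have h3 : HasFDerivAt (fun x : E7 => (f x.1)⁻¹) _ (p, a) :=
    HasFDerivAt.comp (p, a) ((hasDerivAt_inv hf0).hasFDerivAt.restrictScalars ℝ) h2
  have h4 : HasFDerivAt (fun x : E7 => x.2) (ContinuousLinearMap.snd ℝ R5 ℂ) (p, a) :=
    hasFDerivAt_snd
  have h5 := h1.prodMk (h4.fun_mul h3)
  have h6 : bundleLift h f = fun x : E7 => (h x.1, x.2 * (f x.1)⁻¹) := by
    ext1 x
    rw [bundleLift, div_eq_mul_inv]
  rw [h6, h5.fderiv, cD_toC5]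
  ext1
  · rfl
  · simp
    field_simp
    ring

/-- With `a' = a / f` the weights of `a'` cancel the factors of the pulled back rows, and `da'/a' =
da/a - df/f` cancels the `df/f` of the pulled back `θ'`. -/
theorem bundleLift_preserves {M' : LocalSubmanifold} (hV : ∀ q ∈ V, PushesGenerator L L' h f q)
    (hm : Set.MapsTo h V M'.U) (hr : ∀ q ∈ V, star (ρ q) = ρ q)
    (hr' : ∀ q ∈ V, star (ρ' (h q)) = ρ' (h q))
    (hp : ∀ q ∈ V, pull h ρ' q = (f q * conj (f q)) • ρ q ∧ pull h ζ' q = f q • ζ q ∧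
      ∀ X, pull h θ' q ⬝ᵥ X = θ q ⬝ᵥ X + cD f q X / f q) :
    PreservesConnection M' V (coframeOf (coRow L 1) ρ ζ θ).varpi
      (coframeOf (coRow L' 1) ρ' ζ' θ').varpi (bundleLift h f) where
  analytic x hx := by
    obtain ⟨h1, h2, h3⟩ := hV x.1 hx.1
    exact (h1.comp analyticAt_fst).prod (analyticAt_snd.fun_div (h2.comp analyticAt_fst) h3)
  mapsTo x hx := ⟨hm hx.1, div_ne_zero hx.2 (hV x.1 hx.1).ne_zero⟩
  fiber_preserving x hx y hy hxy := by simp [bundleLift, hxy]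
  pullback_eq := by
    rintro ⟨p, a⟩ ⟨hx : p ∈ V, ha : a ≠ 0⟩ v
    have H := hV p hx
    have hf0 := H.ne_zero
    have hb : conj (f p) ≠ 0 := by simpa using hf0
    have hhd := H.analytic.differentiableAt
    obtain ⟨hρ, hζ, hθ⟩ := hp p hx
    rw [fderiv_bundleLift hhd H.analytic_factor.differentiableAt hf0]
    have e : ∀ η : R5 → C5, η (h p) ⬝ᵥ toC5 (fderiv ℝ h p v.1) = pull h η p ⬝ᵥ toC5 v.1 :=
      fun η => by rw [pull_dotProduct, push_toC5 h p v.1 hhd]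
    refine Subtype.ext ?_
    change gMat _ _ _ _ = gMat _ _ _ _
    have h1 : (coframeOf (coRow L' 1) ρ' ζ' θ').rho (h p, a / f p)
        (fderiv ℝ h p v.1, v.2 / f p - a * cD f p (toC5 v.1) / f p ^ 2) =
        (coframeOf (coRow L 1) ρ ζ θ).rho (p, a) v := by
      apply Complex.ofReal_injective
      rw [coframeOf_rho (hr' p hx), coframeOf_rho (hr p hx)]
      simp only [e, hρ, smul_dotProduct, smul_eq_mul, map_div₀]
      field_simp
    rw [bundleLift, h1]
    congr 1
    · rw [coframeOf_lam, coframeOf_lam]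
      simp only [e, hθ]
      field_simp
      ring
    · rw [coframeOf_sig, coframeOf_sig]
      simp only [e, H.pull_coRow_one, smul_dotProduct, smul_eq_mul, map_div₀]
      field_simp
    · rw [coframeOf_zet, coframeOf_zet]
      simp only [e, hζ, smul_dotProduct, smul_eq_mul]
      field_simp

theorem isEquivariant_bundleLift : IsEquivariant V (bundleLift h f) := by
  intro x _ g _
  simp only [fiberAct, bundleLift]
  rw [div_mul_eq_mul_div]

variable {M M' : LocalSubmanifold}

theorem IsLocalBiholomorphism.cD_eq (hh : IsLocalBiholomorphism M M' V h) (hp : p ∈ V) :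
    ∃ A : C4 →L[ℂ] C4, Function.Bijective A ∧
      ∀ X, cD M'.φ (h p) (push h p X) = A (cD M.φ p X) := by
  obtain ⟨H, hH, hb, he⟩ := hh.extends_holomorphically p hp
  refine ⟨_, hb, fun X => ?_⟩
  rw [push, ← cD_comp (M'.analytic _ (hh.mapsTo hp)).differentiableAt
    (hh.analytic p hp).differentiableAt, ← cD_congr he,
    cD_holomorphic_comp (M.analytic p (hh.subset hp)).differentiableAt hH.differentiableAt]

/-- The differential of a holomorphic map is complex linear, so `h` maps `T^{0,1}M` to `T^{0,1}M'`,
and `T^{1,0}M` to `T^{1,0}M'` because `h` is real. The factor is read off with the row dual to `ℒ'`,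
which shows that it is analytic. -/
theorem IsLocalBiholomorphism.pushesGenerator (hh : IsLocalBiholomorphism M M' V h)
    (hM : M.IsClassIII1) (hM' : M'.IsClassIII1) (hL : M.IsGenerator L) (hL' : M'.IsGenerator L') :
    ∀ p ∈ V, PushesGenerator L L' h (fun q => coRow L' 4 (h q) ⬝ᵥ push h q (L q)) p := by
  have hdet := fun q (hq : q ∈ V) => isUnit_det_frameMatrix hM hL (hh.subset hq)
  have hdet' := fun q (hq : q ∈ V) => isUnit_det_frameMatrix hM' hL' (hh.mapsTo hq)
  have hmem : ∀ q ∈ V, ∃ c : ℂ, push h q (L q) = c • L' (h q) := fun q hq => by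
    obtain ⟨A, -, hA⟩ := hh.cD_eq hq
    have h1 : L q ∈ M.T10 q := by
      rw [← hL.span_eq q (hh.subset hq)]
      exact Submodule.mem_span_singleton_self _
    rw [M.mem_T10_iff (hh.subset hq), LocalSubmanifold.T01, LinearMap.mem_ker, complexDeriv_eq] at h1
    have h2 : push h q (L q) ∈ M'.T10 (h q) := by
      rw [M'.mem_T10_iff (hh.mapsTo hq), ← push_star h q (hh.analytic q hq).differentiableAt,
        LocalSubmanifold.T01, LinearMap.mem_ker, complexDeriv_eq, hA, h1, map_zero]
    rw [← hL'.span_eq _ (hh.mapsTo hq), Submodule.mem_span_singleton] at h2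
    obtain ⟨c, hc⟩ := h2
    exact ⟨c, hc.symm⟩
  have heq : ∀ q ∈ V, push h q (L q) = (coRow L' 4 (h q) ⬝ᵥ push h q (L q)) • L' (h q) :=
    fun q hq => by
      obtain ⟨c, hc⟩ := hmem q hq
      rw [hc, dotProduct_smul, ← frame_four (L := L'), (isDualFrame_frame (hdet' q hq)).dual]
      simp
  intro p hp
  have hLp := hL.analytic p (hh.subset hp)
  have hLp' := hL'.analytic _ (hh.mapsTo hp)
  refine ⟨hh.analytic p hp, analyticAt_dotProduct ((analyticAt_coRow hLp' (hdet' p hp) 4).comp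
    (hh.analytic p hp)) (analyticAt_cD (analyticAt_toC5 (hh.analytic p hp)) hLp), fun h0 => ?_, ?_,
    hLp, hLp', ?_, ?_⟩
  · obtain ⟨A, hb, hA⟩ := hh.cD_eq hp
    have h1 := heq p hp
    rw [h0, zero_smul] at h1
    have h2 := hA (L p)
    rw [h1, map_zero] at h2
    have h3 : cD M.φ p (L p) = 0 := hb.1 (by rw [← h2, map_zero])
    -- If the factor vanished, `ℒ` would also lie in `T^{0,1}M`, so `ℒ̄` would be a multiple of `ℒ`,
    -- against the independence of the frame.
    have h4 : star (L p) ∈ M.T10 p := by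
      rw [M.mem_T10_iff (hh.subset hp), star_star]
      exact h3
    rw [← hL.span_eq p (hh.subset hp), Submodule.mem_span_singleton] at h4
    obtain ⟨c, hc⟩ := h4
    have h5 := (isDualFrame_frame (hdet p hp)).dual 3 3
    rw [frame_three, conjField, ← hc, dotProduct_smul, ← frame_four (L := L),
      (isDualFrame_frame (hdet p hp)).dual] at h5
    simp at h5
  · filter_upwards [hh.isOpen.mem_nhds hp] with q hq using heq q hq
  · filter_upwards [hh.isOpen.mem_nhds hp] with q hq using hdet q hq
  · filter_upwards [M'.isOpen_U.mem_nhds (hh.mapsTo hp)] with q hq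
    exact isUnit_det_frameMatrix hM' hL' hq

end ForwardLift

/-! ### Normalized coframes on the bundle and the direct half of canonicity -/

section CanonicalCoframe

/-- The coframe is built from a normalized coframe on the base. -/
def IsNormalized (M : LocalSubmanifold) (L : R5 → C5) (c : Coframe) : Prop :=
  ∃ (B C D E : R5 → ℂ) (ρ ζ θ : R5 → C5), (∀ p ∈ M.U, IsAdapted L B C D E ρ ζ θ p) ∧
    c = coframeOf (coRow L 1) ρ ζ θ

variable {M M' : LocalSubmanifold} {L L' : R5 → C5} {c c' : Coframe}

theorem exists_isNormalized (hM : M.IsClassIII1) (hL : M.IsGenerator L) :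
    ∃ c, IsNormalized M L c := by
  obtain ⟨B, C, D, E, ρ, ζ, θ, h⟩ := exists_adapted_coframe M.isOpen_U hL.analytic
    fun p hp => isUnit_det_frameMatrix hM hL hp
  refine ⟨_, B, C, D, E, ρ, ζ, θ, fun p hp => ?_, rfl⟩
  obtain ⟨h1, h2, h3, h4, h5, h6, h7, h8, h9, h10⟩ := h p hp
  exact ⟨h1, h2, h3, h4, h5, h6, h7, h8, h9, h10⟩

theorem IsNormalized.isCanonical (h : IsNormalized M L c) (hM : M.IsClassIII1)
    (hL : M.IsGenerator L) : c.IsAnalytic (bundleOver M.U) ∧ IsReducedCoframe M L c ∧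
      StructureEquations M L c ∧ IsCartanConnection (bundleOver M.U) c.varpi := by
  obtain ⟨B, C, D, E, ρ, ζ, θ, hA, rfl⟩ := h
  have hdet := fun p hp => isUnit_det_frameMatrix hM hL (p := p) hp
  have hσ : AnalyticOnNhd ℝ (coRow L 1) M.U := fun p hp =>
    analyticAt_coRow (hL.analytic p hp) (hdet p hp) 1
  have hρ : AnalyticOnNhd ℝ ρ M.U := fun p hp => (hA p hp).analytic_rho
  have hζ : AnalyticOnNhd ℝ ζ M.U := fun p hp => (hA p hp).analytic_zeta
  have hθ : AnalyticOnNhd ℝ θ M.U := fun p hp => (hA p hp).analytic_theta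
  exact ⟨coframeOf_isAnalytic hσ hρ hζ hθ, coframeOf_isReduced hA hL.analytic hdet,
    coframeOf_structureEquations hA hL.analytic hdet,
    coframeOf_isCartanConnection hσ hρ hζ hθ
      (fun p hp => (hA p hp).star_rho (hL.analytic p hp) (hdet p hp))
      fun p hp => (hA p hp).exists_dual (hL.analytic p hp) (hdet p hp)⟩

theorem IsNormalized.exists_lift (hc : IsNormalized M L c) (hc' : IsNormalized M' L' c')
    (hM : M.IsClassIII1) (hL : M.IsGenerator L) (hM' : M'.IsClassIII1) (hL' : M'.IsGenerator L')
    {V : Set R5} {h : R5 → R5} (hh : IsLocalBiholomorphism M M' V h) :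
    ∃ F : E7 → E7, Covers V F h ∧ IsEquivariant V F ∧
      PreservesConnection M' V c.varpi c'.varpi F := by
  obtain ⟨B, C, D, E, ρ, ζ, θ, hA, rfl⟩ := hc
  obtain ⟨B', C', D', E', ρ', ζ', θ', hA', rfl⟩ := hc'
  have H := hh.pushesGenerator hM hM' hL hL'
  refine ⟨bundleLift h fun q => coRow L' 4 (h q) ⬝ᵥ push h q (L q), fun x _ => rfl,
    isEquivariant_bundleLift, bundleLift_preserves H hh.mapsTo (fun q hq => ?_) (fun q hq => ?_)
      fun q hq => IsAdapted.pull_eq hh.isOpen H (fun q hq => hA q (hh.subset hq))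
        (fun q hq => hA' _ (hh.mapsTo hq)) hq⟩
  · exact (hA q (hh.subset hq)).star_rho (H q hq).generator (H q hq).isUnit_det.self_of_nhds
  · exact (hA' _ (hh.mapsTo hq)).star_rho (H q hq).generator' (H q hq).isUnit_det'.self_of_nhds

end CanonicalCoframe

/-! ### Factoring a holomorphic map through a submersion -/

section HolomorphicFactor

variable {E F G : Type*} [NormedAddCommGroup E] [NormedSpace ℂ E] [CompleteSpace E]
  [NormedAddCommGroup F] [NormedSpace ℂ F] [FiniteDimensional ℂ F] [CompleteSpace F]
  [NormedAddCommGroup G] [NormedSpace ℂ G] [CompleteSpace G]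

/-- A holomorphic map which is infinitesimally constant along the fibres of a holomorphic submersion
factors through it. -/
theorem exists_holomorphic_factor {Φ : E → F} {Γ : E → G} {z₀ : E} (hΦ : AnalyticAt ℂ Φ z₀)
    (hΓ : AnalyticAt ℂ Γ z₀) (hs : (fderiv ℂ Φ z₀).range = ⊤)
    (hk : ∀ᶠ z in 𝓝 z₀, ∀ v, fderiv ℂ Φ z v = 0 → fderiv ℂ Γ z v = 0) :
    ∃ H : F → G, AnalyticAt ℂ H (Φ z₀) ∧ ∀ᶠ z in 𝓝 z₀, H (Φ z) = Γ z := by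
  obtain ⟨P, hP⟩ := (fderiv ℂ Φ z₀).ker_closedComplemented_of_finiteDimensional_range
  have hPs : P.range = ⊤ := LinearMap.range_eq_top.2 fun x => ⟨x, hP x⟩
  let A := (fderiv ℂ Φ z₀).equivProdOfSurjectiveOfIsCompl P hs hPs (LinearMap.isCompl_of_proj hP)
  -- A projection onto the kernel of the differential completes `Φ` to local coordinates. In these,
  -- `Γ` will not depend on the kernel coordinate, and `H` is obtained by freezing that coordinate
  -- at its value at `z₀`.
  let Ψ : E → F × (fderiv ℂ Φ z₀).ker := fun z => (Φ z, P z)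
  have hΨ : AnalyticAt ℂ Ψ z₀ := hΦ.prod (P.analyticAt z₀)
  have hΨ' : HasFDerivAt Ψ (A : E →L[ℂ] F × (fderiv ℂ Φ z₀).ker) z₀ :=
    hΦ.differentiableAt.hasFDerivAt.prodMk P.hasFDerivAt
  have hc : ContDiffAt ℂ ω Ψ z₀ := hΨ.contDiffAt
  let e := hc.toOpenPartialHomeomorph Ψ hΨ' (by simp)
  have hz : z₀ ∈ e.source := hc.mem_toOpenPartialHomeomorph_source hΨ' (by simp)
  have he0 : e.symm (Ψ z₀) = z₀ := e.left_inv hz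
  have ht : Ψ z₀ ∈ e.target := hc.image_mem_toOpenPartialHomeomorph_target hΨ' (by simp)
  have hsymm : AnalyticAt ℂ e.symm (Ψ z₀) :=
    (hc.to_localInverse hΨ' (by simp)).analyticAt
  have hev : ∀ᶠ y in 𝓝 (Ψ z₀), y ∈ e.target ∧ AnalyticAt ℂ e.symm y ∧
      (∀ v, fderiv ℂ Φ (e.symm y) v = 0 → fderiv ℂ Γ (e.symm y) v = 0) ∧
      AnalyticAt ℂ Φ (e.symm y) ∧ AnalyticAt ℂ Γ (e.symm y) := by
    have hcont : Filter.Tendsto e.symm (𝓝 (Ψ z₀)) (𝓝 z₀) := by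
      have h := hsymm.continuousAt.tendsto
      rwa [he0] at h
    filter_upwards [e.open_target.mem_nhds ht, hsymm.eventually_analyticAt, hcont.eventually hk,
      hcont.eventually hΦ.eventually_analyticAt, hcont.eventually hΓ.eventually_analyticAt]
      with y h1 h2 h3 h4 h5 using ⟨h1, h2, h3, h4, h5⟩
  obtain ⟨ε, hε, hB⟩ := Metric.eventually_nhds_iff_ball.1 hev
  have hconst : ∀ w ∈ Metric.ball (Φ z₀) ε, ∀ s ∈ Metric.ball (P z₀) ε,
      Γ (e.symm (w, s)) = Γ (e.symm (w, P z₀)) := by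
    intro w hw s hs'
    have hmem : ∀ t ∈ Metric.ball (P z₀) ε, (w, t) ∈ Metric.ball (Ψ z₀) ε := fun t ht => by
      change (w, t) ∈ Metric.ball (Φ z₀, P z₀) ε
      rw [← ball_prod_same]
      exact ⟨hw, ht⟩
    have hγ : ∀ t ∈ Metric.ball (P z₀) ε, DifferentiableAt ℂ (fun t => e.symm (w, t)) t :=
      fun t ht => DifferentiableAt.comp t (hB _ (hmem t ht)).2.1.differentiableAt
        ((differentiableAt_const w).prodMk differentiableAt_id)
    refine Metric.isOpen_ball.is_const_of_fderiv_eq_zero (𝕜 := ℂ)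
      (f := fun t => Γ (e.symm (w, t))) (convex_ball (P z₀) ε).isPreconnected ?_ ?_ hs'
      (Metric.mem_ball_self hε)
    · exact fun t ht => (DifferentiableAt.comp t (hB _ (hmem t ht)).2.2.2.2.differentiableAt
        (hγ t ht)).differentiableWithinAt
    · intro t ht
      obtain ⟨-, -, hker, hΦt, hΓt⟩ := hB _ (hmem t ht)
      -- Along the slice `Φ` is constantly `w`, so the velocity of the slice lies in the kernel of
      -- the differential of `Φ`, where that of `Γ` vanishes by assumption.
      have h1 : (fun t => Φ (e.symm (w, t))) =ᶠ[𝓝 t] fun _ => w := by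
        filter_upwards [Metric.isOpen_ball.mem_nhds ht] with u hu
        exact congrArg Prod.fst (e.right_inv (hB _ (hmem u hu)).1)
      have h2 : fderiv ℂ (fun t => Φ (e.symm (w, t))) t =
          (fderiv ℂ Φ (e.symm (w, t))).comp (fderiv ℂ (fun t => e.symm (w, t)) t) :=
        fderiv_comp t hΦt.differentiableAt (hγ t ht)
      have h3 : fderiv ℂ (fun t => Γ (e.symm (w, t))) t =
          (fderiv ℂ Γ (e.symm (w, t))).comp (fderiv ℂ (fun t => e.symm (w, t)) t) :=
        fderiv_comp t hΓt.differentiableAt (hγ t ht)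
      rw [h3]
      ext v
      refine hker _ ?_
      have h4 := congrArg (fun B => B v) h2
      rw [h1.fderiv_eq] at h4
      simpa using h4.symm
  refine ⟨fun w => Γ (e.symm (w, P z₀)), ?_, ?_⟩
  · have h1 : AnalyticAt ℂ (fun w : F => (w, P z₀)) (Φ z₀) := analyticAt_id.prod analyticAt_const
    have h2 : AnalyticAt ℂ (fun w => e.symm (w, P z₀)) (Φ z₀) := AnalyticAt.comp hsymm h1
    refine AnalyticAt.comp (g := Γ) ?_ h2
    change AnalyticAt ℂ Γ (e.symm (Ψ z₀))
    rwa [he0]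
  · filter_upwards [e.open_source.mem_nhds hz,
      hΨ.continuousAt.eventually (Metric.ball_mem_nhds _ hε)] with z h1 h2
    change Ψ z ∈ Metric.ball (Φ z₀, P z₀) ε at h2
    rw [← ball_prod_same] at h2
    have h3 := hconst (Φ z) h2.1 (P z) h2.2
    have h4 : e.symm (Φ z, P z) = z := e.left_inv h1
    rw [h4] at h3
    exact h3.symm

end HolomorphicFactor

/-! ### Holomorphic extension of analytic CR maps -/

section HolomorphicExtension

/-- With the extra row `star (cross A)` the matrix becomes invertible. Subtracting from `v` its
Hermitian projection on `cross A` gives a vector killed by all five rows. -/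
theorem eq_smul_cross {A : Matrix (Fin 4) (Fin 5) ℂ} (h : cross A ≠ 0) {v : C5}
    (hv : A *ᵥ v = 0) : ∃ c : ℂ, v = c • cross A := by
  set r := star (cross A) with hr
  have h0 : r ⬝ᵥ cross A ≠ 0 := fun h0 => h (eq_zero_of_star_dotProduct h0)
  set c := (r ⬝ᵥ v) / (r ⬝ᵥ cross A) with hc
  refine ⟨c, sub_eq_zero.1 ?_⟩
  refine Matrix.eq_zero_of_mulVec_eq_zero (M := Matrix.of (Fin.cons r A : Fin 5 → C5))
    (by rwa [det_cons_eq_dotProduct]) ?_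
  ext i
  refine Fin.cases ?_ (fun i => ?_) i
  · change r ⬝ᵥ (v - c • cross A) = 0
    rw [dotProduct_sub, dotProduct_smul, hc, smul_eq_mul, div_mul_cancel₀ _ h0, sub_self]
  · change (A *ᵥ (v - c • cross A)) i = 0
    rw [Matrix.mulVec_sub, Matrix.mulVec_smul, mulVec_cross, hv]
    simp

theorem analyticAt_cross {A : C5 → Matrix (Fin 4) (Fin 5) ℂ} {z : C5}
    (hA : ∀ i j, AnalyticAt ℂ (fun y => A y i j) z) : AnalyticAt ℂ (fun y => cross (A y)) z := by
  rw [analyticAt_pi_iff]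
  intro j
  simp only [cross, Matrix.det_apply]
  refine Finset.analyticAt_fun_sum _ fun τ _ => ?_
  have h : AnalyticAt ℂ (fun y => ∏ i, (Matrix.of (Fin.cons (Pi.single j 1) (A y) : Fin 5 → C5))
      (τ i) i) z := by
    refine Finset.analyticAt_fun_prod (𝕜 := ℂ) _ fun i _ => ?_
    generalize τ i = k
    refine Fin.cases ?_ (fun k => ?_) k
    · exact analyticAt_const
    · exact hA k i
  rcases Int.units_eq_one_or (Equiv.Perm.sign τ) with hs | hs <;> rw [hs]
  · simpa using h
  · simpa using h.fun_neg

/-- The Jacobian matrix of a holomorphic map. -/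
noncomputable def holJac (Φ : C5 → C4) (z : C5) : Matrix (Fin 4) (Fin 5) ℂ :=
  Matrix.of fun i j => fderiv ℂ Φ z (Pi.single j 1) i

theorem holJac_mulVec (Φ : C5 → C4) (z v : C5) : holJac Φ z *ᵥ v = fderiv ℂ Φ z v := by
  conv_rhs => rw [pi_eq_sum_univ' v, map_sum]
  ext i
  simp [holJac, Matrix.mulVec, dotProduct, mul_comm]

theorem fderiv_complexification_eq_cD {Φ : C5 → C4} {φ : R5 → C4} {q : R5}
    (hΦ : DifferentiableAt ℂ Φ (ofRealVec q)) (h : ∀ᶠ q' in 𝓝 q, Φ (ofRealVec q') = φ q') (X : C5) :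
    fderiv ℂ Φ (ofRealVec q) X = cD φ q X := by
  rw [cD_apply]
  conv_lhs => rw [pi_eq_sum_univ' X, map_sum]
  refine Finset.sum_congr rfl fun j _ => ?_
  have h1 : ofRealVec (Pi.single j 1 : R5) = Pi.single j 1 := by
    ext i
    by_cases hij : i = j
    · subst hij; simp [ofRealVec]
    · simp [ofRealVec, hij]
  rw [map_smul, fderiv_of_complexification hΦ h, h1]

/-- A real-analytic CR map of a CR-generic submanifold extends holomorphically. -/
theorem exists_holomorphic_extension {φ g : R5 → C4} {p : R5} (hφ : AnalyticAt ℝ φ p)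
    (hg : AnalyticAt ℝ g p) (hs : LinearMap.range (cD φ p) = ⊤)
    (hk : ∀ᶠ q in 𝓝 p, ∀ X, cD φ q X = 0 → cD g q X = 0) :
    ∃ H : C4 → C4, AnalyticAt ℂ H (φ p) ∧ ∀ᶠ q in 𝓝 p, H (φ q) = g q := by
  obtain ⟨Φ, hΦ, hΦφ⟩ := exists_complexification hφ
  obtain ⟨Γ, hΓ, hΓg⟩ := exists_complexification hg
  have hcont : Filter.Tendsto (ofRealVec : R5 → C5) (𝓝 p) (𝓝 (ofRealVec p)) :=
    continuous_ofRealVec.tendsto p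
  have hs' : LinearMap.range (fderiv ℂ Φ (ofRealVec p) : C5 →ₗ[ℂ] C4) = ⊤ := by
    rw [← hs]
    congr 1
    exact LinearMap.ext fun X => fderiv_complexification_eq_cD hΦ.differentiableAt hΦφ X
  have hJ : ∀ z, (holJac Φ z).mulVecLin = (fderiv ℂ Φ z : C5 →ₗ[ℂ] C4) := fun z =>
    LinearMap.ext fun v => holJac_mulVec Φ z v
  have hcd : ∀ᶠ z in 𝓝 (ofRealVec p), DifferentiableAt ℂ (fun z => cross (holJac Φ z)) z := by
    filter_upwards [hΦ.fderiv.eventually_analyticAt] with z hz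
    exact (analyticAt_cross fun i j => analyticAt_pi_iff.1
      (((ContinuousLinearMap.apply ℂ C4 (Pi.single j 1 : C5)).analyticAt _).comp hz)
        i).differentiableAt
  have hne : ∀ᶠ z in 𝓝 (ofRealVec p), cross (holJac Φ z) ≠ 0 :=
    hcd.self_of_nhds.continuousAt.eventually_ne (cross_ne_zero (by rw [hJ]; exact hs'))
  -- The CR condition is known at real points only. The cross product of the rows of the Jacobian of
  -- `Φ` is a holomorphic field spanning the kernel, so the derivative of `Γ` along it is
  -- holomorphic; it vanishes at real points and therefore at all nearby complex points.
  have hzero : ∀ᶠ z in 𝓝 (ofRealVec p), fderiv ℂ Γ z (cross (holJac Φ z)) = 0 := by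
    refine eventually_eq_zero_of_real ?_ ?_
    · filter_upwards [hcd, hΓ.fderiv.eventually_analyticAt] with z h1 h2
      exact h2.differentiableAt.clm_apply h1
    · filter_upwards [hk, hΦφ.eventually_nhds, hΓg.eventually_nhds,
        hcont.eventually hΦ.eventually_analyticAt, hcont.eventually hΓ.eventually_analyticAt]
        with q h1 h2 h3 h4 h5
      rw [fderiv_complexification_eq_cD h5.differentiableAt h3]
      refine h1 _ ?_
      rw [← fderiv_complexification_eq_cD h4.differentiableAt h2, ← holJac_mulVec, mulVec_cross]
  obtain ⟨H, hH, he⟩ := exists_holomorphic_factor hΦ hΓ hs' (by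
    filter_upwards [hne, hzero] with z h1 h2 v hv
    rw [← holJac_mulVec] at hv
    obtain ⟨c, rfl⟩ := eq_smul_cross h1 hv
    rw [map_smul, h2, smul_zero])
  rw [hΦφ.self_of_nhds] at hH
  refine ⟨H, hH, ?_⟩
  filter_upwards [hcont.eventually he, hΦφ, hΓg] with q h1 h2 h3
  rw [← h2, h1, h3]

end HolomorphicExtension

/-! ### From connection-preserving maps to local biholomorphisms -/

section Converse

variable {M M' : LocalSubmanifold} {L L' : R5 → C5} {c c' : Coframe}

theorem PreservesConnection.analytic_base {ϖ ϖ' : E7 → E7 →ₗ[ℝ] g7} {V : Set R5} {F : E7 → E7}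
    (hF : PreservesConnection M' V ϖ ϖ' F) : AnalyticOnNhd ℝ (fun p => (F (p, 1)).1) V :=
  fun p hp => analyticAt_fst.comp (AnalyticAt.comp (g := F) (f := fun p : R5 => (p, (1 : ℂ)))
    (hF.analytic (p, 1) ⟨hp, one_ne_zero⟩) (analyticAt_id.prod analyticAt_const))

theorem fderiv_base {F : E7 → E7} {p : R5} (hF : DifferentiableAt ℝ F (p, 1)) (u : R5) :
    fderiv ℝ (fun p => (F (p, 1)).1) p u = (fderiv ℝ F (p, 1) (u, 0)).1 := by
  have h1 : HasFDerivAt (fun p : R5 => (p, (1 : ℂ))) (ContinuousLinearMap.inl ℝ R5 ℂ) p :=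
    (hasFDerivAt_id p).prodMk (hasFDerivAt_const (1 : ℂ) p)
  have h2 : HasFDerivAt (fun p => (F (p, 1)).1) _ p :=
    hasFDerivAt_fst.comp p (HasFDerivAt.comp (g := F) p hF.hasFDerivAt h1)
  rw [h2.fderiv]
  rfl

theorem row_ext_real {r r' : C5} (h : ∀ u : R5, r ⬝ᵥ toC5 u = r' ⬝ᵥ toC5 u) : r = r' := by
  ext j
  have h1 : toC5 (Pi.single j 1) = Pi.single j 1 := by
    ext i
    by_cases hij : i = j
    · subst hij; simp [toC5]
    · simp [toC5, hij]
  have h2 := h (Pi.single j 1)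
  rw [h1] at h2
  simpa using h2

/-- A fibre-preserving map which respects the normalized coframes pulls back each row to a multiple
of the corresponding row. -/
theorem PreservesConnection.pull_eq {σ ρ ζ θ σ' ρ' ζ' θ' : R5 → C5} {V : Set R5} {F : E7 → E7}
    (hF : PreservesConnection M' V (coframeOf σ ρ ζ θ).varpi (coframeOf σ' ρ' ζ' θ').varpi F)
    {p : R5} (hp : p ∈ V) (hr : star (ρ p) = ρ p)
    (hr' : star (ρ' (F (p, 1)).1) = ρ' (F (p, 1)).1) :
    ∃ k₁ k₂ k₃ : ℂ, k₁ ≠ 0 ∧ k₂ ≠ 0 ∧ k₃ ≠ 0 ∧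
      σ p = k₁ • pull (fun p => (F (p, 1)).1) σ' p ∧
      ρ p = k₂ • pull (fun p => (F (p, 1)).1) ρ' p ∧
      ζ p = k₃ • pull (fun p => (F (p, 1)).1) ζ' p := by
  have hx : ((p, 1) : E7) ∈ bundleOver V := ⟨hp, one_ne_zero⟩
  have ha : (F (p, 1)).2 ≠ 0 := (hF.mapsTo hx).2
  have hb : conj (F (p, 1)).2 ≠ 0 := by simpa using ha
  have hd := hF.analytic_base p hp
  have hpush : ∀ (η : R5 → C5) (u : R5), η (F (p, 1)).1 ⬝ᵥ toC5 (fderiv ℝ F (p, 1) (u, 0)).1 =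
      pull (fun p => (F (p, 1)).1) η p ⬝ᵥ toC5 u := fun η u => by
    rw [pull_dotProduct, push_toC5 _ p u hd.differentiableAt,
      fderiv_base (hF.analytic _ hx).differentiableAt]
  have key := fun u : R5 => gMat_injective (congrArg Subtype.val (hF.pullback_eq (p, 1) hx (u, 0)))
  refine ⟨(F (p, 1)).2 ^ 2 * conj (F (p, 1)).2, (F (p, 1)).2 * conj (F (p, 1)).2, (F (p, 1)).2,
    mul_ne_zero (pow_ne_zero 2 ha) hb, mul_ne_zero ha hb, ha, row_ext_real fun u => ?_,
    row_ext_real fun u => ?_, row_ext_real fun u => ?_⟩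
  · have h := (key u).2.1
    rw [coframeOf_sig] at h
    have e : F (p, 1) = ((F (p, 1)).1, (F (p, 1)).2) := rfl
    rw [e, coframeOf_sig, hpush] at h
    rw [smul_dotProduct, smul_eq_mul, h]
    simp
  · have h := congrArg (fun r : ℝ => (r : ℂ)) (key u).2.2.1
    have e : F (p, 1) = ((F (p, 1)).1, (F (p, 1)).2) := rfl
    rw [e] at h
    simp only [coframeOf_rho hr, coframeOf_rho hr'] at h
    rw [hpush] at h
    rw [smul_dotProduct, smul_eq_mul, h]
    simp
  · have h := (key u).2.2.2
    rw [coframeOf_zet] at h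
    have e : F (p, 1) = ((F (p, 1)).1, (F (p, 1)).2) := rfl
    rw [e, coframeOf_zet, hpush] at h
    rw [smul_dotProduct, smul_eq_mul, h]
    simp

theorem mem_T01_of_cD {p : R5} (hL : M.IsGenerator L) (hp : p ∈ M.U) {X : C5}
    (hX : cD M.φ p X = 0) : ∃ k : ℂ, X = k • conjField L p := by
  have h1 : star X ∈ M.T10 p := by
    rw [M.mem_T10_iff hp, star_star]
    exact hX
  rw [← hL.span_eq p hp, Submodule.mem_span_singleton] at h1
  obtain ⟨k, hk⟩ := h1
  refine ⟨conj k, ?_⟩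
  rw [← star_star X, ← hk, star_smul]
  rfl

theorem cD_conjField_eq_zero {p : R5} (hL : M.IsGenerator L) (hp : p ∈ M.U) :
    cD M.φ p (conjField L p) = 0 := by
  have h1 : L p ∈ M.T10 p := by
    rw [← hL.span_eq p hp]
    exact Submodule.mem_span_singleton_self _
  rwa [M.mem_T10_iff hp] at h1

/-- The base map is read off on the section `a = 1`, and fibre preservation makes it independent of
that section. The pulled back rows `σ, ρ, ζ` are nonzero multiples of the rows of `M`, so the map is
an immersion, hence a local diffeomorphism, and it sends `ℒ̄` to a multiple of `ℒ̄'`. It is thus a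
CR map, and the holomorphic extension applies to `φ' ∘ h`. -/
theorem IsNormalized.covers (hc : IsNormalized M L c) (hc' : IsNormalized M' L' c')
    (hM : M.IsClassIII1) (hL : M.IsGenerator L) (hM' : M'.IsClassIII1) (hL' : M'.IsGenerator L')
    {V : Set R5} {F : E7 → E7} (hV : IsOpen V) (hVU : V ⊆ M.U)
    (hF : PreservesConnection M' V c.varpi c'.varpi F) :
    ∃ h : R5 → R5, Covers V F h ∧ IsLocalBiholomorphism M M' V h := by
  obtain ⟨B, C, D, E, ρ, ζ, θ, hA, rfl⟩ := hc
  obtain ⟨B', C', D', E', ρ', ζ', θ', hA', rfl⟩ := hc'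
  have hm : ∀ p ∈ V, (F (p, 1)).1 ∈ M'.U := fun p hp => (hF.mapsTo ⟨hp, one_ne_zero⟩).1
  have han := hF.analytic_base
  have hpull := fun p hp => hF.pull_eq (p := p) hp
    ((hA p (hVU hp)).star_rho (hL.analytic p (hVU hp)) (isUnit_det_frameMatrix hM hL (hVU hp)))
    ((hA' _ (hm p hp)).star_rho (hL'.analytic _ (hm p hp))
      (isUnit_det_frameMatrix hM' hL' (hm p hp)))
  set h : R5 → R5 := fun p => (F (p, 1)).1
  replace hm : ∀ p ∈ V, h p ∈ M'.U := hm
  have hinj : ∀ p ∈ V, ∀ u, fderiv ℝ h p u = 0 → u = 0 := fun p hp u hu => by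
    obtain ⟨k₁, k₂, k₃, -, -, -, h1, h2, h3⟩ := hpull p hp
    obtain ⟨G, hG⟩ := (hA p (hVU hp)).exists_dual (hL.analytic p (hVU hp))
      (isUnit_det_frameMatrix hM hL (hVU hp))
    have h0 : ∀ η : R5 → C5, pull h η p ⬝ᵥ toC5 u = 0 := fun η => by
      rw [pull_dotProduct, push_toC5 h p u (han p hp).differentiableAt, hu]
      simp [toC5, dotProduct]
    have h4 : coRow L 1 p ⬝ᵥ toC5 u = 0 := by rw [h1, smul_dotProduct, h0, smul_zero]
    have h5 : ρ p ⬝ᵥ toC5 u = 0 := by rw [h2, smul_dotProduct, h0, smul_zero]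
    have h6 : ζ p ⬝ᵥ toC5 u = 0 := by rw [h3, smul_dotProduct, h0, smul_zero]
    have h7 := hG.expand (toC5 u)
    simp only [Fin.sum_univ_five, Matrix.cons_val, ← conj_dot_toC5, h4, h5, h6, map_zero, zero_smul,
      add_zero] at h7
    ext j
    have := congrFun h7 j
    simpa [toC5] using this
  -- The image of `ℒ̄` is killed by all rows of the second coframe except the one dual to `ℒ̄'`. The
  -- row `σ̄₀'` is treated through `σ(ℒ) = 0` and conjugation, and the rows `ρ₀'`, `ζ₀'` are then
  -- isolated from `ρ'` and `ζ'`.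
  have hker : ∀ p ∈ V, ∀ X, cD M.φ p X = 0 → cD (fun q => M'.φ (h q)) p X = 0 := by
    intro p hp X hX
    have hpU := hVU hp
    have hdet := isUnit_det_frameMatrix hM hL hpU
    have hdet' := isUnit_det_frameMatrix hM' hL' (hm p hp)
    have hF0 := isDualFrame_frame hdet
    have hd := (han p hp).differentiableAt
    obtain ⟨k, rfl⟩ := mem_T01_of_cD hL hpU hX
    obtain ⟨k₁, k₂, k₃, n₁, n₂, n₃, h1, h2, h3⟩ := hpull p hp
    have e3 : conjField L p = frame L 3 p := rfl
    have e4 : L p = frame L 4 p := rfl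
    have f1 : coRow L' 1 (h p) ⬝ᵥ push h p (conjField L p) = 0 := by
      have h4 := hF0.dual 1 3
      rw [h1, smul_dotProduct, ← e3, pull_dotProduct, if_neg (by decide), smul_eq_zero] at h4
      exact h4.resolve_left n₁
    have f0 : coRow L' 0 (h p) ⬝ᵥ push h p (conjField L p) = 0 := by
      have h4 := hF0.dual 1 4
      rw [h1, smul_dotProduct, ← e4, pull_dotProduct, if_neg (by decide), smul_eq_zero] at h4
      rw [← star_coRow_one (hL'.analytic _ (hm p hp)) hdet', conjField, push_star h p hd,
        star_dotProduct_eq, star_star, h4.resolve_left n₁, map_zero]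
    have f2 : coRow L' 2 (h p) ⬝ᵥ push h p (conjField L p) = 0 := by
      have h4 : ρ p ⬝ᵥ conjField L p = 0 := by
        rw [(hA p hpU).rho_eq]
        simp only [add_dotProduct, smul_dotProduct, e3, hF0.dual]
        simp
      rw [h2, smul_dotProduct, pull_dotProduct, smul_eq_zero] at h4
      have h5 := h4.resolve_left n₂
      rw [(hA' _ (hm p hp)).rho_eq] at h5
      simpa only [add_dotProduct, smul_dotProduct, f0, f1, smul_zero, zero_add] using h5
    have f4 : coRow L' 4 (h p) ⬝ᵥ push h p (conjField L p) = 0 := by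
      have h4 : ζ p ⬝ᵥ conjField L p = 0 := by
        rw [(hA p hpU).zeta_eq]
        simp only [add_dotProduct, smul_dotProduct, e3, hF0.dual]
        simp
      rw [h3, smul_dotProduct, pull_dotProduct, smul_eq_zero] at h4
      have h5 := h4.resolve_left n₃
      rw [(hA' _ (hm p hp)).zeta_eq] at h5
      simpa only [add_dotProduct, smul_dotProduct, f0, f1, f2, smul_zero, zero_add] using h5
    have h6 := (isDualFrame_frame hdet').expand (push h p (conjField L p))
    simp only [Fin.sum_univ_five, f0, f1, f2, f4, zero_smul, zero_add, add_zero] at h6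
    have h7 := cD_comp (M'.analytic _ (hm p hp)).differentiableAt hd (k • conjField L p)
    change _ = cD M'.φ (h p) (push h p (k • conjField L p)) at h7
    rw [h7, map_smul, h6, frame_three, map_smul, map_smul, cD_conjField_eq_zero hL' (hm p hp),
      smul_zero, smul_zero]
  refine ⟨h, fun x hx => hF.fiber_preserving x hx (x.1, 1) ⟨hx.1, one_ne_zero⟩ rfl,
    hV, hVU, hm, han, fun p hp => ?_⟩
  have hpU := hVU hp
  have hd := (han p hp).differentiableAt
  have hφ := M.analytic p hpU
  have hφ' : AnalyticAt ℝ (fun q => M'.φ (h q)) p :=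
    AnalyticAt.comp (g := M'.φ) (M'.analytic _ (hm p hp)) (han p hp)
  have hs : LinearMap.range (cD M.φ p) = ⊤ := M.range_complexDeriv hM.1 hpU
  obtain ⟨H, hH, he⟩ := exists_holomorphic_extension hφ hφ' hs (by
    filter_upwards [hV.mem_nhds hp] with q hq using hker q hq)
  refine ⟨H, hH, ?_, he⟩
  -- The range of the differential of `H` contains the real tangent space of `M'`, because `h` is a
  -- local diffeomorphism, and this space spans `ℂ⁴` over `ℂ` by genericity.
  have hsurj : Function.Surjective (fderiv ℂ H (M.φ p) : C4 →ₗ[ℂ] C4) := by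
    rw [← LinearMap.range_eq_top, eq_top_iff, ← hM'.1 _ (hm p hp), Submodule.span_le]
    rintro _ ⟨v, rfl⟩
    have h1 : Function.Surjective (fderiv ℝ h p : R5 →ₗ[ℝ] R5) :=
      LinearMap.injective_iff_surjective.1 ((injective_iff_map_eq_zero _).2 (hinj p hp))
    obtain ⟨u, rfl⟩ := h1 v
    refine ⟨cD M.φ p (toC5 u), ?_⟩
    have h2 := cD_holomorphic_comp hφ.differentiableAt hH.differentiableAt (toC5 u)
    rw [cD_congr he, cD_comp (M'.analytic _ (hm p hp)).differentiableAt hd] at h2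
    change cD M'.φ (h p) (push h p (toC5 u)) = _ at h2
    rw [push_toC5 h p u hd, cD_toC5] at h2
    exact h2.symm
  exact ⟨LinearMap.injective_iff_surjective.2 hsurj, hsurj⟩

open Classical in
/-- A normalized coframe on the bundle of a submanifold with a generator. -/
noncomputable def canonicalCoframe (M : LocalSubmanifold) (L : R5 → C5) : Coframe :=
  -- The coframe is chosen separately for each pair, with a zero default outside Class III₁ pairs;
  -- the compatibility of the choices rests on the uniqueness behind `IsAdapted.pull_eq`.
  if h : ∃ c, IsNormalized M L c then h.choose else coframeOf 0 0 0 0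

theorem isNormalized_canonicalCoframe (hM : M.IsClassIII1) (hL : M.IsGenerator L) :
    IsNormalized M L (canonicalCoframe M L) := by
  have h := exists_isNormalized hM hL
  rw [canonicalCoframe, dif_pos h]
  exact h.choose_spec

end Converse

theorem theorem1p1 :
    ModelDescription ∧
    (∀ M : LocalSubmanifold, M.IsClassIII1 → ∃ L : R5 → C5, M.IsGenerator L) ∧
    ∃ W : LocalSubmanifold → (R5 → C5) → Coframe,
      (∀ (M : LocalSubmanifold) (L : R5 → C5), M.IsClassIII1 → M.IsGenerator L →
        (W M L).IsAnalytic (bundleOver M.U) ∧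
        IsReducedCoframe M L (W M L) ∧
        StructureEquations M L (W M L) ∧
        IsCartanConnection (bundleOver M.U) (W M L).varpi) ∧
      (∀ (M M' : LocalSubmanifold) (L L' : R5 → C5),
        M.IsClassIII1 → M.IsGenerator L → M'.IsClassIII1 → M'.IsGenerator L' →
        ∀ (V : Set R5) (h : R5 → R5), IsLocalBiholomorphism M M' V h →
          ∃ F : E7 → E7, Covers V F h ∧ IsEquivariant V F ∧
            PreservesConnection M' V (W M L).varpi (W M' L').varpi F) ∧
      (∀ (M M' : LocalSubmanifold) (L L' : R5 → C5),
        M.IsClassIII1 → M.IsGenerator L → M'.IsClassIII1 → M'.IsGenerator L' →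
        ∀ (V : Set R5) (F : E7 → E7), IsOpen V → V ⊆ M.U →
          PreservesConnection M' V (W M L).varpi (W M' L').varpi F →
          ∃ h : R5 → R5, Covers V F h ∧ IsLocalBiholomorphism M M' V h) := by
  have hN := fun (M : LocalSubmanifold) (L : R5 → C5) (hM : M.IsClassIII1)
    (hL : M.IsGenerator L) => isNormalized_canonicalCoframe hM hL
  refine ⟨modelDescription, fun M hM => LocalSubmanifold.exists_generator hM.1, canonicalCoframe,
    fun M L hM hL => (hN M L hM hL).isCanonical hM hL, ?_, ?_⟩
  · exact fun M M' L L' hM hL hM' hL' V h hh =>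
      (hN M L hM hL).exists_lift (hN M' L' hM' hL') hM hL hM' hL' hh
  · exact fun M M' L L' hM hL hM' hL' V F hV hVU hF =>
      (hN M L hM hL).covers (hN M' L' hM' hL') hM hL hM' hL' hV hVU hF
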